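/- Let $k$ be a field, $t$ a positive integer and $K=k^t$, a graded $k$-algebra in degree $0$. A dg $K$-ring is a graded $k$-algebra $A=\bigoplus_i A_i$ (lower grading) with a differential $d$ of degree $-1$ satisfying the graded Leibniz rule, together with a morphism of dg $k$-algebras $K\to A$ (the image of $K$ need not be central); it is augmented if it carries a morphism of dg $K$-rings $\varepsilon\colon A\to K$, and then $\bar A=\ker\varepsilon$. An augmented dg $K$-ring $A$ is *typical* if every $A_i$ is finite-dimensional over $k$ and either $A_i=0$ for all $i<0$, or $A_i=0$ for all $i>0$, $A_0=K$ and $A_{-1}=0$. It is *complete* if $\bigcap_{i\ge 1}\bar A^{\,i}=0$. For such $A$ let $BA=\bigoplus_n (s\bar A)^{\otimes_K n}$ be the bar construction and $\pi\colon BA\to A$, $[a]\mapsto a$, the canonical twisting cochain. The Hochschild cohomology $HH^\bullet(A)$ is the cohomology of the complex $\operatorname{Hom}_{K^e}(BA,A)$ of graded $K$-bimodule maps with the differential $f\mapsto d f-(-1)^{|f|}f d+\pi\cup f-(-1)^{|f|}f\cup\pi$, graded by upper degree, with the product induced by the cup (convolution) product $\cup$. The Hochschild homology $HH_\bullet(A)$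 is the homology of $A\otimes_{K^e}BA$ with the Hochschild boundary, and the Connes operator $B\colon HH_\bullet(A)\to HH_{\bullet+1}(A)$ is induced by $$a_0[a_1|\dots|a_n]\mapsto\sum_{i=0}^n\pm\,1[a_{i+1}|\dots|a_n|a_0|\dots|a_i],$$ where entries are taken modulo $K$ and the sign is the Koszul sign of the cyclic permutation of $sa_0,\dots,sa_n$. Let $A^\vee$ be the graded $k$-linear dual of a typical $A$, $(A^\vee)_{-i}=\operatorname{Hom}_k(A_i,k)$, with its dual structure of a coaugmented dg $K$-coring, and let $\Omega A^\vee=T_K(s^{-1}\overline{A^\vee})$ be its cobar construction, with differential $d\langle c\rangle=-\langle dc\rangle+\sum(-1)^{|c_1|+1}\langle c_1|c_2\rangle$; it is again an augmented dg $K$-ring. **Theorem.** Let $A$ be a complete typical dg $K$-ring. 1. $HH^\bullet(A)$ and $HH^\bullet(\Omega A^\vee)$ are graded commutative, and there is an isomorphism of graded commutative $k$-algebras $$HH^\bullet(A)\;\cong\;HH^\bullet(\Omega A^\vee).$$ 2. There is an isomorphism of graded $k$-modules $h_\bullet\colon HH_\bullet(A)^\vee\to HH_{-\bullet}(\Omega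 A^\vee)$, that is, isomorphisms $h_n\colon\operatorname{Hom}_k(HH_n(A),k)\to HH_{-n}(\Omega A^\vee)$ for all $n\in\mathbb Z$, such that $$h\circ B^\vee=B\circ h,$$ where $B$ on the right is the Connes operator of $\Omega A^\vee$ and $B^\vee$ is the dual of the Connes operator of $A$, $B^\vee(\varphi)=(-1)^{|\varphi|}\varphi\circ B$. -/

import Mathlib

universe u v w

noncomputable section

/-- The sign `(-1)^n` as an integer. -/
def koszulSign (n : ℤ) : ℤ := (n.negOnePow : ℤ)

/-- An augmented dg `K`-ring, `K = k^t`: a graded `k`-algebra `A = ⨁ A_i` (lower grading) with a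
morphism of dg algebras `unit : K → A`, a differential `d` of degree `-1` and an augmentation
`aug : A → K`.  The field `K` is `Fin t → k`, in degree `0` and with zero differential; its image
need not be central, and the `K`-bimodule structure of `A` is given by multiplication with
`unit x` from the left and from the right. -/
structure AugDGKRing (k : Type u) [Field k] (t : ℕ) where
  carrier : Type v
  [ring : Ring carrier]
  [algebra : Algebra k carrier]
  piece : ℤ → Submodule k carrier
  [graded : GradedAlgebra piece]
  unit : (Fin t → k) →ₐ[k] carrier
  d : carrier →ₗ[k] carrier
  aug : carrier →ₐ[k] (Fin t → k)
  unit_mem : ∀ x, unit x ∈ piece 0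
  d_mem : ∀ {i : ℤ} {a : carrier}, a ∈ piece i → d a ∈ piece (i - 1)
  d_mul : ∀ {i : ℤ} {a : carrier}, a ∈ piece i → ∀ b,
    d (a * b) = d a * b + koszulSign i • (a * d b)
  d_d : ∀ a, d (d a) = 0
  d_unit : ∀ x, d (unit x) = 0
  aug_piece : ∀ {i : ℤ} {a : carrier}, i ≠ 0 → a ∈ piece i → aug a = 0
  aug_d : ∀ a, aug (d a) = 0
  aug_unit : ∀ x, aug (unit x) = x

attribute [instance] AugDGKRing.ring AugDGKRing.algebra AugDGKRing.graded

theorem koszulSign_add (m n : ℤ) : koszulSign (m + n) = koszulSign m * koszulSign n := by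
  simp [koszulSign, Int.negOnePow_add]

theorem koszulSign_zero : koszulSign 0 = 1 := by simp [koszulSign]

theorem koszulSign_mul_self (n : ℤ) : koszulSign n * koszulSign n = 1 := by
  rw [← koszulSign_add]; simp [koszulSign, Int.negOnePow_even (n + n) ⟨n, rfl⟩]

theorem koszulSign_congr {m n : ℤ} (h : Even (m - n)) : koszulSign m = koszulSign n := by
  unfold koszulSign; rw [(Int.negOnePow_eq_iff m n).2 h]

theorem koszulSign_one : koszulSign 1 = -1 := by simp [koszulSign]

theorem koszulSign_succ (n : ℤ) : koszulSign (n + 1) = -koszulSign n := by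
  rw [koszulSign_add, koszulSign_one]; ring

/-- The sum of `G u v` over all ways `l = u ++ v` to split a list. -/
def splitSum {α : Type u} {M : Type v} [AddCommGroup M] :
    (List α → List α → M) → List α → M
  | G, [] => G [] []
  | G, b :: l => G [] (b :: l) + splitSum (fun u v => G (b :: u) v) l

namespace AugDGKRing

variable {k : Type u} [Field k] {t : ℕ} (A : AugDGKRing.{u, v} k t)

theorem d_unit_mul (x : Fin t → k) (a : A.carrier) : A.d (A.unit x * a) = A.unit x * A.d a := by
  rw [A.d_mul (A.unit_mem x)]; simp [A.d_unit, koszulSign_zero]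

theorem d_one : A.d 1 = 0 := by simpa using A.d_unit 1

/-- A homogeneous element of `A`, together with its degree. -/
@[ext] structure Hom where
  deg : ℤ
  val : A.carrier
  mem : val ∈ A.piece deg

/-- A homogeneous element of the augmentation ideal, together with its degree. -/
@[ext] structure Red extends A.Hom where
  aug_eq : A.aug val = 0

variable {A}

theorem d_mul_unit {i : ℤ} {a : A.carrier} (ha : a ∈ A.piece i) (x : Fin t → k) :
    A.d (a * A.unit x) = A.d a * A.unit x := by
  rw [A.d_mul ha]; simp [A.d_unit]

theorem mul_unit_mem {i : ℤ} {a : A.carrier} (ha : a ∈ A.piece i) (x : Fin t → k) :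
    a * A.unit x ∈ A.piece i := by
  simpa using SetLike.mul_mem_graded ha (A.unit_mem x)

theorem unit_mul_mem {i : ℤ} {a : A.carrier} (ha : a ∈ A.piece i) (x : Fin t → k) :
    A.unit x * a ∈ A.piece i := by
  simpa using SetLike.mul_mem_graded (A.unit_mem x) ha

namespace Hom

/-- The differential of a homogeneous element. -/
def diff (a : A.Hom) : A.Hom := ⟨a.deg - 1, A.d a.val, A.d_mem a.mem⟩

/-- The left action of `K`. -/
def lact (x : Fin t → k) (a : A.Hom) : A.Hom := ⟨a.deg, A.unit x * a.val, unit_mul_mem a.mem x⟩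

/-- The right action of `K`. -/
def ract (a : A.Hom) (x : Fin t → k) : A.Hom := ⟨a.deg, a.val * A.unit x, mul_unit_mem a.mem x⟩

/-- The product of homogeneous elements. -/
def mul (a b : A.Hom) : A.Hom :=
  ⟨a.deg + b.deg, a.val * b.val, SetLike.mul_mem_graded a.mem b.mem⟩

variable (A) in
/-- The unit element. -/
def one : A.Hom := ⟨0, 1, by simpa using A.unit_mem 1⟩

/-- The component in the augmentation ideal, `a ↦ a - aug a`. -/
def bar (a : A.Hom) : A.Red where
  deg := a.deg
  val := a.val - A.unit (A.aug a.val)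
  mem := by
    by_cases h : a.deg = 0
    · rw [h]; exact Submodule.sub_mem _ (h ▸ a.mem) (A.unit_mem _)
    · rw [A.aug_piece h a.mem]; simpa using a.mem
  aug_eq := by simp [A.aug_unit]

end Hom

namespace Red

/-- The differential of a homogeneous element of the augmentation ideal. -/
def diff (a : A.Red) : A.Red := ⟨a.toHom.diff, A.aug_d _⟩

/-- The left action of `K`. -/
def lact (x : Fin t → k) (a : A.Red) : A.Red :=
  ⟨a.toHom.lact x, by simp [Hom.lact, a.aug_eq]⟩

/-- The right action of `K`. -/
def ract (a : A.Red) (x : Fin t → k) : A.Red :=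
  ⟨a.toHom.ract x, by simp [Hom.ract, a.aug_eq]⟩

/-- The product of homogeneous elements of the augmentation ideal. -/
def mul (a b : A.Red) : A.Red := ⟨a.toHom.mul b.toHom, by simp [Hom.mul, a.aug_eq]⟩

end Red

/-- The degree `∑ (|a_i| + 1)` of `[a_1|...|a_n]` in the bar construction. -/
def barDeg (l : List A.Red) : ℤ := (l.map fun a => a.deg + 1).sum

section bar
variable {M : Type w} [AddCommGroup M]

/-- The term `(-1)^|a| F[ab|...]` that multiplies `a` with the first entry of a list. -/
def mergeHead (F : List A.Red → M) (a : A.Red) : List A.Red → M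
  | [] => 0
  | b :: l => koszulSign a.deg • F (a.mul b :: l)

/-- A function `F` on the bar construction precomposed with the bar differential:
the value on `[a_1|...|a_n]` is
`∑ (-1)^(|a_1|+...+|a_(i-1)|+i) F[a_1|...|d a_i|...|a_n]
  + ∑ (-1)^(|a_1|+...+|a_i|+i-1) F[a_1|...|a_i a_(i+1)|...|a_n]`. -/
def barDiff : (List A.Red → M) → List A.Red → M
  | _, [] => 0
  | F, a :: l => -F (a.diff :: l) + mergeHead F a l +
      koszulSign (a.deg + 1) • barDiff (fun w => F (a :: w)) l

/-- `F` is `k`-multilinear and `K`-balanced, that is: on lists of length `n` it is a linear map on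
the `n`-fold tensor power over `K` of the augmentation ideal. -/
structure IsMultilinear [Module k M] (F : List A.Red → M) : Prop where
  add : ∀ (u v : List A.Red) (a b c : A.Red), a.deg = c.deg → b.deg = c.deg →
    c.val = a.val + b.val → F (u ++ c :: v) = F (u ++ a :: v) + F (u ++ b :: v)
  smul : ∀ (u v : List A.Red) (r : k) (a c : A.Red), a.deg = c.deg →
    c.val = r • a.val → F (u ++ c :: v) = r • F (u ++ a :: v)
  bal : ∀ (u v : List A.Red) (x : Fin t → k) (a b : A.Red),
    F (u ++ a.ract x :: b :: v) = F (u ++ a :: b.lact x :: v)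

end bar

/-! ### Hochschild cohomology -/

/-- `f` is a Hochschild cochain of upper degree `n`: a graded `K`-bimodule morphism of (lower)
degree `-n` from the bar construction of `A` to `A`. -/
structure IsCochain (n : ℤ) (f : List A.Red → A.carrier) : Prop extends IsMultilinear f where
  left : ∀ (v : List A.Red) (x : Fin t → k) (a : A.Red),
    f (a.lact x :: v) = A.unit x * f (a :: v)
  right : ∀ (u : List A.Red) (x : Fin t → k) (a : A.Red),
    f (u ++ [a.ract x]) = f (u ++ [a]) * A.unit x
  nil : ∀ x : Fin t → k, A.unit x * f [] = f [] * A.unit x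
  deg : ∀ l, f l ∈ A.piece (barDeg l - n)

/-- The cup product `(f ∪ g)[a_1|...|a_p] = ∑ (-1)^(|g| |[a_1|...|a_m]|)
f[a_1|...|a_m] g[a_(m+1)|...|a_p]` for `g` of degree `n`. -/
def cup (n : ℤ) (f g : List A.Red → A.carrier) (l : List A.Red) : A.carrier :=
  splitSum (fun u v => koszulSign (n * barDeg u) • (f u * g v)) l

/-- The projection `[a] ↦ a` from the bar construction to `A` (of upper degree `1`). -/
def twist : List A.Red → A.carrier
  | [a] => a.val
  | _ => 0

/-- The Hochschild differential `f ↦ d ∘ f - (-1)^n f ∘ d + twist ∪ f - (-1)^n f ∪ twist`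
on cochains of upper degree `n`. -/
def delta (n : ℤ) (f : List A.Red → A.carrier) (l : List A.Red) : A.carrier :=
  A.d (f l) - koszulSign n • barDiff f l
    + (cup n twist f l - koszulSign n • cup 1 f twist l)

end AugDGKRing

section splitSum
variable {α : Type u} {M : Type v} {N : Type w} [AddCommGroup M] [AddCommGroup N]

theorem splitSum_nil (G : List α → List α → M) : splitSum G [] = G [] [] := rfl

theorem splitSum_cons (G : List α → List α → M) (b : α) (l : List α) :
    splitSum G (b :: l) = G [] (b :: l) + splitSum (fun u v => G (b :: u) v) l := rfl

theorem splitSum_add (G H : List α → List α → M) (l : List α) :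
    splitSum (fun u v => G u v + H u v) l = splitSum G l + splitSum H l := by
  induction l generalizing G H with
  | nil => rfl
  | cons b l ih => simp only [splitSum_cons, ih]; abel

theorem map_splitSum {F : Type*} [FunLike F M N] [AddMonoidHomClass F M N] (φ : F)
    (G : List α → List α → M) (l : List α) :
    φ (splitSum G l) = splitSum (fun u v => φ (G u v)) l := by
  induction l generalizing G with
  | nil => rfl
  | cons b l ih => simp only [splitSum_cons, map_add, ih]

theorem splitSum_congr {G H : List α → List α → M} {l : List α}
    (h : ∀ u v, u ++ v = l → G u v = H u v) : splitSum G l = splitSum H l := by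
  induction l generalizing G H with
  | nil => exact h [] [] rfl
  | cons b l ih =>
    rw [splitSum_cons, splitSum_cons, h [] (b :: l) rfl,
      ih (fun u v huv => h (b :: u) v (by simp [huv]))]

theorem splitSum_zero (l : List α) : splitSum (fun _ _ => (0 : M)) l = 0 := by
  induction l with
  | nil => rfl
  | cons b l ih => simp only [splitSum_cons, ih, add_zero]

theorem splitSum_zsmul (c : ℤ) (G : List α → List α → M) (l : List α) :
    splitSum (fun u v => c • G u v) l = c • splitSum G l :=
  (map_splitSum (zsmulAddGroupHom c : M →+ M) G l).symm

theorem splitSum_neg (G : List α → List α → M) (l : List α) :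
    splitSum (fun u v => -G u v) l = -splitSum G l := by
  simpa using splitSum_zsmul (-1) G l

theorem splitSum_concat (G : List α → List α → M) (l : List α) (z : α) :
    splitSum G (l ++ [z]) = splitSum (fun u v => G u (v ++ [z])) l + G (l ++ [z]) [] := by
  induction l generalizing G with
  | nil => simp [splitSum]
  | cons b l ih => simp only [splitSum_cons, List.cons_append, ih]; abel

theorem splitSum_assoc (G : List α → List α → List α → M) (l : List α) :
    splitSum (fun u w => splitSum (fun v x => G u v x) w) l =
      splitSum (fun w x => splitSum (fun u v => G u v x) w) l := by
  induction l generalizing G with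
  | nil => rfl
  | cons b l ih =>
    simp only [splitSum_cons, splitSum_nil, ih, splitSum_add]
    abel

end splitSum

namespace AugDGKRing
variable {k : Type u} [Field k] {t : ℕ} {A : AugDGKRing.{u, v} k t}

theorem barDeg_nil : barDeg ([] : List A.Red) = 0 := rfl
theorem barDeg_cons (a : A.Red) (l : List A.Red) :
    barDeg (a :: l) = a.deg + 1 + barDeg l := by simp [barDeg]
theorem barDeg_append (l l' : List A.Red) : barDeg (l ++ l') = barDeg l + barDeg l' := by
  simp [barDeg]

section bar
variable {M : Type w} [AddCommGroup M]

theorem barDiff_nil (F : List A.Red → M) : barDiff F [] = 0 := rfl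

theorem barDiff_cons (F : List A.Red → M) (a : A.Red) (l : List A.Red) :
    barDiff F (a :: l) = -F (a.diff :: l) + mergeHead F a l +
      koszulSign (a.deg + 1) • barDiff (fun w => F (a :: w)) l := rfl

theorem mergeHead_add (F G : List A.Red → M) (a : A.Red) (l : List A.Red) :
    mergeHead (fun w => F w + G w) a l = mergeHead F a l + mergeHead G a l := by
  cases l <;> simp [mergeHead]

theorem map_mergeHead {N : Type*} [AddCommGroup N] {Φ : Type*} [FunLike Φ M N]
    [AddMonoidHomClass Φ M N] (φ : Φ) (F : List A.Red → M) (a : A.Red) (l : List A.Red) :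
    mergeHead (fun w => φ (F w)) a l = φ (mergeHead F a l) := by
  cases l <;> simp [mergeHead]

theorem barDiff_add (F G : List A.Red → M) (l : List A.Red) :
    barDiff (fun w => F w + G w) l = barDiff F l + barDiff G l := by
  induction l generalizing F G with
  | nil => simp [barDiff]
  | cons a l ih => simp only [barDiff_cons, ih, mergeHead_add, smul_add]; abel

theorem map_barDiff {N : Type*} [AddCommGroup N] {Φ : Type*} [FunLike Φ M N]
    [AddMonoidHomClass Φ M N] (φ : Φ) (F : List A.Red → M) (l : List A.Red) :
    barDiff (fun w => φ (F w)) l = φ (barDiff F l) := by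
  induction l generalizing F with
  | nil => simp [barDiff]
  | cons a l ih => simp only [barDiff_cons, ih, map_mergeHead, map_add, map_neg, map_zsmul]

theorem barDiff_zsmul (c : ℤ) (F : List A.Red → M) (l : List A.Red) :
    barDiff (fun w => c • F w) l = c • barDiff F l :=
  map_barDiff (zsmulAddGroupHom c : M →+ M) F l

theorem barDiff_smul [Module k M] (c : k) (F : List A.Red → M) (l : List A.Red) :
    barDiff (fun w => c • F w) l = c • barDiff F l :=
  map_barDiff (DistribSMul.toAddMonoidHom M c) F l

theorem barDiff_zero (l : List A.Red) : barDiff (fun _ => (0 : M)) l = 0 := by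
  simpa using barDiff_zsmul 0 (fun _ => (0 : M)) l

theorem barDiff_weight (c : ℤ → ℤ) (F : List A.Red → M) (l : List A.Red) :
    barDiff (fun w => c (barDeg w) • F w) l = c (barDeg l - 1) • barDiff F l := by
  induction l generalizing F c with
  | nil => simp [barDiff]
  | cons a l ih =>
    have h := ih (fun n => c (a.deg + 1 + n)) (fun w => F (a :: w))
    simp only [barDiff_cons, barDeg_cons, h, smul_add, smul_neg]
    congr 1
    · congr 1
      · congr 3; simp only [Red.diff, Hom.diff]; ring
      · cases l with
        | nil => simp [mergeHead]
        | cons b l =>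
          simp only [mergeHead, barDeg_cons, Red.mul, Hom.mul]
          rw [smul_comm]; congr 2; ring
    · rw [smul_comm, add_sub_assoc]

theorem barDiff_splitSum (H : List A.Red → List A.Red → M) (l : List A.Red) :
    barDiff (splitSum H) l = splitSum (fun u v => barDiff (fun w => H w v) u +
      koszulSign (barDeg u) • barDiff (fun w => H u w) v) l := by
  induction l generalizing H with
  | nil => simp [barDiff, splitSum]
  | cons a l ih =>
    have h1 : mergeHead (splitSum H) a l =
        mergeHead (H []) a l + splitSum (fun u v => mergeHead (fun w => H w v) a u) l := by
      cases l with
      | nil => simp [mergeHead, splitSum]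
      | cons b l => simp [mergeHead, splitSum_cons, splitSum_zsmul]
    simp only [barDiff_cons, splitSum_cons, barDiff_add, ih, h1, barDiff_nil, barDeg_cons,
      splitSum_add, smul_add, splitSum_neg, splitSum_zsmul, koszulSign_add, mul_smul, barDeg_nil,
      koszulSign_zero, one_smul]
    abel

end bar

section cup

theorem mul_splitSum {R : Type*} [Ring R] {α : Type*} (a : R) (G : List α → List α → R)
    (l : List α) : a * splitSum G l = splitSum (fun u v => a * G u v) l :=
  map_splitSum (AddMonoidHom.mulLeft a) G l

theorem splitSum_mul {R : Type*} [Ring R] {α : Type*} (a : R) (G : List α → List α → R)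
    (l : List α) : splitSum G l * a = splitSum (fun u v => G u v * a) l :=
  map_splitSum (AddMonoidHom.mulRight a) G l

theorem cup_assoc (n p : ℤ) (f g h : List A.Red → A.carrier) :
    cup p (cup n f g) h = cup (n + p) f (cup p g h) := by
  funext l
  unfold cup
  simp only [mul_splitSum, splitSum_mul, ← splitSum_zsmul]
  rw [splitSum_assoc (fun u v x => koszulSign ((n + p) * barDeg u) •
    (f u * (koszulSign (p * barDeg v) • (g v * h x))))]
  refine splitSum_congr fun w x _ => splitSum_congr fun u v huv => ?_
  simp only [smul_mul_assoc, mul_smul_comm, smul_smul, ← koszulSign_add, mul_assoc, ← huv,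
    barDeg_append]
  congr 2; ring

theorem cup_add_left (n : ℤ) (f f' g : List A.Red → A.carrier) :
    cup n (f + f') g = cup n f g + cup n f' g := by
  funext l; simp [cup, add_mul, splitSum_add]

theorem cup_add_right (n : ℤ) (f g g' : List A.Red → A.carrier) :
    cup n f (g + g') = cup n f g + cup n f g' := by
  funext l; simp [cup, mul_add, splitSum_add]

theorem cup_smul_left (n : ℤ) (c : k) (f g : List A.Red → A.carrier) :
    cup n (c • f) g = c • cup n f g := by
  funext l
  simp only [cup, Pi.smul_apply]
  refine Eq.trans ?_ (map_splitSum (LinearMap.lsmul k A.carrier c) _ l).symm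
  exact splitSum_congr fun u v _ => by
    rw [smul_mul_assoc, smul_comm]; rfl

theorem cup_smul_right (n : ℤ) (c : k) (f g : List A.Red → A.carrier) :
    cup n f (c • g) = c • cup n f g := by
  funext l
  simp only [cup, Pi.smul_apply]
  refine Eq.trans ?_ (map_splitSum (LinearMap.lsmul k A.carrier c) _ l).symm
  exact splitSum_congr fun u v _ => by
    rw [mul_smul_comm, smul_comm]; rfl

theorem cup_zsmul_left (n : ℤ) (c : ℤ) (f g : List A.Red → A.carrier) :
    cup n (c • f) g = c • cup n f g := by
  funext l
  simp only [cup, Pi.smul_apply, ← splitSum_zsmul]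
  exact splitSum_congr fun u v _ => by rw [smul_mul_assoc, smul_comm]

theorem cup_zsmul_right (n : ℤ) (c : ℤ) (f g : List A.Red → A.carrier) :
    cup n f (c • g) = c • cup n f g := by
  funext l
  simp only [cup, Pi.smul_apply, ← splitSum_zsmul]
  exact splitSum_congr fun u v _ => by rw [mul_smul_comm, smul_comm]

/-- The Hochschild differential is a derivation of the cup product. -/
theorem delta_cup {m n : ℤ} {f g : List A.Red → A.carrier}
    (hf : ∀ l, f l ∈ A.piece (barDeg l - m)) :
    delta (m + n) (cup n f g) =
      cup n (delta m f) g + koszulSign m • cup (n + 1) f (delta n g) := by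
  have e1 : (fun l => A.d (cup n f g l)) = cup n (fun l => A.d (f l)) g +
      koszulSign m • cup (n + 1) f (fun l => A.d (g l)) := by
    funext l
    simp only [cup, Pi.add_apply, Pi.smul_apply, ← splitSum_zsmul, ← splitSum_add, map_splitSum]
    refine splitSum_congr fun u v _ => ?_
    rw [map_zsmul, A.d_mul (hf u), smul_add, smul_smul, smul_smul, ← koszulSign_add,
      ← koszulSign_add]
    congr 2
    refine koszulSign_congr ⟨-m, by ring⟩
  have e2 : barDiff (cup n f g) = koszulSign n • cup n (barDiff f) g +
      cup (n + 1) f (barDiff g) := by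
    funext l
    have h := barDiff_splitSum (fun u v => koszulSign (n * barDeg u) • (f u * g v)) l
    refine h.trans ?_
    simp only [cup, Pi.add_apply, Pi.smul_apply, ← splitSum_zsmul, ← splitSum_add]
    refine splitSum_congr fun u v _ => ?_
    rw [barDiff_weight (fun d => koszulSign (n * d)) (fun w => f w * g v) u, barDiff_zsmul,
      show barDiff (fun w => f w * g v) u = barDiff f u * g v from
        map_barDiff (AddMonoidHom.mulRight (g v)) f u,
      show barDiff (fun w => f u * g w) v = f u * barDiff g v from
        map_barDiff (AddMonoidHom.mulLeft (f u)) g v, smul_smul, smul_smul, ← koszulSign_add,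
      ← koszulSign_add]
    congr 2
    · exact koszulSign_congr ⟨-n, by ring⟩
    · congr 1; ring
  have e : ∀ (p : ℤ) (h : List A.Red → A.carrier), delta p h =
      (fun l => A.d (h l)) - koszulSign p • barDiff h +
        (cup p twist h - koszulSign p • cup 1 h twist) := fun p h => rfl
  rw [e, e, e, e1, e2]
  simp only [sub_eq_add_neg, ← neg_smul, cup_add_left, cup_add_right, cup_zsmul_left,
    cup_zsmul_right, cup_assoc, smul_add, koszulSign_add, smul_smul, mul_neg]
  have hn := koszulSign_mul_self n
  have hm : koszulSign m * koszulSign n * koszulSign n = koszulSign m := by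
    rw [mul_assoc, hn, mul_one]
  rw [hm, add_comm 1 n]
  simp only [neg_smul]
  abel

end cup
section multilinear
variable {M : Type w} [AddCommGroup M] [Module k M]

theorem IsMultilinear.prefix {F : List A.Red → M} (hF : IsMultilinear F) (a : A.Red) :
    IsMultilinear fun w => F (a :: w) where
  add u v := hF.add (a :: u) v
  smul u v := hF.smul (a :: u) v
  bal u v := hF.bal (a :: u) v

/-- Multilinearity of a function of two lists, with values on the two halves of a split list. -/
structure IsMultilinear₂ (H : List A.Red → List A.Red → M) : Prop where
  left : ∀ v, IsMultilinear fun u => H u v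
  right : ∀ u, IsMultilinear fun v => H u v
  mid : ∀ u v x a b, H (u ++ [Red.ract a x]) (b :: v) = H (u ++ [a]) (b.lact x :: v)

theorem IsMultilinear₂.prefix {H : List A.Red → List A.Red → M} (hH : IsMultilinear₂ H)
    (a : A.Red) : IsMultilinear₂ fun u v => H (a :: u) v where
  left v := (hH.left v).prefix a
  right u := hH.right (a :: u)
  mid u v := hH.mid (a :: u) v

theorem IsMultilinear₂.sum {H : List A.Red → List A.Red → M} (hH : IsMultilinear₂ H) :
    IsMultilinear (splitSum H) where
  add u v a b c h1 h2 h3 := by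
    induction u generalizing H with
    | nil =>
      have e1 := (hH.right []).add [] v a b c h1 h2 h3
      have e2 := splitSum_congr (l := v) fun u w _ => (hH.left w).add [] u a b c h1 h2 h3
      rw [splitSum_add] at e2
      simp only [List.nil_append, splitSum_cons] at e1 e2 ⊢
      rw [e1, e2]; abel
    | cons d u ih =>
      have e1 := (hH.right []).add (d :: u) v a b c h1 h2 h3
      simp only [List.cons_append, splitSum_cons] at e1 ⊢
      rw [e1, ih (hH.prefix d)]; abel
  smul u v r a c h1 h2 := by
    induction u generalizing H with
    | nil =>
      have e1 := (hH.right []).smul [] v r a c h1 h2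
      have e2 := splitSum_congr (l := v) fun u w _ => (hH.left w).smul [] u r a c h1 h2
      simp only [List.nil_append, splitSum_cons] at e1 e2 ⊢
      rw [e1, e2, smul_add]
      exact congrArg _ (map_splitSum (LinearMap.lsmul k M r) _ v).symm
    | cons d u ih =>
      have e1 := (hH.right []).smul (d :: u) v r a c h1 h2
      simp only [List.cons_append, splitSum_cons] at e1 ⊢
      rw [e1, ih (hH.prefix d), smul_add]
  bal u v x a b := by
    induction u generalizing H with
    | nil =>
      have e1 := (hH.right []).bal [] v x a b
      have e2 := hH.mid [] v x a b
      have e3 := splitSum_congr (l := v) fun u w _ => (hH.left w).bal [] u x a b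
      simp only [List.nil_append, splitSum_cons] at e1 e2 e3 ⊢
      rw [e1, e2, e3]
    | cons d u ih =>
      have e1 := (hH.right []).bal (d :: u) v x a b
      simp only [List.cons_append, splitSum_cons] at e1 ⊢
      rw [e1, ih (hH.prefix d)]

theorem Red.ract_diff (a : A.Red) (x : Fin t → k) : (a.ract x).diff = a.diff.ract x := by
  ext
  · rfl
  · exact d_mul_unit a.mem x

theorem Red.lact_diff (a : A.Red) (x : Fin t → k) : (a.lact x).diff = a.diff.lact x := by
  ext
  · rfl
  · exact A.d_unit_mul x a.val

theorem Red.ract_mul (a b : A.Red) (x : Fin t → k) : (a.ract x).mul b = a.mul (b.lact x) := by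
  ext
  · rfl
  · exact mul_assoc _ _ _

theorem Red.mul_ract (a b : A.Red) (x : Fin t → k) : a.mul (b.ract x) = (a.mul b).ract x := by
  ext
  · rfl
  · exact (mul_assoc _ _ _).symm

theorem Red.lact_mul (a b : A.Red) (x : Fin t → k) : (a.lact x).mul b = (a.mul b).lact x := by
  ext
  · rfl
  · exact mul_assoc _ _ _

theorem IsMultilinear.barDiff {F : List A.Red → M} (hF : IsMultilinear F) :
    IsMultilinear (barDiff F) where
  add u v a b c h1 h2 h3 := by
    induction u generalizing F with
    | nil =>
      have e1 := hF.add [] v a.diff b.diff c.diff (by simp [Red.diff, Hom.diff, h1])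
        (by simp [Red.diff, Hom.diff, h2]) (by simp [Red.diff, Hom.diff, h3])
      have e2 : mergeHead F c v = mergeHead F a v + mergeHead F b v := by
        cases v with
        | nil => simp [mergeHead]
        | cons e v =>
          simp only [mergeHead, h1, h2]
          rw [← smul_add]; congr 1
          exact hF.add [] v _ _ _ (by simp [Red.mul, Hom.mul, h1])
            (by simp [Red.mul, Hom.mul, h2]) (by simp [Red.mul, Hom.mul, h3, add_mul])
      have e3 : (fun w => F (c :: w)) = fun w => F (a :: w) + F (b :: w) :=
        funext fun w => hF.add [] w a b c h1 h2 h3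
      simp only [List.nil_append] at e1 ⊢
      simp only [barDiff_cons, e1, e2, e3, barDiff_add, h1, h2, smul_add]
      abel
    | cons d u ih =>
      have e1 := hF.add (d.diff :: u) v a b c h1 h2 h3
      have e2 : mergeHead F d (u ++ c :: v) =
          mergeHead F d (u ++ a :: v) + mergeHead F d (u ++ b :: v) := by
        cases u with
        | nil =>
          simp only [mergeHead, List.nil_append]
          rw [← smul_add]; congr 1
          exact hF.add [] v _ _ _ (by simp [Red.mul, Hom.mul, h1])
            (by simp [Red.mul, Hom.mul, h2]) (by simp [Red.mul, Hom.mul, h3, mul_add])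
        | cons e u =>
          simp only [mergeHead, List.cons_append]
          rw [← smul_add]; congr 1
          exact hF.add (d.mul e :: u) v a b c h1 h2 h3
      simp only [List.cons_append] at e1 ⊢
      simp only [barDiff_cons, e1, e2, ih (hF.prefix d), smul_add]
      abel
  smul u v r a c h1 h2 := by
    induction u generalizing F with
    | nil =>
      have e1 := hF.smul [] v r a.diff c.diff (by simp [Red.diff, Hom.diff, h1])
        (by simp [Red.diff, Hom.diff, h2])
      have e2 : mergeHead F c v = r • mergeHead F a v := by
        cases v with
        | nil => simp [mergeHead]
        | cons e v =>
          simp only [mergeHead, h1]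
          rw [smul_comm r]; congr 1
          exact hF.smul [] v r _ _ (by simp [Red.mul, Hom.mul, h1])
            (by simp [Red.mul, Hom.mul, h2])
      have e3 : (fun w => F (c :: w)) = fun w => r • F (a :: w) :=
        funext fun w => hF.smul [] w r a c h1 h2
      simp only [List.nil_append] at e1 ⊢
      simp only [barDiff_cons, e1, e2, e3, barDiff_smul, h1, smul_add, smul_neg]
      rw [smul_comm r]
    | cons d u ih =>
      have e1 := hF.smul (d.diff :: u) v r a c h1 h2
      have e2 : mergeHead F d (u ++ c :: v) = r • mergeHead F d (u ++ a :: v) := by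
        cases u with
        | nil =>
          simp only [mergeHead, List.nil_append]
          rw [smul_comm r]; congr 1
          exact hF.smul [] v r _ _ (by simp [Red.mul, Hom.mul, h1])
            (by simp [Red.mul, Hom.mul, h2])
        | cons e u =>
          simp only [mergeHead, List.cons_append]
          rw [smul_comm r]; congr 1
          exact hF.smul (d.mul e :: u) v r a c h1 h2
      simp only [List.cons_append] at e1 ⊢
      simp only [barDiff_cons, e1, e2, ih (hF.prefix d), smul_add, smul_neg]
      rw [smul_comm r]
  bal u v x a b := by
    induction u generalizing F with
    | nil =>
      have e1 := hF.bal [] v x a.diff b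
      have e2 := hF.bal [] v x a b.diff
      have e3 : mergeHead (fun w => F (a.ract x :: w)) b v =
          mergeHead (fun w => F (a :: w)) (b.lact x) v := by
        cases v with
        | nil => rfl
        | cons c v =>
          simp only [mergeHead, Red.lact_mul]
          rw [show (b.lact x).deg = b.deg from rfl]; congr 1
          exact hF.bal [] v x a (b.mul c)
      have e4 : (fun w => F (a.ract x :: b :: w)) = fun w => F (a :: b.lact x :: w) :=
        funext fun w => hF.bal [] w x a b
      simp only [List.nil_append] at e1 e2 ⊢
      have e5 : mergeHead F (a.ract x) (b :: v) = mergeHead F a (b.lact x :: v) := by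
        simp only [mergeHead, Red.ract_mul]; rfl
      simp only [barDiff_cons, e2, e3, e4, e5, Red.ract_diff, Red.lact_diff, e1]
      rfl
    | cons d u ih =>
      have e1 := hF.bal (d.diff :: u) v x a b
      have e2 : mergeHead F d (u ++ a.ract x :: b :: v) =
          mergeHead F d (u ++ a :: b.lact x :: v) := by
        cases u with
        | nil =>
          simp only [mergeHead, List.nil_append, Red.mul_ract]
          congr 1
          exact hF.bal [] v x (d.mul a) b
        | cons e u =>
          simp only [mergeHead, List.cons_append]
          congr 1
          exact hF.bal (d.mul e :: u) v x a b
      simp only [List.cons_append] at e1 ⊢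
      simp only [barDiff_cons, e1, e2, ih (hF.prefix d)]

theorem IsMultilinear.zsmul {F : List A.Red → M} (hF : IsMultilinear F) (c : ℤ) :
    IsMultilinear fun w => c • F w where
  add u v a b e h1 h2 h3 := by simp only [hF.add u v a b e h1 h2 h3, smul_add]
  smul u v r a e h1 h2 := by simp only [hF.smul u v r a e h1 h2]; rw [smul_comm]
  bal u v x a b := by simp only [hF.bal u v x a b]

theorem IsMultilinear.add' {F G : List A.Red → M} (hF : IsMultilinear F)
    (hG : IsMultilinear G) : IsMultilinear fun w => F w + G w where
  add u v a b e h1 h2 h3 := by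
    simp only [hF.add u v a b e h1 h2 h3, hG.add u v a b e h1 h2 h3]; abel
  smul u v r a e h1 h2 := by
    simp only [hF.smul u v r a e h1 h2, hG.smul u v r a e h1 h2, smul_add]
  bal u v x a b := by simp only [hF.bal u v x a b, hG.bal u v x a b]

/-- A weight that depends on the degree only preserves multilinearity. -/
theorem IsMultilinear.weight {F : List A.Red → M} (hF : IsMultilinear F) (c : ℤ → ℤ) :
    IsMultilinear fun w => c (barDeg w) • F w where
  add u v a b e h1 h2 h3 := by
    simp only [hF.add u v a b e h1 h2 h3, smul_add, barDeg_append, barDeg_cons, h1, h2]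
  smul u v r a e h1 h2 := by
    simp only [hF.smul u v r a e h1 h2, barDeg_append, barDeg_cons, h1]; rw [smul_comm]
  bal u v x a b := by
    simp only [hF.bal u v x a b, barDeg_append, barDeg_cons]; rfl

end multilinear

theorem barDeg_ract (u : List A.Red) (a : A.Red) (x : Fin t → k) :
    barDeg (u ++ [a.ract x]) = barDeg (u ++ [a]) := by
  simp only [barDeg_append, barDeg_cons]; rfl

theorem barDeg_lact (v : List A.Red) (a : A.Red) (x : Fin t → k) :
    barDeg (a.lact x :: v) = barDeg (a :: v) := by
  simp only [barDeg_cons]; rfl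

theorem splitSum_mem {α M : Type*} [AddCommGroup M] [Module k M] (S : Submodule k M)
    {G : List α → List α → M} {l : List α} (h : ∀ u v, u ++ v = l → G u v ∈ S) :
    splitSum G l ∈ S := by
  induction l generalizing G with
  | nil => exact h [] [] rfl
  | cons b l ih =>
    exact S.add_mem (h [] (b :: l) rfl) (ih fun u v huv => h (b :: u) v (by simp [huv]))

theorem zsmul_mem' {M : Type*} [AddCommGroup M] [Module k M] (S : Submodule k M) (c : ℤ) {a : M}
    (ha : a ∈ S) : c • a ∈ S := S.toAddSubgroup.zsmul_mem ha c

theorem IsCochain.cup {m n p : ℤ} (h : m + n = p) {f g : List A.Red → A.carrier}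
    (hf : IsCochain m f) (hg : IsCochain n g) : IsCochain p (cup n f g) := by
  have H : IsMultilinear₂ fun u v => koszulSign (n * barDeg u) • (f u * g v) := by
    refine ⟨fun v => ?_, fun u => ?_, fun u v x a b => ?_⟩
    · refine IsMultilinear.weight (F := fun u => f u * g v) ⟨?_, ?_, ?_⟩
        (fun d => koszulSign (n * d))
      · intro u w a b c h1 h2 h3
        simp only [hf.add u w a b c h1 h2 h3, add_mul]
      · intro u w r a c h1 h2
        simp only [hf.smul u w r a c h1 h2, smul_mul_assoc]
      · intro u w x a b
        simp only [hf.bal u w x a b]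
    · refine IsMultilinear.zsmul (F := fun v => f u * g v) ⟨?_, ?_, ?_⟩ _
      · intro u w a b c h1 h2 h3
        simp only [hg.add u w a b c h1 h2 h3, mul_add]
      · intro u w r a c h1 h2
        simp only [hg.smul u w r a c h1 h2, mul_smul_comm]
      · intro u w x a b
        simp only [hg.bal u w x a b]
    · simp only [barDeg_ract, hf.right, hg.left, mul_assoc]
  have HS := H.sum
  refine ⟨⟨HS.add, HS.smul, HS.bal⟩, ?_, ?_, ?_, ?_⟩
  · intro v x a
    simp only [AugDGKRing.cup, splitSum_cons, mul_add, barDeg_lact, hf.left, hg.left,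
      mul_splitSum, barDeg_nil]
    congr 1
    · rw [← mul_assoc, ← hf.nil, mul_smul_comm, mul_assoc]
    · exact splitSum_congr fun u v _ => by rw [mul_smul_comm, mul_assoc]
  · intro u x a
    simp only [AugDGKRing.cup, splitSum_concat, add_mul, barDeg_ract, hf.right, hg.right,
      splitSum_mul]
    congr 1
    · exact splitSum_congr fun u v _ => by rw [smul_mul_assoc, mul_assoc]
    · rw [mul_assoc, hg.nil, smul_mul_assoc, mul_assoc]
  · intro x
    simp only [AugDGKRing.cup, splitSum_nil]
    rw [mul_smul_comm, smul_mul_assoc, ← mul_assoc, hf.nil, mul_assoc, hg.nil, mul_assoc]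
  · intro l
    refine splitSum_mem _ fun u v huv => zsmul_mem' _ _ ?_
    have := SetLike.mul_mem_graded (hf.deg u) (hg.deg v)
    rw [← huv, barDeg_append, ← h]
    convert this using 2; ring

variable (A)

/-- The unit of the cup product: the cochain `[] ↦ 1`. -/
def cupOne : List A.Red → A.carrier
  | [] => 1
  | _ :: _ => 0

theorem isCochain_cupOne : IsCochain 0 A.cupOne where
  add u v a b c _ _ _ := by cases u <;> simp [cupOne]
  smul u v r a c _ _ := by cases u <;> simp [cupOne]
  bal u v x a b := by cases u <;> simp [cupOne]
  left v x a := by simp [cupOne]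
  right u x a := by cases u <;> simp [cupOne]
  nil x := by simp [cupOne]
  deg l := by
    cases l with
    | nil => simpa [cupOne, barDeg] using A.unit_mem 1
    | cons a l => exact Submodule.zero_mem _

variable {A}

theorem cup_cupOne (f : List A.Red → A.carrier) : cup 0 f A.cupOne = f := by
  funext l
  induction l generalizing f with
  | nil => simp [cup, splitSum, cupOne, koszulSign_zero]
  | cons a l ih =>
    have := ih (fun w => f (a :: w))
    simp only [cup, zero_mul, koszulSign_zero, one_smul] at this
    simp only [cup, splitSum_cons, zero_mul, koszulSign_zero, one_smul, this]
    simp [cupOne]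

theorem cupOne_cup (n : ℤ) (f : List A.Red → A.carrier) : cup n A.cupOne f = f := by
  funext l
  cases l with
  | nil => simp [cup, splitSum, cupOne, koszulSign_zero, barDeg]
  | cons a l => simp [cup, splitSum_cons, cupOne, koszulSign_zero, barDeg_nil, splitSum_zero]

theorem delta_cupOne : delta 0 A.cupOne = 0 := by
  funext l
  simp only [delta, koszulSign_zero, one_smul, cup_cupOne, cupOne_cup, sub_self, add_zero,
    Pi.zero_apply]
  cases l with
  | nil => simp [cupOne, barDiff, A.d_one]
  | cons a l =>
    have : (fun w : List A.Red => A.cupOne (a :: w)) = fun _ => 0 := rfl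
    rw [barDiff_cons, this, barDiff_zero]
    cases l <;> simp [cupOne, mergeHead]

/-- The Hochschild differential as a linear map. -/
def deltaLin (A : AugDGKRing.{u, v} k t) (n : ℤ) :
    (List A.Red → A.carrier) →ₗ[k] (List A.Red → A.carrier) where
  toFun := delta n
  map_add' f g := by
    funext l
    have : barDiff (f + g) l = _ := barDiff_add f g l
    simp only [delta, Pi.add_apply, map_add, this, cup_add_left, cup_add_right, smul_add]
    abel
  map_smul' c f := by
    funext l
    have : barDiff (c • f) l = _ := barDiff_smul c f l
    simp only [delta, Pi.smul_apply, map_smul, this, cup_smul_left, cup_smul_right,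
      RingHom.id_apply, smul_add, smul_sub]
    simp only [smul_comm c (koszulSign n)]

/-- The Hochschild cochains of upper degree `n`. -/
def cochains (A : AugDGKRing.{u, v} k t) (n : ℤ) : Submodule k (List A.Red → A.carrier) where
  carrier := {f | IsCochain n f}
  add_mem' {f g} hf hg :=
    { toIsMultilinear := hf.toIsMultilinear.add' hg.toIsMultilinear
      left := fun v x a => by simp [hf.left, hg.left, mul_add]
      right := fun u x a => by simp [hf.right, hg.right, add_mul]
      nil := fun x => by simp [hf.nil, hg.nil, mul_add, add_mul]
      deg := fun l => Submodule.add_mem _ (hf.deg l) (hg.deg l) }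
  zero_mem' := ⟨⟨by simp, by simp, by simp⟩, by simp, by simp, by simp, by simp⟩
  smul_mem' c f hf :=
    { add := fun u v a b e h1 h2 h3 => by simp [hf.add u v a b e h1 h2 h3]
      smul := fun u v r a e h1 h2 => by simp [hf.smul u v r a e h1 h2, smul_comm c r]
      bal := fun u v x a b => by simp [hf.bal]
      left := fun v x a => by simp [hf.left]
      right := fun u x a => by simp [hf.right]
      nil := fun x => by simp [hf.nil]
      deg := fun l => Submodule.smul_mem _ _ (hf.deg l) }

/-- The Hochschild cocycles of upper degree `n`. -/
def cocycles (A : AugDGKRing.{u, v} k t) (n : ℤ) : Submodule k (List A.Red → A.carrier) :=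
  A.cochains n ⊓ LinearMap.ker (A.deltaLin n)

/-- The Hochschild coboundaries of upper degree `n`. -/
def coboundaries (A : AugDGKRing.{u, v} k t) (n : ℤ) : Submodule k (List A.Red → A.carrier) :=
  (A.cochains (n - 1)).map (A.deltaLin (n - 1))

/-- The Hochschild cohomology `HH^n(A)`. -/
abbrev HHCoh (A : AugDGKRing.{u, v} k t) (n : ℤ) : Type v :=
  A.cocycles n ⧸ (A.coboundaries n).submoduleOf (A.cocycles n)

theorem cup_mem_cocycles {m n p : ℤ} (h : m + n = p) {f g : List A.Red → A.carrier}
    (hf : f ∈ A.cocycles m) (hg : g ∈ A.cocycles n) : cup n f g ∈ A.cocycles p := by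
  refine ⟨hf.1.cup h hg.1, ?_⟩
  have h1 : delta m f = 0 := hf.2
  have h2 : delta n g = 0 := hg.2
  change delta p (cup n f g) = 0
  rw [← h, delta_cup hf.1.deg, h1, h2]
  have z1 := cup_zsmul_left n 0 (0 : List A.Red → A.carrier) g
  have z2 := cup_zsmul_right (n + 1) 0 f (0 : List A.Red → A.carrier)
  simp only [zero_smul] at z1 z2
  rw [z1, z2]; simp

/-- The cup product of cocycles, as a bilinear map. -/
def cupCocycles (A : AugDGKRing.{u, v} k t) (m n p : ℤ) (h : m + n = p) :
    A.cocycles m →ₗ[k] A.cocycles n →ₗ[k] A.cocycles p :=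
  LinearMap.mk₂ k (fun f g => ⟨cup n f.1 g.1, cup_mem_cocycles h f.2 g.2⟩)
    (fun f f' g => Subtype.ext (cup_add_left n f.1 f'.1 g.1))
    (fun c f g => Subtype.ext (cup_smul_left n c f.1 g.1))
    (fun f g g' => Subtype.ext (cup_add_right n f.1 g.1 g'.1))
    (fun c f g => Subtype.ext (cup_smul_right n c f.1 g.1))

theorem cup_mem_coboundaries_left {m n p : ℤ} (h : m + n = p) {f g : List A.Red → A.carrier}
    (hf : f ∈ A.coboundaries m) (hg : g ∈ A.cocycles n) : cup n f g ∈ A.coboundaries p := by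
  obtain ⟨f, hf, rfl⟩ := hf
  refine ⟨cup n f g, hf.cup (by lia) hg.1, ?_⟩
  have h2 : delta n g = 0 := hg.2
  have e := delta_cup (n := n) (g := g) hf.deg
  have z2 := cup_zsmul_right (n + 1) 0 f (0 : List A.Red → A.carrier)
  simp only [zero_smul] at z2
  rw [h2, z2, smul_zero, add_zero] at e
  rw [show p - 1 = m - 1 + n by lia]
  exact e

theorem cup_mem_coboundaries_right {m n p : ℤ} (h : m + n = p) {f g : List A.Red → A.carrier}
    (hf : f ∈ A.cocycles m) (hg : g ∈ A.coboundaries n) : cup n f g ∈ A.coboundaries p := by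
  obtain ⟨g, hg, rfl⟩ := hg
  refine ⟨koszulSign m • cup (n - 1) f g, zsmul_mem' _ _ (hf.1.cup (by lia) hg), ?_⟩
  have h2 : delta m f = 0 := hf.2
  have e := delta_cup (n := n - 1) (g := g) hf.1.deg
  have z2 := cup_zsmul_left (n - 1) 0 (0 : List A.Red → A.carrier) g
  simp only [zero_smul] at z2
  rw [h2, z2, zero_add, sub_add_cancel] at e
  rw [map_zsmul, show p - 1 = m + (n - 1) by lia]
  change koszulSign m • delta (m + (n - 1)) (cup (n - 1) f g) = cup n f (delta (n - 1) g)
  rw [e, smul_smul, koszulSign_mul_self, one_smul]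

/-- The cup product `HH^m(A) × HH^n(A) → HH^p(A)`, `p = m + n`. -/
def HHCoh.cup (A : AugDGKRing.{u, v} k t) (m n p : ℤ) (h : m + n = p) :
    A.HHCoh m →ₗ[k] A.HHCoh n →ₗ[k] A.HHCoh p :=
  Submodule.liftQ _
    { toFun := fun f => Submodule.mapQ ((A.coboundaries n).submoduleOf (A.cocycles n))
        ((A.coboundaries p).submoduleOf (A.cocycles p)) (A.cupCocycles m n p h f) fun g hg =>
        cup_mem_coboundaries_right h f.2 hg
      map_add' := fun f f' => by
        apply Submodule.linearMap_qext; ext g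
        change Submodule.Quotient.mk (A.cupCocycles m n p h (f + f') g) = _
        rw [map_add]; rfl
      map_smul' := fun c f => by
        apply Submodule.linearMap_qext; ext g
        change Submodule.Quotient.mk (A.cupCocycles m n p h (c • f) g) = _
        rw [map_smul]; rfl }
    (by
      intro f hf
      apply Submodule.linearMap_qext
      ext g
      exact (Submodule.Quotient.mk_eq_zero _).2 (cup_mem_coboundaries_left h hf g.2))

/-- The unit of Hochschild cohomology. -/
def HHCoh.one (A : AugDGKRing.{u, v} k t) : A.HHCoh 0 :=
  Submodule.Quotient.mk ⟨A.cupOne, A.isCochain_cupOne, delta_cupOne⟩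


/-! ### Hochschild homology -/

section symbols
variable {M : Type w} [AddCommGroup M]

/-- The term `(-1)^(|a_0|+1) a_0 a_1 ⊗ [a_2|...|a_n]` of the Hochschild boundary. -/
def headTerm (F : A.Hom → List A.Red → M) (a : A.Hom) : List A.Red → M
  | [] => 0
  | b :: l => koszulSign (a.deg + 1) • F (a.mul b.toHom) l

/-- The term `± a_n a_0 ⊗ [a_1|...|a_(n-1)]` of the Hochschild boundary, where the exponent of the
sign is `(|a_0| + |[a_1|...|a_(n-1)]|) (|a_n| + 1)`. -/
def lastTerm (F : A.Hom → List A.Red → M) (a : A.Hom) (l : List A.Red) : M :=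
  match l.reverse with
  | [] => 0
  | z :: r => koszulSign ((a.deg + barDeg r.reverse) * (z.deg + 1)) •
      F (z.toHom.mul a) r.reverse

/-- The Hochschild boundary on symbols. -/
def boundaryFun (F : A.Hom → List A.Red → M) (a : A.Hom) (l : List A.Red) : M :=
  F a.diff l + koszulSign a.deg • barDiff (F a) l + headTerm F a l + lastTerm F a l

/-- The Connes operator on symbols: `a_0 ⊗ [a_1|...|a_n]` is mapped to
`∑ ± 1 ⊗ [a_(i+1)|...|a_n|a_0|...|a_i]`, where the exponent of the sign is
`(∑_(j ≤ i) (|a_j| + 1)) (∑_(j > i) (|a_j| + 1))`. -/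
def connesFun (F : A.Hom → List A.Red → M) (a : A.Hom) (l : List A.Red) : M :=
  splitSum (fun u v => koszulSign ((a.deg + 1 + barDeg u) * barDeg v) •
    F (Hom.one A) (v ++ a.bar :: u)) l

theorem lastTerm_nil (F : A.Hom → List A.Red → M) (a : A.Hom) : lastTerm F a [] = 0 := rfl

theorem lastTerm_concat (F : A.Hom → List A.Red → M) (a : A.Hom) (u : List A.Red) (z : A.Red) :
    lastTerm F a (u ++ [z]) =
      koszulSign ((a.deg + barDeg u) * (z.deg + 1)) • F (z.toHom.mul a) u := by
  simp [lastTerm]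

theorem Hom.ract_mul (a : A.Hom) (b : A.Red) (x : Fin t → k) :
    (a.ract x).mul b.toHom = a.mul (b.lact x).toHom := by
  ext
  · rfl
  · exact mul_assoc _ _ _

theorem Hom.mul_ract (a b : A.Hom) (x : Fin t → k) : a.mul (b.ract x) = (a.mul b).ract x := by
  ext
  · rfl
  · exact (mul_assoc _ _ _).symm

theorem Hom.lact_mul (a b : A.Hom) (x : Fin t → k) : (a.lact x).mul b = (a.mul b).lact x := by
  ext
  · rfl
  · exact mul_assoc _ _ _

theorem Hom.ract_mul' (a b : A.Hom) (x : Fin t → k) : (a.ract x).mul b = a.mul (b.lact x) := by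
  ext
  · rfl
  · exact mul_assoc _ _ _

theorem Hom.ract_diff (a : A.Hom) (x : Fin t → k) : (a.ract x).diff = a.diff.ract x := by
  ext
  · rfl
  · exact d_mul_unit a.mem x

theorem Hom.lact_diff (a : A.Hom) (x : Fin t → k) : (a.lact x).diff = a.diff.lact x := by
  ext
  · rfl
  · exact A.d_unit_mul x a.val

theorem barDiff_concat_ract {G G' : List A.Red → M} {x : Fin t → k}
    (h : ∀ u b, G (u ++ [Red.ract b x]) = G' (u ++ [b])) (u : List A.Red) (b : A.Red) :
    barDiff G (u ++ [b.ract x]) = barDiff G' (u ++ [b]) := by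
  induction u generalizing G G' with
  | nil =>
    simp only [List.nil_append, barDiff_cons, mergeHead, barDiff_nil, Red.ract_diff,
      show G [b.diff.ract x] = _ from h [] b.diff, smul_zero]
  | cons d u ih =>
    have e1 := h (d.diff :: u) b
    have e2 : mergeHead G d (u ++ [b.ract x]) = mergeHead G' d (u ++ [b]) := by
      cases u with
      | nil =>
        simp only [List.nil_append, mergeHead, Red.mul_ract]
        exact congrArg _ (h [] (d.mul b))
      | cons e u => exact congrArg _ (h (d.mul e :: u) b)
    have e3 := ih (G := fun w => G (d :: w)) (G' := fun w => G' (d :: w)) fun u b => h (d :: u) b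
    simp only [List.cons_append] at e1 ⊢
    simp only [barDiff_cons, e1, e2, e3]

theorem barDiff_cons_lact {G G' : List A.Red → M} {x : Fin t → k}
    (h : ∀ b u, G (b :: u) = G' (Red.lact x b :: u)) (b : A.Red) (u : List A.Red) :
    barDiff G (b :: u) = barDiff G' (b.lact x :: u) := by
  have e2 : mergeHead G b u = mergeHead G' (b.lact x) u := by
    cases u with
    | nil => rfl
    | cons e u => simp only [mergeHead, Red.lact_mul, h]; rfl
  simp only [barDiff_cons, e2, h, Red.lact_diff]; rfl

end symbols

section chains
variable {M : Type w} [AddCommGroup M] [Module k M]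

/-- The function `F` of `a_0 ⊗ [a_1|...|a_n]` is `k`-multilinear, `K`-balanced and cyclically
`K`-balanced: for each `n` it is a linear map on the tensor product over `K^e` of `A` with the
`n`-fold tensor power over `K` of the augmentation ideal. -/
structure IsCyclic (F : A.Hom → List A.Red → M) : Prop where
  slots : ∀ a, IsMultilinear (F a)
  add : ∀ (l : List A.Red) (a b c : A.Hom), a.deg = c.deg → b.deg = c.deg →
    c.val = a.val + b.val → F c l = F a l + F b l
  smul : ∀ (l : List A.Red) (r : k) (a c : A.Hom), a.deg = c.deg → c.val = r • a.val →
    F c l = r • F a l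
  bal : ∀ (v : List A.Red) (x : Fin t → k) (a : A.Hom) (b : A.Red),
    F (a.ract x) (b :: v) = F a (b.lact x :: v)
  cyc : ∀ (u : List A.Red) (x : Fin t → k) (a : A.Hom) (b : A.Red),
    F a (u ++ [b.ract x]) = F (a.lact x) (u ++ [b])
  cyc_nil : ∀ (x : Fin t → k) (a : A.Hom), F (a.ract x) [] = F (a.lact x) []

variable (A) in
/-- The relations between the symbols `a_0 ⊗ [a_1|...|a_n]`: the smallest submodule of the free
module on these symbols modulo which they are multilinear and (cyclically) `K`-balanced. -/
def chainRel : Submodule k (A.Hom × List A.Red →₀ k) :=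
  sInf {S | IsCyclic fun a l => S.mkQ (Finsupp.single (a, l) 1)}

variable (A) in
/-- The module of Hochschild chains of `A`: the direct sum over `n` of the tensor products over
`K^e` of `A` with the `n`-fold tensor power over `K` of the suspended augmentation ideal. -/
abbrev Chain : Type (max u v) := (A.Hom × List A.Red →₀ k) ⧸ A.chainRel

/-- The Hochschild chain `a_0 ⊗ [a_1|...|a_n]`. -/
def sym (a : A.Hom) (l : List A.Red) : A.Chain := A.chainRel.mkQ (Finsupp.single (a, l) 1)

theorem isCyclic_sym : IsCyclic (sym : A.Hom → List A.Red → A.Chain) := by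
  have key : ∀ x y : A.Hom × List A.Red →₀ k,
      (∀ S : Submodule k (A.Hom × List A.Red →₀ k),
        IsCyclic (fun a l => S.mkQ (Finsupp.single (a, l) 1)) → S.mkQ x = S.mkQ y) →
      A.chainRel.mkQ x = A.chainRel.mkQ y := by
    intro x y h
    refine (Submodule.Quotient.eq _).2 ((Submodule.mem_sInf).2 fun S hS => ?_)
    exact (Submodule.Quotient.eq _).1 (h S hS)
  refine ⟨fun a => ⟨?_, ?_, ?_⟩, ?_, ?_, ?_, ?_, ?_⟩
  · intro u v a' b c h1 h2 h3
    unfold sym; rw [← map_add]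
    exact key _ _ fun S hS => by rw [map_add]; exact (hS.slots a).add u v a' b c h1 h2 h3
  · intro u v r a' c h1 h2
    unfold sym; rw [← map_smul]
    exact key _ _ fun S hS => by rw [map_smul]; exact (hS.slots a).smul u v r a' c h1 h2
  · intro u v x a' b
    exact key _ _ fun S hS => (hS.slots a).bal u v x a' b
  · intro l a b c h1 h2 h3
    unfold sym; rw [← map_add]
    exact key _ _ fun S hS => by rw [map_add]; exact hS.add l a b c h1 h2 h3
  · intro l r a c h1 h2
    unfold sym; rw [← map_smul]
    exact key _ _ fun S hS => by rw [map_smul]; exact hS.smul l r a c h1 h2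
  · exact fun v x a b => key _ _ fun S hS => hS.bal v x a b
  · exact fun u x a b => key _ _ fun S hS => hS.cyc u x a b
  · exact fun x a => key _ _ fun S hS => hS.cyc_nil x a

/-- The linear map on Hochschild chains with given values on the symbols. -/
def chainLift (F : A.Hom → List A.Red → M) (hF : IsCyclic F) : A.Chain →ₗ[k] M :=
  A.chainRel.liftQ (Finsupp.linearCombination k fun p : A.Hom × List A.Red => F p.1 p.2) <| by
    refine sInf_le ?_
    set φ := Finsupp.linearCombination k fun p : A.Hom × List A.Red => F p.1 p.2 with hφ
    have hs : ∀ a l, φ (Finsupp.single (a, l) 1) = F a l := fun a l => by simp [hφ]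
    have key : ∀ x y : A.Hom × List A.Red →₀ k, φ x = φ y →
        (LinearMap.ker φ).mkQ x = (LinearMap.ker φ).mkQ y := fun x y h =>
      (Submodule.Quotient.eq _).2 (by simp [h])
    refine ⟨fun a => ⟨?_, ?_, ?_⟩, ?_, ?_, ?_, ?_, ?_⟩
    · intro u v a' b c h1 h2 h3
      rw [← map_add]; apply key
      rw [map_add, hs, hs, hs]; exact (hF.slots a).add u v a' b c h1 h2 h3
    · intro u v r a' c h1 h2
      rw [← map_smul]; apply key
      rw [map_smul, hs, hs]; exact (hF.slots a).smul u v r a' c h1 h2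
    · intro u v x a' b
      apply key; rw [hs, hs]; exact (hF.slots a).bal u v x a' b
    · intro l a b c h1 h2 h3
      rw [← map_add]; apply key
      rw [map_add, hs, hs, hs]; exact hF.add l a b c h1 h2 h3
    · intro l r a c h1 h2
      rw [← map_smul]; apply key
      rw [map_smul, hs, hs]; exact hF.smul l r a c h1 h2
    · intro v x a b; apply key; rw [hs, hs]; exact hF.bal v x a b
    · intro u x a b; apply key; rw [hs, hs]; exact hF.cyc u x a b
    · intro x a; apply key; rw [hs, hs]; exact hF.cyc_nil x a

theorem chainLift_sym (F : A.Hom → List A.Red → M) (hF : IsCyclic F) (a : A.Hom)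
    (l : List A.Red) : chainLift F hF (sym a l) = F a l := by
  change Finsupp.linearCombination k (fun p : A.Hom × List A.Red => F p.1 p.2)
    (Finsupp.single (a, l) 1) = _
  simp

theorem chain_ext {φ ψ : A.Chain →ₗ[k] M} (h : ∀ a l, φ (sym a l) = ψ (sym a l)) : φ = ψ := by
  apply Submodule.linearMap_qext
  ext ⟨a, l⟩
  exact h a l

theorem IsCyclic.zero {F : A.Hom → List A.Red → M} (hF : IsCyclic F) {a : A.Hom}
    (ha : a.val = 0) (l : List A.Red) : F a l = 0 := by
  simpa using hF.smul l 0 a a rfl (by simp [ha])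

theorem IsCyclic.headTerm {F : A.Hom → List A.Red → M} (hF : IsCyclic F) (a : A.Hom) :
    IsMultilinear (headTerm F a) where
  add u v b c e h1 h2 h3 := by
    cases u with
    | nil =>
      simp only [List.nil_append, AugDGKRing.headTerm, ← smul_add]; congr 1
      exact hF.add v _ _ _ (by simp [Hom.mul, h1]) (by simp [Hom.mul, h2])
        (by simp [Hom.mul, h3, mul_add])
    | cons d u =>
      simp only [List.cons_append, AugDGKRing.headTerm, ← smul_add]; congr 1
      exact (hF.slots _).add u v b c e h1 h2 h3
  smul u v r b e h1 h2 := by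
    cases u with
    | nil =>
      simp only [List.nil_append, AugDGKRing.headTerm]
      rw [smul_comm r]; congr 1
      exact hF.smul v r _ _ (by simp [Hom.mul, h1]) (by simp [Hom.mul, h2])
    | cons d u =>
      simp only [List.cons_append, AugDGKRing.headTerm]
      rw [smul_comm r]; congr 1
      exact (hF.slots _).smul u v r b e h1 h2
  bal u v x b c := by
    cases u with
    | nil =>
      simp only [List.nil_append, AugDGKRing.headTerm]; congr 1
      rw [show (b.ract x).toHom = b.toHom.ract x from rfl, Hom.mul_ract, hF.bal]
    | cons d u =>
      simp only [List.cons_append, AugDGKRing.headTerm]; congr 1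
      exact (hF.slots _).bal u v x b c

theorem IsCyclic.lastTerm {F : A.Hom → List A.Red → M} (hF : IsCyclic F) (a : A.Hom) :
    IsMultilinear (lastTerm F a) where
  add u v b c e h1 h2 h3 := by
    rcases List.eq_nil_or_concat v with rfl | ⟨v, z, rfl⟩
    · simp only [lastTerm_concat, h1, h2, ← smul_add]; congr 1
      exact hF.add u _ _ _ (by simp [Hom.mul, h1]) (by simp [Hom.mul, h2])
        (by simp [Hom.mul, h3, add_mul])
    · simp only [List.concat_eq_append, ← List.cons_append, ← List.append_assoc, lastTerm_concat,
        barDeg_append, barDeg_cons, h1, h2, ← smul_add]; congr 1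
      exact (hF.slots _).add u v b c e h1 h2 h3
  smul u v r b e h1 h2 := by
    rcases List.eq_nil_or_concat v with rfl | ⟨v, z, rfl⟩
    · simp only [lastTerm_concat, h1]; rw [smul_comm r]; congr 1
      exact hF.smul u r _ _ (by simp [Hom.mul, h1]) (by simp [Hom.mul, h2])
    · simp only [List.concat_eq_append, ← List.cons_append, ← List.append_assoc, lastTerm_concat,
        barDeg_append, barDeg_cons, h1]; rw [smul_comm r]; congr 1
      exact (hF.slots _).smul u v r b e h1 h2
  bal u v x b c := by
    rcases List.eq_nil_or_concat v with rfl | ⟨v, z, rfl⟩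
    · have e1 := lastTerm_concat F a (u ++ [b.ract x]) c
      have e2 := lastTerm_concat F a (u ++ [b]) (c.lact x)
      rw [barDeg_ract, hF.cyc] at e1
      simp only [List.append_assoc, List.cons_append, List.nil_append] at e1 e2
      rw [e1, e2, show (c.lact x).toHom = c.toHom.lact x from rfl, Hom.lact_mul]
      rfl
    · simp only [List.concat_eq_append, ← List.cons_append, ← List.append_assoc, lastTerm_concat]
      congr 1
      · simp only [barDeg_append, barDeg_cons]; rfl
      · exact (hF.slots _).bal u v x b c

theorem IsCyclic.boundary {F : A.Hom → List A.Red → M} (hF : IsCyclic F) :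
    IsCyclic (boundaryFun F) where
  slots a := (((hF.slots _).add' ((hF.slots a).barDiff.zsmul _)).add' (hF.headTerm a)).add'
    (hF.lastTerm a)
  add l a b c h1 h2 h3 := by
    have e1 := hF.add l a.diff b.diff c.diff (by simp [Hom.diff, h1]) (by simp [Hom.diff, h2])
      (by simp [Hom.diff, h3])
    have e2 : F c = fun w => F a w + F b w := funext fun w => hF.add w a b c h1 h2 h3
    have e3 : AugDGKRing.headTerm F c l =
        AugDGKRing.headTerm F a l + AugDGKRing.headTerm F b l := by
      cases l with
      | nil => simp [AugDGKRing.headTerm]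
      | cons d l =>
        simp only [AugDGKRing.headTerm, h1, h2, ← smul_add]; congr 1
        exact hF.add l _ _ _ (by simp [Hom.mul, h1]) (by simp [Hom.mul, h2])
          (by simp [Hom.mul, h3, add_mul])
    have e4 : AugDGKRing.lastTerm F c l =
        AugDGKRing.lastTerm F a l + AugDGKRing.lastTerm F b l := by
      rcases List.eq_nil_or_concat l with rfl | ⟨l, z, rfl⟩
      · simp [lastTerm_nil]
      · simp only [List.concat_eq_append, lastTerm_concat, h1, h2, ← smul_add]; congr 1
        exact hF.add l _ _ _ (by simp [Hom.mul, h1]) (by simp [Hom.mul, h2])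
          (by simp [Hom.mul, h3, mul_add])
    have e5 := barDiff_add (F a) (F b) l
    simp only [boundaryFun, e1, e3, e4, h1, h2]
    rw [e2, e5, smul_add]; abel
  smul l r a c h1 h2 := by
    have e1 := hF.smul l r a.diff c.diff (by simp [Hom.diff, h1]) (by simp [Hom.diff, h2])
    have e2 : F c = fun w => r • F a w := funext fun w => hF.smul w r a c h1 h2
    have e3 : AugDGKRing.headTerm F c l = r • AugDGKRing.headTerm F a l := by
      cases l with
      | nil => simp [AugDGKRing.headTerm]
      | cons d l =>
        simp only [AugDGKRing.headTerm, h1]; rw [smul_comm r]; congr 1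
        exact hF.smul l r _ _ (by simp [Hom.mul, h1]) (by simp [Hom.mul, h2])
    have e4 : AugDGKRing.lastTerm F c l = r • AugDGKRing.lastTerm F a l := by
      rcases List.eq_nil_or_concat l with rfl | ⟨l, z, rfl⟩
      · simp [lastTerm_nil]
      · simp only [List.concat_eq_append, lastTerm_concat, h1]; rw [smul_comm r]; congr 1
        exact hF.smul l r _ _ (by simp [Hom.mul, h1]) (by simp [Hom.mul, h2])
    have e5 := barDiff_smul r (F a) l
    simp only [boundaryFun, e1, e3, e4, h1, smul_add]
    rw [e2, e5, smul_comm r]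
  bal v x a b := by
    have e1 := hF.bal v x a.diff b
    have e2 := barDiff_cons_lact (fun b u => hF.bal u x a b) b v
    have e3 : AugDGKRing.headTerm F (a.ract x) (b :: v) =
        AugDGKRing.headTerm F a (b.lact x :: v) := by
      simp only [AugDGKRing.headTerm, Hom.ract_mul]; rfl
    have e4 : AugDGKRing.lastTerm F (a.ract x) (b :: v) =
        AugDGKRing.lastTerm F a (b.lact x :: v) := by
      rcases List.eq_nil_or_concat v with rfl | ⟨v, z, rfl⟩
      · have h1 := lastTerm_concat F (a.ract x) [] b
        have h2 := lastTerm_concat F a [] (b.lact x)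
        rw [Hom.mul_ract, hF.cyc_nil, ← Hom.lact_mul] at h1
        exact h1.trans h2.symm
      · rw [List.concat_eq_append, ← List.cons_append, ← List.cons_append, lastTerm_concat,
          lastTerm_concat, Hom.mul_ract, hF.bal, barDeg_lact]; rfl
    simp only [boundaryFun, e2, e3, e4, Hom.ract_diff, e1]; rfl
  cyc u x a b := by
    have e1 := hF.cyc u x a.diff b
    have e2 := barDiff_concat_ract (G := F a) (G' := F (a.lact x)) (x := x)
      (fun u b => hF.cyc u x a b) u b
    have e3 : AugDGKRing.headTerm F a (u ++ [b.ract x]) =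
        AugDGKRing.headTerm F (a.lact x) (u ++ [b]) := by
      cases u with
      | nil =>
        simp only [List.nil_append, AugDGKRing.headTerm]
        rw [show (b.ract x).toHom = b.toHom.ract x from rfl, Hom.mul_ract, hF.cyc_nil,
          ← Hom.lact_mul]; rfl
      | cons c u =>
        simp only [List.cons_append, AugDGKRing.headTerm]
        rw [hF.cyc, ← Hom.lact_mul]; rfl
    have e4 : AugDGKRing.lastTerm F a (u ++ [b.ract x]) =
        AugDGKRing.lastTerm F (a.lact x) (u ++ [b]) := by
      rw [lastTerm_concat, lastTerm_concat, show (b.ract x).toHom = b.toHom.ract x from rfl,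
        Hom.ract_mul']; rfl
    simp only [boundaryFun, e1, e2, e3, e4, Hom.lact_diff]; rfl
  cyc_nil x a := by
    simp only [boundaryFun, Hom.ract_diff, Hom.lact_diff, hF.cyc_nil, barDiff_nil, smul_zero,
      AugDGKRing.headTerm, lastTerm_nil]

theorem IsMultilinear.append {F : List A.Red → M} (hF : IsMultilinear F) (s : List A.Red) :
    IsMultilinear fun w => F (s ++ w) where
  add u v a b c h1 h2 h3 := by
    simpa only [List.append_assoc] using hF.add (s ++ u) v a b c h1 h2 h3
  smul u v r a c h1 h2 := by
    simpa only [List.append_assoc] using hF.smul (s ++ u) v r a c h1 h2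
  bal u v x a b := by
    simpa only [List.append_assoc] using hF.bal (s ++ u) v x a b

theorem IsMultilinear.append_right {F : List A.Red → M} (hF : IsMultilinear F)
    (s : List A.Red) : IsMultilinear fun w => F (w ++ s) where
  add u v a b c h1 h2 h3 := by
    simpa only [List.append_assoc, List.cons_append] using hF.add u (v ++ s) a b c h1 h2 h3
  smul u v r a c h1 h2 := by
    simpa only [List.append_assoc, List.cons_append] using hF.smul u (v ++ s) r a c h1 h2
  bal u v x a b := by
    simpa only [List.append_assoc, List.cons_append] using hF.bal u (v ++ s) x a b

theorem Hom.lact_one (x : Fin t → k) : (Hom.one A).lact x = (Hom.one A).ract x := by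
  ext
  · rfl
  · simp [Hom.lact, Hom.ract, Hom.one]

theorem Hom.bar_ract (a : A.Hom) (x : Fin t → k) : (a.ract x).bar = a.bar.ract x := by
  ext
  · rfl
  · simp [Hom.bar, Red.ract, Hom.ract, sub_mul, A.aug_unit]

theorem Hom.bar_lact (a : A.Hom) (x : Fin t → k) : (a.lact x).bar = a.bar.lact x := by
  ext
  · rfl
  · simp [Hom.bar, Red.lact, Hom.lact, mul_sub, A.aug_unit]

/-- Moving an element of `K` around the cycle. -/
theorem IsCyclic.rot {F : A.Hom → List A.Red → M} (hF : IsCyclic F) (u : List A.Red)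
    (x : Fin t → k) (b c : A.Red) :
    F (Hom.one A) (c :: u ++ [b.ract x]) = F (Hom.one A) (c.lact x :: u ++ [b]) := by
  rw [hF.cyc, Hom.lact_one, List.cons_append, hF.bal, List.cons_append]

theorem IsCyclic.connes {F : A.Hom → List A.Red → M} (hF : IsCyclic F) :
    IsCyclic (connesFun F) where
  slots a := by
    refine IsMultilinear₂.sum ⟨fun v => ?_, fun u => ?_, fun u v x b c => ?_⟩
    · exact (((hF.slots _).append v).prefix a.bar).weight
        fun d => koszulSign ((a.deg + 1 + d) * barDeg v)
    · exact ((hF.slots _).append_right (a.bar :: u)).weight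
        fun d => koszulSign ((a.deg + 1 + barDeg u) * d)
    · rw [barDeg_ract, barDeg_lact]; congr 1
      simpa using hF.rot (v ++ a.bar :: u) x b c
  add l a b c h1 h2 h3 := by
    rw [connesFun, connesFun, connesFun, ← splitSum_add]
    refine splitSum_congr fun u v _ => ?_
    rw [h1, h2, ← smul_add]; congr 1
    exact (hF.slots _).add v u _ _ _ h1 h2 (by simp [Hom.bar, h3]; abel)
  smul l r a c h1 h2 := by
    rw [connesFun, connesFun]
    refine Eq.trans ?_ (map_splitSum (LinearMap.lsmul k M r) _ l).symm
    refine splitSum_congr fun u v _ => ?_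
    rw [h1, LinearMap.lsmul_apply, smul_comm r]; congr 1
    exact (hF.slots _).smul v u r _ _ h1 (by simp [Hom.bar, h2, smul_sub])
  bal v x a b := by
    simp only [connesFun, splitSum_cons, Hom.bar_ract]
    congr 1
    · rw [barDeg_lact]
      exact congrArg _ (hF.rot v x a.bar b)
    · refine splitSum_congr fun u w _ => ?_
      rw [barDeg_lact, (hF.slots _).bal]; rfl
  cyc u x a b := by
    simp only [connesFun, splitSum_concat, Hom.bar_lact]
    congr 1
    · refine splitSum_congr fun u w _ => ?_
      rw [barDeg_ract]; congr 1
      simpa using (hF.slots _).bal w u x b a.bar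
    · rw [barDeg_ract]
      exact congrArg _ (hF.rot u x b a.bar)
  cyc_nil x a := by
    simp only [connesFun, splitSum_nil, Hom.bar_ract, Hom.bar_lact]
    have h := hF.cyc [] x (Hom.one A) a.bar
    rw [Hom.lact_one] at h
    exact congrArg _ (h.trans (hF.bal [] x (Hom.one A) a.bar))

end chains


section chains
variable {M : Type w} [AddCommGroup M]

/-- The term of the bar differential of `x ++ y` that multiplies the last entry of `x` with the
first entry of `y`. -/
def junction (F : List A.Red → M) (x y : List A.Red) : M :=
  match x.reverse with
  | [] => 0
  | z :: r => koszulSign (barDeg r.reverse) • mergeHead (fun w => F (r.reverse ++ w)) z y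

theorem junction_nil (F : List A.Red → M) (y : List A.Red) : junction F [] y = 0 := rfl

theorem junction_concat (F : List A.Red → M) (x y : List A.Red) (z : A.Red) :
    junction F (x ++ [z]) y = koszulSign (barDeg x) • mergeHead (fun w => F (x ++ w)) z y := by
  simp [junction]

theorem junction_cons_concat (F : List A.Red → M) (a : A.Red) (x y : List A.Red) (z : A.Red) :
    junction F (a :: (x ++ [z])) y =
      koszulSign (a.deg + 1) • junction (fun w => F (a :: w)) (x ++ [z]) y := by
  rw [← List.cons_append, junction_concat, junction_concat, barDeg_cons, koszulSign_add, mul_smul]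
  rfl

theorem barDiff_append (F : List A.Red → M) (x y : List A.Red) :
    barDiff F (x ++ y) = barDiff (fun w => F (w ++ y)) x +
      koszulSign (barDeg x) • barDiff (fun w => F (x ++ w)) y + junction F x y := by
  induction x generalizing F with
  | nil => simp [barDiff_nil, barDeg_nil, koszulSign_zero, junction_nil]
  | cons a x ih =>
    rcases List.eq_nil_or_concat x with rfl | ⟨x, z, rfl⟩
    · have := junction_concat F [] y a
      simp only [List.nil_append, barDeg_nil, koszulSign_zero, one_smul] at this
      simp only [List.cons_append, List.nil_append, barDiff_cons, barDiff_nil, this, barDeg_cons,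
        barDeg_nil, add_zero, smul_zero, mergeHead]
      abel
    · rw [List.concat_eq_append] at ih ⊢
      have hm : ∀ G : List A.Red → M, mergeHead G a (x ++ [z] ++ y) =
          mergeHead (fun w => G (w ++ y)) a (x ++ [z]) := by
        intro G; cases x <;> rfl
      rw [List.cons_append, barDiff_cons, barDiff_cons, ih, hm, junction_cons_concat,
        barDeg_cons, koszulSign_add (a.deg + 1), mul_smul]
      simp only [smul_add, List.cons_append]
      abel

theorem splitSum_telescope {α : Type*} (P Q : List α → List α → M)
    (h : ∀ u b v, P u (b :: v) = -Q (u ++ [b]) v) (l : List α) :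
    splitSum (fun u v => P u v + Q u v) l = P l [] + Q [] l := by
  induction l generalizing P Q with
  | nil => rfl
  | cons b l ih =>
    rw [splitSum_cons, ih (fun u v => P (b :: u) v) (fun u v => Q (b :: u) v)
      (fun u c v => h (b :: u) c v), h [] b l]
    simp only [List.nil_append]; abel

theorem Hom.one_mul (b : A.Hom) : (Hom.one A).mul b = b := by
  ext
  · simp [Hom.one, Hom.mul]
  · simp [Hom.one, Hom.mul]

theorem Hom.mul_one (b : A.Hom) : b.mul (Hom.one A) = b := by
  ext
  · simp [Hom.one, Hom.mul]
  · simp [Hom.one, Hom.mul]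

theorem Red.bar_toHom (b : A.Red) : b.toHom.bar = b := by
  ext
  · rfl
  · simp [Hom.bar, b.aug_eq]

theorem Hom.bar_diff (a : A.Hom) : a.diff.bar = a.bar.diff := by
  ext
  · rfl
  · simp [Hom.bar, Hom.diff, Red.diff, A.aug_d, A.d_unit]

theorem Hom.bar_mul (a : A.Hom) (b : A.Red) :
    (a.bar.toHom.mul b.toHom).bar = a.bar.mul b := Red.bar_toHom (a.bar.mul b)

theorem Hom.mul_bar (a : A.Hom) (b : A.Red) :
    (b.toHom.mul a.bar.toHom).bar = b.mul a.bar := Red.bar_toHom (b.mul a.bar)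

/-- The component in `K`. -/
def Hom.const (a : A.Hom) : A.Hom where
  deg := a.deg
  val := A.unit (A.aug a.val)
  mem := by
    by_cases h : a.deg = 0
    · rw [h]; exact A.unit_mem _
    · rw [A.aug_piece h a.mem]; simp

/-- The boundary of `1 ⊗ w`, summed over all rotations. -/
theorem connes_head_last {F : A.Hom → List A.Red → M} (a : A.Hom)
    (l : List A.Red) :
    splitSum (fun u v => koszulSign ((a.deg + 1 + barDeg u) * barDeg v) •
      (headTerm F (Hom.one A) (v ++ a.bar :: u) + lastTerm F (Hom.one A) (v ++ a.bar :: u))) l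
      = 0 := by
  simp only [smul_add]
  rw [splitSum_telescope]
  · have h1 : headTerm F (Hom.one A) (a.bar :: l) = - F a.bar.toHom l := by
      simp only [headTerm, Hom.one_mul]; simp [Hom.one, koszulSign_one]
    have h2 : lastTerm F (Hom.one A) (l ++ [a.bar]) =
        koszulSign (barDeg l * (a.deg + 1)) • F a.bar.toHom l := by
      rw [lastTerm_concat, Hom.mul_one]
      simp [Hom.one, Hom.bar]
    simp only [List.nil_append, h1, h2, barDeg_nil, mul_zero, koszulSign_zero, one_smul, add_zero,
      smul_smul, ← koszulSign_add]
    rw [koszulSign_congr (n := 0) ⟨(a.deg + 1) * barDeg l, by ring⟩]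
    simp [koszulSign_zero]
  · intro u b v
    have h1 : headTerm F (Hom.one A) (b :: v ++ a.bar :: u) =
        - F b.toHom (v ++ a.bar :: u) := by
      simp only [List.cons_append, headTerm, Hom.one_mul]; simp [Hom.one, koszulSign_one]
    have h2 : lastTerm F (Hom.one A) (v ++ a.bar :: (u ++ [b])) =
        koszulSign ((barDeg v + (a.deg + 1 + barDeg u)) * (b.deg + 1)) •
          F b.toHom (v ++ a.bar :: u) := by
      have := lastTerm_concat F (Hom.one A) (v ++ a.bar :: u) b
      rw [Hom.mul_one, barDeg_append, barDeg_cons] at this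
      simpa [Hom.one, Hom.bar] using this
    rw [h1, h2, smul_neg, smul_smul, ← koszulSign_add]
    congr 2
    simp only [barDeg_append, barDeg_cons, barDeg_nil]
    refine koszulSign_congr ⟨-(b.deg + 1) * barDeg v , by ring⟩

theorem connes_rot {F : A.Hom → List A.Red → M} (c z : A.Red) (v : List A.Red) :
    connesFun F c.toHom (v ++ [z]) =
      koszulSign ((z.deg + 1) * (c.deg + 1 + barDeg v)) • connesFun F z.toHom (c :: v) := by
  simp only [connesFun, splitSum_concat, splitSum_cons, Red.bar_toHom, smul_add]
  rw [add_comm]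
  congr 1
  · simp only [smul_smul, ← koszulSign_add, List.cons_append, List.nil_append, barDeg_cons,
      barDeg_nil, barDeg_append]
    congr 1
    exact koszulSign_congr ⟨-(z.deg + 1) * (c.deg + 1 + barDeg v), by ring⟩
  · rw [← splitSum_zsmul]
    refine splitSum_congr fun u w h => ?_
    rw [smul_smul, ← koszulSign_add, ← h]
    simp only [barDeg_append, barDeg_cons, barDeg_nil, List.append_assoc, List.cons_append,
      List.nil_append]
    congr 1
    exact koszulSign_congr ⟨-(z.deg + 1) * barDeg w, by ring⟩

variable [Module k M]

theorem connes_const {F : A.Hom → List A.Red → M} (hF : IsCyclic F) (a : A.Hom)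
    (l : List A.Red) :
    headTerm (connesFun F) a.const l + lastTerm (connesFun F) a.const l = 0 := by
  have hG := hF.connes
  by_cases h0 : a.deg = 0
  · obtain ⟨x, hx⟩ : ∃ x, a.const = (Hom.one A).lact x := by
      refine ⟨A.aug a.val, ?_⟩
      ext
      · exact h0
      · simp [Hom.const, Hom.lact, Hom.one]
    have e1 : ∀ b : A.Red, ((Hom.one A).lact x).mul b.toHom = (b.lact x).toHom := fun b => by
      rw [Hom.lact_mul, Hom.one_mul]; rfl
    have e2 : ∀ b : A.Red, b.toHom.mul ((Hom.one A).lact x) = b.toHom.ract x := fun b => by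
      rw [Hom.lact_one, Hom.mul_ract, Hom.mul_one]
    rw [hx]
    have hd : ((Hom.one A).lact x).deg = 0 := rfl
    cases l with
    | nil => simp [headTerm, lastTerm_nil]
    | cons b l =>
      rcases List.eq_nil_or_concat l with rfl | ⟨v, z, rfl⟩
      · have := lastTerm_concat (connesFun F) ((Hom.one A).lact x) [] b
        rw [List.nil_append] at this
        rw [this, headTerm, e1, e2, hG.cyc_nil, hd]
        simp [barDeg_nil, koszulSign_zero, koszulSign_one]
        exact neg_add_cancel _
      · rw [List.concat_eq_append, ← List.cons_append, lastTerm_concat, List.cons_append,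
          headTerm, e1, e2, hG.bal, connes_rot, hd]
        rw [barDeg_cons, zero_add, zero_add, koszulSign_one, neg_smul, one_smul, mul_comm]
        exact neg_add_cancel _
  · have hz : a.const.val = 0 := by simp [Hom.const, A.aug_piece h0 a.mem]
    have e1 : headTerm (connesFun F) a.const l = 0 := by
      cases l with
      | nil => rfl
      | cons b l => rw [headTerm, hG.zero (by simp [Hom.mul, hz]), smul_zero]
    have e2 : lastTerm (connesFun F) a.const l = 0 := by
      rcases List.eq_nil_or_concat l with rfl | ⟨v, z, rfl⟩
      · rfl
      · rw [List.concat_eq_append, lastTerm_concat, hG.zero (by simp [Hom.mul, hz]), smul_zero]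
    rw [e1, e2, add_zero]

theorem headTerm_split {G : A.Hom → List A.Red → M} (hG : IsCyclic G) (a : A.Hom)
    (l : List A.Red) :
    headTerm G a l = headTerm G a.bar.toHom l + headTerm G a.const l := by
  cases l with
  | nil => simp [headTerm]
  | cons b l =>
    simp only [headTerm, show a.bar.deg = a.deg from rfl, show a.const.deg = a.deg from rfl,
      ← smul_add]
    congr 1
    exact hG.add l _ _ _ rfl rfl (by simp [Hom.mul, Hom.bar, Hom.const, sub_mul])

theorem lastTerm_split {G : A.Hom → List A.Red → M} (hG : IsCyclic G) (a : A.Hom)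
    (l : List A.Red) :
    lastTerm G a l = lastTerm G a.bar.toHom l + lastTerm G a.const l := by
  rcases List.eq_nil_or_concat l with rfl | ⟨l, z, rfl⟩
  · simp [lastTerm_nil]
  · simp only [List.concat_eq_append, lastTerm_concat, show a.bar.deg = a.deg from rfl,
      show a.const.deg = a.deg from rfl, ← smul_add]
    congr 1
    exact hG.add l _ _ _ rfl rfl (by simp [Hom.mul, Hom.bar, Hom.const, mul_sub])

/-- The Connes operator anticommutes with the Hochschild boundary. -/
theorem boundary_connes {F : A.Hom → List A.Red → M} (hF : IsCyclic F) (a : A.Hom)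
    (l : List A.Red) :
    boundaryFun (connesFun F) a l + connesFun (boundaryFun F) a l = 0 := by
  have hG := hF.connes
  set Φ := F (Hom.one A) with hΦ
  -- the boundary of the rotations
  have key : connesFun (boundaryFun F) a l =
      splitSum (fun u v => koszulSign ((a.deg + 1 + barDeg u) * barDeg v) •
        barDiff Φ (v ++ a.bar :: u)) l := by
    rw [← add_zero (splitSum _ l), ← connes_head_last (F := F) a l, ← splitSum_add]
    refine splitSum_congr fun u v _ => ?_
    rw [← smul_add]; congr 1
    rw [boundaryFun, hF.zero (a := (Hom.one A).diff) (by simp [Hom.diff, Hom.one, A.d_one])]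
    rw [show (Hom.one A).deg = 0 from rfl, koszulSign_zero, one_smul, zero_add, add_assoc]
  -- the differential of the symbol
  have e1 : connesFun F a.diff l = splitSum (fun u v =>
      koszulSign ((a.deg + barDeg u) * barDeg v) • Φ (v ++ a.bar.diff :: u)) l := by
    refine splitSum_congr fun u v _ => ?_
    rw [Hom.bar_diff]; congr 2
    simp [Hom.diff]
  have e2 : barDiff (connesFun F a) l = splitSum (fun u v =>
      koszulSign ((a.deg + barDeg u) * barDeg v) • barDiff (fun w => Φ (v ++ a.bar :: w)) u +
      koszulSign (barDeg u + (a.deg + 1 + barDeg u) * (barDeg v - 1)) •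
        barDiff (fun w => Φ (w ++ a.bar :: u)) v) l := by
    refine (barDiff_splitSum _ l).trans (splitSum_congr fun u v _ => ?_)
    rw [barDiff_weight (fun d => koszulSign ((a.deg + 1 + d) * barDeg v))
      (fun w => Φ (v ++ a.bar :: w)), barDiff_weight
      (fun d => koszulSign ((a.deg + 1 + barDeg u) * d)) (fun w => Φ (w ++ a.bar :: u)),
      smul_smul, ← koszulSign_add]
    congr 3; ring
  have e3 : headTerm (connesFun F) a.bar.toHom l = -splitSum (fun u v =>
      koszulSign ((a.deg + 1 + barDeg u) * barDeg v + barDeg v) •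
        mergeHead (fun w => Φ (v ++ w)) a.bar u) l := by
    cases l with
    | nil => simp [headTerm, splitSum, mergeHead]
    | cons b l =>
      rw [splitSum_cons, headTerm, connesFun, ← splitSum_zsmul, mergeHead,
        smul_zero, zero_add, ← splitSum_neg]
      refine splitSum_congr fun u v _ => ?_
      rw [Hom.bar_mul, mergeHead, smul_smul, smul_smul, ← neg_smul, ← koszulSign_add,
        ← koszulSign_add, ← koszulSign_succ]
      congr 1
      simp only [Hom.mul, Hom.bar, barDeg_cons]
      exact koszulSign_congr ⟨-barDeg v, by ring⟩
  have e4 : lastTerm (connesFun F) a.bar.toHom l = -splitSum (fun u v =>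
      koszulSign ((a.deg + 1 + barDeg u) * barDeg v) •
        junction Φ v (a.bar :: u)) l := by
    rcases List.eq_nil_or_concat l with rfl | ⟨l, z, rfl⟩
    · simp [lastTerm_nil, splitSum, junction_nil]
    · rw [List.concat_eq_append, lastTerm_concat, connesFun, splitSum_concat, junction_nil,
        smul_zero, add_zero, ← splitSum_zsmul, ← splitSum_neg]
      refine splitSum_congr fun u v h => ?_
      rw [Hom.mul_bar, junction_concat, mergeHead, smul_smul, smul_smul, smul_smul, ← neg_smul,
        ← koszulSign_add, ← koszulSign_add, ← koszulSign_add, ← koszulSign_succ, ← h]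
      congr 1
      simp only [Hom.mul, Hom.bar, barDeg_append, barDeg_cons, barDeg_nil]
      exact koszulSign_congr ⟨barDeg v * (z.deg + 1) - barDeg v - z.deg - 1, by ring⟩
  rw [boundaryFun, headTerm_split hG, lastTerm_split hG]
  have e5 := connes_const hF a l
  have e6 : connesFun F a.diff l + koszulSign a.deg • barDiff (connesFun F a) l +
      headTerm (connesFun F) a.bar.toHom l + lastTerm (connesFun F) a.bar.toHom l +
      connesFun (boundaryFun F) a l = 0 := by
    rw [e1, e2, e3, e4, key, ← splitSum_zsmul, ← splitSum_neg, ← splitSum_neg, ← splitSum_add,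
      ← splitSum_add, ← splitSum_add, ← splitSum_add]
    rw [← splitSum_zero (M := M) l]
    refine splitSum_congr fun u v _ => ?_
    rw [barDiff_append, barDiff_cons]
    simp only [smul_add, smul_neg, smul_smul, ← koszulSign_add]
    rw [show a.bar.deg = a.deg from rfl]
    have s1 : koszulSign ((a.deg + 1 + barDeg u) * barDeg v + barDeg v) =
        koszulSign ((a.deg + barDeg u) * barDeg v) :=
      koszulSign_congr ⟨barDeg v, by ring⟩
    have s2 : koszulSign ((a.deg + 1 + barDeg u) * barDeg v + (barDeg v + (a.deg + 1))) =
        -koszulSign (a.deg + (a.deg + barDeg u) * barDeg v) := by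
      rw [← koszulSign_succ]
      exact koszulSign_congr ⟨barDeg v, by ring⟩
    have s3 : koszulSign (a.deg + (barDeg u + (a.deg + 1 + barDeg u) * (barDeg v - 1))) =
        -koszulSign ((a.deg + 1 + barDeg u) * barDeg v) := by
      rw [← koszulSign_succ]
      exact koszulSign_congr ⟨-1, by ring⟩
    simp only [← add_assoc] at s1 s2 s3 ⊢
    rw [s1, s2, s3]
    simp only [neg_smul]
    abel
  rw [← e6]
  have : headTerm (connesFun F) a.const l = - lastTerm (connesFun F) a.const l :=
    eq_neg_of_add_eq_zero_left e5
  rw [this]; abel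

variable (A) in
/-- The Hochschild boundary. -/
def hochBoundary : A.Chain →ₗ[k] A.Chain := chainLift (boundaryFun sym) isCyclic_sym.boundary

variable (A) in
/-- The Connes operator on Hochschild chains. -/
def connes : A.Chain →ₗ[k] A.Chain := chainLift (connesFun sym) isCyclic_sym.connes

variable (A) in
/-- The Hochschild chains of degree `n`. -/
def chains (n : ℤ) : Submodule k A.Chain :=
  Submodule.span k {c | ∃ (a : A.Hom) (l : List A.Red), a.deg + barDeg l = n ∧ c = sym a l}

variable (A) in
/-- The Hochschild cycles of degree `n`. -/
def cycles (n : ℤ) : Submodule k A.Chain := A.chains n ⊓ LinearMap.ker A.hochBoundary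

variable (A) in
/-- The Hochschild boundaries of degree `n`. -/
def boundaries (n : ℤ) : Submodule k A.Chain := (A.chains (n + 1)).map A.hochBoundary

variable (A) in
/-- The Hochschild homology `HH_n(A)`. -/
abbrev HHHom (n : ℤ) : Type (max u v) :=
  A.cycles n ⧸ (A.boundaries n).submoduleOf (A.cycles n)

theorem map_boundaryFun {N : Type*} [AddCommGroup N] [Module k N] (φ : M →ₗ[k] N)
    (F : A.Hom → List A.Red → M) (a : A.Hom) (l : List A.Red) :
    φ (boundaryFun F a l) = boundaryFun (fun a l => φ (F a l)) a l := by
  have h1 : φ (headTerm F a l) = headTerm (fun a l => φ (F a l)) a l := by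
    cases l <;> simp [headTerm]
  have h2 : φ (lastTerm F a l) = lastTerm (fun a l => φ (F a l)) a l := by
    rcases List.eq_nil_or_concat l with rfl | ⟨l, z, rfl⟩
    · simp [lastTerm_nil]
    · simp only [List.concat_eq_append, lastTerm_concat, map_zsmul]
  simp only [boundaryFun, map_add, map_zsmul, h1, h2, map_barDiff]

theorem map_connesFun {N : Type*} [AddCommGroup N] [Module k N] (φ : M →ₗ[k] N)
    (F : A.Hom → List A.Red → M) (a : A.Hom) (l : List A.Red) :
    φ (connesFun F a l) = connesFun (fun a l => φ (F a l)) a l := by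
  simp only [connesFun, map_splitSum, map_zsmul]

theorem connes_hochBoundary (c : A.Chain) :
    A.connes (A.hochBoundary c) = -A.hochBoundary (A.connes c) := by
  have : A.connes ∘ₗ A.hochBoundary = -(A.hochBoundary ∘ₗ A.connes) := by
    refine chain_ext fun a l => ?_
    simp only [LinearMap.comp_apply, LinearMap.neg_apply]
    rw [hochBoundary, chainLift_sym, map_boundaryFun]
    rw [show A.connes (sym a l) = connesFun sym a l from chainLift_sym _ _ _ _, map_connesFun]
    simp only [connes, chainLift_sym]
    exact eq_neg_of_add_eq_zero_left (boundary_connes isCyclic_sym a l)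
  exact LinearMap.congr_fun this c

theorem connes_mem_chains {m n : ℤ} (h : n = m + 1) {c : A.Chain} (hc : c ∈ A.chains m) :
    A.connes c ∈ A.chains n := by
  induction hc using Submodule.span_induction with
  | zero => rw [map_zero]; exact Submodule.zero_mem _
  | add x y _ _ hx hy => rw [map_add]; exact Submodule.add_mem _ hx hy
  | smul r x _ hx => rw [map_smul]; exact Submodule.smul_mem _ _ hx
  | mem x hx =>
    obtain ⟨a, l, hd, rfl⟩ := hx
    rw [connes, chainLift_sym]
    refine splitSum_mem _ fun u v huv => zsmul_mem' _ _ (Submodule.subset_span ⟨_, _, ?_, rfl⟩)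
    rw [← huv, barDeg_append] at hd
    rw [barDeg_append, barDeg_cons, h, ← hd]
    simp only [Hom.one, Hom.bar]; ring

/-- The Connes operator `HH_m(A) → HH_n(A)`, `n = m + 1`, on Hochschild homology. -/
def HHHom.connes (A : AugDGKRing.{u, v} k t) (m n : ℤ) (h : n = m + 1) :
    A.HHHom m →ₗ[k] A.HHHom n :=
  Submodule.mapQ _ _
    (A.connes.restrict (p := A.cycles m) (q := A.cycles n) fun c hc =>
      ⟨connes_mem_chains h hc.1, by
        change A.hochBoundary (A.connes c) = 0
        rw [← neg_eq_zero, ← connes_hochBoundary, LinearMap.mem_ker.1 hc.2,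
          map_zero]⟩)
    (by
      rintro ⟨c, hc⟩ ⟨e, he, hec⟩
      refine ⟨-A.connes e, Submodule.neg_mem _ (connes_mem_chains (by lia) he), ?_⟩
      rw [map_neg, ← connes_hochBoundary, hec]; rfl)

end chains

/-! ### The Koszul dual -/

section koszul

variable (A) in
/-- The augmentation ideal. -/
def augIdeal : Submodule k A.carrier := LinearMap.ker A.aug.toLinearMap

variable (A) in
/-- `A` is complete: the powers of the augmentation ideal intersect in zero. -/
def IsComplete : Prop := ⨅ n : ℕ, A.augIdeal ^ (n + 1) = ⊥

variable (A) in
/-- `A` is typical: locally finite, and either non-negative, or non-positive and simply connected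
(`A_0 = K` and `A_(-1) = 0`). -/
structure IsTypical : Prop where
  finite : ∀ i, FiniteDimensional k (A.piece i)
  bounded : (∀ i < 0, A.piece i = ⊥) ∨
    ((∀ i > 0, A.piece i = ⊥) ∧ (∀ a ∈ A.piece 0, ∃ x, A.unit x = a) ∧ A.piece (-1) = ⊥)

variable (A) in
/-- A homogeneous element of the coaugmentation coideal of the dual coring `A^∨`: a linear form
supported in a single degree `deg` that vanishes on `K`.  Its lower degree in `A^∨` is `-deg`. -/
@[ext] structure Codual where
  deg : ℤ
  val : Module.Dual k A.carrier
  supp : ∀ {m : ℤ}, m ≠ deg → ∀ a ∈ A.piece m, val a = 0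
  unit_eq : ∀ x, val (A.unit x) = 0

namespace Codual

/-- The left action of `K` on `A^∨`, `(x f)(a) = f(a x)`. -/
def lact (x : Fin t → k) (f : A.Codual) : A.Codual where
  deg := f.deg
  val := f.val ∘ₗ LinearMap.mulRight k (A.unit x)
  supp h a ha := f.supp h _ (mul_unit_mem ha x)
  unit_eq y := by simp [← map_mul, f.unit_eq]

/-- The right action of `K` on `A^∨`, `(f x)(a) = f(x a)`. -/
def ract (f : A.Codual) (x : Fin t → k) : A.Codual where
  deg := f.deg
  val := f.val ∘ₗ LinearMap.mulLeft k (A.unit x)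
  supp h a ha := f.supp h _ (unit_mul_mem ha x)
  unit_eq y := by simp [← map_mul, f.unit_eq]

end Codual

variable (A) in
/-- The relations of the tensor ring over `K` of the desuspension of the coaugmentation coideal of
`A^∨`, on the generators `x` of `K` and `⟨f⟩`. -/
inductive CobarRel : FreeAlgebra k ((Fin t → k) ⊕ A.Codual) →
    FreeAlgebra k ((Fin t → k) ⊕ A.Codual) → Prop
  | const (r : k) : CobarRel (FreeAlgebra.ι k (.inl (algebraMap k _ r))) (algebraMap k _ r)
  | const_add (x y : Fin t → k) : CobarRel (FreeAlgebra.ι k (.inl (x + y)))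
      (FreeAlgebra.ι k (.inl x) + FreeAlgebra.ι k (.inl y))
  | const_mul (x y : Fin t → k) : CobarRel (FreeAlgebra.ι k (.inl (x * y)))
      (FreeAlgebra.ι k (.inl x) * FreeAlgebra.ι k (.inl y))
  | add (f g h : A.Codual) : f.deg = h.deg → g.deg = h.deg → h.val = f.val + g.val →
      CobarRel (FreeAlgebra.ι k (.inr h)) (FreeAlgebra.ι k (.inr f) + FreeAlgebra.ι k (.inr g))
  | smul (r : k) (f h : A.Codual) : f.deg = h.deg → h.val = r • f.val →
      CobarRel (FreeAlgebra.ι k (.inr h)) (r • FreeAlgebra.ι k (.inr f))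
  | lact (x : Fin t → k) (f : A.Codual) : CobarRel (FreeAlgebra.ι k (.inr (f.lact x)))
      (FreeAlgebra.ι k (.inl x) * FreeAlgebra.ι k (.inr f))
  | ract (x : Fin t → k) (f : A.Codual) : CobarRel (FreeAlgebra.ι k (.inr (f.ract x)))
      (FreeAlgebra.ι k (.inr f) * FreeAlgebra.ι k (.inl x))

variable (A) in
/-- The ring underlying the cobar construction of the dual coring `A^∨`: the tensor ring over `K` of
the desuspension of the coaugmentation coideal of `A^∨`. -/
def Cobar : Type (max u v) := RingQuot A.CobarRel

instance cobarRing : Ring A.Cobar := inferInstanceAs (Ring (RingQuot A.CobarRel))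

instance cobarAlgebra : Algebra k A.Cobar := inferInstanceAs (Algebra k (RingQuot A.CobarRel))

variable (A) in
/-- The quotient map onto the cobar construction. -/
def cobarMk : FreeAlgebra k ((Fin t → k) ⊕ A.Codual) →ₐ[k] A.Cobar :=
  RingQuot.mkAlgHom k A.CobarRel

theorem cobarMk_rel {a b : FreeAlgebra k ((Fin t → k) ⊕ A.Codual)} (h : A.CobarRel a b) :
    A.cobarMk a = A.cobarMk b := RingQuot.mkAlgHom_rel k h

variable (A) in
/-- The image of a generator in the cobar construction. -/
def letter (g : (Fin t → k) ⊕ A.Codual) : A.Cobar :=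
  A.cobarMk (FreeAlgebra.ι k g)

/-- The generator `⟨f⟩` of the cobar construction. -/
def gen (f : A.Codual) : A.Cobar := A.letter (.inr f)

variable (A) in
/-- The unit of the cobar construction. -/
def cobarUnit : (Fin t → k) →ₐ[k] A.Cobar :=
  AlgHom.ofLinearMap
    { toFun := fun x => A.letter (.inl x)
      map_add' := fun x y => by
        simp only [letter, ← map_add]
        exact cobarMk_rel (.const_add x y)
      map_smul' := fun r x => by
        have h := cobarMk_rel (CobarRel.const_mul (A := A) (algebraMap k _ r) x)
        rw [map_mul, cobarMk_rel (CobarRel.const (A := A) r), AlgHom.commutes,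
          ← Algebra.smul_def, ← Algebra.smul_def] at h
        exact h }
    (by
      have h := cobarMk_rel (CobarRel.const (A := A) 1)
      rw [map_one, map_one, map_one] at h
      exact h)
    (fun x y => (cobarMk_rel (CobarRel.const_mul (A := A) x y)).trans
      (map_mul _ _ _))

theorem gen_add {f g h : A.Codual} (h1 : f.deg = h.deg) (h2 : g.deg = h.deg)
    (h3 : h.val = f.val + g.val) : gen h = gen f + gen g := by
  simpa [gen, letter] using cobarMk_rel (CobarRel.add f g h h1 h2 h3)

theorem gen_smul {r : k} {f h : A.Codual} (h1 : f.deg = h.deg) (h2 : h.val = r • f.val) :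
    gen h = r • gen f := by
  simpa [gen, letter] using cobarMk_rel (CobarRel.smul r f h h1 h2)

theorem gen_lact (x : Fin t → k) (f : A.Codual) : gen (f.lact x) = A.cobarUnit x * gen f := by
  exact (cobarMk_rel (CobarRel.lact x f)).trans (map_mul _ _ _)

theorem gen_ract (x : Fin t → k) (f : A.Codual) : gen (f.ract x) = gen f * A.cobarUnit x := by
  exact (cobarMk_rel (CobarRel.ract x f)).trans (map_mul _ _ _)

/-- The universal property of the cobar construction as a tensor ring over `K`. -/
def cobarLift {B : Type w} [Semiring B] [Algebra k B] (η : (Fin t → k) →ₐ[k] B) (φ : A.Codual → B)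
    (hadd : ∀ f g h : A.Codual, f.deg = h.deg → g.deg = h.deg → h.val = f.val + g.val →
      φ h = φ f + φ g)
    (hsmul : ∀ (r : k) (f h : A.Codual), f.deg = h.deg → h.val = r • f.val → φ h = r • φ f)
    (hl : ∀ x f, φ (f.lact x) = η x * φ f) (hr : ∀ x f, φ (f.ract x) = φ f * η x) :
    A.Cobar →ₐ[k] B :=
  RingQuot.liftAlgHom k ⟨FreeAlgebra.lift k (Sum.elim η φ), by
    intro a b hab
    cases hab with
    | const r => simp only [FreeAlgebra.lift_ι_apply, Sum.elim_inl, AlgHom.commutes]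
    | const_add x y => simp
    | const_mul x y => simp
    | add f g h h1 h2 h3 => simpa using hadd f g h h1 h2 h3
    | smul r f h h1 h2 => simpa using hsmul r f h h1 h2
    | lact x f => simpa using hl x f
    | ract x f => simpa using hr x f⟩

section lift
variable {B : Type w} [Semiring B] [Algebra k B] (η : (Fin t → k) →ₐ[k] B) (φ : A.Codual → B)
    (hadd : ∀ f g h : A.Codual, f.deg = h.deg → g.deg = h.deg → h.val = f.val + g.val →
      φ h = φ f + φ g)
    (hsmul : ∀ (r : k) (f h : A.Codual), f.deg = h.deg → h.val = r • f.val → φ h = r • φ f)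
    (hl : ∀ x f, φ (f.lact x) = η x * φ f) (hr : ∀ x f, φ (f.ract x) = φ f * η x)

theorem cobarLift_unit (x : Fin t → k) :
    cobarLift η φ hadd hsmul hl hr (A.cobarUnit x) = η x := by
  change RingQuot.liftAlgHom k _ (RingQuot.mkAlgHom k _ _) = _
  simp

theorem cobarLift_gen (f : A.Codual) : cobarLift η φ hadd hsmul hl hr (gen f) = φ f := by
  change RingQuot.liftAlgHom k _ (RingQuot.mkAlgHom k _ _) = _
  simp

end lift

theorem cobar_induction {P : A.Cobar → Prop} (hu : ∀ x, P (A.cobarUnit x))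
    (hg : ∀ f, P (gen f)) (hadd : ∀ a b, P a → P b → P (a + b))
    (hmul : ∀ a b, P a → P b → P (a * b)) (a : A.Cobar) : P a := by
  obtain ⟨a, rfl⟩ := RingQuot.mkAlgHom_surjective k A.CobarRel a
  induction a using FreeAlgebra.induction with
  | grade0 r =>
    have := hu (algebraMap k _ r)
    rwa [AlgHom.commutes] at this ⊢
  | grade1 g =>
    cases g with
    | inl x => exact hu x
    | inr f => exact hg f
  | mul a b ha hb => rw [map_mul]; exact hmul _ _ ha hb
  | add a b ha hb => rw [map_add]; exact hadd _ _ ha hb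

theorem cobarHom_ext {B : Type w} [Semiring B] [Algebra k B] {φ ψ : A.Cobar →ₐ[k] B}
    (hu : ∀ x, φ (A.cobarUnit x) = ψ (A.cobarUnit x)) (hg : ∀ f, φ (gen f) = ψ (gen f)) :
    φ = ψ :=
  AlgHom.ext fun a => cobar_induction (P := fun a => φ a = ψ a) hu hg
    (fun a b ha hb => by rw [map_add, map_add, ha, hb])
    (fun a b ha hb => by rw [map_mul, map_mul, ha, hb]) a

/-- The degree of a generator: `0` for `x` in `K` and `|f| - 1` for `⟨f⟩`. -/
def letterDeg : (Fin t → k) ⊕ A.Codual → ℤ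
  | .inl _ => 0
  | .inr f => -f.deg - 1

variable (A) in
/-- The component of degree `n` of the cobar construction. -/
def cobarPiece (n : ℤ) : Submodule k A.Cobar :=
  Submodule.span k {a | ∃ l : List ((Fin t → k) ⊕ A.Codual),
    (l.map letterDeg).sum = n ∧ a = (l.map A.letter).prod}

theorem letter_mem (g : (Fin t → k) ⊕ A.Codual) : A.letter g ∈ A.cobarPiece (letterDeg g) :=
  Submodule.subset_span ⟨[g], by simp, by simp⟩

theorem cobarUnit_mem (x : Fin t → k) : A.cobarUnit x ∈ A.cobarPiece 0 := letter_mem (.inl x)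

theorem gen_mem (f : A.Codual) : gen f ∈ A.cobarPiece (-f.deg - 1) := letter_mem (.inr f)

instance cobarGradedMonoid : SetLike.GradedMonoid A.cobarPiece where
  one_mem := Submodule.subset_span ⟨[], by simp, by simp⟩
  mul_mem := by
    intro i j a b ha hb
    have h := Submodule.mul_mem_mul ha hb
    rw [cobarPiece, cobarPiece, Submodule.span_mul_span] at h
    refine Submodule.span_mono ?_ h
    rintro _ ⟨_, ⟨l, hl, rfl⟩, _, ⟨l', hl', rfl⟩, rfl⟩
    exact ⟨l ++ l', by simp [hl, hl'], by simp⟩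

theorem of_congr {i j : ℤ} {a b : A.Cobar} (ha : a ∈ A.cobarPiece i) (hb : b ∈ A.cobarPiece j)
    (hij : i = j) (hab : a = b) :
    DirectSum.of (fun n => A.cobarPiece n) i ⟨a, ha⟩ =
      DirectSum.of (fun n => A.cobarPiece n) j ⟨b, hb⟩ := by
  subst hij; subst hab; rfl

variable (A) in
/-- The decomposition of the cobar construction into its homogeneous components. -/
def cobarDecompose : A.Cobar →ₐ[k] DirectSum ℤ fun n => A.cobarPiece n :=
  cobarLift
    (AlgHom.ofLinearMap
      (DirectSum.lof k ℤ (fun n => A.cobarPiece n) 0 ∘ₗ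
        A.cobarUnit.toLinearMap.codRestrict (A.cobarPiece 0) fun x => cobarUnit_mem x)
      (by
        rw [DirectSum.one_def]
        exact of_congr _ _ rfl (map_one A.cobarUnit))
      (fun x y => by
        change DirectSum.of (fun n => A.cobarPiece n) 0 _ =
          DirectSum.of (fun n => A.cobarPiece n) 0 _ * DirectSum.of (fun n => A.cobarPiece n) 0 _
        rw [DirectSum.of_mul_of]
        exact of_congr _ _ (by simp) (map_mul A.cobarUnit x y)))
    (fun f => DirectSum.of (fun n => A.cobarPiece n) (-f.deg - 1) ⟨gen f, gen_mem f⟩)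
    (fun f g h h1 h2 h3 => by
      rw [of_congr (gen_mem f) (h1 ▸ gen_mem f) (by rw [h1]) rfl,
        of_congr (gen_mem g) (h2 ▸ gen_mem g) (by rw [h2]) rfl, ← map_add]
      exact of_congr _ _ rfl (gen_add h1 h2 h3))
    (fun r f h h1 h2 => by
      rw [of_congr (gen_mem f) (h1 ▸ gen_mem f) (by rw [h1]) rfl]
      refine Eq.trans ?_ ((DirectSum.lof k ℤ (fun n => A.cobarPiece n) _).map_smul r _)
      exact of_congr _ _ rfl (gen_smul h1 h2))
    (fun x f => by
      change _ = DirectSum.of (fun n => A.cobarPiece n) 0 _ * _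
      rw [DirectSum.of_mul_of]
      exact of_congr _ _ (by simp [Codual.lact]) (gen_lact x f))
    (fun x f => by
      change _ = _ * DirectSum.of (fun n => A.cobarPiece n) 0 _
      rw [DirectSum.of_mul_of]
      exact of_congr _ _ (by simp [Codual.ract]) (gen_ract x f))

theorem cobarDecompose_letter (g : (Fin t → k) ⊕ A.Codual) :
    A.cobarDecompose (A.letter g) =
      DirectSum.of (fun n => A.cobarPiece n) (letterDeg g) ⟨A.letter g, letter_mem g⟩ := by
  cases g with
  | inl x => exact cobarLift_unit _ _ _ _ _ _ x
  | inr f => exact cobarLift_gen _ _ _ _ _ _ f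

instance cobarGradedAlgebra : GradedAlgebra A.cobarPiece :=
  GradedAlgebra.ofAlgHom A.cobarPiece A.cobarDecompose
    (cobarHom_ext (fun x => by
      have := cobarDecompose_letter (A := A) (.inl x)
      change DirectSum.coeAlgHom A.cobarPiece (A.cobarDecompose (A.letter (.inl x))) = _
      rw [this]; simp; rfl)
      (fun f => by
      have := cobarDecompose_letter (A := A) (.inr f)
      change DirectSum.coeAlgHom A.cobarPiece (A.cobarDecompose (A.letter (.inr f))) = _
      rw [this]; simp; rfl))
    (by
      rintro i ⟨a, ha⟩
      change A.cobarDecompose a = _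
      have key : ∀ a (ha : a ∈ A.cobarPiece i), A.cobarDecompose a =
          DirectSum.lof k ℤ (fun n => A.cobarPiece n) i ⟨a, ha⟩ := by
        intro a ha
        induction ha using Submodule.span_induction with
        | zero => rw [map_zero]; exact (map_zero _).symm
        | add x y hx hy h1 h2 => rw [map_add, h1, h2, ← map_add]; rfl
        | smul r x hx h => rw [map_smul, h, ← map_smul]; rfl
        | mem x hx =>
          obtain ⟨l, hl, rfl⟩ := hx
          clear ha
          induction l generalizing i with
          | nil =>
            simp only [List.map_nil, List.prod_nil, map_one]
            rw [DirectSum.one_def]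
            exact of_congr _ _ (by simpa using hl) rfl
          | cons g l ih =>
            have h2 := ih _ rfl
            simp only [List.map_cons, List.prod_cons, map_mul, cobarDecompose_letter, h2]
            refine (DirectSum.of_mul_of _ _).trans ?_
            exact of_congr _ _ (by simpa using hl) rfl
      exact key a ha)


variable (A) in
/-- The component of degree `i` of the augmentation ideal. -/
def redPiece (i : ℤ) : Submodule k A.carrier := A.piece i ⊓ A.augIdeal

variable (A) in
/-- The projection of `A` onto the component of degree `i` of the augmentation ideal. -/
def redProj (i : ℤ) : A.carrier →ₗ[k] A.redPiece i :=
  LinearMap.codRestrict _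
    ((LinearMap.id - A.unit.toLinearMap ∘ₗ A.aug.toLinearMap) ∘ₗ GradedAlgebra.proj A.piece i)
    (fun a => by
      rw [LinearMap.comp_apply]
      have h : GradedAlgebra.proj A.piece i a ∈ A.piece i := SetLike.coe_mem _
      generalize GradedAlgebra.proj A.piece i a = b at h
      exact ⟨(⟨i, b, h⟩ : A.Hom).bar.mem, (⟨i, b, h⟩ : A.Hom).bar.aug_eq⟩)

theorem redProj_coe (i : ℤ) (a : A.carrier) : (A.redProj i a : A.carrier) =
    GradedAlgebra.proj A.piece i a - A.unit (A.aug (GradedAlgebra.proj A.piece i a)) := rfl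

theorem redProj_same {i : ℤ} {a : A.carrier} (ha : a ∈ A.redPiece i) :
    (A.redProj i a : A.carrier) = a := by
  have h : A.aug a = 0 := ha.2
  rw [redProj_coe, GradedAlgebra.proj_apply, DirectSum.decompose_of_mem_same _ ha.1, h]
  simp

theorem redProj_ne {i m : ℤ} (hm : m ≠ i) {a : A.carrier} (ha : a ∈ A.piece m) :
    A.redProj i a = 0 := by
  ext
  rw [redProj_coe, GradedAlgebra.proj_apply, DirectSum.decompose_of_mem_ne _ ha hm]
  simp

theorem redProj_unit (i : ℤ) (x : Fin t → k) : A.redProj i (A.unit x) = 0 := by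
  by_cases h : 0 = i
  · subst h
    ext
    rw [redProj_coe, GradedAlgebra.proj_apply, DirectSum.decompose_of_mem_same _ (A.unit_mem x),
      A.aug_unit]
    simp
  · exact redProj_ne h (A.unit_mem x)

theorem hom_induction {P : A.carrier → Prop} (h0 : ∀ i, ∀ a ∈ A.piece i, P a)
    (hadd : ∀ a b, P a → P b → P (a + b)) (a : A.carrier) : P a :=
  DirectSum.Decomposition.inductionOn A.piece (h0 0 0 (Submodule.zero_mem _))
    (fun {i} m => h0 i m m.2) hadd a

theorem redProj_of_mem {i : ℤ} {a : A.carrier} (ha : a ∈ A.piece i) :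
    (A.redProj i a : A.carrier) = a - A.unit (A.aug a) := by
  rw [redProj_coe, GradedAlgebra.proj_apply, DirectSum.decompose_of_mem_same _ ha]

theorem redProj_mul_unit (i : ℤ) (a : A.carrier) (x : Fin t → k) :
    (A.redProj i (a * A.unit x) : A.carrier) = A.redProj i a * A.unit x := by
  refine hom_induction (P := fun a => (A.redProj i (a * A.unit x) : A.carrier) =
    A.redProj i a * A.unit x) (fun m a ha => ?_) (fun a b ha hb => ?_) a
  · by_cases h : m = i
    · subst h
      rw [redProj_of_mem ha, redProj_of_mem (mul_unit_mem ha x)]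
      simp [A.aug_unit, sub_mul]
    · rw [redProj_ne h ha, redProj_ne h (mul_unit_mem ha x)]; simp
  · simp only [add_mul, map_add, Submodule.coe_add, ha, hb]

theorem redProj_unit_mul (i : ℤ) (a : A.carrier) (x : Fin t → k) :
    (A.redProj i (A.unit x * a) : A.carrier) = A.unit x * A.redProj i a := by
  refine hom_induction (P := fun a => (A.redProj i (A.unit x * a) : A.carrier) =
    A.unit x * A.redProj i a) (fun m a ha => ?_) (fun a b ha hb => ?_) a
  · by_cases h : m = i
    · subst h
      rw [redProj_of_mem ha, redProj_of_mem (unit_mul_mem ha x)]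
      simp [A.aug_unit, mul_sub]
    · rw [redProj_ne h ha, redProj_ne h (unit_mul_mem ha x)]; simp
  · simp only [mul_add, map_add, Submodule.coe_add, ha, hb]

/-- The element of the coaugmentation coideal of `A^∨` given by the restriction of a linear form to
the component of degree `i` of the augmentation ideal. -/
def Codual.of (i : ℤ) (g : Module.Dual k A.carrier) : A.Codual where
  deg := i
  val := g ∘ₗ (A.redPiece i).subtype ∘ₗ A.redProj i
  supp h a ha := by simp [redProj_ne h ha]
  unit_eq x := by simp [redProj_unit]

theorem Codual.of_self (f : A.Codual) : Codual.of f.deg f.val = f := by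
  refine Codual.ext rfl (LinearMap.ext fun a => ?_)
  change f.val (A.redProj f.deg a) = f.val a
  refine hom_induction (P := fun a => f.val (A.redProj f.deg a) = f.val a)
    (fun m a ha => ?_) (fun a b ha hb => ?_) a
  · by_cases h : m = f.deg
    · rw [redProj_of_mem (h ▸ ha), map_sub, f.unit_eq, sub_zero]
    · rw [redProj_ne h ha, f.supp h a ha]; simp
  · simp only [map_add, Submodule.coe_add, ha, hb]

variable (A) in
/-- The generator `⟨f⟩` of the cobar construction, for `f` the restriction of a linear form to the
component of degree `i` of the augmentation ideal. -/
def genLin (i : ℤ) : Module.Dual k A.carrier →ₗ[k] A.Cobar where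
  toFun g := gen (Codual.of i g)
  map_add' _ _ := gen_add rfl rfl rfl
  map_smul' _ _ := gen_smul rfl rfl

theorem genLin_val (f : A.Codual) : A.genLin f.deg f.val = gen f :=
  congrArg gen f.of_self

theorem genLin_congr {i : ℤ} {g h : Module.Dual k A.carrier}
    (H : ∀ a ∈ A.redPiece i, g a = h a) : A.genLin i g = A.genLin i h :=
  congrArg gen (Codual.ext rfl (LinearMap.ext fun a => H _ (A.redProj i a).2))

theorem genLin_zero {i : ℤ} {g : Module.Dual k A.carrier}
    (H : ∀ a ∈ A.redPiece i, g a = 0) : A.genLin i g = 0 :=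
  (genLin_congr (h := 0) H).trans (map_zero _)

theorem genLin_lact (i : ℤ) (g : Module.Dual k A.carrier) (x : Fin t → k) :
    A.genLin i (g ∘ₗ LinearMap.mulRight k (A.unit x)) = A.cobarUnit x * A.genLin i g := by
  have h : Codual.of i (g ∘ₗ LinearMap.mulRight k (A.unit x)) = Codual.lact x (Codual.of i g) :=
    Codual.ext rfl (LinearMap.ext fun a => congrArg g (redProj_mul_unit i a x).symm)
  exact (congrArg gen h).trans (gen_lact x _)

theorem genLin_ract (i : ℤ) (g : Module.Dual k A.carrier) (x : Fin t → k) :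
    A.genLin i (g ∘ₗ LinearMap.mulLeft k (A.unit x)) = A.genLin i g * A.cobarUnit x := by
  have h : Codual.of i (g ∘ₗ LinearMap.mulLeft k (A.unit x)) = Codual.ract (Codual.of i g) x :=
    Codual.ext rfl (LinearMap.ext fun a => congrArg g (redProj_unit_mul i a x).symm)
  exact (congrArg gen h).trans (gen_ract x _)

theorem genLin_mem (i : ℤ) (g : Module.Dual k A.carrier) :
    A.genLin i g ∈ A.cobarPiece (-i - 1) := gen_mem (Codual.of i g)

theorem IsTypical.finite_redPiece (hA : A.IsTypical) (i : ℤ) :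
    FiniteDimensional k (A.redPiece i) :=
  haveI := hA.finite i
  Submodule.finiteDimensional_inf_left (A.piece i) A.augIdeal

/-- A basis of the component of degree `i` of the augmentation ideal. -/
def redBasis (hA : A.IsTypical) (i : ℤ) :
    Module.Basis (Fin (Module.finrank k (A.redPiece i))) k (A.redPiece i) :=
  haveI := hA.finite_redPiece i
  Module.finBasis k (A.redPiece i)

/-- The form dual to a basis element. -/
def dualForm (hA : A.IsTypical) (i : ℤ) (α : Fin (Module.finrank k (A.redPiece i))) :
    Module.Dual k A.carrier := (redBasis hA i).coord α ∘ₗ A.redProj i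

/-- The sum `∑ L(x_α) ⟨x_α^*⟩` over a basis `x_α` of the component of degree `i` of the augmentation
ideal (it does not depend on the basis). -/
def contract (hA : A.IsTypical) (i : ℤ) (L : A.carrier →ₗ[k] A.Cobar) : A.Cobar :=
  ∑ α, L (redBasis hA i α) * A.genLin i (dualForm hA i α)

/-- The linear form `b ↦ g (a b)`. -/
def mulForm (g : Module.Dual k A.carrier) : A.carrier →ₗ[k] Module.Dual k A.carrier :=
  (LinearMap.mul k A.carrier).compr₂ g

theorem mulForm_apply (g : Module.Dual k A.carrier) (a b : A.carrier) :
    mulForm g a b = g (a * b) := rfl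

/-- The differential of the generator `⟨f⟩` of the cobar construction,
`d⟨f⟩ = -⟨d f⟩ + ∑ (-1)^(|f_1|+1) ⟨f_1⟩⟨f_2⟩`, for `f` the restriction of `g` to the component of
degree `n` of the augmentation ideal (so that `|f| = -n`).  Here `d f = -(-1)^n f ∘ d`, and the
reduced coproduct of `f` is `∑ f(x_α ·) ⊗ x_α^*`, for a homogeneous basis `x_α` of the augmentation
ideal; only degrees between `0` and `n` contribute. -/
def genDiff (hA : A.IsTypical) (n : ℤ) (g : Module.Dual k A.carrier) : A.Cobar :=
  koszulSign n • A.genLin (n + 1) (g ∘ₗ A.d) +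
    ∑ i ∈ Finset.uIcc 0 n,
      koszulSign (n - i + 1) • contract hA i (A.genLin (n - i) ∘ₗ mulForm g)

section diff
variable (hA : A.IsTypical)

theorem contract_congr {i : ℤ} {L L' : A.carrier →ₗ[k] A.Cobar}
    (h : ∀ a ∈ A.redPiece i, L a = L' a) : contract hA i L = contract hA i L' :=
  Finset.sum_congr rfl fun α _ => by rw [h _ (redBasis hA i α).2]

theorem contract_add (i : ℤ) (L L' : A.carrier →ₗ[k] A.Cobar) :
    contract hA i (L + L') = contract hA i L + contract hA i L' := by
  simp only [contract, LinearMap.add_apply, add_mul, Finset.sum_add_distrib]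

theorem contract_smul (i : ℤ) (r : k) (L : A.carrier →ₗ[k] A.Cobar) :
    contract hA i (r • L) = r • contract hA i L := by
  simp only [contract, LinearMap.smul_apply, smul_mul_assoc, Finset.smul_sum]

theorem contract_zsmul (i : ℤ) (r : ℤ) (L : A.carrier →ₗ[k] A.Cobar) :
    contract hA i (r • L) = r • contract hA i L := by
  simp only [contract, LinearMap.smul_apply, smul_mul_assoc, Finset.smul_sum]

theorem contract_zero {i : ℤ} {L : A.carrier →ₗ[k] A.Cobar}
    (h : ∀ a ∈ A.redPiece i, L a = 0) : contract hA i L = 0 :=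
  Finset.sum_eq_zero fun α _ => by rw [h _ (redBasis hA i α).2, zero_mul]

/-- Moving a linear map across the sum over dual bases. -/
theorem contract_move (i j : ℤ) (L : A.carrier →ₗ[k] A.Cobar) (r : A.carrier →ₗ[k] A.carrier) :
    ∑ α, L (redBasis hA i α) * A.genLin j (dualForm hA i α ∘ₗ r) =
      contract hA j (L ∘ₗ (A.redPiece i).subtype ∘ₗ A.redProj i ∘ₗ r) := by
  have h1 : ∀ α, A.genLin j (dualForm hA i α ∘ₗ r) =
      ∑ γ, (redBasis hA i).coord α (A.redProj i (r (redBasis hA j γ))) •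
        A.genLin j (dualForm hA j γ) := by
    intro α
    simp only [← map_smul, ← map_sum]
    refine genLin_congr fun a ha => ?_
    have h2 : a = ∑ γ, (redBasis hA j).coord γ (A.redProj j a) •
        (redBasis hA j γ : A.carrier) := by
      have h3 := congrArg (A.redPiece j).subtype ((redBasis hA j).sum_repr (A.redProj j a))
      rw [map_sum] at h3
      exact ((redProj_same ha).symm.trans h3.symm)
    change dualForm hA i α (r a) = (∑ γ, (redBasis hA i).coord α (A.redProj i (r (redBasis hA j γ))) •
      dualForm hA j γ) a
    rw [LinearMap.sum_apply]
    conv_lhs => rw [h2, map_sum, map_sum]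
    refine Finset.sum_congr rfl fun γ _ => ?_
    rw [map_smul, map_smul, smul_eq_mul, mul_comm]
    rfl
  have h2 : ∀ γ, L (A.redProj i (r (redBasis hA j γ))) =
      ∑ α, (redBasis hA i).coord α (A.redProj i (r (redBasis hA j γ))) •
        L (redBasis hA i α) := by
    intro γ
    have h3 := congrArg (L ∘ₗ (A.redPiece i).subtype)
      ((redBasis hA i).sum_repr (A.redProj i (r (redBasis hA j γ))))
    rw [map_sum] at h3
    refine h3.symm.trans (Finset.sum_congr rfl fun α _ => ?_)
    rw [map_smul]; rfl
  simp only [contract, h1, LinearMap.comp_apply, Submodule.subtype_apply, h2, Finset.mul_sum,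
    Finset.sum_mul]
  rw [Finset.sum_comm]
  simp only [mul_smul_comm, smul_mul_assoc]

theorem mulForm_add (g h : Module.Dual k A.carrier) : mulForm (g + h) = mulForm g + mulForm h := by
  ext; rfl

theorem mulForm_smul (r : k) (g : Module.Dual k A.carrier) : mulForm (r • g) = r • mulForm g := by
  ext; rfl

theorem genDiff_add (n : ℤ) (g h : Module.Dual k A.carrier) :
    genDiff hA n (g + h) = genDiff hA n g + genDiff hA n h := by
  simp only [genDiff, mulForm_add, LinearMap.comp_add, LinearMap.add_comp, contract_add, map_add,
    smul_add, Finset.sum_add_distrib]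
  abel

theorem genDiff_smul (n : ℤ) (r : k) (g : Module.Dual k A.carrier) :
    genDiff hA n (r • g) = r • genDiff hA n g := by
  simp only [genDiff, mulForm_smul, LinearMap.comp_smul, LinearMap.smul_comp, contract_smul,
    map_smul, smul_add, Finset.smul_sum]
  simp only [smul_comm (_ : ℤ) r]

theorem d_mul_unit' (a : A.carrier) (x : Fin t → k) :
    A.d (a * A.unit x) = A.d a * A.unit x :=
  hom_induction (P := fun a => A.d (a * A.unit x) = A.d a * A.unit x)
    (fun _ _ ha => d_mul_unit ha x)
    (fun a b ha hb => by simp only [add_mul, map_add, ha, hb]) a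

theorem genDiff_lact (n : ℤ) (g : Module.Dual k A.carrier) (x : Fin t → k) :
    genDiff hA n (g ∘ₗ LinearMap.mulRight k (A.unit x)) = A.cobarUnit x * genDiff hA n g := by
  have h1 : (g ∘ₗ LinearMap.mulRight k (A.unit x)) ∘ₗ A.d =
      (g ∘ₗ A.d) ∘ₗ LinearMap.mulRight k (A.unit x) := by
    ext a; simp [d_mul_unit']
  have h2 : ∀ i, contract hA i (A.genLin (n - i) ∘ₗ
      mulForm (g ∘ₗ LinearMap.mulRight k (A.unit x))) =
      A.cobarUnit x * contract hA i (A.genLin (n - i) ∘ₗ mulForm g) := by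
    intro i
    simp only [contract, Finset.mul_sum, ← mul_assoc, LinearMap.comp_apply, ← genLin_lact]
    refine Finset.sum_congr rfl fun α _ => ?_
    congr 2
    ext b; simp [mulForm_apply, mul_assoc]
  simp only [genDiff, h1, h2, genLin_lact, mul_add, Finset.mul_sum, mul_smul_comm]

theorem genDiff_ract (n : ℤ) (g : Module.Dual k A.carrier) (x : Fin t → k) :
    genDiff hA n (g ∘ₗ LinearMap.mulLeft k (A.unit x)) = genDiff hA n g * A.cobarUnit x := by
  have h1 : (g ∘ₗ LinearMap.mulLeft k (A.unit x)) ∘ₗ A.d =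
      (g ∘ₗ A.d) ∘ₗ LinearMap.mulLeft k (A.unit x) := by
    ext a; simp [d_unit_mul]
  have h2 : ∀ i, contract hA i (A.genLin (n - i) ∘ₗ
      mulForm (g ∘ₗ LinearMap.mulLeft k (A.unit x))) =
      contract hA i (A.genLin (n - i) ∘ₗ mulForm g) * A.cobarUnit x := by
    intro i
    conv_rhs => rw [contract, Finset.sum_mul]
    simp only [mul_assoc, ← genLin_ract]
    rw [contract_move]
    refine contract_congr hA fun a ha => ?_
    have h3 := redProj_unit_mul i a x
    rw [redProj_same ha] at h3
    simp only [LinearMap.comp_apply, Submodule.subtype_apply, LinearMap.mulLeft_apply, h3]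
    congr 1
    ext b; simp [mulForm_apply, mul_assoc]
  simp only [genDiff, h1, h2, genLin_ract, add_mul, Finset.sum_mul, smul_mul_assoc]

/-- The matrices that encode a derivation of the cobar construction. -/
def cobarMatrix : A.Cobar →ₐ[k] Matrix (Fin 2) (Fin 2) A.Cobar :=
  cobarLift
    ((Matrix.diagonalAlgHom (n := Fin 2) (α := A.Cobar) k).comp
      (Pi.constAlgHom k (Fin 2) A.Cobar |>.comp A.cobarUnit))
    (fun f => !![koszulSign (f.deg + 1) • gen f, genDiff hA f.deg f.val; 0, gen f])
    (fun f g h h1 h2 h3 => by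
      rw [gen_add h1 h2 h3, h3, genDiff_add, h1, h2]
      ext i j; fin_cases i <;> fin_cases j <;> simp)
    (fun r f h h1 h2 => by
      rw [gen_smul h1 h2, h2, genDiff_smul, h1]
      ext i j; fin_cases i <;> fin_cases j <;> simp [smul_comm])
    (fun x f => by
      have h := genDiff_lact hA f.deg f.val x
      rw [gen_lact]
      change !![_, genDiff hA f.deg (f.val ∘ₗ LinearMap.mulRight k (A.unit x)); _, _] = _
      rw [h]
      ext i j; fin_cases i <;> fin_cases j <;>
        simp [Matrix.mul_apply, Fin.sum_univ_two, Codual.lact, -zsmul_eq_mul])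
    (fun x f => by
      have h := genDiff_ract hA f.deg f.val x
      rw [gen_ract]
      change !![_, genDiff hA f.deg (f.val ∘ₗ LinearMap.mulLeft k (A.unit x)); _, _] = _
      rw [h]
      ext i j; fin_cases i <;> fin_cases j <;>
        simp [Matrix.mul_apply, Fin.sum_univ_two, Codual.ract, -zsmul_eq_mul])

end diff

section diff
variable (hA : A.IsTypical)

/-- The sign automorphism `a ↦ (-1)^|a| a` of the cobar construction. -/
def cobarSign (a : A.Cobar) : A.Cobar := cobarMatrix hA a 0 0

/-- The differential of the cobar construction. -/
def cobarDiff : A.Cobar →ₗ[k] A.Cobar where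
  toFun a := cobarMatrix hA a 0 1
  map_add' a b := by rw [map_add]; rfl
  map_smul' r a := by rw [map_smul]; rfl

theorem cobarMatrix_unit (x : Fin t → k) : cobarMatrix hA (A.cobarUnit x) =
    Matrix.diagonal fun _ => A.cobarUnit x := cobarLift_unit _ _ _ _ _ _ x

theorem cobarMatrix_gen (f : A.Codual) : cobarMatrix hA (gen f) =
    !![koszulSign (f.deg + 1) • gen f, genDiff hA f.deg f.val; 0, gen f] :=
  cobarLift_gen _ _ _ _ _ _ f

theorem cobarMatrix_low (a : A.Cobar) : cobarMatrix hA a 1 0 = 0 ∧ cobarMatrix hA a 1 1 = a := by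
  refine cobar_induction (P := fun a => cobarMatrix hA a 1 0 = 0 ∧ cobarMatrix hA a 1 1 = a)
    (fun x => ?_) (fun f => ?_) (fun a b ha hb => ?_) (fun a b ha hb => ?_) a
  · rw [cobarMatrix_unit]; simp
  · rw [cobarMatrix_gen]; simp
  · rw [map_add]; simp [ha.1, ha.2, hb.1, hb.2]
  · rw [map_mul]; simp [Matrix.mul_apply, Fin.sum_univ_two, ha.1, ha.2, hb.1, hb.2]

theorem cobarSign_mul (a b : A.Cobar) :
    cobarSign hA (a * b) = cobarSign hA a * cobarSign hA b := by
  unfold cobarSign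
  rw [map_mul, Matrix.mul_apply, Fin.sum_univ_two, (cobarMatrix_low hA b).1, mul_zero, add_zero]

theorem cobarSign_add (a b : A.Cobar) :
    cobarSign hA (a + b) = cobarSign hA a + cobarSign hA b := by
  unfold cobarSign; rw [map_add]; rfl

theorem cobarSign_unit (x : Fin t → k) : cobarSign hA (A.cobarUnit x) = A.cobarUnit x := by
  unfold cobarSign; rw [cobarMatrix_unit]; simp

theorem cobarSign_gen (f : A.Codual) :
    cobarSign hA (gen f) = koszulSign (f.deg + 1) • gen f := by
  unfold cobarSign; rw [cobarMatrix_gen]; rfl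

theorem cobarDiff_mul' (a b : A.Cobar) :
    cobarDiff hA (a * b) = cobarDiff hA a * b + cobarSign hA a * cobarDiff hA b := by
  unfold cobarDiff cobarSign
  simp only [LinearMap.coe_mk, AddHom.coe_mk]
  rw [map_mul, Matrix.mul_apply, Fin.sum_univ_two, (cobarMatrix_low hA b).2, add_comm]

theorem cobarDiff_unit (x : Fin t → k) : cobarDiff hA (A.cobarUnit x) = 0 := by
  change cobarMatrix hA _ 0 1 = 0
  rw [cobarMatrix_unit]; simp

theorem cobarDiff_gen (f : A.Codual) : cobarDiff hA (gen f) = genDiff hA f.deg f.val := by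
  change cobarMatrix hA _ 0 1 = _
  rw [cobarMatrix_gen]; rfl

theorem cobarSign_list (l : List ((Fin t → k) ⊕ A.Codual)) :
    cobarSign hA (l.map A.letter).prod =
      koszulSign (l.map letterDeg).sum • (l.map A.letter).prod := by
  induction l with
  | nil => simpa [koszulSign_zero] using cobarSign_unit hA 1
  | cons g l ih =>
    have h : cobarSign hA (A.letter g) = koszulSign (letterDeg g) • A.letter g := by
      cases g with
      | inl x =>
        rw [letterDeg, koszulSign_zero, one_smul]; exact cobarSign_unit hA x
      | inr f =>
        refine (cobarSign_gen hA f).trans ?_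
        rw [letterDeg, koszulSign_congr (m := f.deg + 1) (n := -f.deg - 1) ⟨f.deg + 1, by ring⟩]
        rfl
    simp only [List.map_cons, List.prod_cons, List.sum_cons, cobarSign_mul, h, ih, koszulSign_add,
      smul_mul_smul_comm]

theorem cobarSign_of_mem {i : ℤ} {a : A.Cobar} (ha : a ∈ A.cobarPiece i) :
    cobarSign hA a = koszulSign i • a := by
  induction ha using Submodule.span_induction with
  | zero => unfold cobarSign; rw [map_zero, smul_zero]; rfl
  | add x y _ _ hx hy => rw [cobarSign_add, hx, hy, smul_add]
  | smul r x _ hx =>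
    have : cobarSign hA (r • x) = r • cobarSign hA x := by unfold cobarSign; rw [map_smul]; rfl
    rw [this, hx, smul_comm]
  | mem x hx =>
    obtain ⟨l, rfl, rfl⟩ := hx
    exact cobarSign_list hA l

theorem cobarDiff_mul {i : ℤ} {a : A.Cobar} (ha : a ∈ A.cobarPiece i) (b : A.Cobar) :
    cobarDiff hA (a * b) = cobarDiff hA a * b + koszulSign i • (a * cobarDiff hA b) := by
  rw [cobarDiff_mul', cobarSign_of_mem hA ha, smul_mul_assoc]

theorem zsmul_mem_cobar {i : ℤ} (r : ℤ) {a : A.Cobar} (ha : a ∈ A.cobarPiece i) :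
    r • a ∈ A.cobarPiece i := zsmul_mem ha r

theorem genDiff_mem (n : ℤ) (g : Module.Dual k A.carrier) :
    genDiff hA n g ∈ A.cobarPiece (-n - 2) := by
  refine Submodule.add_mem _ (zsmul_mem_cobar _ ?_)
    (Submodule.sum_mem _ fun i _ => zsmul_mem_cobar _ (Submodule.sum_mem _ fun α _ => ?_))
  · have h := genLin_mem (n + 1) (g ∘ₗ A.d)
    rwa [show -(n + 1) - 1 = -n - 2 by ring] at h
  · have h := SetLike.mul_mem_graded (genLin_mem (n - i) (mulForm g (redBasis hA i α)))
      (genLin_mem i (dualForm hA i α))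
    rwa [show -(n - i) - 1 + (-i - 1) = -n - 2 by ring] at h

theorem cobarDiff_list (l : List ((Fin t → k) ⊕ A.Codual)) :
    cobarDiff hA (l.map A.letter).prod ∈ A.cobarPiece ((l.map letterDeg).sum - 1) := by
  induction l with
  | nil =>
    have h := cobarDiff_unit hA 1
    rw [map_one] at h
    simp [h]
  | cons g l ih =>
    have h : cobarDiff hA (A.letter g) ∈ A.cobarPiece (letterDeg g - 1) := by
      cases g with
      | inl x =>
        have := cobarDiff_unit hA x
        change cobarDiff hA (A.letter _) = 0 at this
        rw [this]; exact Submodule.zero_mem _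
      | inr f =>
        have := cobarDiff_gen hA f
        change cobarDiff hA (A.letter _) = _ at this
        rw [this, letterDeg, show -f.deg - 1 - 1 = -f.deg - 2 by ring]
        exact genDiff_mem hA _ _
    have h2 : (l.map A.letter).prod ∈ A.cobarPiece (l.map letterDeg).sum :=
      Submodule.subset_span ⟨l, rfl, rfl⟩
    simp only [List.map_cons, List.prod_cons, List.sum_cons]
    rw [cobarDiff_mul hA (letter_mem g)]
    refine Submodule.add_mem _ ?_ (zsmul_mem_cobar _ ?_)
    · have := SetLike.mul_mem_graded h h2
      rwa [show letterDeg g - 1 + (l.map letterDeg).sum =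
        letterDeg g + (l.map letterDeg).sum - 1 by ring] at this
    · have := SetLike.mul_mem_graded (letter_mem g) ih
      rwa [show letterDeg g + ((l.map letterDeg).sum - 1) =
        letterDeg g + (l.map letterDeg).sum - 1 by ring] at this

theorem cobarDiff_mem {i : ℤ} {a : A.Cobar} (ha : a ∈ A.cobarPiece i) :
    cobarDiff hA a ∈ A.cobarPiece (i - 1) := by
  induction ha using Submodule.span_induction with
  | zero => rw [map_zero]; exact Submodule.zero_mem _
  | add x y _ _ hx hy => rw [map_add]; exact Submodule.add_mem _ hx hy
  | smul r x _ hx => rw [map_smul]; exact Submodule.smul_mem _ _ hx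
  | mem x hx =>
    obtain ⟨l, rfl, rfl⟩ := hx
    exact cobarDiff_list hA l

variable (A) in
/-- The augmentation of the cobar construction. -/
def cobarAug : A.Cobar →ₐ[k] (Fin t → k) :=
  cobarLift (AlgHom.id k _) (fun _ => 0) (by simp) (by simp) (by simp) (by simp)

theorem cobarAug_unit (x : Fin t → k) : A.cobarAug (A.cobarUnit x) = x :=
  cobarLift_unit _ _ _ _ _ _ x

theorem cobarAug_gen (f : A.Codual) : A.cobarAug (gen f) = 0 := cobarLift_gen _ _ _ _ _ _ f

theorem cobarAug_piece {i : ℤ} {a : A.Cobar} (hi : i ≠ 0) (ha : a ∈ A.cobarPiece i) :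
    A.cobarAug a = 0 := by
  induction ha using Submodule.span_induction with
  | zero => exact map_zero _
  | add x y _ _ hx hy => rw [map_add, hx, hy, add_zero]
  | smul r x _ hx => rw [map_smul, hx, smul_zero]
  | mem x hx =>
    obtain ⟨l, rfl, rfl⟩ := hx
    induction l with
    | nil => simp at hi
    | cons g l ih =>
      simp only [List.map_cons, List.prod_cons, map_mul]
      cases g with
      | inl x => rw [ih (by simpa [letterDeg] using hi), mul_zero]
      | inr f =>
        have := cobarAug_gen f
        change A.cobarAug (A.letter _) = 0 at this
        rw [this, zero_mul]

theorem cobarAug_genDiff (n : ℤ) (g : Module.Dual k A.carrier) :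
    A.cobarAug (genDiff hA n g) = 0 := by
  have h : ∀ i g, A.cobarAug (A.genLin i g) = 0 := fun i g => cobarAug_gen _
  simp [genDiff, contract, h]

theorem cobarAug_diff (a : A.Cobar) : A.cobarAug (cobarDiff hA a) = 0 := by
  refine cobar_induction (P := fun a => A.cobarAug (cobarDiff hA a) = 0)
    (fun x => ?_) (fun f => ?_) (fun a b ha hb => ?_) (fun a b ha hb => ?_) a
  · rw [cobarDiff_unit, map_zero]
  · rw [cobarDiff_gen, cobarAug_genDiff]
  · rw [map_add, map_add, ha, hb, add_zero]
  · rw [cobarDiff_mul', map_add, map_mul, map_mul, ha, hb, zero_mul, mul_zero, add_zero]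

theorem cobarSign_diff (a : A.Cobar) :
    cobarSign hA (cobarDiff hA a) + cobarDiff hA (cobarSign hA a) = 0 := by
  refine cobar_induction
    (P := fun a => cobarSign hA (cobarDiff hA a) + cobarDiff hA (cobarSign hA a) = 0)
    (fun x => ?_) (fun f => ?_) (fun a b ha hb => ?_) (fun a b ha hb => ?_) a
  · have : cobarSign hA (0 : A.Cobar) = 0 := by unfold cobarSign; rw [map_zero]; rfl
    rw [cobarSign_unit, cobarDiff_unit, this, add_zero]
  · rw [cobarSign_gen, map_zsmul, cobarDiff_gen, cobarSign_of_mem hA (genDiff_mem hA _ _),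
      koszulSign_succ, koszulSign_congr (m := -f.deg - 2) (n := f.deg) ⟨-f.deg - 1, by ring⟩,
      neg_smul, add_neg_cancel]
  · rw [map_add, cobarSign_add, cobarSign_add, map_add, add_add_add_comm, ha, hb, add_zero]
  · rw [cobarDiff_mul', cobarSign_add, cobarSign_mul, cobarSign_mul, cobarSign_mul, cobarDiff_mul',
      eq_neg_of_add_eq_zero_left ha, eq_neg_of_add_eq_zero_left hb]
    noncomm_ring

theorem cobarDiff_diff_of (h : ∀ f : A.Codual, cobarDiff hA (cobarDiff hA (gen f)) = 0)
    (a : A.Cobar) : cobarDiff hA (cobarDiff hA a) = 0 := by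
  refine cobar_induction (P := fun a => cobarDiff hA (cobarDiff hA a) = 0)
    (fun x => ?_) h (fun a b ha hb => ?_) (fun a b ha hb => ?_) a
  · rw [cobarDiff_unit, map_zero]
  · rw [map_add, map_add, ha, hb, add_zero]
  · rw [cobarDiff_mul', map_add, cobarDiff_mul', cobarDiff_mul', ha, hb,
      eq_neg_of_add_eq_zero_left (cobarSign_diff hA a)]
    noncomm_ring

end diff

section diffDiff
variable (hA : A.IsTypical)

theorem cobarDiff_genLin (n : ℤ) (g : Module.Dual k A.carrier) :
    cobarDiff hA (A.genLin n g) = genDiff hA n g := by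
  refine (cobarDiff_gen hA (Codual.of n g)).trans ?_
  have h2 : A.genLin (n + 1) ((Codual.of n g).val ∘ₗ A.d) = A.genLin (n + 1) (g ∘ₗ A.d) := by
    refine genLin_congr fun a ha => congrArg g (redProj_same ⟨?_, A.aug_d a⟩)
    have := A.d_mem ha.1
    rwa [add_sub_cancel_right] at this
  have h3 : ∀ i, contract hA i (A.genLin (n - i) ∘ₗ mulForm (Codual.of n g).val) =
      contract hA i (A.genLin (n - i) ∘ₗ mulForm g) := by
    refine fun i => contract_congr hA fun a ha => genLin_congr fun b hb => ?_
    refine congrArg g (redProj_same ⟨?_, ?_⟩)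
    · have := SetLike.mul_mem_graded ha.1 hb.1
      rwa [add_sub_cancel] at this
    · have h : A.aug a = 0 := ha.2
      change A.aug (a * b) = 0
      rw [map_mul, h, zero_mul]
  change koszulSign n • A.genLin (n + 1) ((Codual.of n g).val ∘ₗ A.d) +
    ∑ i ∈ Finset.uIcc 0 n, koszulSign (n - i + 1) •
      contract hA i (A.genLin (n - i) ∘ₗ mulForm (Codual.of n g).val) = _
  simp only [h2, h3, genDiff]

theorem redMul {i j : ℤ} {a b : A.carrier} (ha : a ∈ A.redPiece i) (hb : b ∈ A.redPiece j) :
    a * b ∈ A.redPiece (i + j) := by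
  refine ⟨SetLike.mul_mem_graded ha.1 hb.1, ?_⟩
  have h : A.aug a = 0 := ha.2
  change A.aug (a * b) = 0
  rw [map_mul, h, zero_mul]

theorem redDiff {i : ℤ} {a : A.carrier} (ha : a ∈ A.redPiece i) : A.d a ∈ A.redPiece (i - 1) :=
  ⟨A.d_mem ha.1, A.aug_d a⟩

/-- The threefold reduced coproduct. -/
def triple (n : ℤ) (g : Module.Dual k A.carrier) (p q : ℤ) : A.Cobar :=
  ∑ β, ∑ γ, A.genLin (n - p - q) (mulForm g (redBasis hA p β * redBasis hA q γ)) *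
    A.genLin q (dualForm hA q γ) * A.genLin p (dualForm hA p β)

/-- The part `b ↦ g (a d b)` of the differential. -/
def partR (n : ℤ) (g : Module.Dual k A.carrier) (i : ℤ) : A.Cobar :=
  contract hA i ((A.genLin (n + 1 - i) ∘ₗ LinearMap.lcomp k k A.d) ∘ₗ mulForm g)

/-- The part `b ↦ g (d a b)` of the differential. -/
def partL (n : ℤ) (g : Module.Dual k A.carrier) (i : ℤ) : A.Cobar :=
  contract hA i (A.genLin (n + 1 - i) ∘ₗ mulForm g ∘ₗ A.d)

theorem diff_term1 (n : ℤ) (g : Module.Dual k A.carrier) :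
    koszulSign n • genDiff hA (n + 1) (g ∘ₗ A.d) =
      ∑ i ∈ Finset.uIcc 0 (n + 1), (partR hA n g i + koszulSign i • partL hA n g i) := by
  have h0 : (g ∘ₗ A.d) ∘ₗ A.d = 0 := by ext a; simp [A.d_d]
  rw [genDiff, h0, map_zero, smul_zero, zero_add, Finset.smul_sum]
  refine Finset.sum_congr rfl fun i _ => ?_
  rw [smul_smul, ← koszulSign_add, koszulSign_congr (m := n + (n + 1 - i + 1)) (n := i)
    ⟨n + 1 - i, by ring⟩]
  have : contract hA i (A.genLin (n + 1 - i) ∘ₗ mulForm (g ∘ₗ A.d)) =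
      partL hA n g i + koszulSign i • partR hA n g i := by
    rw [partL, partR, ← contract_zsmul, ← contract_add]
    refine contract_congr hA fun a ha => ?_
    change A.genLin _ _ = A.genLin _ _ + koszulSign i • A.genLin _ _
    rw [← map_zsmul, ← map_add]
    congr 1
    ext b
    change g (A.d (a * b)) = g (A.d a * b) + koszulSign i • g (a * A.d b)
    rw [A.d_mul ha.1, map_add, map_zsmul]
  rw [this, smul_add, smul_smul, koszulSign_mul_self, one_smul, add_comm]

theorem diff_term2 (n : ℤ) (g : Module.Dual k A.carrier) (i : ℤ) :
    koszulSign (n - i + 1) • cobarDiff hA (contract hA i (A.genLin (n - i) ∘ₗ mulForm g)) =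
      (-partR hA n g i + ∑ j ∈ Finset.uIcc 0 (n - i), koszulSign j • triple hA n g i j) +
      (koszulSign i • partL hA n g (i + 1) +
        ∑ j ∈ Finset.uIcc 0 i, koszulSign (i - j + 1) • triple hA n g j (i - j)) := by
  have h1 : cobarDiff hA (contract hA i (A.genLin (n - i) ∘ₗ mulForm g)) =
      ∑ α, genDiff hA (n - i) (mulForm g (redBasis hA i α)) * A.genLin i (dualForm hA i α) +
      koszulSign (n - i + 1) • ∑ α, A.genLin (n - i) (mulForm g (redBasis hA i α)) *
        genDiff hA i (dualForm hA i α) := by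
    rw [contract, map_sum, Finset.smul_sum, ← Finset.sum_add_distrib]
    refine Finset.sum_congr rfl fun α _ => ?_
    rw [LinearMap.comp_apply, cobarDiff_mul hA (genLin_mem _ _), cobarDiff_genLin,
      cobarDiff_genLin, koszulSign_congr (m := -(n - i) - 1) (n := n - i + 1)
        ⟨-(n - i) - 1, by ring⟩]
  have h2 : ∑ α, genDiff hA (n - i) (mulForm g (redBasis hA i α)) * A.genLin i (dualForm hA i α) =
      koszulSign (n - i) • partR hA n g i +
        ∑ j ∈ Finset.uIcc 0 (n - i), koszulSign (n - i - j + 1) • triple hA n g i j := by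
    simp only [genDiff, add_mul, Finset.sum_add_distrib]
    congr 1
    · rw [partR, contract, Finset.smul_sum]
      refine Finset.sum_congr rfl fun α _ => ?_
      rw [smul_mul_assoc, show n - i + 1 = n + 1 - i by ring]
      rfl
    · simp only [Finset.sum_mul]
      rw [Finset.sum_comm]
      refine Finset.sum_congr rfl fun j _ => ?_
      rw [triple, Finset.smul_sum]
      refine Finset.sum_congr rfl fun α _ => ?_
      rw [smul_mul_assoc, contract, Finset.sum_mul]
      congr 1
      refine Finset.sum_congr rfl fun γ _ => ?_
      have h : mulForm (mulForm g (redBasis hA i α)) (redBasis hA j γ) =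
          mulForm g (redBasis hA i α * redBasis hA j γ) := by
        ext b
        simp [mulForm_apply, mul_assoc]
      rw [LinearMap.comp_apply, h]
  have h3 : ∑ α, A.genLin (n - i) (mulForm g (redBasis hA i α)) *
        genDiff hA i (dualForm hA i α) =
      koszulSign i • partL hA n g (i + 1) +
        ∑ j ∈ Finset.uIcc 0 i, koszulSign (i - j + 1) • triple hA n g j (i - j) := by
    simp only [genDiff, mul_add, Finset.sum_add_distrib]
    congr 1
    · simp only [mul_smul_comm]
      rw [← Finset.smul_sum]
      congr 1
      have := contract_move hA i (i + 1) (A.genLin (n - i) ∘ₗ mulForm g) A.d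
      simp only [LinearMap.comp_apply] at this
      rw [this, partL]
      refine contract_congr hA fun a ha => ?_
      have h4 := redDiff ha
      rw [add_sub_cancel_right] at h4
      rw [show n + 1 - (i + 1) = n - i by ring]
      simp only [LinearMap.comp_apply, Submodule.subtype_apply, redProj_same h4]
    · simp only [Finset.mul_sum]
      rw [Finset.sum_comm]
      refine Finset.sum_congr rfl fun j _ => ?_
      simp only [mul_smul_comm]
      rw [← Finset.smul_sum]
      congr 1
      simp only [contract, Finset.mul_sum, triple]
      rw [Finset.sum_comm]
      refine Finset.sum_congr rfl fun β _ => ?_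
      have := contract_move hA i (i - j) (A.genLin (n - i) ∘ₗ mulForm g)
        (LinearMap.mulLeft k (redBasis hA j β : A.carrier))
      simp only [← mul_assoc]
      rw [← Finset.sum_mul, ← Finset.sum_mul]
      congr 1
      refine Eq.trans this ?_
      refine Finset.sum_congr rfl fun γ _ => ?_
      have h4 := redMul (redBasis hA j β).2 (redBasis hA (i - j) γ).2
      rw [add_sub_cancel] at h4
      simp only [LinearMap.comp_apply, Submodule.subtype_apply, LinearMap.mulLeft_apply,
        redProj_same h4]
      rw [show n - j - (i - j) = n - i by ring]
  rw [h1, h2, h3, smul_add, smul_smul, koszulSign_mul_self, one_smul, smul_add, smul_smul,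
    koszulSign_succ, neg_mul, koszulSign_mul_self, neg_smul, one_smul, Finset.smul_sum]
  congr 2
  refine Finset.sum_congr rfl fun j _ => ?_
  rw [smul_smul, ← koszulSign_succ, ← koszulSign_add,
    koszulSign_congr (m := n - i + 1 + (n - i - j + 1)) (n := j) ⟨n - i - j + 1, by ring⟩]

theorem diff_triple (n : ℤ) (T : ℤ → ℤ → A.Cobar) :
    ∑ i ∈ Finset.uIcc 0 n, ∑ j ∈ Finset.uIcc 0 (n - i), koszulSign j • T i j +
      ∑ i ∈ Finset.uIcc 0 n, ∑ j ∈ Finset.uIcc 0 i, koszulSign (i - j + 1) • T j (i - j) = 0 := by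
  rw [Finset.sum_sigma', Finset.sum_sigma', add_eq_zero_iff_eq_neg, ← Finset.sum_neg_distrib]
  refine Finset.sum_nbij' (fun p => ⟨p.1 + p.2, p.1⟩) (fun p => ⟨p.2, p.1 - p.2⟩) ?_ ?_ ?_ ?_ ?_
  · rintro ⟨p, q⟩ h
    simp only [Finset.mem_sigma, Finset.mem_uIcc] at h ⊢
    omega
  · rintro ⟨p, q⟩ h
    simp only [Finset.mem_sigma, Finset.mem_uIcc] at h ⊢
    omega
  · rintro ⟨p, q⟩ _; simp
  · rintro ⟨p, q⟩ _; simp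
  · rintro ⟨p, q⟩ _
    simp [koszulSign_succ]

theorem partR_zero {n : ℤ} (g : Module.Dual k A.carrier) {i : ℤ}
    (h : A.redPiece i = ⊥ ∨ A.redPiece (n - i) = ⊥) : partR hA n g i = 0 := by
  refine contract_zero hA fun a ha => ?_
  rcases h with h | h
  · rw [h, Submodule.mem_bot] at ha
    rw [ha, map_zero]
  · refine genLin_zero fun b hb => ?_
    have h1 := redDiff hb
    rw [show n + 1 - i - 1 = n - i by ring, h, Submodule.mem_bot] at h1
    change g (a * A.d b) = 0
    rw [h1, mul_zero, map_zero]

theorem partL_zero {n : ℤ} (g : Module.Dual k A.carrier) {i : ℤ}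
    (h : A.redPiece i = ⊥ ∨ A.redPiece (i - 1) = ⊥) : partL hA n g i = 0 := by
  refine contract_zero hA fun a ha => ?_
  rcases h with h | h
  · rw [h, Submodule.mem_bot] at ha
    rw [ha, map_zero]
  · have h1 := redDiff ha
    rw [h, Submodule.mem_bot] at h1
    rw [LinearMap.comp_apply, LinearMap.comp_apply, h1, map_zero, map_zero]

theorem redPiece_bot {i : ℤ} (h : A.piece i = ⊥) : A.redPiece i = ⊥ :=
  bot_unique (h ▸ inf_le_left)

theorem genDiff_diff (n : ℤ) (g : Module.Dual k A.carrier) :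
    cobarDiff hA (genDiff hA n g) = 0 := by
  by_cases hn : A.redPiece n = ⊥
  · rw [← cobarDiff_genLin, genLin_zero (fun a ha => ?_), map_zero, map_zero]
    rw [hn, Submodule.mem_bot] at ha
    rw [ha, map_zero]
  have key : ∑ i ∈ Finset.uIcc 0 (n + 1), partR hA n g i = ∑ i ∈ Finset.uIcc 0 n, partR hA n g i ∧
      ∑ i ∈ Finset.uIcc 0 (n + 1), koszulSign i • partL hA n g i =
        -∑ i ∈ Finset.uIcc 0 n, koszulSign i • partL hA n g (i + 1) := by
    have shift : -∑ i ∈ Finset.uIcc 0 n, koszulSign i • partL hA n g (i + 1) =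
        ∑ i ∈ Finset.uIcc 1 (n + 1), koszulSign i • partL hA n g i := by
      rw [← Finset.sum_neg_distrib]
      refine Finset.sum_nbij' (fun i => i + 1) (fun i => i - 1) ?_ ?_ ?_ ?_ ?_
      · intro i h; simp only [Finset.mem_uIcc] at h ⊢; omega
      · intro i h; simp only [Finset.mem_uIcc] at h ⊢; omega
      · intro i _; simp
      · intro i _; simp
      · intro i _; simp [koszulSign_succ]
    rw [shift]
    rcases hA.bounded with hb | ⟨hb, h0, -⟩
    · have hn0 : 0 ≤ n := not_lt.1 fun h => hn (redPiece_bot (hb n h))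
      constructor
      · refine (Finset.sum_subset ?_ ?_).symm
        · intro i h; simp only [Finset.mem_uIcc] at h ⊢; omega
        · intro i h h'
          refine partR_zero hA g (Or.inr (redPiece_bot (hb _ ?_)))
          simp only [Finset.mem_uIcc] at h h'; omega
      · refine (Finset.sum_subset ?_ ?_).symm
        · intro i h; simp only [Finset.mem_uIcc] at h ⊢; omega
        · intro i h h'
          rw [partL_zero hA g (Or.inr (redPiece_bot (hb _ ?_))), smul_zero]
          simp only [Finset.mem_uIcc] at h h'; omega
    · have h00 : A.redPiece 0 = ⊥ := by
        refine bot_unique fun a ha => ?_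
        obtain ⟨x, rfl⟩ := h0 a ha.1
        have h1 : A.aug (A.unit x) = 0 := ha.2
        rw [A.aug_unit] at h1
        rw [h1, map_zero]; exact Submodule.zero_mem _
      have hn0 : n < 0 := by
        by_contra h
        rcases (not_lt.1 h).lt_or_eq with h | h
        · exact hn (redPiece_bot (hb n h))
        · exact hn (h ▸ h00)
      constructor
      · refine Finset.sum_subset ?_ ?_
        · intro i h; simp only [Finset.mem_uIcc] at h ⊢; omega
        · intro i h h'
          have hi : n - i = 0 := by
            simp only [Finset.mem_uIcc] at h h'; omega
          exact partR_zero hA g (Or.inr (hi ▸ h00))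
      · refine Finset.sum_subset ?_ ?_
        · intro i h; simp only [Finset.mem_uIcc] at h ⊢; omega
        · intro i h h'
          rw [partL_zero hA g (Or.inl (redPiece_bot (hb _ ?_))), smul_zero]
          simp only [Finset.mem_uIcc] at h h'; omega
  rw [genDiff, map_add, map_zsmul, cobarDiff_genLin, diff_term1, map_sum]
  simp only [map_zsmul, diff_term2]
  simp only [Finset.sum_add_distrib, key.1, key.2, Finset.sum_neg_distrib]
  have := diff_triple n (triple hA n g)
  refine Eq.trans ?_ this
  abel

end diffDiff

/-- The Koszul dual `Ω(A^∨)`: the cobar construction of the graded dual of `A`. -/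
def koszulDual (A : AugDGKRing.{u, v} k t) (hA : A.IsTypical) : AugDGKRing.{u, max u v} k t where
  carrier := A.Cobar
  piece := A.cobarPiece
  unit := A.cobarUnit
  d := cobarDiff hA
  aug := A.cobarAug
  unit_mem := cobarUnit_mem
  d_mem := cobarDiff_mem hA
  d_mul := cobarDiff_mul hA
  d_d := cobarDiff_diff_of hA fun f => by rw [cobarDiff_gen, genDiff_diff]
  d_unit := cobarDiff_unit hA
  aug_piece := cobarAug_piece
  aug_d := cobarAug_diff hA
  aug_unit := cobarAug_unit

end koszul

/-- The dual `φ ↦ (-1)^|φ| φ ∘ B` of the Connes operator, from `HH_(n+1)(A)^∨` to `HH_n(A)^∨`;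
forms on `HH_(n+1)(A)` have degree `-(n+1)`. -/
def HHHom.connesDual (A : AugDGKRing.{u, v} k t) (n : ℤ) :
    Module.Dual k (A.HHHom (n + 1)) →ₗ[k] Module.Dual k (A.HHHom n) :=
  koszulSign (n + 1) • (HHHom.connes A n (n + 1) rfl).dualMap

end AugDGKRing

end

noncomputable section

set_option linter.unusedSectionVars false
set_option linter.unusedSimpArgs false
set_option linter.unusedVariables false

namespace AugDGKRing
variable {k : Type u} [Field k] {t : ℕ} {A : AugDGKRing.{u, v} k t}

theorem koszulSign_eq {m n : ℤ} (h : (m - n) % 2 = 0) : koszulSign m = koszulSign n :=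
  koszulSign_congr (Int.even_iff.2 h)

theorem koszulSign_eq_neg {m n : ℤ} (h : (m - n) % 2 = 1) : koszulSign m = -koszulSign n := by
  rw [← koszulSign_succ]
  exact koszulSign_eq (by omega)

theorem koszulSign_eq_one {m : ℤ} (h : m % 2 = 0) : koszulSign m = 1 := by
  rw [← koszulSign_zero]
  exact koszulSign_eq (by omega)

theorem koszulSign_eq_neg_one {m : ℤ} (h : m % 2 = 1) : koszulSign m = -1 := by
  rw [← koszulSign_one]
  exact koszulSign_eq (by omega)

theorem mergeHead_nil {M : Type w} [AddCommGroup M] (F : List A.Red → M) (a : A.Red) :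
    mergeHead F a [] = 0 := rfl

theorem mergeHead_cons {M : Type w} [AddCommGroup M] (F : List A.Red → M) (a b : A.Red)
    (l : List A.Red) : mergeHead F a (b :: l) = koszulSign a.deg • F (a.mul b :: l) := rfl

theorem Red.mul_deg (a b : A.Red) : (a.mul b).deg = a.deg + b.deg := rfl
theorem Red.diff_deg (a : A.Red) : a.diff.deg = a.deg - 1 := rfl
theorem Hom.mul_deg (a b : A.Hom) : (a.mul b).deg = a.deg + b.deg := rfl
theorem Hom.diff_deg (a : A.Hom) : a.diff.deg = a.deg - 1 := rfl
theorem Red.mul_assoc (a b c : A.Red) : (a.mul b).mul c = a.mul (b.mul c) :=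
  Red.ext (add_assoc _ _ _) (_root_.mul_assoc _ _ _)
theorem Hom.mul_assoc (a b c : A.Hom) : (a.mul b).mul c = a.mul (b.mul c) :=
  Hom.ext (add_assoc _ _ _) (_root_.mul_assoc _ _ _)

section square
variable {M : Type w} [AddCommGroup M] [Module k M]

theorem IsMultilinear.zero {F : List A.Red → M} (hF : IsMultilinear F) {a : A.Red}
    (ha : a.val = 0) (l l' : List A.Red) : F (l ++ a :: l') = 0 := by
  simpa using hF.smul l l' 0 a a rfl (by simp [ha])

theorem IsMultilinear.zero_cons {F : List A.Red → M} (hF : IsMultilinear F) {a : A.Red}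
    (ha : a.val = 0) (l : List A.Red) : F (a :: l) = 0 := hF.zero ha [] l

/-- A multilinear function depends on the value of an entry and on its degree. -/
theorem IsMultilinear.congr {F : List A.Red → M} (hF : IsMultilinear F) {a b : A.Red}
    (h : a.val = b.val) (hd : a.deg = b.deg) (l : List A.Red) : F (a :: l) = F (b :: l) := by
  rw [show a = b from Red.ext hd h]

theorem barDiff_neg (F : List A.Red → M) (l : List A.Red) :
    barDiff (fun w => -F w) l = -barDiff F l := by
  simpa using barDiff_zsmul (-1) F l

theorem barDiff_barDiff {F : List A.Red → M} (hF : IsMultilinear F) (l : List A.Red) :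
    barDiff (barDiff F) l = 0 := by
  induction l generalizing F with
  | nil => rfl
  | cons a l ih =>
    have e1 : F (a.diff.diff :: l) = 0 := hF.zero_cons (A.d_d _) l
    have e2 : barDiff (fun w => barDiff F (a :: w)) l =
        -barDiff (fun w => F (a.diff :: w)) l + barDiff (fun w => mergeHead F a w) l := by
      simp only [barDiff_cons]
      rw [barDiff_add, barDiff_add, barDiff_neg, barDiff_zsmul, ih (hF.prefix a), smul_zero,
        add_zero]
    rw [barDiff_cons, e2, barDiff_cons F a.diff, e1]
    have hd : a.diff.deg = a.deg - 1 := rfl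
    rw [hd, sub_add_cancel]
    cases l with
    | nil => simp [mergeHead, barDiff_nil]
    | cons b l =>
      simp only [mergeHead_cons, barDiff_cons]
      have e3 : F ((a.mul b).diff :: l) = F (a.diff.mul b :: l) +
          koszulSign a.deg • F (a.mul b.diff :: l) := by
        have h1 := hF.smul [] l (koszulSign a.deg : k) (a.mul b.diff)
          ⟨⟨a.deg + (b.deg - 1), koszulSign a.deg • (a.mul b.diff).val,
            zsmul_mem' _ _ (a.mul b.diff).mem⟩, by
              rw [map_zsmul, (a.mul b.diff).aug_eq, smul_zero]⟩ rfl (by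
              rw [Int.cast_smul_eq_zsmul])
        rw [Int.cast_smul_eq_zsmul] at h1
        simp only [List.nil_append] at h1
        rw [← h1]
        refine hF.add [] l _ _ _ ?_ ?_ ?_
        · simp only [Red.diff, Red.mul, Hom.diff, Hom.mul]; ring
        · simp only [Red.diff, Red.mul, Hom.diff, Hom.mul]; ring
        · exact A.d_mul a.mem b.val
      have e5 : mergeHead (fun w => mergeHead F a w) b l =
          mergeHead F (a.mul b) l := by
        cases l with
        | nil => simp only [mergeHead_nil]
        | cons c l =>
          simp only [mergeHead_cons, Red.mul_assoc, Red.mul_deg, smul_smul, ← koszulSign_add]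
          congr 1
          rw [add_comm b.deg]
      rw [e3, e5, barDiff_zsmul]
      simp only [Red.mul_deg, Red.diff_deg, smul_add, smul_neg, smul_smul, ← koszulSign_add]
      have s1 : ∀ n, koszulSign (a.deg + (a.deg + n + 1)) = -koszulSign n := fun n =>
        koszulSign_eq_neg (by ring_nf; omega)
      have s2 : ∀ n, koszulSign (a.deg + 1 + (n + 1 + a.deg)) = koszulSign n := fun n =>
        koszulSign_eq (by ring_nf; omega)
      have s3 : koszulSign (a.deg + 1 + a.deg) = -1 := koszulSign_eq_neg_one (by omega)
      have s4 : koszulSign (a.deg - 1) = -koszulSign a.deg := koszulSign_eq_neg (by omega)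
      have s5 : koszulSign (a.deg + a.deg) = 1 := koszulSign_eq_one (by omega)
      simp only [s1, s2, s3, s4, s5, koszulSign_succ a.deg, neg_smul, one_smul, smul_neg, neg_neg,
        koszulSign_add, koszulSign_one, mul_smul]
      abel

theorem Hom.d_mul_sub {F : A.Hom → List A.Red → M} (hF : IsCyclic F) (a b : A.Hom)
    (l : List A.Red) : F (a.mul b).diff l =
      F (a.diff.mul b) l + koszulSign a.deg • F (a.mul b.diff) l := by
  have h1 := hF.smul l (koszulSign a.deg : k) (a.mul b.diff)
    ⟨a.deg + (b.deg - 1), koszulSign a.deg • (a.mul b.diff).val,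
      zsmul_mem' _ _ (a.mul b.diff).mem⟩ rfl (by rw [Int.cast_smul_eq_zsmul])
  rw [Int.cast_smul_eq_zsmul] at h1
  rw [← h1]
  refine hF.add l _ _ _ ?_ ?_ ?_
  · simp only [Hom.mul_deg, Hom.diff_deg]; ring
  · simp only [Hom.mul_deg, Hom.diff_deg]; ring
  · exact A.d_mul a.mem b.val

theorem headTerm_cons (F : A.Hom → List A.Red → M) (a : A.Hom) (b : A.Red) (l : List A.Red) :
    headTerm F a (b :: l) = koszulSign (a.deg + 1) • F (a.mul b.toHom) l := rfl

theorem headTerm_nil (F : A.Hom → List A.Red → M) (a : A.Hom) : headTerm F a [] = 0 := rfl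

theorem head_boundary {F : A.Hom → List A.Red → M} (hF : IsCyclic F) (a : A.Hom)
    (l : List A.Red) : headTerm F a.diff l + koszulSign a.deg • barDiff (headTerm F a) l +
      headTerm (fun a l => F a.diff l + koszulSign a.deg • barDiff (F a) l + headTerm F a l) a l
      = 0 := by
  cases l with
  | nil => simp only [headTerm_nil, barDiff_nil, smul_zero, add_zero]
  | cons b l =>
    have e1 : koszulSign (a.deg + 1) • headTerm F (a.mul b.toHom) l +
        koszulSign a.deg • mergeHead (headTerm F a) b l = 0 := by
      cases l with
      | nil => simp only [headTerm_nil, mergeHead_nil, smul_zero, add_zero]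
      | cons c l =>
        simp only [headTerm_cons, mergeHead_cons, Hom.mul_assoc, Hom.mul_deg, smul_smul,
          ← koszulSign_add]
        rw [koszulSign_eq_neg (m := a.deg + 1 + _) (n := a.deg + (b.deg + (a.deg + 1)))
          (by ring_nf; omega), neg_smul]
        exact neg_add_cancel _
    simp only [barDiff_cons, headTerm_cons, barDiff_zsmul, Hom.d_mul_sub hF, smul_add]
    rw [eq_neg_of_add_eq_zero_left e1]
    simp only [smul_neg, smul_smul, ← koszulSign_add, Hom.mul_deg, Hom.diff_deg]
    have s1 : koszulSign (a.deg - 1 + 1) = -koszulSign (a.deg + 1) :=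
      koszulSign_eq_neg (by omega)
    have s2 : koszulSign (a.deg + (b.deg + 1 + (a.deg + 1))) =
        -koszulSign (a.deg + 1 + (a.deg + b.deg)) := koszulSign_eq_neg (by ring_nf; omega)
    have s3 : koszulSign (a.deg + 1 + a.deg) = koszulSign (a.deg + (a.deg + 1)) := by
      rw [add_comm]
    have s4 : koszulSign (a.deg + 1) = -koszulSign a.deg := koszulSign_succ _
    simp only [s1, s2, s3, s4, neg_smul]
    have s5 : b.diff.toHom = b.toHom.diff := rfl
    rw [s5]
    abel

theorem last_boundary {F : A.Hom → List A.Red → M} (hF : IsCyclic F) (a : A.Hom)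
    (l : List A.Red) : lastTerm F a.diff l + koszulSign a.deg • barDiff (lastTerm F a) l +
      lastTerm (fun a l => F a.diff l + koszulSign a.deg • barDiff (F a) l + lastTerm F a l) a l
      = 0 := by
  rcases List.eq_nil_or_concat l with rfl | ⟨u, z, rfl⟩
  · simp only [lastTerm_nil, barDiff_nil, smul_zero, add_zero]
  · have e1 : koszulSign a.deg • junction (lastTerm F a) u [z] +
        koszulSign ((a.deg + barDeg u) * (z.deg + 1)) • lastTerm F (z.toHom.mul a) u = 0 := by
      rcases List.eq_nil_or_concat u with rfl | ⟨u, y, rfl⟩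
      · simp only [lastTerm_nil, junction_nil, smul_zero, add_zero]
      · simp only [List.concat_eq_append, junction_concat, mergeHead_cons, lastTerm_concat,
          ← Hom.mul_assoc, Hom.mul_deg, smul_smul, ← koszulSign_add, barDeg_append, barDeg_cons,
          barDeg_nil, Red.mul_deg]
        rw [koszulSign_eq_neg (n := (a.deg + (barDeg u + (y.deg + 1 + 0))) * (z.deg + 1) +
          (z.deg + a.deg + barDeg u) * (y.deg + 1)) (by ring_nf; omega), neg_smul]
        exact neg_add_cancel _
    rw [List.concat_eq_append, barDiff_append]
    simp only [lastTerm_concat, barDiff_cons, barDiff_nil, mergeHead_nil, smul_zero, add_zero]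
    rw [barDiff_weight (fun d => koszulSign ((a.deg + d) * (z.deg + 1)))]
    simp only [smul_add, Hom.d_mul_sub hF]
    rw [eq_neg_of_add_eq_zero_left e1]
    simp only [smul_neg, smul_smul, ← koszulSign_add, Hom.mul_deg, Hom.diff_deg, Red.diff_deg]
    have s1 : koszulSign ((a.deg + barDeg u) * (z.deg + 1) + z.deg) =
        -koszulSign ((a.deg - 1 + barDeg u) * (z.deg + 1)) :=
      koszulSign_eq_neg (by ring_nf; omega)
    have s2 : koszulSign ((a.deg + barDeg u) * (z.deg + 1) + (z.deg + a.deg)) =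
        -koszulSign (a.deg + (a.deg + (barDeg u - 1)) * (z.deg + 1)) :=
      koszulSign_eq_neg (by ring_nf; omega)
    have s3 : koszulSign (a.deg + (barDeg u + (a.deg + barDeg u) * (z.deg - 1 + 1))) =
        koszulSign ((a.deg + barDeg u) * (z.deg + 1)) :=
      koszulSign_eq (by ring_nf; omega)
    have s5 : z.diff.toHom = z.toHom.diff := rfl
    simp only [s1, s2, s3, neg_smul]
    rw [s5]
    abel

theorem head_last (F : A.Hom → List A.Red → M) (a : A.Hom) (l : List A.Red) :
    headTerm (lastTerm F) a l + lastTerm (headTerm F) a l = 0 := by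
  cases l with
  | nil => simp only [headTerm_nil, lastTerm_nil, add_zero]
  | cons b l =>
    rcases List.eq_nil_or_concat l with rfl | ⟨v, z, rfl⟩
    · have := lastTerm_concat (headTerm F) a [] b
      rw [List.nil_append] at this
      rw [this, headTerm_cons, lastTerm_nil, headTerm_nil, smul_zero, smul_zero, add_zero]
    · rw [List.concat_eq_append, ← List.cons_append, lastTerm_concat, List.cons_append,
        headTerm_cons, headTerm_cons, lastTerm_concat, Hom.mul_assoc]
      simp only [smul_smul, ← koszulSign_add, Hom.mul_deg, barDeg_cons]
      rw [koszulSign_eq_neg (n := (a.deg + (b.deg + 1 + barDeg v)) * (z.deg + 1) +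
        (z.deg + a.deg + 1)) (by ring_nf; omega), neg_smul]
      exact neg_add_cancel _

theorem headTerm_add (F G : A.Hom → List A.Red → M) (a : A.Hom) (l : List A.Red) :
    headTerm (fun a l => F a l + G a l) a l = headTerm F a l + headTerm G a l := by
  cases l <;> simp [headTerm]

theorem lastTerm_add (F G : A.Hom → List A.Red → M) (a : A.Hom) (l : List A.Red) :
    lastTerm (fun a l => F a l + G a l) a l = lastTerm F a l + lastTerm G a l := by
  rcases List.eq_nil_or_concat l with rfl | ⟨v, z, rfl⟩
  · simp [lastTerm_nil]
  · simp only [List.concat_eq_append, lastTerm_concat, smul_add]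

theorem boundary_boundary {F : A.Hom → List A.Red → M} (hF : IsCyclic F) (a : A.Hom)
    (l : List A.Red) : boundaryFun (boundaryFun F) a l = 0 := by
  have h1 := head_boundary hF a l
  have h2 := last_boundary hF a l
  have h3 := head_last F a l
  have h4 : F a.diff.diff l = 0 := hF.zero (A.d_d _) l
  have h5 := barDiff_barDiff (hF.slots a) l
  have h6 : barDiff (boundaryFun F a) l = barDiff (F a.diff) l +
      koszulSign a.deg • barDiff (barDiff (F a)) l + barDiff (headTerm F a) l +
      barDiff (lastTerm F a) l := by
    rw [← barDiff_zsmul, ← barDiff_add, ← barDiff_add, ← barDiff_add]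
    rfl
  have h7 : headTerm (boundaryFun F) a l = headTerm (fun a l => F a.diff l +
      koszulSign a.deg • barDiff (F a) l + headTerm F a l) a l + headTerm (lastTerm F) a l :=
    headTerm_add _ _ _ _
  have h8 : lastTerm (boundaryFun F) a l = lastTerm (fun a l => F a.diff l +
      koszulSign a.deg • barDiff (F a) l + lastTerm F a l) a l + lastTerm (headTerm F) a l := by
    rw [← lastTerm_add]
    congr 1
    funext a l
    rw [boundaryFun, add_right_comm]
  rw [boundaryFun, h6, h7, h8, h5, boundaryFun, h4, Hom.diff_deg,
    koszulSign_eq_neg (m := a.deg - 1) (n := a.deg) (by ring_nf; omega)]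
  simp only [smul_add, smul_zero, neg_smul]
  calc _ = (headTerm F a.diff l + koszulSign a.deg • barDiff (headTerm F a) l +
      headTerm (fun a l => F a.diff l + koszulSign a.deg • barDiff (F a) l + headTerm F a l) a l) +
      (lastTerm F a.diff l + koszulSign a.deg • barDiff (lastTerm F a) l +
      lastTerm (fun a l => F a.diff l + koszulSign a.deg • barDiff (F a) l + lastTerm F a l) a l) +
      (headTerm (lastTerm F) a l + lastTerm (headTerm F) a l) := by abel
    _ = 0 := by rw [h1, h2, h3]; simp

theorem hochBoundary_hochBoundary (c : A.Chain) : A.hochBoundary (A.hochBoundary c) = 0 := by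
  have : A.hochBoundary ∘ₗ A.hochBoundary = 0 := by
    refine chain_ext fun a l => ?_
    rw [LinearMap.comp_apply, hochBoundary, chainLift_sym, map_boundaryFun]
    simp only [chainLift_sym]
    exact boundary_boundary isCyclic_sym a l
  exact LinearMap.congr_fun this c

theorem barDiff_mem (S : Submodule k M) {G : List A.Red → M} {l : List A.Red}
    (h : ∀ w, barDeg w = barDeg l - 1 → G w ∈ S) : barDiff G l ∈ S := by
  induction l generalizing G with
  | nil => exact S.zero_mem
  | cons a l ih =>
    rw [barDiff_cons]
    refine S.add_mem (S.add_mem (S.neg_mem (h _ ?_)) ?_) (zsmul_mem' _ _ (ih fun w hw => h _ ?_))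
    · simp only [barDeg_cons, Red.diff_deg]; ring
    · cases l with
      | nil => exact S.zero_mem
      | cons b l =>
        refine zsmul_mem' _ _ (h _ ?_)
        simp only [barDeg_cons, Red.mul_deg]; ring
    · rw [barDeg_cons, hw, barDeg_cons]; ring

theorem boundaryFun_mem (S : Submodule k M) {F : A.Hom → List A.Red → M} {a : A.Hom}
    {l : List A.Red} (h : ∀ b w, b.deg + barDeg w = a.deg + barDeg l - 1 → F b w ∈ S) :
    boundaryFun F a l ∈ S := by
  refine S.add_mem (S.add_mem (S.add_mem (h _ _ ?_) (zsmul_mem' _ _ (barDiff_mem S fun w hw =>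
    h _ _ ?_))) ?_) ?_
  · rw [Hom.diff_deg]; ring
  · rw [hw]; ring
  · cases l with
    | nil => exact S.zero_mem
    | cons b l =>
      refine zsmul_mem' _ _ (h _ _ ?_)
      simp only [barDeg_cons, Hom.mul_deg]; ring
  · rcases List.eq_nil_or_concat l with rfl | ⟨l, z, rfl⟩
    · exact S.zero_mem
    · rw [List.concat_eq_append, lastTerm_concat]
      refine zsmul_mem' _ _ (h _ _ ?_)
      simp only [List.concat_eq_append, barDeg_append, barDeg_cons, Hom.mul_deg, barDeg_nil]; ring

theorem hochBoundary_mem_chains {n : ℤ} {c : A.Chain} (hc : c ∈ A.chains n) :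
    A.hochBoundary c ∈ A.chains (n - 1) := by
  induction hc using Submodule.span_induction with
  | zero => rw [map_zero]; exact Submodule.zero_mem _
  | add x y _ _ hx hy => rw [map_add]; exact Submodule.add_mem _ hx hy
  | smul r x _ hx => rw [map_smul]; exact Submodule.smul_mem _ _ hx
  | mem x hx =>
    obtain ⟨a, l, rfl, rfl⟩ := hx
    rw [hochBoundary, chainLift_sym]
    exact boundaryFun_mem _ fun b w h => Submodule.subset_span ⟨b, w, h, rfl⟩

end square

section delta

theorem twist_mem (l : List A.Red) : twist l ∈ A.piece (barDeg l - 1) := by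
  match l with
  | [] => exact Submodule.zero_mem _
  | [a] => simpa [twist, barDeg] using a.mem
  | _ :: _ :: _ => exact Submodule.zero_mem _

theorem delta_twist : delta 1 (twist : List A.Red → A.carrier) = cup 1 twist twist := by
  have h : ∀ l : List A.Red, A.d (twist l) + barDiff twist l + cup 1 twist twist l = 0 := by
    intro l
    match l with
    | [] => simp [twist, barDiff, cup, splitSum]
    | [a] => simp [twist, barDiff, cup, splitSum, mergeHead, Red.diff, Hom.diff]
    | [a, b] =>
      simp [twist, barDiff, cup, splitSum, mergeHead, Red.diff, Hom.diff, Red.mul, Hom.mul,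
        barDeg, koszulSign_succ]
    | a :: b :: c :: l =>
      have h1 : cup 1 twist twist (a :: b :: c :: l) = (0 : A.carrier) := by
        rw [cup, ← splitSum_zero (a :: b :: c :: l)]
        refine splitSum_congr fun u v huv => ?_
        match u, v with
        | [], v => simp [twist]
        | [a], [] => simp at huv
        | [a], [b] => simp at huv
        | [a], _ :: _ :: _ => simp [twist]
        | _ :: _ :: _, v => simp [twist]
      have h2 : ∀ x, (fun w => twist (x :: b :: w)) = fun _ => (0 : A.carrier) := fun _ => rfl
      have h3 : mergeHead (fun w => twist (a :: w)) b (c :: l) = (0 : A.carrier) := by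
        simp [mergeHead, twist]
      rw [h1, barDiff_cons, barDiff_cons, h3, h2, barDiff_zero]
      simp [twist, mergeHead]
  funext l
  have := h l
  rw [delta, koszulSign_one]
  simp only [neg_smul, one_smul, sub_neg_eq_add]
  rw [← add_assoc, this, zero_add]

theorem delta_delta {n : ℤ} {f : List A.Red → A.carrier} (hf : IsCochain n f) :
    delta (n + 1) (delta n f) = 0 := by
  have e : ∀ (p : ℤ) (h : List A.Red → A.carrier), delta p h =
      ((fun l => A.d (h l)) - koszulSign p • barDiff h) +
        (cup p twist h - koszulSign p • cup 1 h twist) := fun p h => rfl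
  have e1 : ((fun l => A.d (((fun l => A.d (f l)) - koszulSign n • barDiff f) l)) -
      koszulSign (n + 1) • barDiff ((fun l => A.d (f l)) - koszulSign n • barDiff f)) = 0 := by
    funext l
    have h1 : barDiff ((fun l => A.d (f l)) - koszulSign n • barDiff f) l =
        A.d (barDiff f l) - koszulSign n • barDiff (barDiff f) l := by
      rw [← map_barDiff A.d, ← barDiff_zsmul, sub_eq_add_neg (barDiff _ l), ← barDiff_neg,
        ← barDiff_add]
      simp only [← sub_eq_add_neg]
      rfl
    simp only [Pi.sub_apply, Pi.smul_apply, map_sub, h1, barDiff_barDiff hf.toIsMultilinear,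
      A.d_d, map_zsmul, koszulSign_succ, Pi.zero_apply]
    simp
  have h1 : delta n f + (koszulSign n • cup 1 f twist - cup n twist f) =
      ((fun l => A.d (f l)) - koszulSign n • barDiff f) := by
    rw [e]; abel
  have h2 : delta (n + 1) ((fun l => A.d (f l)) - koszulSign n • barDiff f) =
      cup (n + 1) twist ((fun l => A.d (f l)) - koszulSign n • barDiff f) +
      koszulSign n • cup 1 ((fun l => A.d (f l)) - koszulSign n • barDiff f) twist := by
    rw [e, e1, koszulSign_succ, neg_smul, sub_neg_eq_add, zero_add]
  have h3 := delta_cup (m := 1) (n := n) (f := twist) (g := f) twist_mem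
  have h4 := delta_cup (m := n) (n := 1) (f := f) (g := twist) hf.deg
  rw [delta_twist] at h3 h4
  rw [add_comm 1 n] at h3
  have h5 : delta (n + 1) (delta n f) = A.deltaLin (n + 1) (((fun l => A.d (f l)) -
      koszulSign n • barDiff f) + (cup n twist f - koszulSign n • cup 1 f twist)) := by
    rw [← e]; rfl
  have h6 : ∀ P Q R, A.deltaLin (n + 1) (P + (Q - koszulSign n • R)) =
      delta (n + 1) P + (delta (n + 1) Q - koszulSign n • delta (n + 1) R) := fun P Q R => by
    rw [map_add, map_sub, map_zsmul]; rfl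
  rw [h5, h6]
  rw [h2, h3, h4, ← h1]
  simp only [sub_eq_add_neg, ← neg_smul, ← neg_one_smul ℤ (cup n twist f), cup_add_left,
    cup_add_right, cup_zsmul_left, cup_zsmul_right, cup_assoc, smul_add, smul_smul, mul_neg,
    koszulSign_mul_self, koszulSign_one]
  have s1 : (1 : ℤ) + 1 = 2 := rfl
  have s2 : n + 1 = 1 + n := add_comm _ _
  simp only [s1, s2, neg_smul, one_smul, neg_mul, mul_neg, koszulSign_mul_self, mul_one, one_mul,
    neg_neg]
  abel

end delta

section delta

theorem isCochain_twist : IsCochain 1 (twist : List A.Red → A.carrier) where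
  add u v a b c h1 h2 h3 := by
    rcases u with _ | ⟨d, _ | ⟨e, u⟩⟩ <;> rcases v with _ | ⟨z, v⟩ <;> simp [twist, h3]
  smul u v r a c h1 h2 := by
    rcases u with _ | ⟨d, _ | ⟨e, u⟩⟩ <;> rcases v with _ | ⟨z, v⟩ <;> simp [twist, h2]
  bal u v x a b := by rcases u with _ | ⟨d, u⟩ <;> simp [twist]
  left v x a := by rcases v with _ | ⟨z, v⟩ <;> simp [twist, Red.lact, Hom.lact]
  right u x a := by rcases u with _ | ⟨d, _ | ⟨e, u⟩⟩ <;> simp [twist, Red.ract, Hom.ract]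
  nil x := by simp [twist]
  deg := twist_mem

theorem IsCochain.delta {n : ℤ} {f : List A.Red → A.carrier} (hf : IsCochain n f) :
    IsCochain (n + 1) (delta n f) := by
  have h1 : IsCochain (n + 1) (fun l => A.d (f l)) :=
    { add := fun u v a b c h1 h2 h3 => by simp only [hf.add u v a b c h1 h2 h3, map_add]
      smul := fun u v r a c h1 h2 => by simp only [hf.smul u v r a c h1 h2, map_smul]
      bal := fun u v x a b => by simp only [hf.bal]
      left := fun v x a => by simp only [hf.left, d_unit_mul]
      right := fun u x a => by simp only [hf.right, d_mul_unit']
      nil := fun x => by simp only [← d_unit_mul, hf.nil, d_mul_unit']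
      deg := fun l => by
        have := A.d_mem (hf.deg l)
        rwa [sub_sub] at this }
  have h2 : IsCochain (n + 1) (barDiff f) :=
    { toIsMultilinear := hf.toIsMultilinear.barDiff
      left := fun v x a => by
        rw [← barDiff_cons_lact (G := fun w => A.unit x * f w) (fun b u => (hf.left u x b).symm)]
        exact map_barDiff (AddMonoidHom.mulLeft (A.unit x)) f _
      right := fun u x a => by
        rw [barDiff_concat_ract (G' := fun w => f w * A.unit x) (fun u b => hf.right u x b)]
        exact map_barDiff (AddMonoidHom.mulRight (A.unit x)) f _
      nil := fun x => by simp only [barDiff_nil, mul_zero, zero_mul]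
      deg := fun l => barDiff_mem _ fun w hw => by
        have := hf.deg w
        rwa [hw, sub_sub, add_comm 1 n] at this }
  have h3 := isCochain_twist.cup (add_comm 1 n) hf
  have h4 := hf.cup rfl isCochain_twist
  have h5 : AugDGKRing.delta n f = (fun l => A.d (f l)) - koszulSign n • barDiff f +
      (AugDGKRing.cup n twist f - koszulSign n • AugDGKRing.cup 1 f twist) := rfl
  rw [h5]
  exact (A.cochains (n + 1)).add_mem ((A.cochains (n + 1)).sub_mem h1 (zsmul_mem' _ _ h2))
    ((A.cochains (n + 1)).sub_mem h3 (zsmul_mem' _ _ h4))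

end delta

/-! ### The cobar construction -/

section monomials

variable (A) in
/-- `Mono n σ`: `σ` is a product of an element of `K` and of generators, of total degree `n`. -/
inductive Mono : ℤ → A.Cobar → Prop
  | unit (x : Fin t → k) : Mono 0 (A.cobarUnit x)
  | mul_gen {n : ℤ} {σ : A.Cobar} (c : A.Codual) : Mono n σ → Mono (n + (-c.deg - 1)) (σ * gen c)

theorem Mono.mem {n : ℤ} {σ : A.Cobar} (h : A.Mono n σ) : σ ∈ A.cobarPiece n := by
  induction h with
  | unit x => exact cobarUnit_mem x
  | mul_gen c _ ih => exact SetLike.mul_mem_graded ih (gen_mem c)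

theorem Mono.mul_unit {n : ℤ} {σ : A.Cobar} (h : A.Mono n σ) (x : Fin t → k) :
    A.Mono n (σ * A.cobarUnit x) := by
  cases h with
  | unit y => rw [← map_mul]; exact .unit _
  | mul_gen c h => rw [mul_assoc, ← gen_ract]; exact .mul_gen (c.ract x) h

theorem Mono.smul {n : ℤ} {σ : A.Cobar} (h : A.Mono n σ) (r : k) : A.Mono n (r • σ) := by
  induction h with
  | unit y => rw [← map_smul]; exact .unit _
  | mul_gen c _ ih => rw [← smul_mul_assoc]; exact .mul_gen c ih

theorem mono_list (l : List ((Fin t → k) ⊕ A.Codual)) :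
    A.Mono (l.map letterDeg).sum (l.map A.letter).prod := by
  induction l using List.reverseRecOn with
  | nil => simpa using Mono.unit (A := A) 1
  | append_singleton l g ih =>
    cases g with
    | inl x =>
      have h := ih.mul_unit x
      rw [List.map_append, List.map_append, List.sum_append, List.prod_append]
      simpa [letterDeg] using! h
    | inr c =>
      have h := ih.mul_gen c
      rw [List.map_append, List.map_append, List.sum_append, List.prod_append]
      simpa [letterDeg] using! h

/-- A homogeneous element of the cobar construction is a sum of monomials. -/
theorem cobarPiece_induction {n : ℤ} {P : A.Cobar → Prop} (h0 : P 0)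
    (hadd : ∀ a b, P a → P b → P (a + b)) (hmono : ∀ σ, A.Mono n σ → P σ) {a : A.Cobar}
    (ha : a ∈ A.cobarPiece n) : P a := by
  rw [cobarPiece] at ha
  have := (Submodule.mem_span_set' (R := k)).1 ha
  obtain ⟨m, f, g, rfl⟩ := this
  refine Finset.sum_induction _ P hadd h0 fun i _ => hmono _ ?_
  obtain ⟨l, hl, hg⟩ := (g i).2
  rw [hg, ← hl]
  exact (mono_list l).smul _

/-- Induction on the last generator of a monomial. -/
theorem cobar_rightInduction {P : A.Cobar → Prop} (hu : ∀ x, P (A.cobarUnit x))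
    (hadd : ∀ a b, P a → P b → P (a + b))
    (hgen : ∀ (n : ℤ) (σ : A.Cobar) (c : A.Codual), σ ∈ A.cobarPiece n → P σ → P (σ * gen c))
    (a : A.Cobar) : P a := by
  have hm : ∀ n σ, A.Mono n σ → P σ := fun n σ h => by
    induction h with
    | unit x => exact hu x
    | mul_gen c h ih => exact hgen _ _ c h.mem ih
  have h0 : P 0 := by simpa using hu 0
  exact DirectSum.Decomposition.inductionOn A.cobarPiece h0
    (fun {i} m => cobarPiece_induction h0 hadd (hm i) m.2) hadd a

/-- Two linear maps that agree on `K` and satisfy the same recursion agree. -/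
theorem cobar_linearMap_ext {M : Type*} [AddCommGroup M] [Module k M] {f g : A.Cobar →ₗ[k] M}
    (hu : ∀ x, f (A.cobarUnit x) = g (A.cobarUnit x))
    (hgen : ∀ (n : ℤ) (σ : A.Cobar) (c : A.Codual), σ ∈ A.cobarPiece n → f σ = g σ →
      f (σ * gen c) = g (σ * gen c)) : f = g :=
  LinearMap.ext fun a => cobar_rightInduction (P := fun a => f a = g a) hu
    (fun a b ha hb => by rw [map_add, map_add, ha, hb]) hgen a

end monomials

/-! ### The pairing between the cobar construction and the bar construction -/

section pairing

variable (A) in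
/-- The idempotent `e_p` of `K`, in `A`. -/
def idem (p : Fin t) : A.carrier := A.unit (Pi.single p 1)

theorem idem_mul_unit (p : Fin t) (x : Fin t → k) : A.idem p * A.unit x = x p • A.idem p := by
  rw [idem, ← map_mul, ← map_smul]
  congr 1
  ext q
  by_cases h : q = p
  · subst h; simp
  · simp [h]

theorem unit_mul_idem (p : Fin t) (x : Fin t → k) : A.unit x * A.idem p = x p • A.idem p := by
  rw [← idem_mul_unit, idem, ← map_mul, ← map_mul, mul_comm]

theorem sum_idem : ∑ p, A.idem p = 1 := by
  simp only [idem, ← map_sum]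
  rw [← map_one A.unit]
  congr 1
  ext q
  simp [Finset.sum_apply, Pi.single_apply]

/-- The matrix `g(e_p a e_q)` of values of a linear form. -/
def cmat (g : Module.Dual k A.carrier) (a : A.carrier) : Matrix (Fin t) (Fin t) k :=
  Matrix.of fun p q => g (A.idem p * a * A.idem q)

theorem cmat_apply (g : Module.Dual k A.carrier) (a : A.carrier) (p q : Fin t) :
    cmat g a p q = g (A.idem p * a * A.idem q) := rfl

theorem cmat_add_left (g h : Module.Dual k A.carrier) (a : A.carrier) :
    cmat (g + h) a = cmat g a + cmat h a := rfl

theorem cmat_smul_left (r : k) (g : Module.Dual k A.carrier) (a : A.carrier) :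
    cmat (r • g) a = r • cmat g a := rfl

theorem cmat_add (g : Module.Dual k A.carrier) (a b : A.carrier) :
    cmat g (a + b) = cmat g a + cmat g b := by
  ext; simp [cmat_apply, mul_add, add_mul]

theorem cmat_smul (g : Module.Dual k A.carrier) (r : k) (a : A.carrier) :
    cmat g (r • a) = r • cmat g a := by
  ext; simp [cmat_apply]

theorem cmat_zsmul (g : Module.Dual k A.carrier) (r : ℤ) (a : A.carrier) :
    cmat g (r • a) = r • cmat g a := by
  rw [← Int.cast_smul_eq_zsmul k, cmat_smul, Int.cast_smul_eq_zsmul]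

theorem cmat_lact (g : Module.Dual k A.carrier) (x : Fin t → k) (a : A.carrier) :
    cmat g (A.unit x * a) = Matrix.diagonal x * cmat g a := by
  ext p q
  rw [Matrix.diagonal_mul, cmat_apply, cmat_apply, ← mul_assoc, idem_mul_unit]
  simp

theorem cmat_ract (g : Module.Dual k A.carrier) (x : Fin t → k) (a : A.carrier) :
    cmat g (a * A.unit x) = cmat g a * Matrix.diagonal x := by
  ext p q
  rw [Matrix.mul_diagonal, cmat_apply, cmat_apply, ← mul_assoc, mul_assoc, unit_mul_idem]
  simp [mul_comm]

theorem cmat_comp_mulRight (g : Module.Dual k A.carrier) (x : Fin t → k) (a : A.carrier) :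
    cmat (g ∘ₗ LinearMap.mulRight k (A.unit x)) a = cmat g a * Matrix.diagonal x := by
  ext p q
  rw [Matrix.mul_diagonal, cmat_apply, cmat_apply, LinearMap.comp_apply, LinearMap.mulRight_apply,
    mul_assoc _ _ (A.unit x), idem_mul_unit]
  simp [mul_comm]

theorem cmat_comp_mulLeft (g : Module.Dual k A.carrier) (x : Fin t → k) (a : A.carrier) :
    cmat (g ∘ₗ LinearMap.mulLeft k (A.unit x)) a = Matrix.diagonal x * cmat g a := by
  ext p q
  rw [Matrix.diagonal_mul, cmat_apply, cmat_apply, LinearMap.comp_apply, LinearMap.mulLeft_apply,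
    ← mul_assoc, ← mul_assoc, unit_mul_idem]
  simp

theorem cmat_eq_zero {c : A.Codual} {a : A.Red} (h : a.deg ≠ c.deg) : cmat c.val a.val = 0 := by
  ext p q
  refine c.supp h _ ?_
  have := mul_unit_mem (unit_mul_mem a.mem (Pi.single p 1)) (Pi.single q 1)
  exact this

/-- The functions on the bar construction with values in matrices. -/
abbrev MatFun (A : AugDGKRing.{u, v} k t) : Type (max u v) :=
  List A.Red → Matrix (Fin t) (Fin t) k

/-- Multiplication of a function by an element of `K`. -/
def matDiag (A : AugDGKRing.{u, v} k t) : (Fin t → k) →ₐ[k] (Module.End k A.MatFun)ᵐᵒᵖ :=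
  AlgHom.ofLinearMap
    { toFun := fun x => MulOpposite.op
        { toFun := fun φ w => Matrix.diagonal x * φ w
          map_add' := fun φ ψ => by funext w; simp [mul_add]
          map_smul' := fun r φ => by funext w; simp }
      map_add' := fun x y => by
        rw [← MulOpposite.op_add]; congr 1
        refine LinearMap.ext fun φ => funext fun w => ?_
        change Matrix.diagonal (x + y) * φ w = Matrix.diagonal x * φ w + Matrix.diagonal y * φ w
        rw [← add_mul, Matrix.diagonal_add]; rfl
      map_smul' := fun r x => by
        rw [RingHom.id_apply, ← MulOpposite.op_smul]; congr 1
        refine LinearMap.ext fun φ => funext fun w => ?_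
        simp [Matrix.diagonal_smul] }
    (by
      rw [← MulOpposite.op_one]; 
      refine congrArg MulOpposite.op (LinearMap.ext fun φ => funext fun w => ?_)
      simp)
    (fun x y => by
      refine congrArg MulOpposite.op (LinearMap.ext fun φ => funext fun w => ?_)
      change Matrix.diagonal (x * y) * φ w = Matrix.diagonal y * (Matrix.diagonal x * φ w)
      rw [← mul_assoc, Matrix.diagonal_mul_diagonal]
      congr 2
      funext i; exact mul_comm _ _)

/-- Prepending a letter paired with a linear form. -/
def matGen (g : Module.Dual k A.carrier) : Module.End k A.MatFun where
  toFun φ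
    | [] => 0
    | a :: v => cmat g a.val * φ v
  map_add' φ ψ := by funext w; cases w <;> simp [mul_add]
  map_smul' r φ := by funext w; cases w <;> simp

variable (A) in
/-- The action of the cobar construction on functions on the bar construction. -/
def evAct : A.Cobar →ₐ[k] (Module.End k A.MatFun)ᵐᵒᵖ :=
  cobarLift A.matDiag (fun c => MulOpposite.op (matGen c.val))
    (fun f g h _ _ h3 => by
      rw [h3, ← MulOpposite.op_add]
      refine congrArg MulOpposite.op (LinearMap.ext fun φ => funext fun w => ?_)
      cases w <;> simp [matGen, cmat_add_left, add_mul])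
    (fun r f h _ h2 => by
      rw [h2, ← MulOpposite.op_smul]
      refine congrArg MulOpposite.op (LinearMap.ext fun φ => funext fun w => ?_)
      cases w <;> simp [matGen, cmat_smul_left])
    (fun x f => by
      refine congrArg MulOpposite.op (LinearMap.ext fun φ => funext fun w => ?_)
      cases w with
      | nil => rfl
      | cons a w =>
        change cmat (f.val ∘ₗ LinearMap.mulRight k (A.unit x)) a.val * φ w =
          cmat f.val a.val * (Matrix.diagonal x * φ w)
        rw [cmat_comp_mulRight, mul_assoc])
    (fun x f => by
      refine congrArg MulOpposite.op (LinearMap.ext fun φ => funext fun w => ?_)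
      cases w with
      | nil => exact (mul_zero _).symm
      | cons a w =>
        change cmat (f.val ∘ₗ LinearMap.mulLeft k (A.unit x)) a.val * φ w =
          Matrix.diagonal x * (cmat f.val a.val * φ w)
        rw [cmat_comp_mulLeft, mul_assoc])

variable (A) in
/-- The pairing of the cobar construction of `A^∨` with the bar construction of `A`. -/
def ev : A.Cobar →ₗ[k] A.MatFun where
  toFun τ := (A.evAct τ).unop fun w => if w.isEmpty then 1 else 0
  map_add' σ τ := by rw [map_add]; rfl
  map_smul' r τ := by rw [map_smul]; rfl

theorem ev_mul_unit (σ : A.Cobar) (x : Fin t → k) (w : List A.Red) :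
    A.ev (σ * A.cobarUnit x) w = Matrix.diagonal x * A.ev σ w := by
  change (A.evAct (σ * _)).unop _ w = _
  rw [map_mul, evAct, cobarLift_unit]
  rfl

theorem ev_mul_gen (σ : A.Cobar) (c : A.Codual) :
    A.ev (σ * gen c) = matGen c.val (A.ev σ) := by
  change (A.evAct (σ * _)).unop _ = _
  rw [map_mul, evAct, cobarLift_gen]
  rfl

theorem ev_mul_gen_nil (σ : A.Cobar) (c : A.Codual) : A.ev (σ * gen c) [] = 0 := by
  rw [ev_mul_gen]; rfl

theorem ev_mul_gen_cons (σ : A.Cobar) (c : A.Codual) (a : A.Red) (w : List A.Red) :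
    A.ev (σ * gen c) (a :: w) = cmat c.val a.val * A.ev σ w := by
  rw [ev_mul_gen]; rfl

theorem ev_one_nil : A.ev 1 [] = 1 := by
  change (A.evAct 1).unop _ [] = _
  rw [map_one]; rfl

theorem ev_one_cons (a : A.Red) (w : List A.Red) : A.ev 1 (a :: w) = 0 := by
  change (A.evAct 1).unop _ (a :: w) = _
  rw [map_one]; rfl

theorem ev_unit_nil (x : Fin t → k) : A.ev (A.cobarUnit x) [] = Matrix.diagonal x := by
  rw [← one_mul (A.cobarUnit x), ev_mul_unit, ev_one_nil, mul_one]

theorem ev_unit_cons (x : Fin t → k) (a : A.Red) (w : List A.Red) :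
    A.ev (A.cobarUnit x) (a :: w) = 0 := by
  rw [← one_mul (A.cobarUnit x), ev_mul_unit, ev_one_cons, mul_zero]

theorem ev_mul (σ τ : A.Cobar) (w : List A.Red) :
    A.ev (σ * τ) w = splitSum (fun u v => A.ev τ u * A.ev σ v) w := by
  refine cobar_rightInduction (P := fun τ => ∀ w, A.ev (σ * τ) w =
    splitSum (fun u v => A.ev τ u * A.ev σ v) w) (fun x w => ?_) (fun a b ha hb w => ?_)
    (fun n τ c _ ih w => ?_) τ w
  · cases w with
    | nil => rw [splitSum_nil, ev_mul_unit, ev_unit_nil]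
    | cons a w =>
      rw [splitSum_cons, ev_mul_unit, ev_unit_nil]
      simp only [ev_unit_cons, zero_mul, splitSum_zero, add_zero]
  · simp only [mul_add, map_add, Pi.add_apply, add_mul, splitSum_add, ha, hb]
  · rw [← mul_assoc]
    cases w with
    | nil => rw [splitSum_nil, ev_mul_gen_nil, ev_mul_gen_nil, zero_mul]
    | cons a w =>
      rw [splitSum_cons, ev_mul_gen_cons, ev_mul_gen_nil, zero_mul, zero_add, ih]
      simp only [ev_mul_gen_cons, mul_assoc]
      exact mul_splitSum _ _ _

theorem Mono.ev_eq_zero {n : ℤ} {σ : A.Cobar} (h : A.Mono n σ) {w : List A.Red}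
    (hw : barDeg w ≠ -n) : A.ev σ w = 0 := by
  induction h generalizing w with
  | unit x =>
    cases w with
    | nil => exact absurd rfl hw
    | cons a w => exact ev_unit_cons x a w
  | mul_gen c h ih =>
    cases w with
    | nil => exact ev_mul_gen_nil _ _
    | cons a w =>
      rw [ev_mul_gen_cons]
      by_cases hd : a.deg = c.deg
      · rw [ih (fun h' => hw ?_), mul_zero]
        rw [barDeg_cons, h', hd]; ring
      · rw [cmat_eq_zero hd, zero_mul]

/-- The pairing respects degrees. -/
theorem ev_eq_zero {n : ℤ} {τ : A.Cobar} (hτ : τ ∈ A.cobarPiece n) {w : List A.Red}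
    (hw : barDeg w ≠ -n) : A.ev τ w = 0 :=
  cobarPiece_induction (P := fun τ => A.ev τ w = 0) (by simp)
    (fun a b ha hb => by rw [map_add, Pi.add_apply, ha, hb, add_zero])
    (fun σ h => h.ev_eq_zero hw) hτ

end pairing

section pairing

theorem ev_nil (τ : A.Cobar) : A.ev τ [] = Matrix.diagonal (A.cobarAug τ) := by
  refine cobar_rightInduction (P := fun τ => A.ev τ [] = Matrix.diagonal (A.cobarAug τ))
    (fun x => ?_) (fun a b ha hb => ?_) (fun n σ c _ _ => ?_) τ
  · rw [ev_unit_nil, cobarAug_unit]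
  · rw [map_add, Pi.add_apply, ha, hb, map_add, Matrix.diagonal_add]; rfl
  · rw [ev_mul_gen_nil, map_mul, cobarAug_gen, mul_zero]; simp

theorem ev_left (τ : A.Cobar) (v : List A.Red) (x : Fin t → k) (a : A.Red) :
    A.ev τ (a.lact x :: v) = Matrix.diagonal x * A.ev τ (a :: v) := by
  refine cobar_rightInduction (P := fun τ => A.ev τ (a.lact x :: v) =
    Matrix.diagonal x * A.ev τ (a :: v))
    (fun y => ?_) (fun a b ha hb => ?_) (fun n σ c _ _ => ?_) τ
  · rw [ev_unit_cons, ev_unit_cons, mul_zero]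
  · rw [map_add, Pi.add_apply, ha, hb, Pi.add_apply, mul_add]
  · rw [ev_mul_gen_cons, ev_mul_gen_cons, ← mul_assoc, ← cmat_lact]; rfl

theorem ev_right (τ : A.Cobar) (u : List A.Red) (x : Fin t → k) (a : A.Red) :
    A.ev τ (u ++ [a.ract x]) = A.ev τ (u ++ [a]) * Matrix.diagonal x := by
  refine cobar_rightInduction (P := fun τ => ∀ u, A.ev τ (u ++ [a.ract x]) =
    A.ev τ (u ++ [a]) * Matrix.diagonal x)
    (fun y u => ?_) (fun a b ha hb u => ?_) (fun n σ c _ ih u => ?_) τ u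
  · cases u <;> simp only [List.nil_append, List.cons_append, ev_unit_cons, zero_mul]
  · rw [map_add, Pi.add_apply, ha, hb, Pi.add_apply, add_mul]
  · cases u with
    | nil =>
      rw [List.nil_append, List.nil_append, ev_mul_gen_cons, ev_mul_gen_cons, ev_nil, mul_assoc,
        Matrix.diagonal_mul_diagonal]
      change cmat c.val (a.val * A.unit x) * _ = _
      rw [cmat_ract, mul_assoc, Matrix.diagonal_mul_diagonal]
      simp only [mul_comm]
    | cons b u =>
      rw [List.cons_append, List.cons_append, ev_mul_gen_cons, ev_mul_gen_cons, ih, mul_assoc]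

theorem ev_multilinear (τ : A.Cobar) : IsMultilinear (A.ev τ) := by
  refine cobar_rightInduction (P := fun τ => IsMultilinear (A.ev τ))
    (fun y => ?_) (fun a b ha hb => ?_) (fun n σ c _ ih => ?_) τ
  · refine ⟨fun u v a b c _ _ _ => ?_, fun u v r a c _ _ => ?_, fun u v x a b => ?_⟩ <;>
      cases u <;> simp only [List.nil_append, List.cons_append, ev_unit_cons, add_zero, smul_zero]
  · rw [map_add]; exact ha.add' hb
  · refine ⟨fun u v a b e h1 h2 h3 => ?_, fun u v r a e h1 h2 => ?_, fun u v x a b => ?_⟩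
    · cases u with
      | nil => simp only [List.nil_append, ev_mul_gen_cons, h3, cmat_add, add_mul]
      | cons d u => simp only [List.cons_append, ev_mul_gen_cons, ih.add u v a b e h1 h2 h3, mul_add]
    · cases u with
      | nil => simp only [List.nil_append, ev_mul_gen_cons, h2, cmat_smul, Matrix.smul_mul]
      | cons d u =>
        simp only [List.cons_append, ev_mul_gen_cons, ih.smul u v r a e h1 h2, Matrix.mul_smul]
    · cases u with
      | nil =>
        simp only [List.nil_append, ev_mul_gen_cons, ev_left, ← mul_assoc, ← cmat_ract]; rfl
      | cons d u => simp only [List.cons_append, ev_mul_gen_cons, ih.bal]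

variable (A) in
/-- Matrix valued functions of degree `j` on the bar construction that are compatible with the
actions of `K`: the dual of the bar construction, as a tensor algebra over `K`. -/
structure IsMatCochain (j : ℤ) (φ : A.MatFun) : Prop extends IsMultilinear φ where
  left : ∀ (v : List A.Red) (x : Fin t → k) (a : A.Red),
    φ (a.lact x :: v) = Matrix.diagonal x * φ (a :: v)
  right : ∀ (u : List A.Red) (x : Fin t → k) (a : A.Red),
    φ (u ++ [a.ract x]) = φ (u ++ [a]) * Matrix.diagonal x
  nil : ∃ x, φ [] = Matrix.diagonal x
  supp : ∀ w, barDeg w ≠ j → φ w = 0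

/-- An element of `redPiece i` as a homogeneous element. -/
def Red.of (i : ℤ) (x : A.redPiece i) : A.Red := ⟨⟨i, x.1, x.2.1⟩, x.2.2⟩

theorem Red.mem_redPiece (a : A.Red) : a.val ∈ A.redPiece a.deg := ⟨a.mem, a.aug_eq⟩

/-- A multilinear function, as a linear map in one of the entries. -/
def IsMultilinear.slot {M : Type w} [AddCommGroup M] [Module k M] {F : List A.Red → M}
    (hF : IsMultilinear F) (u v : List A.Red) (i : ℤ) : A.redPiece i →ₗ[k] M where
  toFun x := F (u ++ Red.of i x :: v)
  map_add' x y := hF.add u v _ _ _ rfl rfl rfl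
  map_smul' r x := hF.smul u v r _ _ rfl rfl

theorem ev_genLin {i : ℤ} (g : Module.Dual k A.carrier) (σ : A.Cobar) (a : A.Red)
    (v : List A.Red) (h : a.deg = i) :
    A.ev (σ * A.genLin i g) (a :: v) = cmat g a.val * A.ev σ v := by
  subst h
  refine (ev_mul_gen_cons σ _ a v).trans ?_
  congr 1
  ext p q
  refine congrArg g (redProj_same ?_)
  exact ((a.lact (Pi.single p 1)).ract (Pi.single q 1)).mem_redPiece

theorem ev_genLin_ne {i : ℤ} (g : Module.Dual k A.carrier) (σ : A.Cobar) (a : A.Red)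
    (v : List A.Red) (h : a.deg ≠ i) : A.ev (σ * A.genLin i g) (a :: v) = 0 :=
  (ev_mul_gen_cons σ _ a v).trans (by
    rw [cmat_eq_zero (c := Codual.of i g) h, zero_mul])

theorem sum_mul_idem (a : A.carrier) : ∑ r, a * A.idem r = a := by
  rw [← Finset.mul_sum, sum_idem, mul_one]

theorem idem_mul_self (p : Fin t) : A.idem p * A.idem p = A.idem p := by
  simp only [idem, ← map_mul]
  congr 1; ext q
  by_cases h : q = p
  · subst h; simp
  · simp [h]

theorem dualForm_sum (hA : A.IsTypical) {i : ℤ} {a : A.carrier} (ha : a ∈ A.redPiece i) :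
    ∑ α, dualForm hA i α a • (redBasis hA i α : A.carrier) = a := by
  have h := congrArg (A.redPiece i).subtype ((redBasis hA i).sum_repr (A.redProj i a))
  rw [map_sum] at h
  exact h.trans (redProj_same ha)

theorem cmat_contract (hA : A.IsTypical) (g : Module.Dual k A.carrier) (a : A.Red)
    (b : A.carrier) :
    ∑ α, cmat (dualForm hA a.deg α) a.val * cmat (mulForm g (redBasis hA a.deg α)) b =
      cmat g (a.val * b) := by
  ext p q
  simp only [Matrix.sum_apply, Matrix.mul_apply, cmat_apply, mulForm_apply]
  rw [Finset.sum_comm]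
  have : ∀ r, ∑ α, dualForm hA a.deg α (A.idem p * a.val * A.idem r) *
      g (redBasis hA a.deg α * (A.idem r * b * A.idem q)) =
      g (A.idem p * a.val * A.idem r * (b * A.idem q)) := by
    intro r
    have h := dualForm_sum hA ((a.lact (Pi.single p 1)).ract (Pi.single r 1)).mem_redPiece
    change ∑ α, dualForm hA a.deg α (A.idem p * a.val * A.idem r) • _ =
      A.idem p * a.val * A.idem r at h
    conv_rhs => rw [← idem_mul_self r, ← mul_assoc (A.idem p * a.val), ← h, Finset.sum_mul,
      Finset.sum_mul, map_sum]
    refine Finset.sum_congr rfl fun α _ => ?_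
    rw [smul_mul_assoc, smul_mul_assoc, map_smul, smul_eq_mul]
    simp only [mul_assoc]
    rfl
  simp only [this]
  rw [← map_sum, ← Finset.sum_mul, sum_mul_idem]
  simp only [mul_assoc]

theorem ev_contract (hA : A.IsTypical) (i j : ℤ) (g : Module.Dual k A.carrier) (σ : A.Cobar)
    (a : A.Red) (v : List A.Red) : A.ev (σ * contract hA i (A.genLin j ∘ₗ mulForm g)) (a :: v) =
      if a.deg = i then (match v with
        | [] => 0
        | b :: v => if b.deg = j then cmat g (a.mul b).val * A.ev σ v else 0)
      else 0 := by
  rw [contract, Finset.mul_sum, map_sum, Finset.sum_apply]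
  by_cases h : a.deg = i
  · subst h
    simp only [if_true, LinearMap.comp_apply, ← mul_assoc]
    simp only [ev_genLin _ _ _ _ rfl]
    cases v with
    | nil => simp only [ev_mul_gen_nil, genLin, LinearMap.coe_mk, AddHom.coe_mk, mul_zero, Finset.sum_const_zero]
    | cons b v =>
      by_cases h : b.deg = j
      · simp only [h, if_true, ev_genLin _ _ _ _ h, ← mul_assoc, ← Finset.sum_mul]
        rw [cmat_contract]; rfl
      · simp only [h, if_false, ev_genLin_ne _ _ _ _ h, mul_zero, Finset.sum_const_zero]
  · simp only [h, if_false, ← mul_assoc, ev_genLin_ne _ _ _ _ h, Finset.sum_const_zero]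

theorem IsTypical.redPiece_zero (hA : A.IsTypical) : (∀ i < 0, A.redPiece i = ⊥) ∨
    (∀ i > -2, A.redPiece i = ⊥) := by
  rcases hA.bounded with hb | ⟨hb, h0, h1⟩
  · exact .inl fun i hi => redPiece_bot (hb i hi)
  · refine .inr fun i hi => ?_
    rcases lt_trichotomy i 0 with h | h | h
    · rw [show i = -1 by omega]; exact redPiece_bot h1
    · subst h
      refine bot_unique fun a ha => ?_
      obtain ⟨x, rfl⟩ := h0 a ha.1
      have h1 : A.aug (A.unit x) = 0 := ha.2
      rw [A.aug_unit] at h1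
      rw [h1, map_zero]; exact Submodule.zero_mem _
    · exact redPiece_bot (hb i h)

/-- The degrees `i + 1` of the entries in the bar construction all have the same sign. -/
theorem IsTypical.sign (hA : A.IsTypical) :
    ∃ s : ℤ, (s = 1 ∨ s = -1) ∧ ∀ i, A.redPiece i ≠ ⊥ → 1 ≤ s * (i + 1) := by
  rcases hA.redPiece_zero with h | h
  · refine ⟨1, .inl rfl, fun i hi => ?_⟩
    have : ¬ i < 0 := fun h' => hi (h i h')
    omega
  · refine ⟨-1, .inr rfl, fun i hi => ?_⟩
    have : ¬ i > -2 := fun h' => hi (h i h')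
    omega

theorem Red.val_eq_zero {a : A.Red} (h : A.redPiece a.deg = ⊥) : a.val = 0 := by
  have := a.mem_redPiece
  rwa [h, Submodule.mem_bot] at this

theorem IsTypical.mem_uIcc (hA : A.IsTypical) {a b : A.Red} (ha : a.val ≠ 0) (hb : b.val ≠ 0) :
    a.deg ∈ Finset.uIcc 0 (a.deg + b.deg) := by
  have h : ∀ c : A.Red, c.val ≠ 0 → A.redPiece c.deg ≠ ⊥ := fun c hc h => hc (Red.val_eq_zero h)
  obtain ⟨s, hs, h'⟩ := hA.sign
  have h1 := h' _ (h a ha)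
  have h2 := h' _ (h b hb)
  rw [Finset.mem_uIcc]
  rcases hs with rfl | rfl <;> omega

theorem ev_mul_genDiff (hA : A.IsTypical) (c : A.Codual) (σ : A.Cobar) (a : A.Red)
    (v : List A.Red) : A.ev (σ * genDiff hA c.deg c.val) (a :: v) =
      koszulSign c.deg • (cmat c.val a.diff.val * A.ev σ v) +
      match v with
        | [] => 0
        | b :: v => koszulSign (b.deg + 1) • (cmat c.val (a.mul b).val * A.ev σ v) := by
  rw [genDiff, mul_add, map_add, Pi.add_apply, mul_smul_comm, map_zsmul, Pi.smul_apply]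
  congr 1
  · congr 1
    by_cases h : a.deg = c.deg + 1
    · rw [ev_genLin _ _ _ _ h]
      congr 1
      ext p q
      simp only [cmat_apply, LinearMap.comp_apply, idem, d_mul_unit', d_unit_mul]; rfl
    · rw [ev_genLin_ne _ _ _ _ h, cmat_eq_zero, zero_mul]
      rw [Red.diff_deg]; omega
  · rw [Finset.mul_sum, map_sum, Finset.sum_apply]
    simp only [mul_smul_comm, map_zsmul, Pi.smul_apply, ev_contract]
    cases v with
    | nil => simp
    | cons b v =>
      simp only []
      by_cases h : a.val = 0 ∨ b.val = 0
      · have h0 : (a.mul b).val = 0 := by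
          change a.val * b.val = 0
          rcases h with h | h <;> simp [h]
        have h1 : cmat c.val (a.mul b).val = 0 := by
          ext p q; rw [cmat_apply, h0, mul_zero, zero_mul, map_zero]; rfl
        simp [h1]
      · push Not at h
        have h1 := hA.mem_uIcc h.1 h.2
        by_cases h2 : a.deg + b.deg = c.deg
        · rw [h2] at h1
          rw [Finset.sum_eq_single_of_mem _ h1 (fun i _ hi => by rw [if_neg (Ne.symm hi), smul_zero]),
            if_pos rfl, if_pos (by omega)]
          congr 2; omega
        · rw [cmat_eq_zero (a := a.mul b) h2, zero_mul, smul_zero]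
          refine Finset.sum_eq_zero fun i _ => ?_
          split_ifs with h3 h4
          · omega
          · rw [smul_zero]
          · rw [smul_zero]

theorem ev_diff (hA : A.IsTypical) (τ : A.Cobar) (w : List A.Red) :
    A.ev (cobarDiff hA τ) w = koszulSign (barDeg w + 1) • barDiff (A.ev τ) w := by
  refine cobar_rightInduction (P := fun τ => ∀ w, A.ev (cobarDiff hA τ) w =
    koszulSign (barDeg w + 1) • barDiff (A.ev τ) w)
    (fun y w => ?_) (fun a b ha hb w => ?_) (fun n σ c hσ ih w => ?_) τ w
  · rw [cobarDiff_unit, map_zero]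
    cases w with
    | nil => rw [barDiff_nil, smul_zero]; rfl
    | cons a w =>
      rw [barDiff_cons, ev_unit_cons]
      simp only [ev_unit_cons, barDiff_zero]
      cases w <;> simp [mergeHead, ev_unit_cons]
  · rw [map_add, map_add, Pi.add_apply, ha, hb, ← smul_add, map_add]
    exact congrArg _ (barDiff_add _ _ w).symm
  · rw [cobarDiff_mul hA hσ, map_add, map_zsmul, cobarDiff_gen, Pi.add_apply, Pi.smul_apply]
    cases w with
    | nil =>
      rw [ev_mul_gen_nil, ev_nil, map_mul, cobarAug_genDiff]
      simp [barDiff_nil]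
    | cons a v =>
      rw [ev_mul_gen_cons, ih, ev_mul_genDiff, barDiff_cons, ev_mul_gen_cons]
      have h1 : barDiff (fun w => A.ev (σ * gen c) (a :: w)) v =
          cmat c.val a.val * barDiff (A.ev σ) v := by
        simp only [ev_mul_gen_cons]
        exact map_barDiff (AddMonoidHom.mulLeft (cmat c.val a.val)) (A.ev σ) v
      have h2 : koszulSign n • koszulSign c.deg • (cmat c.val a.diff.val * A.ev σ v) =
          -(koszulSign (barDeg (a :: v) + 1) • (cmat c.val a.diff.val * A.ev σ v)) := by
        by_cases h : a.deg - 1 = c.deg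
        · by_cases h' : barDeg v = -n
          · rw [smul_smul, ← koszulSign_add, ← neg_smul, barDeg_cons, ← koszulSign_succ]
            congr 1
            apply koszulSign_eq; omega
          · rw [ev_eq_zero hσ h', mul_zero]; simp
        · rw [cmat_eq_zero (a := a.diff) h, zero_mul]; simp
      rw [h1, smul_add, h2, smul_add, smul_add, smul_neg, smul_smul, ← koszulSign_add]
      have h3 : koszulSign (barDeg (a :: v) + 1 + (a.deg + 1)) = koszulSign (barDeg v + 1) := by
        rw [barDeg_cons]; apply koszulSign_eq; omega
      rw [h3, Matrix.mul_smul, add_comm, add_right_cancel_iff]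
      congr 1
      cases v with
      | nil => simp [mergeHead]
      | cons b v =>
        simp only [mergeHead, ev_mul_gen_cons, smul_smul, ← koszulSign_add]
        by_cases h' : barDeg v = -n
        · congr 1
          apply koszulSign_eq
          rw [barDeg_cons, barDeg_cons]; omega
        · rw [ev_eq_zero hσ h', mul_zero]; simp

end pairing

section perfect

theorem unit_eq_sum (y : Fin t → k) : A.unit y = ∑ r, y r • A.idem r := by
  simp only [idem, ← map_smul, ← map_sum]
  congr 1
  ext q
  simp [Finset.sum_apply, Pi.single_apply]

/-- The part of a function on the bar construction that begins with a given letter. -/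
def MatFun.shift (a : A.Red) : A.MatFun →ₗ[k] A.MatFun where
  toFun φ w := Matrix.of fun r q => ∑ p, φ (a.ract (Pi.single r 1) :: w) p q
  map_add' φ ψ := by ext; simp [Finset.sum_add_distrib]
  map_smul' r φ := by ext; simp [Finset.mul_sum]

theorem MatFun.shift_apply (a : A.Red) (φ : A.MatFun) (w : List A.Red) (r q : Fin t) :
    MatFun.shift a φ w r q = ∑ p, φ (a.ract (Pi.single r 1) :: w) p q := rfl

theorem shift_ev (σ : A.Cobar) (c : A.Codual) (a : A.Red) :
    MatFun.shift a (A.ev (σ * gen c)) =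
      A.ev (σ * A.cobarUnit fun r => c.val (a.val * A.idem r)) := by
  funext w
  ext r q
  rw [ev_mul_unit, MatFun.shift_apply, Matrix.diagonal_mul]
  have h : ∀ p, A.ev (σ * gen c) (a.ract (Pi.single r 1) :: w) p q =
      cmat c.val a.val p r * A.ev σ w r q := by
    intro p
    rw [ev_mul_gen_cons]
    change (cmat c.val (a.val * A.unit (Pi.single r 1)) * A.ev σ w) p q = _
    rw [cmat_ract, mul_assoc, Matrix.mul_apply, Finset.sum_eq_single r]
    · rw [Matrix.diagonal_mul]; simp
    · intro s _ hs; rw [Matrix.diagonal_mul]; simp [hs]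
    · simp
  simp only [h, ← Finset.sum_mul]
  congr 1
  simp only [cmat_apply, ← map_sum, ← Finset.sum_mul, sum_idem, one_mul]

/-- The element of the cobar construction with given values on words of length at most `n` in
letters with degrees in `I`. -/
def unev (hA : A.IsTypical) (I : Finset ℤ) : ℕ → A.MatFun →ₗ[k] A.Cobar
  | 0 => A.cobarUnit.toLinearMap ∘ₗ Matrix.diagLinearMap (Fin t) k k ∘ₗ LinearMap.proj []
  | n + 1 => A.cobarUnit.toLinearMap ∘ₗ Matrix.diagLinearMap (Fin t) k k ∘ₗ LinearMap.proj [] +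
      ∑ i ∈ I, ∑ α, LinearMap.mulRight k (A.genLin i (dualForm hA i α)) ∘ₗ unev hA I n ∘ₗ
        MatFun.shift (Red.of i (redBasis hA i α))

theorem unev_zero (hA : A.IsTypical) (I : Finset ℤ) (φ : A.MatFun) :
    unev hA I 0 φ = A.cobarUnit (φ []).diag := rfl

theorem unev_succ (hA : A.IsTypical) (I : Finset ℤ) (n : ℕ) (φ : A.MatFun) :
    unev hA I (n + 1) φ = A.cobarUnit (φ []).diag + ∑ i ∈ I, ∑ α,
      unev hA I n (MatFun.shift (Red.of i (redBasis hA i α)) φ) *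
        A.genLin i (dualForm hA i α) := by
  rw [unev]
  simp only [LinearMap.add_apply, LinearMap.sum_apply]
  rfl

theorem gen_expand (hA : A.IsTypical) (c : A.Codual) :
    ∑ α, A.cobarUnit (fun r => c.val ((redBasis hA c.deg α : A.carrier) * A.idem r)) *
      A.genLin c.deg (dualForm hA c.deg α) = gen c := by
  rw [← genLin_val]
  simp only [← genLin_lact, ← map_sum]
  refine genLin_congr fun a ha => ?_
  simp only [LinearMap.sum_apply, LinearMap.comp_apply, LinearMap.mulRight_apply]
  simp only [unit_eq_sum (A := A) (fun r => _), Finset.mul_sum, map_sum, mul_smul_comm, map_smul]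
  rw [Finset.sum_comm]
  have h : ∀ r, ∑ α, c.val ((redBasis hA c.deg α : A.carrier) * A.idem r) •
      dualForm hA c.deg α (a * A.idem r) = c.val (a * A.idem r) := by
    intro r
    have h := dualForm_sum hA (((Red.of _ ⟨a, ha⟩).ract (Pi.single r 1)).mem_redPiece)
    change ∑ α, dualForm hA c.deg α (a * A.idem r) • (redBasis hA c.deg α : A.carrier) =
      a * A.idem r at h
    conv_rhs => rw [← idem_mul_self r, ← mul_assoc, ← h, Finset.sum_mul, map_sum]
    refine Finset.sum_congr rfl fun α _ => ?_
    rw [smul_mul_assoc, map_smul, smul_eq_mul, smul_eq_mul, mul_comm]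
  simp only [h, ← map_sum, sum_mul_idem]

theorem unev_ev (hA : A.IsTypical) (τ : A.Cobar) :
    ∃ (n₀ : ℕ) (I₀ : Finset ℤ), ∀ n, n₀ ≤ n → ∀ I, I₀ ⊆ I → ∀ y,
      unev hA I n (A.ev (τ * A.cobarUnit y)) = τ * A.cobarUnit y := by
  classical
  refine cobar_rightInduction (P := fun τ => ∃ (n₀ : ℕ) (I₀ : Finset ℤ), ∀ n, n₀ ≤ n →
    ∀ I, I₀ ⊆ I → ∀ y, unev hA I n (A.ev (τ * A.cobarUnit y)) = τ * A.cobarUnit y)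
    (fun x => ?_) (fun a b ha hb => ?_) (fun m σ c hσ ih => ?_) τ
  · refine ⟨0, ∅, fun n _ I _ y => ?_⟩
    rw [← map_mul]
    cases n with
    | zero => rw [unev_zero, ev_unit_nil, Matrix.diag_diagonal]
    | succ n =>
      have h : ∀ a, MatFun.shift a (A.ev (A.cobarUnit (x * y))) = 0 := by
        intro a
        funext w
        ext r q
        rw [MatFun.shift_apply]
        simp only [ev_unit_cons]
        simp
      rw [unev_succ, ev_unit_nil, Matrix.diag_diagonal]
      simp only [h, map_zero, zero_mul, Finset.sum_const_zero, add_zero]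
  · obtain ⟨n₁, I₁, h₁⟩ := ha
    obtain ⟨n₂, I₂, h₂⟩ := hb
    refine ⟨max n₁ n₂, I₁ ∪ I₂, fun n hn I hI y => ?_⟩
    rw [add_mul, map_add, map_add, h₁ n (le_trans (le_max_left _ _) hn) I
      (Finset.union_subset_left hI), h₂ n (le_trans (le_max_right _ _) hn) I
      (Finset.union_subset_right hI)]
  · obtain ⟨n₁, I₁, h₁⟩ := ih
    refine ⟨n₁ + 1, insert c.deg I₁, fun n hn I hI y => ?_⟩
    rw [mul_assoc, ← gen_ract]
    obtain ⟨n, rfl⟩ : ∃ n', n = n' + 1 := ⟨n - 1, by omega⟩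
    generalize hc' : c.ract y = c'
    have hd : c'.deg = c.deg := by rw [← hc']; rfl
    rw [← hd] at hI
    rw [unev_succ, ev_mul_gen_nil, Matrix.diag_zero, map_zero, zero_add]
    simp only [shift_ev, h₁ n (by omega) I ((Finset.subset_insert _ _).trans hI)]
    rw [Finset.sum_eq_single_of_mem c'.deg (hI (Finset.mem_insert_self _ _))]
    · simp only [mul_assoc, ← Finset.mul_sum]
      congr 1
      exact gen_expand hA c'
    · intro i _ hi
      refine Finset.sum_eq_zero fun α _ => ?_
      have : (fun r => c'.val ((Red.of i (redBasis hA i α)).val * A.idem r)) = 0 := by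
        funext r
        exact c'.supp hi _ ((Red.of i (redBasis hA i α)).ract (Pi.single r 1)).mem
      rw [this, map_zero, mul_zero, zero_mul]

/-- The pairing is nondegenerate on the side of the cobar construction. -/
theorem ev_injective (hA : A.IsTypical) : Function.Injective A.ev := by
  classical
  intro σ τ h
  obtain ⟨n₁, I₁, h₁⟩ := unev_ev hA σ
  obtain ⟨n₂, I₂, h₂⟩ := unev_ev hA τ
  have h1 := h₁ _ (le_max_left n₁ n₂) _ (Finset.subset_union_left (s₂ := I₂)) 1
  have h2 := h₂ _ (le_max_right n₁ n₂) _ (Finset.subset_union_right (s₁ := I₁)) 1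
  rw [map_one, mul_one] at h1 h2
  rw [← h1, h, h2]

theorem IsMatCochain.shift {j : ℤ} {φ : A.MatFun} (hφ : A.IsMatCochain j φ) (a : A.Red) :
    A.IsMatCochain (j - (a.deg + 1)) (MatFun.shift a φ) where
  add u v b c e h1 h2 h3 := by
    ext r q
    simp only [MatFun.shift_apply, Matrix.add_apply, ← Finset.sum_add_distrib]
    exact Finset.sum_congr rfl fun p _ => congrFun (congrFun
      (hφ.add (a.ract (Pi.single r 1) :: u) v b c e h1 h2 h3) p) q
  smul u v s b c h1 h2 := by
    ext r q
    simp only [MatFun.shift_apply, Matrix.smul_apply, Finset.smul_sum]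
    exact Finset.sum_congr rfl fun p _ => congrFun (congrFun
      (hφ.smul (a.ract (Pi.single r 1) :: u) v s b c h1 h2) p) q
  bal u v x b c := by
    ext r q
    simp only [MatFun.shift_apply]
    exact Finset.sum_congr rfl fun p _ => congrFun (congrFun
      (hφ.bal (a.ract (Pi.single r 1) :: u) v x b c) p) q
  left v x b := by
    ext r q
    simp only [MatFun.shift_apply, Matrix.diagonal_mul, Finset.mul_sum]
    refine Finset.sum_congr rfl fun p _ => ?_
    have h1 := hφ.bal [] v x (a.ract (Pi.single r 1)) b
    have h2 := hφ.smul [] (b :: v) (x r) (a.ract (Pi.single r 1))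
      ((a.ract (Pi.single r 1)).ract x) rfl (by
        change a.val * A.idem r * A.unit x = x r • (a.val * A.idem r)
        rw [mul_assoc, idem_mul_unit, mul_smul_comm])
    exact congrFun (congrFun (h1.symm.trans h2) p) q
  right u x b := by
    ext r q
    simp only [MatFun.shift_apply, Matrix.mul_diagonal, Finset.sum_mul]
    refine Finset.sum_congr rfl fun p _ => ?_
    have h1 := congrFun (congrFun (hφ.right (a.ract (Pi.single r 1) :: u) x b) p) q
    rw [Matrix.mul_diagonal] at h1
    exact h1
  nil := by
    refine ⟨fun r => ∑ p, φ [a] p r, ?_⟩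
    ext r q
    have h1 := hφ.right [] (Pi.single r 1) a
    simp only [List.nil_append] at h1
    simp only [MatFun.shift_apply, h1, Matrix.mul_diagonal, ← Finset.sum_mul]
    by_cases h : r = q
    · subst h; simp
    · simp [h, Matrix.diagonal_apply, Ne.symm h]
  supp w hw := by
    ext r q
    rw [MatFun.shift_apply]
    refine Finset.sum_eq_zero fun p _ => ?_
    rw [hφ.supp]
    · rfl
    · rw [barDeg_cons]
      intro h; apply hw; rw [← h]; change _ = a.deg + 1 + _ - _; ring

theorem shift_expand (hA : A.IsTypical) {j : ℤ} {φ : A.MatFun} (hφ : A.IsMatCochain j φ)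
    (a : A.Red) (v : List A.Red) :
    ∑ α, cmat (dualForm hA a.deg α) a.val *
      MatFun.shift (Red.of a.deg (redBasis hA a.deg α)) φ v = φ (a :: v) := by
  ext p q
  simp only [Matrix.sum_apply, Matrix.mul_apply, cmat_apply, MatFun.shift_apply]
  rw [Finset.sum_comm]
  have h : ∀ r, ∑ α, dualForm hA a.deg α (A.idem p * a.val * A.idem r) *
      ∑ p', φ ((Red.of a.deg (redBasis hA a.deg α)).ract (Pi.single r 1) :: v) p' q =
      φ (a.ract (Pi.single r 1) :: v) p q := by
    intro r
    let L : A.redPiece a.deg →ₗ[k] k :=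
      { toFun := fun x => ∑ p', φ ((Red.of a.deg x).ract (Pi.single r 1) :: v) p' q
        map_add' := fun x y => by
          rw [← Finset.sum_add_distrib]
          exact Finset.sum_congr rfl fun p _ => congrFun (congrFun
            (hφ.add [] v ((Red.of a.deg x).ract (Pi.single r 1))
              ((Red.of a.deg y).ract (Pi.single r 1))
              ((Red.of a.deg (x + y)).ract (Pi.single r 1)) rfl rfl (add_mul _ _ _)) p) q
        map_smul' := fun s x => by
          rw [RingHom.id_apply, Finset.smul_sum]
          exact Finset.sum_congr rfl fun p _ => congrFun (congrFun
            (hφ.smul [] v s ((Red.of a.deg x).ract (Pi.single r 1))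
              ((Red.of a.deg (s • x)).ract (Pi.single r 1)) rfl
              (smul_mul_assoc _ _ _)) p) q }
    have h1 := ((a.lact (Pi.single p 1)).ract (Pi.single r 1)).mem_redPiece
    have h2 := dualForm_sum hA h1
    have h3 : ∑ α, dualForm hA a.deg α (A.idem p * a.val * A.idem r) • redBasis hA a.deg α =
        ⟨_, h1⟩ := Subtype.ext (by rw [Submodule.coe_sum]; exact h2)
    have h4 := congrArg L h3
    rw [map_sum] at h4
    simp only [map_smul, smul_eq_mul] at h4
    refine h4.trans ?_
    change ∑ p', φ ((Red.of a.deg ⟨_, h1⟩).ract (Pi.single r 1) :: v) p' q = _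
    have h5 : φ ((Red.of a.deg ⟨_, h1⟩).ract (Pi.single r 1) :: v) =
        φ ((a.ract (Pi.single r 1)).lact (Pi.single p 1) :: v) :=
      hφ.congr (a := (Red.of a.deg ⟨_, h1⟩).ract (Pi.single r 1))
        (b := (a.ract (Pi.single r 1)).lact (Pi.single p 1)) (by
        change A.idem p * a.val * A.idem r * A.idem r = A.idem p * (a.val * A.idem r)
        rw [mul_assoc, idem_mul_self, mul_assoc]) rfl v
    rw [h5, hφ.left]
    simp [Matrix.diagonal_mul, Pi.single_apply]
  simp only [h]
  have h1 : φ (a :: v) = ∑ r, φ (a.ract (Pi.single r 1) :: v) := by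
    have h2 := map_sum (hφ.slot [] v a.deg) (fun r : Fin t =>
      (⟨_, (a.ract (Pi.single r 1)).mem_redPiece⟩ : A.redPiece a.deg)) Finset.univ
    refine Eq.trans ?_ h2
    change φ (a :: v) = φ (Red.of a.deg _ :: v)
    refine hφ.congr (a := a) (b := Red.of a.deg _) ?_ rfl v
    change a.val = ((∑ r : Fin t, (⟨_, (a.ract (Pi.single r 1)).mem_redPiece⟩ :
      A.redPiece a.deg) : A.redPiece a.deg) : A.carrier)
    rw [Submodule.coe_sum]
    exact (sum_mul_idem a.val).symm
  rw [h1, Matrix.sum_apply]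

theorem length_le_barDeg {s : ℤ} (hs : ∀ i, A.redPiece i ≠ ⊥ → 1 ≤ s * (i + 1))
    {w : List A.Red} (hw : ∀ a ∈ w, a.val ≠ 0) : (w.length : ℤ) ≤ s * barDeg w := by
  induction w with
  | nil => simp [barDeg_nil]
  | cons a w ih =>
    have h1 := hs a.deg fun h => hw a (by simp) (Red.val_eq_zero h)
    have h2 := ih fun b hb => hw b (by simp [hb])
    rw [barDeg_cons, mul_add, List.length_cons]
    push_cast
    linarith

theorem IsMultilinear.ne_zero {M : Type w} [AddCommGroup M] [Module k M] {F : List A.Red → M}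
    (hF : IsMultilinear F) {w : List A.Red} (hw : F w ≠ 0) : ∀ a ∈ w, a.val ≠ 0 := by
  intro a ha h
  obtain ⟨u, v, rfl⟩ := List.append_of_mem ha
  exact hw (hF.zero h u v)

/-- Every function on the bar construction that is compatible with the actions of `K` is given by
an element of the cobar construction. -/
theorem ev_surjective (hA : A.IsTypical) {j : ℤ} {φ : A.MatFun} (hφ : A.IsMatCochain j φ) :
    ∃ τ ∈ A.cobarPiece (-j), A.ev τ = φ := by
  obtain ⟨s, hs, h⟩ := hA.sign
  suffices H : ∀ (n : ℕ) (j : ℤ) (φ : A.MatFun), A.IsMatCochain j φ → s * j < n →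
      ∃ τ ∈ A.cobarPiece (-j), A.ev τ = φ from
    H ((s * j).toNat + 1) j φ hφ (by push_cast; have := Int.self_le_toNat (s * j); omega)
  intro n
  induction n with
  | zero =>
    intro j φ hφ hj
    refine ⟨0, Submodule.zero_mem _, ?_⟩
    rw [map_zero]
    funext w
    by_contra hne
    have h1 := length_le_barDeg h (hφ.ne_zero (Ne.symm hne))
    have h2 : barDeg w = j := by_contra fun h => hne (hφ.supp w h).symm
    rw [h2] at h1
    push_cast at hj
    omega
  | succ n ih =>
    intro j φ hφ hj
    have h1 : ∀ (i : ℤ) (α : Fin (Module.finrank k (A.redPiece i))),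
        ∃ τ ∈ A.cobarPiece (-(j - (i + 1))),
          A.ev τ = MatFun.shift (Red.of i (redBasis hA i α)) φ := by
      intro i α
      refine ih _ _ (hφ.shift (Red.of i (redBasis hA i α))) ?_
      have h2 := h i fun h => by
        have h1 : Module.finrank k (A.redPiece i) = 0 := by rw [h, finrank_bot]
        have := α.2
        omega
      rw [mul_sub]
      push_cast at hj
      omega
    choose σ hσ hev using h1
    obtain ⟨x, hx⟩ := hφ.nil
    refine ⟨A.cobarUnit x + ∑ i ∈ Finset.Icc (-|j| - 1) |j|, ∑ α,
      σ i α * A.genLin i (dualForm hA i α), ?_, ?_⟩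
    · refine Submodule.add_mem _ ?_ (Submodule.sum_mem _ fun i _ => Submodule.sum_mem _ fun α _ => ?_)
      · by_cases h0 : j = 0
        · rw [h0]; exact cobarUnit_mem x
        · have : x = 0 := by
            have h1 := hφ.supp [] (fun h => h0 (by rw [← h, barDeg_nil]))
            rw [hx, ← Matrix.diagonal_zero'] at h1
            exact Matrix.diagonal_injective h1
          rw [this, map_zero]; exact Submodule.zero_mem _
      · have := SetLike.mul_mem_graded (hσ i α) (genLin_mem i (dualForm hA i α))
        rwa [show -(j - (i + 1)) + (-i - 1) = -j by ring] at this
    · funext w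
      simp only [map_add, map_sum, Pi.add_apply, Finset.sum_apply]
      cases w with
      | nil =>
        rw [ev_unit_nil, hx]
        simp [genLin, ev_mul_gen_nil]
      | cons a v =>
        rw [ev_unit_cons, zero_add]
        have hz : ∀ i, a.deg ≠ i → ∑ α, A.ev (σ i α * A.genLin i (dualForm hA i α)) (a :: v) = 0 :=
          fun i hi => Finset.sum_eq_zero fun α _ => ev_genLin_ne _ _ _ _ hi
        by_cases hi : a.deg ∈ Finset.Icc (-|j| - 1) |j|
        · rw [Finset.sum_eq_single_of_mem _ hi fun i _ h => hz i (Ne.symm h)]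
          simp only [ev_genLin _ _ _ _ rfl, hev]
          exact shift_expand hA hφ a v
        · rw [Finset.sum_eq_zero fun i hi' => hz i fun h => hi (h ▸ hi')]
          by_contra hne
          have h1 := hφ.ne_zero (Ne.symm hne)
          have h2 := h a.deg fun h => h1 a (by simp) (Red.val_eq_zero h)
          have h3 := length_le_barDeg h (w := v) fun b hb => h1 b (by simp [hb])
          have h4 : barDeg (a :: v) = j := by_contra fun h => hne (hφ.supp _ h).symm
          rw [barDeg_cons] at h4
          apply hi
          rw [Finset.mem_Icc]
          rcases hs with rfl | rfl <;> rcases abs_cases j with h | h <;> omega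

end perfect

/-! ### The filtration of the cobar construction by powers of the augmentation ideal -/

section weight

theorem mul_mem_augIdeal_pow {q r : ℕ} {a b : A.carrier} (ha : a ∈ A.augIdeal ^ q)
    (hb : b ∈ A.augIdeal ^ r) : a * b ∈ A.augIdeal ^ (q + r) := by
  rw [pow_add]; exact Submodule.mul_mem_mul ha hb

theorem augIdeal_pow_succ_le (q : ℕ) : A.augIdeal ^ (q + 2) ≤ A.augIdeal ^ (q + 1) := by
  have h : A.augIdeal ^ 2 ≤ A.augIdeal := by
    rw [pow_two, Submodule.mul_le]
    intro a ha b _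
    change A.aug (a * b) = 0
    rw [map_mul, show A.aug a = 0 from ha, zero_mul]
  rw [pow_add, pow_succ]
  exact mul_le_mul_right h _

theorem augIdeal_pow_antitone {q r : ℕ} (h : q ≤ r) :
    A.augIdeal ^ (r + 1) ≤ A.augIdeal ^ (q + 1) :=
  antitone_nat_of_succ_le (f := fun q => A.augIdeal ^ (q + 1)) augIdeal_pow_succ_le h

theorem augIdeal_pow_le (q : ℕ) : A.augIdeal ^ (q + 1) ≤ A.augIdeal := by
  simpa using augIdeal_pow_antitone (A := A) (Nat.zero_le q)

theorem proj_mem_augIdeal {a : A.carrier} (ha : a ∈ A.augIdeal) (i : ℤ) :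
    GradedAlgebra.proj A.piece i a ∈ A.augIdeal := by
  change A.aug _ = 0
  by_cases hi : i = 0
  · subst hi
    have h : A.aug a = A.aug (GradedAlgebra.proj A.piece 0 a) := by
      clear ha
      refine hom_induction (P := fun a => A.aug a = A.aug (GradedAlgebra.proj A.piece 0 a))
        (fun m a ha => ?_) (fun a b ha hb => by rw [map_add, ha, hb, map_add, map_add]) a
      rw [GradedAlgebra.proj_apply]
      by_cases h : m = 0
      · subst h; rw [DirectSum.decompose_of_mem_same _ ha]
      · rw [DirectSum.decompose_of_mem_ne _ ha h, A.aug_piece h ha, map_zero]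
    rw [← h]; exact ha
  · exact A.aug_piece hi (SetLike.coe_mem _)

theorem proj_mem_augIdeal_pow (q : ℕ) {a : A.carrier} (ha : a ∈ A.augIdeal ^ (q + 1)) (i : ℤ) :
    GradedAlgebra.proj A.piece i a ∈ A.augIdeal ^ (q + 1) := by
  classical
  induction q generalizing a i with
  | zero =>
    rw [zero_add, pow_one] at ha ⊢
    exact proj_mem_augIdeal ha i
  | succ q ih =>
    rw [pow_succ] at ha
    induction ha using Submodule.mul_induction_on' with
    | mem_mul_mem a ha b hb =>
      have h1 := DirectSum.sum_support_decompose A.piece a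
      have h2 := DirectSum.sum_support_decompose A.piece b
      rw [← h1, ← h2, Finset.sum_mul_sum, map_sum]
      refine Submodule.sum_mem _ fun j _ => ?_
      rw [map_sum]
      refine Submodule.sum_mem _ fun l _ => ?_
      have h3 := SetLike.mul_mem_graded (SetLike.coe_mem (DirectSum.decompose A.piece a j))
        (SetLike.coe_mem (DirectSum.decompose A.piece b l))
      rw [GradedAlgebra.proj_apply]
      by_cases h : j + l = i
      · subst h
        rw [DirectSum.decompose_of_mem_same _ h3, pow_succ]
        exact Submodule.mul_mem_mul (ih ha j) (proj_mem_augIdeal hb l)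
      · rw [DirectSum.decompose_of_mem_ne _ h3 h]; exact Submodule.zero_mem _
    | add a _ b _ ha hb => rw [map_add]; exact Submodule.add_mem _ ha hb

theorem d_mem_augIdeal_pow (q : ℕ) {a : A.carrier} (ha : a ∈ A.augIdeal ^ (q + 1)) :
    A.d a ∈ A.augIdeal ^ (q + 1) := by
  classical
  induction q generalizing a with
  | zero =>
    rw [zero_add, pow_one]
    exact A.aug_d a
  | succ q ih =>
    rw [pow_succ] at ha
    induction ha using Submodule.mul_induction_on' with
    | mem_mul_mem a ha b hb =>
      rw [← DirectSum.sum_support_decompose A.piece a, Finset.sum_mul, map_sum]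
      refine Submodule.sum_mem _ fun j _ => ?_
      rw [A.d_mul (SetLike.coe_mem (DirectSum.decompose A.piece a j)), pow_succ]
      have h1 : (DirectSum.decompose A.piece a j : A.carrier) ∈ A.augIdeal ^ (q + 1) :=
        proj_mem_augIdeal_pow q ha j
      exact Submodule.add_mem _ (Submodule.mul_mem_mul (ih h1) hb)
        (zsmul_mem (Submodule.mul_mem_mul h1 (A.aug_d b)) _)
    | add a _ b _ ha hb => rw [map_add]; exact Submodule.add_mem _ ha hb

/-- The linear form `c` vanishes on the power `q + 1` of the augmentation ideal. -/
def Codual.HasWeight (c : A.Codual) (q : ℕ) : Prop :=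
  ∀ a ∈ A.augIdeal ^ (q + 1), a ∈ A.piece c.deg → c.val a = 0

theorem Codual.exists_hasWeight (hA : A.IsTypical) (hc : A.IsComplete) (c : A.Codual) :
    ∃ q, c.HasWeight q := by
  have := hA.finite c.deg
  let f : ℕ →o (Submodule k (A.piece c.deg))ᵒᵈ :=
    { toFun := fun q => OrderDual.toDual ((A.augIdeal ^ (q + 1)).comap (A.piece c.deg).subtype)
      monotone' := fun q r h => Submodule.comap_mono (augIdeal_pow_antitone h) }
  obtain ⟨n, hn⟩ := IsArtinian.monotone_stabilizes f
  refine ⟨n, fun a ha hd => ?_⟩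
  have h : ∀ m, a ∈ A.augIdeal ^ (m + 1) := by
    intro m
    rcases le_total n m with h | h
    · have h1 : (⟨a, hd⟩ : A.piece c.deg) ∈ OrderDual.ofDual (f n) := ha
      rw [hn m h] at h1
      exact h1
    · exact augIdeal_pow_antitone h ha
  have h0 : a ∈ ⨅ n : ℕ, A.augIdeal ^ (n + 1) := Submodule.mem_iInf _ |>.2 h
  rw [hc, Submodule.mem_bot] at h0
  rw [h0, map_zero]

theorem Codual.HasWeight.gen_eq_zero {c : A.Codual} (h : c.HasWeight 0) : gen c = 0 := by
  rw [← genLin_val]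
  refine genLin_zero fun a ha => h a ?_ ha.1
  simpa using ha.2

theorem Codual.HasWeight.ract {c : A.Codual} {q : ℕ} (h : c.HasWeight q) (x : Fin t → k) :
    (c.ract x).HasWeight q := by
  intro a ha hd
  refine h _ ?_ (unit_mul_mem hd x)
  clear hd
  change A.unit x * a ∈ _
  have h1 : ∀ b ∈ A.augIdeal, A.unit x * b ∈ A.augIdeal := fun b hb => by
    change A.aug _ = 0
    rw [map_mul, show A.aug b = 0 from hb, mul_zero]
  rw [pow_succ'] at ha ⊢
  induction ha using Submodule.mul_induction_on' with
  | mem_mul_mem a ha b hb => rw [← mul_assoc]; exact Submodule.mul_mem_mul (h1 a ha) hb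
  | add a _ b _ ha hb => rw [mul_add]; exact Submodule.add_mem _ ha hb

variable (A) in
/-- `WMono q n σ`: `σ` is a monomial of degree `n` in generators whose weights have sum at
most `q`. -/
inductive WMono : ℕ → ℤ → A.Cobar → Prop
  | unit (q : ℕ) (x : Fin t → k) : WMono q 0 (A.cobarUnit x)
  | mul_gen {q r : ℕ} {n : ℤ} {σ : A.Cobar} (c : A.Codual) : WMono q n σ → c.HasWeight r →
      WMono (q + r) (n + (-c.deg - 1)) (σ * gen c)

theorem WMono.mono {q : ℕ} {n : ℤ} {σ : A.Cobar} (h : A.WMono q n σ) : A.Mono n σ := by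
  induction h with
  | unit q x => exact .unit x
  | mul_gen c _ _ ih => exact .mul_gen c ih

theorem WMono.weaken {q q' : ℕ} {n : ℤ} {σ : A.Cobar} (h : A.WMono q n σ) (hq : q ≤ q') :
    A.WMono q' n σ := by
  induction h generalizing q' with
  | unit q x => exact .unit q' x
  | @mul_gen q r n σ c _ hr ih =>
    have := WMono.mul_gen c (ih (q' := q' - r) (by omega)) hr
    rwa [show q' - r + r = q' by omega] at this

theorem WMono.mul_unit {q : ℕ} {n : ℤ} {σ : A.Cobar} (h : A.WMono q n σ) (x : Fin t → k) :
    A.WMono q n (σ * A.cobarUnit x) := by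
  cases h with
  | unit q y => rw [← map_mul]; exact .unit _ _
  | mul_gen c h hr => rw [mul_assoc, ← gen_ract]; exact .mul_gen (c.ract x) h (hr.ract x)

theorem WMono.mul {q r : ℕ} {m n : ℤ} {σ τ : A.Cobar} (hσ : A.WMono q m σ) (hτ : A.WMono r n τ) :
    A.WMono (q + r) (m + n) (σ * τ) := by
  induction hτ with
  | unit r x => rw [add_zero]; exact (hσ.mul_unit x).weaken (Nat.le_add_right q r)
  | mul_gen c _ hr ih =>
    rw [← mul_assoc, ← add_assoc, ← add_assoc]; exact .mul_gen c ih hr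

theorem Mono.wMono (hA : A.IsTypical) (hc : A.IsComplete) {n : ℤ} {σ : A.Cobar}
    (h : A.Mono n σ) : ∃ q, A.WMono q n σ := by
  induction h with
  | unit x => exact ⟨0, .unit 0 x⟩
  | mul_gen c _ ih =>
    obtain ⟨q, hq⟩ := ih
    obtain ⟨r, hr⟩ := c.exists_hasWeight hA hc
    exact ⟨q + r, .mul_gen c hq hr⟩

theorem WMono.eq_unit {n : ℤ} {σ : A.Cobar} (h : A.WMono 0 n σ) : ∃ x, σ = A.cobarUnit x := by
  generalize hq : 0 = q at h
  cases h with
  | unit q x => exact ⟨x, rfl⟩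
  | @mul_gen q r n σ c _ hr =>
    obtain rfl : r = 0 := by omega
    exact ⟨0, by rw [hr.gen_eq_zero, mul_zero, map_zero]⟩

variable (A) in
/-- The elements of degree `n` and weight at most `q` of the cobar construction. -/
def wPiece (q : ℕ) (n : ℤ) : Submodule k A.Cobar := Submodule.span k {σ | A.WMono q n σ}

theorem wPiece_le (q : ℕ) (n : ℤ) : A.wPiece q n ≤ A.cobarPiece n :=
  Submodule.span_le.2 fun _ h => WMono.mono h |>.mem

theorem wPiece_mono {q r : ℕ} (h : q ≤ r) (n : ℤ) : A.wPiece q n ≤ A.wPiece r n :=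
  Submodule.span_mono fun _ h' => WMono.weaken h' h

theorem cobarUnit_mem_wPiece (q : ℕ) (x : Fin t → k) : A.cobarUnit x ∈ A.wPiece q 0 :=
  Submodule.subset_span (.unit q x)

theorem mul_mem_wPiece {q r : ℕ} {m n : ℤ} {σ τ : A.Cobar} (hσ : σ ∈ A.wPiece q m)
    (hτ : τ ∈ A.wPiece r n) : σ * τ ∈ A.wPiece (q + r) (m + n) := by
  have h := Submodule.mul_mem_mul hσ hτ
  rw [wPiece, wPiece, Submodule.span_mul_span] at h
  refine Submodule.span_mono ?_ h
  rintro _ ⟨σ, hσ, τ, hτ, rfl⟩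
  exact WMono.mul hσ hτ

theorem gen_mem_wPiece {c : A.Codual} {q : ℕ} (h : c.HasWeight q) :
    gen c ∈ A.wPiece q (-c.deg - 1) := by
  have := WMono.mul_gen c (.unit 0 1) h
  rw [map_one, one_mul, zero_add, zero_add] at this
  exact Submodule.subset_span this

theorem exists_mem_wPiece (hA : A.IsTypical) (hc : A.IsComplete) {n : ℤ} {σ : A.Cobar}
    (h : σ ∈ A.cobarPiece n) : ∃ q, σ ∈ A.wPiece q n := by
  refine cobarPiece_induction (P := fun σ => ∃ q, σ ∈ A.wPiece q n)
    ⟨0, Submodule.zero_mem _⟩ ?_ ?_ h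
  · rintro a b ⟨q, ha⟩ ⟨r, hb⟩
    exact ⟨max q r, Submodule.add_mem _ (wPiece_mono (le_max_left _ _) _ ha)
      (wPiece_mono (le_max_right _ _) _ hb)⟩
  · intro σ h
    obtain ⟨q, hq⟩ := h.wMono hA hc
    exact ⟨q, Submodule.subset_span hq⟩

theorem wPiece_zero {n : ℤ} {σ : A.Cobar} (h : σ ∈ A.wPiece 0 n) : ∃ x, σ = A.cobarUnit x := by
  induction h using Submodule.span_induction with
  | mem x h => exact WMono.eq_unit h
  | zero => exact ⟨0, (map_zero _).symm⟩
  | add a b _ _ ha hb =>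
    obtain ⟨x, rfl⟩ := ha
    obtain ⟨y, rfl⟩ := hb
    exact ⟨x + y, (map_add _ _ _).symm⟩
  | smul r a _ ha =>
    obtain ⟨x, rfl⟩ := ha
    exact ⟨r • x, (map_smul _ _ _).symm⟩

/-- A projection onto a part of a graded piece that is compatible with a power of the augmentation
ideal. -/
theorem exists_powProj (q : ℕ) (i : ℤ) : ∃ e : A.carrier →ₗ[k] A.carrier,
    (∀ a, e a ∈ A.augIdeal ^ q ⊓ A.redPiece i) ∧ ∀ a ∈ A.augIdeal ^ q ⊓ A.redPiece i, e a = a := by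
  obtain ⟨p, hp⟩ := (A.augIdeal ^ q ⊓ A.redPiece i).subtype.exists_leftInverse_of_injective
    (Submodule.ker_subtype _)
  refine ⟨(Submodule.subtype _) ∘ₗ p, fun a => (p a).2, fun a ha => ?_⟩
  exact congrArg Subtype.val (LinearMap.congr_fun hp ⟨a, ha⟩)

theorem genLin_mem_wPiece {q : ℕ} {i : ℤ} {g : Module.Dual k A.carrier}
    (h : ∀ a ∈ A.augIdeal ^ (q + 1), a ∈ A.redPiece i → g a = 0) :
    A.genLin i g ∈ A.wPiece q (-i - 1) := by
  refine gen_mem_wPiece (c := Codual.of i g) fun a ha hd => ?_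
  have h1 : a ∈ A.redPiece i := ⟨hd, augIdeal_pow_le q ha⟩
  change g (A.redProj i a) = 0
  rw [redProj_same h1]
  exact h a ha h1

theorem contract_mem_wPiece (hA : A.IsTypical) {q : ℕ} {i n : ℤ} {g : Module.Dual k A.carrier}
    (h : ∀ a ∈ A.augIdeal ^ (q + 1), a ∈ A.piece n → g a = 0) :
    contract hA i (A.genLin (n - i) ∘ₗ mulForm g) ∈ A.wPiece q (-n - 2) := by
  choose e he he' using fun r : ℕ => exists_powProj (A := A) r i
  set L := A.genLin (n - i) ∘ₗ mulForm g with hL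
  have key : ∀ r : ℕ, r ≤ q →
      contract hA i L - contract hA i (L ∘ₗ e (r + 1)) ∈ A.wPiece q (-n - 2) := by
    intro r hr
    induction r with
    | zero =>
      have : contract hA i L = contract hA i (L ∘ₗ e (0 + 1)) := by
        refine contract_congr hA fun a ha => ?_
        rw [LinearMap.comp_apply L, he']
        exact ⟨by rw [zero_add, pow_one]; exact ha.2, ha⟩
      rw [this, sub_self]; exact Submodule.zero_mem _
    | succ r ih =>
      rw [← sub_add_sub_cancel _ (contract hA i (L ∘ₗ e (r + 1)))]
      refine Submodule.add_mem _ (ih (by omega)) ?_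
      have h1 := contract_move hA i i (L ∘ₗ e (r + 1)) (LinearMap.id - e (r + 1 + 1))
      have h2 : contract hA i ((L ∘ₗ e (r + 1)) ∘ₗ (A.redPiece i).subtype ∘ₗ A.redProj i ∘ₗ
          (LinearMap.id - e (r + 1 + 1))) + contract hA i (L ∘ₗ e (r + 1 + 1)) =
          contract hA i (L ∘ₗ e (r + 1)) := by
        rw [← contract_add]
        refine contract_congr hA fun a ha => ?_
        have h3 := he (r + 1 + 1) a
        have h4 : a - e (r + 1 + 1) a ∈ A.redPiece i := Submodule.sub_mem _ ha h3.2
        simp only [LinearMap.add_apply, LinearMap.comp_apply, LinearMap.sub_apply,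
          LinearMap.id_apply, Submodule.subtype_apply, redProj_same h4]
        rw [map_sub, map_sub, he' (r + 1) (e (r + 1 + 1) a) ⟨augIdeal_pow_succ_le r h3.1, h3.2⟩,
          sub_add_cancel]
      rw [← h2, add_sub_cancel_right, ← h1]
      refine Submodule.sum_mem _ fun α _ => ?_
      have h5 : (L ∘ₗ e (r + 1)) (redBasis hA i α) ∈ A.wPiece (q - (r + 1)) (-(n - i) - 1) := by
        rw [LinearMap.comp_apply, hL, LinearMap.comp_apply]
        refine genLin_mem_wPiece fun b hb hd => ?_
        have h6 := he (r + 1) (redBasis hA i α)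
        refine h _ ?_ ?_
        · have := mul_mem_augIdeal_pow h6.1 hb
          rwa [show r + 1 + (q - (r + 1) + 1) = q + 1 by omega] at this
        · have := SetLike.mul_mem_graded h6.2.1 hd.1
          rwa [add_sub_cancel] at this
      have h6 : A.genLin i (dualForm hA i α ∘ₗ (LinearMap.id - e (r + 1 + 1))) ∈
          A.wPiece (r + 1) (-i - 1) := by
        refine genLin_mem_wPiece fun b hb hd => ?_
        rw [LinearMap.comp_apply, LinearMap.sub_apply, LinearMap.id_apply, he' _ b ⟨hb, hd⟩,
          sub_self, map_zero]
      have := mul_mem_wPiece h5 h6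
      rwa [show q - (r + 1) + (r + 1) = q by omega,
        show -(n - i) - 1 + (-i - 1) = -n - 2 by ring] at this
  have h0 : contract hA i (L ∘ₗ e (q + 1)) = 0 := by
    refine contract_zero hA fun a _ => ?_
    rw [LinearMap.comp_apply, hL, LinearMap.comp_apply]
    refine genLin_zero fun b hb => ?_
    have h6 := he (q + 1) a
    refine h _ ?_ ?_
    · have hb' : b ∈ A.augIdeal ^ 1 := by rw [pow_one]; exact hb.2
      exact augIdeal_pow_succ_le q (mul_mem_augIdeal_pow (q := q + 1) (r := 1) h6.1 hb')
    · have := SetLike.mul_mem_graded h6.2.1 hb.1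
      rwa [add_sub_cancel] at this
  have := key q le_rfl
  rwa [h0, sub_zero] at this

theorem diff_mem_wPiece (hA : A.IsTypical) {q : ℕ} {n : ℤ} {σ : A.Cobar}
    (h : σ ∈ A.wPiece q n) : cobarDiff hA σ ∈ A.wPiece q (n - 1) := by
  induction h using Submodule.span_induction with
  | zero => rw [map_zero]; exact Submodule.zero_mem _
  | add a b _ _ ha hb => rw [map_add]; exact Submodule.add_mem _ ha hb
  | smul r a _ ha => rw [map_smul]; exact Submodule.smul_mem _ _ ha
  | mem σ h =>
    have h' : A.WMono q n σ := h
    clear h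
    induction h' with
    | unit q x => rw [cobarDiff_unit]; exact Submodule.zero_mem _
    | @mul_gen q r n σ c h hr ih =>
      rw [cobarDiff_mul hA h.mono.mem]
      refine Submodule.add_mem _ ?_ (zsmul_mem ?_ _)
      · have := mul_mem_wPiece ih (gen_mem_wPiece hr)
        rwa [show n - 1 + (-c.deg - 1) = n + (-c.deg - 1) - 1 by ring] at this
      · have h1 : cobarDiff hA (gen c) ∈ A.wPiece r (-c.deg - 2) := by
          rw [cobarDiff_gen]
          refine Submodule.add_mem _ (zsmul_mem ?_ _)
            (Submodule.sum_mem _ fun i _ => zsmul_mem (contract_mem_wPiece hA hr) _)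
          have := genLin_mem_wPiece (A := A) (q := r) (i := c.deg + 1) (g := c.val ∘ₗ A.d)
            fun a ha hd => hr _ (d_mem_augIdeal_pow r ha) (by
              have := A.d_mem hd.1
              rwa [add_sub_cancel_right] at this)
          rwa [show -(c.deg + 1) - 1 = -c.deg - 2 by ring] at this
        have h2 : σ ∈ A.wPiece q n := Submodule.subset_span h
        have := mul_mem_wPiece h2 h1
        rwa [show n + (-c.deg - 2) = n + (-c.deg - 1) - 1 by ring] at this

/-- The sum of the weights of the entries is at most `p`. -/
def WordWeight (hA : A.IsTypical) : ℕ → List (A.koszulDual hA).Red → Prop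
  | _, [] => True
  | p, a :: l => ∃ q r, q + r ≤ p ∧ a.val ∈ A.wPiece q a.deg ∧ WordWeight hA r l

variable {hA : A.IsTypical}

theorem exists_wordWeight (hc : A.IsComplete) (l : List (A.koszulDual hA).Red) :
    ∃ p, WordWeight hA p l := by
  induction l with
  | nil => exact ⟨0, trivial⟩
  | cons a l ih =>
    obtain ⟨r, hr⟩ := ih
    obtain ⟨q, hq⟩ := exists_mem_wPiece hA hc a.mem
    exact ⟨q + r, q, r, le_rfl, hq, hr⟩

theorem WordWeight.exists_eq_zero {p : ℕ} {l : List (A.koszulDual hA).Red}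
    (h : WordWeight hA p l) (hl : p < l.length) : ∃ a ∈ l, a.val = 0 := by
  induction l generalizing p with
  | nil => exact absurd hl (Nat.not_lt_zero _)
  | cons a l ih =>
    obtain ⟨q, r, h1, h2, h3⟩ := h
    rcases Nat.eq_zero_or_pos q with rfl | hq
    · obtain ⟨x, hx⟩ := wPiece_zero h2
      refine ⟨a, by simp, ?_⟩
      have h4 : A.cobarAug a.val = 0 := a.aug_eq
      rw [hx, cobarAug_unit] at h4
      rw [hx, h4]; exact map_zero _
    · rw [List.length_cons] at hl
      obtain ⟨b, hb, hb'⟩ := ih h3 (by omega)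
      exact ⟨b, by simp [hb], hb'⟩

end weight

/-! ### A contraction of the bar construction of the cobar construction -/

section peel
variable {hA : A.IsTypical} {N : Type w} [AddCommGroup N] [Module k N]

variable (A) (N) in
/-- A right module over the cobar construction. -/
abbrev RAct := A.Cobar →ₐ[k] (Module.End k N)ᵐᵒᵖ

namespace RAct

/-- The action of an element. -/
def act (ρ : RAct A N) (τ : A.Cobar) : N →ₗ[k] N := (AlgHom.toLinearMap ρ τ).unop

variable (ρ : RAct A N)

theorem act_mul (σ τ : A.Cobar) (n : N) : ρ.act (σ * τ) n = ρ.act τ (ρ.act σ n) := by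
  change (ρ (σ * τ)).unop n = _
  rw [map_mul]; rfl

theorem act_one (n : N) : ρ.act 1 n = n := by
  change (ρ 1).unop n = _
  rw [map_one]; rfl

/-- The action as a linear map in the acting element. -/
def actLin (n : N) : A.Cobar →ₗ[k] N where
  toFun τ := ρ.act τ n
  map_add' σ τ := by
    change (ρ (σ + τ)).unop n = _
    rw [map_add]; rfl
  map_smul' r τ := by
    change (ρ (r • τ)).unop n = _
    rw [map_smul]; rfl

/-- The diagonal action on `N × A.Cobar`. -/
def prodAct : A.Cobar →ₐ[k] (Module.End k (N × A.Cobar))ᵐᵒᵖ :=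
  AlgHom.ofLinearMap
    { toFun := fun τ => MulOpposite.op ((ρ.act τ).prodMap (LinearMap.mulRight k τ))
      map_add' := fun σ τ => by
        rw [← MulOpposite.op_add]
        refine congrArg MulOpposite.op (LinearMap.ext fun n => Prod.ext ?_ ?_)
        · exact map_add (ρ.actLin n.1) σ τ
        · exact mul_add _ _ _
      map_smul' := fun r τ => by
        rw [RingHom.id_apply, ← MulOpposite.op_smul]
        refine congrArg MulOpposite.op (LinearMap.ext fun n => Prod.ext ?_ ?_)
        · exact map_smul (ρ.actLin n.1) r τ
        · exact mul_smul_comm r n.2 τ }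
    (congrArg MulOpposite.op (LinearMap.ext fun n => Prod.ext (ρ.act_one n.1) (mul_one n.2)))
    (fun σ τ => congrArg MulOpposite.op (LinearMap.ext fun n => Prod.ext (ρ.act_mul σ τ n.1)
      (mul_assoc n.2 σ τ).symm))

end RAct

/-- The conditions on `g` under which the recursion `H(σ⟨c⟩) = H(σ)⟨c⟩ + g c σ` has a solution. -/
structure IsPeel (ρ : RAct A N) (g : A.Codual → A.Cobar →ₗ[k] N) : Prop where
  add : ∀ a b c : A.Codual, a.deg = c.deg → b.deg = c.deg → c.val = a.val + b.val →
    g c = g a + g b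
  smul : ∀ (r : k) (a c : A.Codual), a.deg = c.deg → c.val = r • a.val → g c = r • g a
  lact : ∀ x c τ, g (c.lact x) τ = g c (τ * A.cobarUnit x)
  ract : ∀ x c τ, g (c.ract x) τ = ρ.act (A.cobarUnit x) (g c τ)

variable {ρ : RAct A N}

/-- The action of generators on `N × A.Cobar` that encodes the recursion. -/
def IsPeel.hom {g : A.Codual → A.Cobar →ₗ[k] N} (hg : IsPeel ρ g) :
    A.Cobar →ₐ[k] (Module.End k (N × A.Cobar))ᵐᵒᵖ :=
  cobarLift (ρ.prodAct.comp A.cobarUnit)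
    (fun c => ρ.prodAct (gen c) +
      MulOpposite.op (LinearMap.inl k N A.Cobar ∘ₗ g c ∘ₗ LinearMap.snd k N A.Cobar))
    (fun a b c h1 h2 h3 => by
      rw [gen_add h1 h2 h3, hg.add a b c h1 h2 h3, map_add, LinearMap.add_comp, LinearMap.comp_add,
        MulOpposite.op_add, add_add_add_comm])
    (fun r a c h1 h2 => by
      rw [gen_smul h1 h2, hg.smul r a c h1 h2, map_smul, LinearMap.smul_comp, LinearMap.comp_smul,
        MulOpposite.op_smul, smul_add])
    (fun x c => by
      rw [gen_lact, map_mul, mul_add]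
      congr 1
      refine congrArg MulOpposite.op (LinearMap.ext fun n => Prod.ext ?_ rfl)
      exact hg.lact x c n.2)
    (fun x c => by
      rw [gen_ract, map_mul, add_mul]
      congr 1
      refine congrArg MulOpposite.op (LinearMap.ext fun n => Prod.ext ?_ ?_)
      · exact hg.ract x c n.2
      · exact (zero_mul (A.cobarUnit x)).symm)

/-- The solution of the recursion `H(σ⟨c⟩) = H(σ)⟨c⟩ + g c σ` that vanishes on `K`. -/
def IsPeel.peel {g : A.Codual → A.Cobar →ₗ[k] N} (hg : IsPeel ρ g) : A.Cobar →ₗ[k] N where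
  toFun τ := ((hg.hom τ).unop (0, 1)).1
  map_add' σ τ := by rw [map_add]; rfl
  map_smul' r τ := by rw [map_smul]; rfl

section
variable {g : A.Codual → A.Cobar →ₗ[k] N} (hg : IsPeel ρ g)

theorem IsPeel.peel_unit (x : Fin t → k) : hg.peel (A.cobarUnit x) = 0 := by
  change ((hg.hom _).unop (0, 1)).1 = 0
  rw [IsPeel.hom, cobarLift_unit]
  exact map_zero (ρ.act (A.cobarUnit x))

theorem IsPeel.hom_snd (τ : A.Cobar) : ((hg.hom τ).unop (0, 1)).2 = τ := by
  refine cobar_rightInduction (P := fun τ => ((hg.hom τ).unop (0, 1)).2 = τ)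
    (fun x => ?_) (fun a b ha hb => ?_) (fun n σ c _ ih => ?_) τ
  · rw [IsPeel.hom, cobarLift_unit]; exact one_mul (A.cobarUnit x)
  · rw [map_add]; exact congrArg₂ (· + ·) ha hb
  · rw [map_mul]
    change ((hg.hom (gen c)).unop ((hg.hom σ).unop (0, 1))).2 = _
    rw [IsPeel.hom, cobarLift_gen]
    change ((hg.hom σ).unop (0, 1)).2 * gen c + 0 = _
    rw [ih, add_zero]

theorem IsPeel.peel_gen (σ : A.Cobar) (c : A.Codual) :
    hg.peel (σ * gen c) = ρ.act (gen c) (hg.peel σ) + g c σ := by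
  change ((hg.hom (σ * gen c)).unop (0, 1)).1 = _
  rw [map_mul]
  change ((hg.hom (gen c)).unop ((hg.hom σ).unop (0, 1))).1 = _
  conv_lhs => rw [IsPeel.hom, cobarLift_gen]
  change ρ.act (gen c) (hg.peel σ) + g c ((hg.hom σ).unop (0, 1)).2 = _
  rw [hg.hom_snd]

theorem IsPeel.peel_unique {L : A.Cobar →ₗ[k] N} (hu : ∀ x, L (A.cobarUnit x) = 0)
    (hL : ∀ (n : ℤ) (σ : A.Cobar) (c : A.Codual), σ ∈ A.cobarPiece n →
      L (σ * gen c) = ρ.act (gen c) (L σ) + g c σ) : L = hg.peel :=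
  cobar_linearMap_ext (fun x => by rw [hu, hg.peel_unit]) fun n σ c hσ h => by
    rw [hL n σ c hσ, hg.peel_gen, h]

theorem IsPeel.peel_mul_unit (σ : A.Cobar) (x : Fin t → k) :
    hg.peel (σ * A.cobarUnit x) = ρ.act (A.cobarUnit x) (hg.peel σ) := by
  refine cobar_rightInduction (P := fun σ => hg.peel (σ * A.cobarUnit x) =
    ρ.act (A.cobarUnit x) (hg.peel σ)) (fun y => ?_) (fun a b ha hb => ?_)
    (fun n σ c _ _ => ?_) σ
  · rw [← map_mul, hg.peel_unit, hg.peel_unit, map_zero]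
  · rw [add_mul, map_add, ha, hb, map_add, map_add]
  · rw [mul_assoc, ← gen_ract, hg.peel_gen, hg.peel_gen, map_add, gen_ract, ρ.act_mul, hg.ract]

end

/-- The linear map with given values on homogeneous elements. -/
def homLift (f : ∀ i, A.cobarPiece i →ₗ[k] N) : A.Cobar →ₗ[k] N :=
  DirectSum.toModule k ℤ N f ∘ₗ (DirectSum.decomposeLinearEquiv A.cobarPiece).toLinearMap

theorem homLift_apply (f : ∀ i, A.cobarPiece i →ₗ[k] N) {i : ℤ} {a : A.Cobar}
    (ha : a ∈ A.cobarPiece i) : homLift f a = f i ⟨a, ha⟩ := by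
  change DirectSum.toModule k ℤ N f (DirectSum.decompose A.cobarPiece a) = _
  rw [DirectSum.decompose_of_mem _ ha]
  exact DirectSum.toModule_lof _ _ _

theorem homLift_sign (s : ℤ → ℤ) (L : A.Cobar →ₗ[k] N) {n : ℤ} {σ : A.Cobar}
    (hσ : σ ∈ A.cobarPiece n) :
    homLift (fun i => s i • (L ∘ₗ (A.cobarPiece i).subtype)) σ = s n • L σ :=
  homLift_apply _ hσ

theorem cobar_hom_ext {L L' : A.Cobar →ₗ[k] N} (h : ∀ n, ∀ σ ∈ A.cobarPiece n, L σ = L' σ) :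
    L = L' :=
  LinearMap.ext fun a => DirectSum.Decomposition.inductionOn (motive := fun a => L a = L' a)
    A.cobarPiece (by rw [map_zero, map_zero]) (fun {i} m => h i m m.2)
    (fun a b ha hb => by rw [map_add, map_add, ha, hb]) a

variable (hA) in
/-- A homogeneous element of the cobar construction. -/
def cobarHom (n : ℤ) (σ : A.Cobar) (h : σ ∈ A.cobarPiece n) : (A.koszulDual hA).Hom := ⟨n, σ, h⟩

/-- The element of the cobar construction underlying a homogeneous element. -/
def cval (a : (A.koszulDual hA).Red) : A.Cobar := a.val

variable (hA) in
/-- A generator, as an element of the augmentation ideal. -/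
def redGen (c : A.Codual) : (A.koszulDual hA).Red := ⟨⟨-c.deg - 1, gen c, gen_mem c⟩, cobarAug_gen c⟩

variable (hA) in
/-- The projection of a homogeneous component to the augmentation ideal. -/
def cobarBar (i : ℤ) : A.cobarPiece i →ₗ[k] (A.koszulDual hA).redPiece i where
  toFun σ := ⟨σ.1 - A.cobarUnit (A.cobarAug σ.1), (cobarHom hA i σ.1 σ.2).bar.mem,
    (cobarHom hA i σ.1 σ.2).bar.aug_eq⟩
  map_add' σ τ := Subtype.ext (by
    change σ.1 + τ.1 - A.cobarUnit (A.cobarAug (σ.1 + τ.1)) =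
      σ.1 - A.cobarUnit (A.cobarAug σ.1) + (τ.1 - A.cobarUnit (A.cobarAug τ.1))
    rw [map_add, map_add]; abel)
  map_smul' r σ := Subtype.ext (by
    change r • σ.1 - A.cobarUnit (A.cobarAug (r • σ.1)) =
      r • (σ.1 - A.cobarUnit (A.cobarAug σ.1))
    rw [map_smul, map_smul, smul_sub])

variable (hA) (ρ) in
/-- Functions on words that are multilinear and compatible with the right action of `K`. -/
structure IsRightLin (Φ : List (A.koszulDual hA).Red → N) : Prop extends IsMultilinear Φ where
  right : ∀ (u : List (A.koszulDual hA).Red) (x : Fin t → k) (a : (A.koszulDual hA).Red),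
    Φ (u ++ [a.ract x]) = ρ.act (A.cobarUnit x) (Φ (u ++ [a]))

variable (hA) (ρ) in
/-- The submodule of functions that are compatible with the right action of `K`. -/
def rightLin : Submodule k (List (A.koszulDual hA).Red → N) where
  carrier := {Φ | IsRightLin hA ρ Φ}
  add_mem' {f g} hf hg :=
    { toIsMultilinear := hf.toIsMultilinear.add' hg.toIsMultilinear
      right := fun u x a => by simp [hf.right, hg.right] }
  zero_mem' := ⟨⟨by simp, by simp, by simp⟩, by simp⟩
  smul_mem' c f hf :=
    { add := fun u v a b e h1 h2 h3 => by simp [hf.add u v a b e h1 h2 h3]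
      smul := fun u v r a e h1 h2 => by simp [hf.smul u v r a e h1 h2, smul_comm c r]
      bal := fun u v x a b => by simp [hf.bal]
      right := fun u x a => by simp [hf.right] }

theorem IsRightLin.prefix {Φ : List (A.koszulDual hA).Red → N} (h : IsRightLin hA ρ Φ)
    (b : (A.koszulDual hA).Red) : IsRightLin hA ρ fun w => Φ (b :: w) where
  toIsMultilinear := h.toIsMultilinear.prefix b
  right u x a := h.right (b :: u) x a

/-- The linear extension of `σ ↦ Φ(u, σ̄, v)`. -/
def IsRightLin.barSlot {Φ : List (A.koszulDual hA).Red → N} (h : IsRightLin hA ρ Φ)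
    (u v : List (A.koszulDual hA).Red) (s : ℤ → ℤ) : A.Cobar →ₗ[k] N :=
  homLift fun i => s i • (h.slot u v i ∘ₗ cobarBar hA i)

theorem IsRightLin.barSlot_apply {Φ : List (A.koszulDual hA).Red → N} (h : IsRightLin hA ρ Φ)
    (u v : List (A.koszulDual hA).Red) (s : ℤ → ℤ) {n : ℤ} {σ : A.Cobar}
    (hσ : σ ∈ A.cobarPiece n) :
    h.barSlot u v s σ = s n • Φ (u ++ (cobarHom hA n σ hσ).bar :: v) :=
  homLift_apply _ hσ

theorem redGen_lact (x : Fin t → k) (c : A.Codual) :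
    redGen hA (c.lact x) = (redGen hA c).lact x :=
  Red.ext rfl (gen_lact x c)

theorem redGen_ract (x : Fin t → k) (c : A.Codual) :
    redGen hA (c.ract x) = (redGen hA c).ract x :=
  Red.ext rfl (gen_ract x c)

theorem IsRightLin.isPeel {Φ : List (A.koszulDual hA).Red → N} (h : IsRightLin hA ρ Φ) :
    IsPeel ρ fun c => h.barSlot [] [redGen hA c] koszulSign where
  add a b c h1 h2 h3 := cobar_hom_ext fun n σ hσ => by
    rw [LinearMap.add_apply, h.barSlot_apply _ _ _ hσ, h.barSlot_apply _ _ _ hσ,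
      h.barSlot_apply _ _ _ hσ, ← smul_add]
    congr 1
    exact h.add [_] [] (redGen hA a) (redGen hA b) (redGen hA c) (by simp [redGen, h1])
      (by simp [redGen, h2]) (gen_add h1 h2 h3)
  smul r a c h1 h2 := cobar_hom_ext fun n σ hσ => by
    rw [LinearMap.smul_apply, h.barSlot_apply _ _ _ hσ, h.barSlot_apply _ _ _ hσ, smul_comm]
    congr 1
    exact h.smul [_] [] r (redGen hA a) (redGen hA c) (by simp [redGen, h1]) (gen_smul h1 h2)
  lact x c τ := by
    refine LinearMap.congr_fun (f := h.barSlot [] [redGen hA (c.lact x)] koszulSign)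
      (g := h.barSlot [] [redGen hA c] koszulSign ∘ₗ LinearMap.mulRight k (A.cobarUnit x))
      (cobar_hom_ext fun n σ hσ => ?_) τ
    have hσ' : σ * A.cobarUnit x ∈ A.cobarPiece n := mul_unit_mem (A := A.koszulDual hA) hσ x
    rw [LinearMap.comp_apply, LinearMap.mulRight_apply, h.barSlot_apply _ _ _ hσ,
      h.barSlot_apply _ _ _ hσ', redGen_lact]
    congr 1
    exact (h.bal [] [] x _ _).symm.trans
      (congrArg (fun a => Φ [a, redGen hA c]) (Hom.bar_ract (cobarHom hA n σ hσ) x).symm)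
  ract x c τ := by
    refine LinearMap.congr_fun (f := h.barSlot [] [redGen hA (c.ract x)] koszulSign)
      (g := ρ.act (A.cobarUnit x) ∘ₗ h.barSlot [] [redGen hA c] koszulSign)
      (cobar_hom_ext fun n σ hσ => ?_) τ
    rw [LinearMap.comp_apply, h.barSlot_apply _ _ _ hσ, h.barSlot_apply _ _ _ hσ, map_zsmul,
      redGen_ract]
    congr 1
    exact h.right [_] x _

/-- The map `H` with `H(σ⟨c⟩) = H(σ)⟨c⟩ + (-1)^|σ| Φ[σ̄|c]`. -/
def IsRightLin.peel {Φ : List (A.koszulDual hA).Red → N} (h : IsRightLin hA ρ Φ) :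
    A.Cobar →ₗ[k] N := h.isPeel.peel

theorem IsRightLin.peel_unit {Φ : List (A.koszulDual hA).Red → N} (h : IsRightLin hA ρ Φ)
    (x : Fin t → k) : h.peel (A.cobarUnit x) = 0 := h.isPeel.peel_unit x

theorem IsRightLin.peel_mul_unit {Φ : List (A.koszulDual hA).Red → N} (h : IsRightLin hA ρ Φ)
    (σ : A.Cobar) (x : Fin t → k) :
    h.peel (σ * A.cobarUnit x) = ρ.act (A.cobarUnit x) (h.peel σ) := h.isPeel.peel_mul_unit σ x

theorem IsRightLin.peel_gen {Φ : List (A.koszulDual hA).Red → N} (h : IsRightLin hA ρ Φ)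
    {n : ℤ} {σ : A.Cobar} (hσ : σ ∈ A.cobarPiece n) (c : A.Codual) :
    h.peel (σ * gen c) = ρ.act (gen c) (h.peel σ) +
      koszulSign n • Φ [(cobarHom hA n σ hσ).bar, redGen hA c] :=
  (h.isPeel.peel_gen σ c).trans (congrArg _ (h.barSlot_apply [] [redGen hA c] _ hσ))

theorem IsRightLin.peel_unique {Φ : List (A.koszulDual hA).Red → N} (h : IsRightLin hA ρ Φ)
    {L : A.Cobar →ₗ[k] N} (hu : ∀ x, L (A.cobarUnit x) = 0)
    (hL : ∀ (n : ℤ) (σ : A.Cobar) (hσ : σ ∈ A.cobarPiece n) (c : A.Codual),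
      L (σ * gen c) = ρ.act (gen c) (L σ) +
        koszulSign n • Φ [(cobarHom hA n σ hσ).bar, redGen hA c]) : L = h.peel :=
  h.isPeel.peel_unique hu fun n σ c hσ =>
    (hL n σ hσ c).trans (congrArg _ (h.barSlot_apply [] [redGen hA c] _ hσ).symm)

variable (hA) (ρ) in
open Classical in
/-- The contraction of functions on words: the value on `[τ_1|...|τ_m]` is obtained by splitting the
last generators off `τ_m`. -/
def ctr : (List (A.koszulDual hA).Red → N) → List (A.koszulDual hA).Red → N
  | _, [] => 0
  | Φ, [a] => if h : IsRightLin hA ρ Φ then h.peel (cval a) else 0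
  | Φ, b :: c :: l => koszulSign (b.deg + 1) • ctr (fun w => Φ (b :: w)) (c :: l)

variable {Φ Ψ : List (A.koszulDual hA).Red → N}

theorem ctr_nil (Φ : List (A.koszulDual hA).Red → N) : ctr hA ρ Φ [] = 0 := by rw [ctr]

theorem ctr_single (h : IsRightLin hA ρ Φ) (a : (A.koszulDual hA).Red) :
    ctr hA ρ Φ [a] = h.peel (cval a) := by rw [ctr, dif_pos h]

theorem ctr_cons (Φ : List (A.koszulDual hA).Red → N) (b : (A.koszulDual hA).Red)
    {l : List (A.koszulDual hA).Red} (hl : l ≠ []) :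
    ctr hA ρ Φ (b :: l) = koszulSign (b.deg + 1) • ctr hA ρ (fun w => Φ (b :: w)) l := by
  cases l with
  | nil => exact absurd rfl hl
  | cons c l => rw [ctr]

theorem ctr_add (hΦ : IsRightLin hA ρ Φ) (hΨ : IsRightLin hA ρ Ψ)
    (l : List (A.koszulDual hA).Red) :
    ctr hA ρ (fun w => Φ w + Ψ w) l = ctr hA ρ Φ l + ctr hA ρ Ψ l := by
  induction l generalizing Φ Ψ with
  | nil => simp only [ctr_nil, add_zero]
  | cons b l ih =>
    by_cases hl : l = []
    · subst hl
      have h : IsRightLin hA ρ fun w => Φ w + Ψ w := (rightLin hA ρ).add_mem hΦ hΨ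
      rw [ctr_single h, ctr_single hΦ, ctr_single hΨ]
      refine LinearMap.congr_fun (g := hΦ.peel + hΨ.peel) (h.peel_unique (fun x => ?_)
        fun n σ hσ c => ?_).symm _
      · rw [LinearMap.add_apply, hΦ.peel_unit, hΨ.peel_unit, add_zero]
      · rw [LinearMap.add_apply, hΦ.peel_gen hσ, hΨ.peel_gen hσ, LinearMap.add_apply, map_add,
          smul_add]
        abel
    · simp only [ctr_cons _ _ hl, ih (hΦ.prefix b) (hΨ.prefix b), smul_add]

/-- The contraction commutes with maps that respect the right actions up to sign. -/
theorem ctr_comp {N' : Type*} [AddCommGroup N'] [Module k N'] {ρ' : RAct A N'} (e : ℤ)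
    (f : N →ₗ[k] N')
    (hf : ∀ (n : ℤ) (τ : A.Cobar) (x : N), τ ∈ A.cobarPiece n →
      ρ'.act τ (f x) = koszulSign (e * n) • f (ρ.act τ x))
    (hΦ : IsRightLin hA ρ Φ) (h' : IsRightLin hA ρ' fun w => koszulSign (e * barDeg w) • f (Φ w))
    (l : List (A.koszulDual hA).Red) :
    ctr hA ρ' (fun w => koszulSign (e * barDeg w) • f (Φ w)) l =
      koszulSign (e * (barDeg l + 1)) • f (ctr hA ρ Φ l) := by
  have key : ∀ (s : ℤ) (l : List (A.koszulDual hA).Red) (Φ : List (A.koszulDual hA).Red → N)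
      (hΦ : IsRightLin hA ρ Φ)
      (h' : IsRightLin hA ρ' fun w => koszulSign (e * (s + barDeg w)) • f (Φ w)),
      ctr hA ρ' (fun w => koszulSign (e * (s + barDeg w)) • f (Φ w)) l =
        koszulSign (e * (s + barDeg l + 1)) • f (ctr hA ρ Φ l) := by
    intro s l
    induction l generalizing s with
    | nil => intro Φ _ _; simp only [ctr_nil, map_zero, smul_zero]
    | cons b l ih =>
      intro Φ hΦ h'
      by_cases hl : l = []
      · subst hl
        rw [ctr_single h', ctr_single hΦ]
        have h1 : homLift (fun i => (fun i => koszulSign (e * (s + i))) i • ((f ∘ₗ hΦ.peel) ∘ₗ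
            (A.cobarPiece i).subtype)) = h'.peel := by
          refine h'.peel_unique (fun x => ?_) fun n σ hσ c => ?_
          · rw [homLift_sign _ _ (cobarUnit_mem x), LinearMap.comp_apply, hΦ.peel_unit, map_zero,
              smul_zero]
          · have h2 := SetLike.mul_mem_graded hσ (gen_mem c)
            rw [homLift_sign _ _ hσ, homLift_sign _ _ h2, LinearMap.comp_apply,
              LinearMap.comp_apply]
            rw [hΦ.peel_gen hσ, map_zsmul, hf _ _ _ (gen_mem c), smul_smul, ← koszulSign_add,
              map_add, smul_add]
            congr 1
            · congr 2; ring
            · rw [map_zsmul, smul_comm]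
              congr 2
              simp only [barDeg_cons, barDeg_nil]
              apply koszulSign_congr
              refine ⟨-e, ?_⟩
              change e * (s + (n + (-c.deg - 1))) - e * (s + (n + 1 + (-c.deg - 1 + 1 + 0))) = _
              ring
        rw [← h1]
        refine (homLift_sign _ _ b.mem).trans ?_
        change koszulSign (e * (s + b.deg)) • f (hΦ.peel (cval b)) = _
        congr 1
        simp only [barDeg_cons, barDeg_nil]
        apply koszulSign_congr
        exact ⟨-e, by ring⟩
      · rw [ctr_cons _ _ hl, ctr_cons _ _ hl, map_zsmul, smul_comm]
        have h2 := h'.prefix b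
        have h3 := ih (s + (b.deg + 1)) (fun w => Φ (b :: w)) (hΦ.prefix b) (by
          simp only [barDeg_cons, ← add_assoc] at h2 ⊢; exact h2)
        simp only [barDeg_cons, ← add_assoc] at h3 ⊢
        rw [h3, smul_comm]
  have := key 0 l Φ hΦ (by simpa only [zero_add] using h')
  simpa only [zero_add] using this

theorem ctr_smul (r : k) (hΦ : IsRightLin hA ρ Φ) (l : List (A.koszulDual hA).Red) :
    ctr hA ρ (fun w => r • Φ w) l = r • ctr hA ρ Φ l := by
  have h := ctr_comp (ρ' := ρ) 0 (r • LinearMap.id) (fun n τ x _ => by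
    simp [koszulSign_zero]) hΦ (by
      simp only [zero_mul, koszulSign_zero, one_smul]
      exact (rightLin hA ρ).smul_mem r hΦ) l
  simpa only [zero_mul, koszulSign_zero, one_smul, LinearMap.smul_apply, LinearMap.id_apply] using h

theorem ctr_zsmul (r : ℤ) (hΦ : IsRightLin hA ρ Φ) (l : List (A.koszulDual hA).Red) :
    ctr hA ρ (fun w => r • Φ w) l = r • ctr hA ρ Φ l := by
  simpa only [Int.cast_smul_eq_zsmul] using ctr_smul (r : k) hΦ l

theorem IsRightLin.ctr (h : IsRightLin hA ρ Φ) : IsRightLin hA ρ (ctr hA ρ Φ) where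
  add u v a b c h1 h2 h3 := by
    induction u generalizing Φ with
    | nil =>
      by_cases hv : v = []
      · subst hv
        rw [List.nil_append, List.nil_append, List.nil_append, ctr_single h, ctr_single h,
          ctr_single h, cval, h3]
        exact map_add h.peel _ _
      · rw [List.nil_append, List.nil_append, List.nil_append, ctr_cons _ _ hv, ctr_cons _ _ hv,
          ctr_cons _ _ hv, h1, h2, ← smul_add, ← ctr_add (h.prefix a) (h.prefix b)]
        congr 2
        funext w
        exact h.add [] w a b c h1 h2 h3
    | cons d u ih =>
      rw [List.cons_append, List.cons_append, List.cons_append, ctr_cons _ _ (by simp),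
        ctr_cons _ _ (by simp), ctr_cons _ _ (by simp), ih (h.prefix d), smul_add]
  smul u v r a c h1 h2 := by
    induction u generalizing Φ with
    | nil =>
      by_cases hv : v = []
      · subst hv
        rw [List.nil_append, List.nil_append, ctr_single h, ctr_single h, cval, h2]
        exact map_smul h.peel _ _
      · rw [List.nil_append, List.nil_append, ctr_cons _ _ hv, ctr_cons _ _ hv, h1, smul_comm,
          ← ctr_smul _ (h.prefix a)]
        congr 2
        funext w
        exact h.smul [] w r a c h1 h2
    | cons d u ih =>
      rw [List.cons_append, List.cons_append, ctr_cons _ _ (by simp), ctr_cons _ _ (by simp),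
        ih (h.prefix d), smul_comm]
  bal u v x a b := by
    induction u generalizing Φ with
    | nil =>
      rw [List.nil_append, List.nil_append, ctr_cons _ (a.ract x) (List.cons_ne_nil _ _),
        ctr_cons _ a (List.cons_ne_nil _ _)]
      congr 1
      by_cases hv : v = []
      · subst hv
        rw [ctr_single (h.prefix _), ctr_single (h.prefix _)]
        refine LinearMap.congr_fun (g := (h.prefix a).peel ∘ₗ LinearMap.mulLeft k (A.cobarUnit x))
          ((h.prefix (a.ract x)).peel_unique (fun y => ?_) fun n σ hσ c => ?_).symm _
        · rw [LinearMap.comp_apply, LinearMap.mulLeft_apply, ← map_mul, (h.prefix a).peel_unit]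
        · have hσ' : A.cobarUnit x * σ ∈ A.cobarPiece n := unit_mul_mem (A := A.koszulDual hA) hσ x
          rw [LinearMap.comp_apply, LinearMap.mulLeft_apply, ← mul_assoc,
            (h.prefix a).peel_gen hσ']
          congr 2
          refine Eq.trans ?_ (h.bal [] [redGen hA c] x a _).symm
          exact congrArg (fun z => Φ [a, z, redGen hA c]) (Hom.bar_lact (cobarHom hA n σ hσ) x)
      · rw [ctr_cons _ _ hv, ctr_cons _ _ hv]
        congr 2
        funext w
        exact h.bal [] w x a b
    | cons d u ih =>
      rw [List.cons_append, List.cons_append, ctr_cons _ _ (by simp), ctr_cons _ _ (by simp),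
        ih (h.prefix d)]
  right u x a := by
    induction u generalizing Φ with
    | nil =>
      rw [List.nil_append, List.nil_append, ctr_single h, ctr_single h]
      exact h.peel_mul_unit (cval a) x
    | cons d u ih =>
      rw [List.cons_append, List.cons_append, ctr_cons _ _ (by simp), ctr_cons _ _ (by simp),
        ih (h.prefix d), map_zsmul]

end peel

section contraction
variable {hA : A.IsTypical} {N : Type w} [AddCommGroup N] [Module k N] {ρ : RAct A N}
  {Φ Ψ : List (A.koszulDual hA).Red → N}

theorem wPiece_induction_zero {L : A.Cobar →ₗ[k] N} {p : ℕ} (hu : ∀ x, L (A.cobarUnit x) = 0)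
    (hL : ∀ (q r : ℕ) (n : ℤ) (σ : A.Cobar) (c : A.Codual), A.WMono q n σ → c.HasWeight r →
      q + r ≤ p → L σ = 0 → L (σ * gen c) = 0)
    {n : ℤ} {σ : A.Cobar} (hσ : σ ∈ A.wPiece p n) : L σ = 0 := by
  have h : ∀ (q : ℕ) (n : ℤ) (σ : A.Cobar), A.WMono q n σ → q ≤ p → L σ = 0 := by
    intro q n σ h
    induction h with
    | unit q x => exact fun _ => hu x
    | mul_gen c h hr ih => exact fun hq => hL _ _ _ _ c h hr hq (ih (by omega))
  have h2 : A.wPiece p n ≤ LinearMap.ker L := Submodule.span_le.2 fun σ hσ => h p n σ hσ le_rfl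
  exact h2 hσ

theorem bar_mem_wPiece {q : ℕ} {n : ℤ} {σ : A.Cobar} (h : σ ∈ A.cobarPiece n)
    (hq : σ ∈ A.wPiece q n) : (cobarHom hA n σ h).bar.val ∈ A.wPiece q n := by
  refine Submodule.sub_mem _ hq ?_
  change A.cobarUnit (A.cobarAug σ) ∈ A.wPiece q n
  by_cases hn : n = 0
  · subst hn; exact cobarUnit_mem_wPiece q _
  · rw [cobarAug_piece hn h, map_zero]; exact Submodule.zero_mem _

theorem ctr_eq_zero (hΦ : IsRightLin hA ρ Φ) {p : ℕ} {l : List (A.koszulDual hA).Red}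
    (hl : WordWeight hA p l)
    (hv : ∀ w, WordWeight hA p w → w.length = l.length + 1 → Φ w = 0) :
    ctr hA ρ Φ l = 0 := by
  induction l generalizing p Φ with
  | nil => exact ctr_nil Φ
  | cons b l ih =>
    obtain ⟨q, r, hqr, hb, hl⟩ := hl
    by_cases h : l = []
    · subst h
      rw [ctr_single hΦ]
      refine wPiece_induction_zero (fun x => hΦ.peel_unit x) (fun q' r' n σ c hσ hc h1 h2 => ?_) hb
      have hσ' : σ ∈ A.wPiece q' n := Submodule.subset_span hσ
      rw [hΦ.peel_gen (wPiece_le _ _ hσ'), h2, map_zero, zero_add, hv _ _ rfl, smul_zero]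
      exact ⟨q', r', by omega, bar_mem_wPiece _ hσ', r', 0, by omega, gen_mem_wPiece hc, trivial⟩
    · rw [ctr_cons _ _ h, ih (hΦ.prefix b) hl fun w hw hlen => hv _ ⟨q, r, hqr, hb, hw⟩ ?_,
        smul_zero]
      simp [hlen]

variable (ρ) in
/-- The term `(-1)^|u| Φ(u) z` of the differential of a function on words `u ++ [z]`. -/
def lastAct (Φ : List (A.koszulDual hA).Red → N) (l : List (A.koszulDual hA).Red) : N :=
  match l.reverse with
  | [] => 0
  | z :: r => koszulSign (barDeg r.reverse) • ρ.act (cval z) (Φ r.reverse)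

theorem lastAct_nil (Φ : List (A.koszulDual hA).Red → N) : lastAct ρ Φ [] = 0 := rfl

theorem lastAct_concat (Φ : List (A.koszulDual hA).Red → N) (u : List (A.koszulDual hA).Red)
    (z : (A.koszulDual hA).Red) :
    lastAct ρ Φ (u ++ [z]) = koszulSign (barDeg u) • ρ.act (cval z) (Φ u) := by
  simp [lastAct]

theorem lastAct_single (Φ : List (A.koszulDual hA).Red → N) (z : (A.koszulDual hA).Red) :
    lastAct ρ Φ [z] = ρ.act (cval z) (Φ []) := by
  rw [← List.nil_append [z], lastAct_concat, barDeg_nil, koszulSign_zero, one_smul]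

theorem lastAct_cons (Φ : List (A.koszulDual hA).Red → N) (b : (A.koszulDual hA).Red)
    {l : List (A.koszulDual hA).Red} (hl : l ≠ []) :
    lastAct ρ Φ (b :: l) = koszulSign (b.deg + 1) • lastAct ρ (fun w => Φ (b :: w)) l := by
  obtain ⟨u, z, rfl⟩ := (List.eq_nil_or_concat' l).resolve_left hl
  rw [← List.cons_append, lastAct_concat, lastAct_concat, barDeg_cons, koszulSign_add, mul_smul]

variable (ρ) in
/-- The part of the differential of a function on words that does not involve a left action. -/
def wordDiff (Φ : List (A.koszulDual hA).Red → N) (l : List (A.koszulDual hA).Red) : N :=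
  barDiff Φ l + lastAct ρ Φ l

theorem wordDiff_cons (Φ : List (A.koszulDual hA).Red → N) (b : (A.koszulDual hA).Red)
    {l : List (A.koszulDual hA).Red} (hl : l ≠ []) :
    wordDiff ρ Φ (b :: l) = -Φ (b.diff :: l) + mergeHead Φ b l +
      koszulSign (b.deg + 1) • wordDiff ρ (fun w => Φ (b :: w)) l := by
  rw [wordDiff, wordDiff, barDiff_cons, lastAct_cons _ _ hl, smul_add, ← add_assoc]

theorem IsRightLin.lastAct (h : IsRightLin hA ρ Φ) : IsRightLin hA ρ (lastAct ρ Φ) where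
  add u v a b c h1 h2 h3 := by
    obtain rfl | ⟨v, z, rfl⟩ := List.eq_nil_or_concat' v
    · rw [lastAct_concat, lastAct_concat, lastAct_concat, cval, h3, ← smul_add]
      congr 1
      exact map_add (ρ.actLin _) _ _
    · simp only [← List.cons_append, ← List.append_assoc, lastAct_concat]
      rw [h.add u v a b c h1 h2 h3, map_add, smul_add]
      simp only [barDeg_append, barDeg_cons, h1, h2]
  smul u v r a c h1 h2 := by
    obtain rfl | ⟨v, z, rfl⟩ := List.eq_nil_or_concat' v
    · rw [lastAct_concat, lastAct_concat, cval, h2, smul_comm]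
      congr 1
      exact map_smul (ρ.actLin _) _ _
    · simp only [← List.cons_append, ← List.append_assoc, lastAct_concat]
      rw [h.smul u v r a c h1 h2, map_smul, smul_comm]
      simp only [barDeg_append, barDeg_cons, h1]
  bal u v x a b := by
    obtain rfl | ⟨v, z, rfl⟩ := List.eq_nil_or_concat' v
    · rw [← List.singleton_append, ← List.append_assoc, lastAct_concat, h.right,
        ← List.singleton_append (l := [b.lact x]), ← List.append_assoc, lastAct_concat,
        ← ρ.act_mul, barDeg_append, barDeg_append]
      rfl
    · simp only [← List.cons_append, ← List.append_assoc, lastAct_concat]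
      rw [h.bal, barDeg_append, barDeg_append, barDeg_cons, barDeg_cons, barDeg_cons, barDeg_cons]
      rfl
  right u x a := by
    rw [lastAct_concat, lastAct_concat, map_zsmul]
    congr 1
    exact ρ.act_mul _ _ _

theorem IsRightLin.barDiff (h : IsRightLin hA ρ Φ) : IsRightLin hA ρ (barDiff Φ) where
  toIsMultilinear := h.toIsMultilinear.barDiff
  right u x a := by
    rw [barDiff_concat_ract (G' := fun w => ρ.act (A.cobarUnit x) (Φ w)) fun u b => h.right u x b]
    exact map_barDiff (ρ.act (A.cobarUnit x)) Φ _

theorem IsRightLin.wordDiff (h : IsRightLin hA ρ Φ) : IsRightLin hA ρ (wordDiff ρ Φ) :=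
  (rightLin hA ρ).add_mem h.barDiff h.lastAct

theorem barDiff_congr {M : Type*} [AddCommGroup M] {F G : List A.Red → M} {l : List A.Red}
    (h : ∀ w, l.length ≤ w.length + 1 → F w = G w) : barDiff F l = barDiff G l := by
  induction l generalizing F G with
  | nil => rfl
  | cons a l ih =>
    rw [barDiff_cons, barDiff_cons, h _ (by simp), ih fun w hw => h _ (by simpa using hw)]
    congr 2
    cases l with
    | nil => rfl
    | cons b l => rw [mergeHead_cons, mergeHead_cons, h _ (by simp)]

theorem diff_wordWeight {p : ℕ} {b : (A.koszulDual hA).Red} {l : List (A.koszulDual hA).Red}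
    (h : WordWeight hA p (b :: l)) : WordWeight hA p (b.diff :: l) := by
  obtain ⟨q, r, hqr, hb, hl⟩ := h
  exact ⟨q, r, hqr, diff_mem_wPiece hA hb, hl⟩

theorem bar_mul_sub (hΦ : IsRightLin hA ρ Φ) (b : (A.koszulDual hA).Red) {m : ℤ} {σ : A.Cobar}
    (hσ : σ ∈ A.cobarPiece m) (hbσ : cval b * σ ∈ A.cobarPiece (b.deg + m)) (c : A.Codual)
    (hσc : σ * gen c ∈ A.cobarPiece (m + (-c.deg - 1))) :
    koszulSign m • (Φ [(cobarHom hA _ (cval b * σ) hbσ).bar, redGen hA c] -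
      Φ [b.mul (cobarHom hA m σ hσ).bar, redGen hA c]) =
    Φ [b, (cobarHom hA _ (σ * gen c) hσc).bar] -
      Φ [b, (cobarHom hA m σ hσ).bar.mul (redGen hA c)] := by
  have hb : A.cobarAug (cval b) = 0 := b.aug_eq
  set x := A.cobarAug σ with hx
  have e1 : (cobarHom hA _ (cval b * σ) hbσ).bar.val =
      (b.mul (cobarHom hA m σ hσ).bar).val + (b.ract x).val := by
    change cval b * σ - A.cobarUnit (A.cobarAug (cval b * σ)) =
      cval b * (σ - A.cobarUnit x) + cval b * A.cobarUnit x
    rw [map_mul, hb, zero_mul, map_zero, sub_zero, mul_sub, sub_add_cancel]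
  have e2 : (cobarHom hA _ (σ * gen c) hσc).bar.val =
      ((cobarHom hA m σ hσ).bar.mul (redGen hA c)).val + ((redGen hA c).lact x).val := by
    change σ * gen c - A.cobarUnit (A.cobarAug (σ * gen c)) =
      (σ - A.cobarUnit x) * gen c + A.cobarUnit x * gen c
    rw [map_mul, cobarAug_gen, mul_zero, map_zero, sub_zero, sub_mul, sub_add_cancel]
  by_cases hm : m = 0
  · subst hm
    have h1 := hΦ.add [] [redGen hA c] (b.mul (cobarHom hA 0 σ hσ).bar) (b.ract x)
      (cobarHom hA _ (cval b * σ) hbσ).bar rfl (add_zero b.deg).symm e1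
    have h2 := hΦ.add [b] [] ((cobarHom hA 0 σ hσ).bar.mul (redGen hA c)) ((redGen hA c).lact x)
      (cobarHom hA _ (σ * gen c) hσc).bar rfl (zero_add (-c.deg - 1)).symm e2
    simp only [List.nil_append, List.singleton_append] at h1 h2
    rw [h1, h2, add_sub_cancel_left, add_sub_cancel_left, koszulSign_zero, one_smul]
    exact hΦ.bal [] [] x b (redGen hA c)
  · have hx0 : x = 0 := cobarAug_piece hm hσ
    have z1 : (b.ract x).val = 0 := by
      rw [hx0]
      change cval b * A.cobarUnit 0 = 0
      rw [map_zero, mul_zero]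
    have z2 : ((redGen hA c).lact x).val = 0 := by
      rw [hx0]
      change A.cobarUnit 0 * gen c = 0
      rw [map_zero, zero_mul]
    rw [z1, add_zero] at e1
    rw [z2, add_zero] at e2
    have f1 : (cobarHom hA _ (cval b * σ) hbσ).bar = b.mul (cobarHom hA m σ hσ).bar :=
      Red.ext rfl e1
    have f2 : (cobarHom hA _ (σ * gen c) hσc).bar = (cobarHom hA m σ hσ).bar.mul (redGen hA c) :=
      Red.ext rfl e2
    rw [f1, f2, sub_self, sub_self, smul_zero]

theorem wordDiff_ctr_pair (hΦ : IsRightLin hA ρ Φ) {p : ℕ} {b τ : (A.koszulDual hA).Red}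
    (hl : WordWeight hA p [b, τ])
    (hv : ∀ w, WordWeight hA p w → w.length = 3 → Φ w = 0) :
    wordDiff ρ (ctr hA ρ Φ) [b, τ] + ctr hA ρ (wordDiff ρ Φ) [b, τ] = Φ [b, τ] := by
  have hl' := hl
  obtain ⟨q, r, hqr, hb, q', r', hqr', hτ, -⟩ := hl
  have hK := hΦ.wordDiff.prefix b
  let L : A.Cobar →ₗ[k] N := hΦ.peel ∘ₗ LinearMap.mulLeft k (cval b) -
    ρ.actLin (hΦ.peel (cval b)) - hK.peel - koszulSign b.deg • hΦ.barSlot [b] [] fun _ => 1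
  have hL : ∀ {n : ℤ} {σ : A.Cobar} (hσ : σ ∈ A.cobarPiece n), L σ =
      hΦ.peel (cval b * σ) - ρ.act σ (hΦ.peel (cval b)) - hK.peel σ -
        koszulSign b.deg • Φ [b, (cobarHom hA n σ hσ).bar] := by
    intro n σ hσ
    have h := hΦ.barSlot_apply [b] [] (fun _ => 1) hσ
    rw [one_smul] at h
    change _ - _ - _ - koszulSign b.deg • hΦ.barSlot [b] [] (fun _ => 1) σ = _
    rw [h]
    rfl
  have key : L (cval τ) = 0 := by
    refine wPiece_induction_zero (fun x => ?_) (fun q₁ r₁ m σ c hσ hc h1 ih => ?_) hτ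
    · have hx := cobarUnit_mem (A := A) x
      have h0 : Φ ([b] ++ (cobarHom hA 0 (A.cobarUnit x) hx).bar :: []) = 0 := by
        refine hΦ.zero ?_ [b] []
        change A.cobarUnit x - A.cobarUnit (A.cobarAug (A.cobarUnit x)) = 0
        rw [cobarAug_unit, sub_self]
      rw [hL hx, hK.peel_unit, hΦ.peel_mul_unit, sub_self, sub_zero, zero_sub, neg_eq_zero]
      exact (congrArg _ h0).trans (smul_zero _)
    · have hσw : σ ∈ A.wPiece q₁ m := Submodule.subset_span hσ
      have hσm := wPiece_le _ _ hσw
      have hσc := SetLike.mul_mem_graded hσm (gen_mem c)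
      have hbσ : cval b * σ ∈ A.cobarPiece (b.deg + m) := SetLike.mul_mem_graded b.mem hσm
      have hbar := bar_mem_wPiece (hA := hA) hσm hσw
      rw [hL hσm, sub_eq_zero, sub_eq_iff_eq_add, sub_eq_iff_eq_add] at ih
      rw [hL hσc, ← mul_assoc, hΦ.peel_gen hbσ, ih, hK.peel_gen hσm, ρ.act_mul]
      have hw : WordWeight hA p [b, (cobarHom hA m σ hσm).bar, redGen hA c] :=
        ⟨q, r, hqr, hb, q₁, r₁, by omega, hbar, r₁, 0, le_rfl, gen_mem_wPiece hc, trivial⟩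
      have v1 := hv _ (diff_wordWeight hw) rfl
      have v2 : Φ [b, (cobarHom hA m σ hσm).bar.diff, redGen hA c] = 0 :=
        hv _ ⟨q, r, hqr, hb, q₁, r₁, by omega, diff_mem_wPiece hA hbar, r₁, 0, le_rfl,
          gen_mem_wPiece hc, trivial⟩ rfl
      have v3 : Φ [b, (cobarHom hA m σ hσm).bar, (redGen hA c).diff] = 0 :=
        hv _ ⟨q, r, hqr, hb, q₁, r₁, by omega, hbar, r₁, 0, le_rfl,
          diff_mem_wPiece hA (gen_mem_wPiece hc), trivial⟩ rfl
      have h2 := bar_mul_sub hΦ b hσm hbσ c hσc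
      have h3 : wordDiff ρ Φ [b, (cobarHom hA m σ hσm).bar, redGen hA c] =
          koszulSign b.deg • (Φ [b.mul (cobarHom hA m σ hσm).bar, redGen hA c] -
            koszulSign m • Φ [b, (cobarHom hA m σ hσm).bar.mul (redGen hA c)] +
            koszulSign m • ρ.act (gen c) (Φ [b, (cobarHom hA m σ hσm).bar])) := by
        rw [wordDiff_cons _ _ (by simp), v1, wordDiff_cons _ _ (by simp), v2, wordDiff, barDiff_cons,
          v3, lastAct_single, mergeHead_cons, mergeHead_cons, mergeHead_nil, barDiff_nil,
          koszulSign_succ, koszulSign_succ]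
        change _ + -_ • (_ + koszulSign m • _ + -koszulSign m • (_ + ρ.act (gen c) _)) = _
        module
      rw [h3]
      have h4 := eq_add_of_sub_eq h2.symm
      rw [h4]
      simp only [map_add, map_zsmul, koszulSign_add, smul_add, smul_sub, smul_smul]
      rcases Int.even_or_odd m with hm | hm
      · have : koszulSign m = 1 := by simp [koszulSign, Int.negOnePow_even m hm]
        rw [this]; module
      · have : koszulSign m = -1 := by simp [koszulSign, Int.negOnePow_odd m hm]
        rw [this]; module
  have hτ' : (cobarHom hA τ.deg τ.val τ.mem).bar = τ := Red.bar_toHom τ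
  have h5 := hL (σ := cval τ) τ.mem
  change L (cval τ) = _ - _ - _ - koszulSign b.deg •
    Φ [b, (cobarHom hA τ.deg τ.val τ.mem).bar] at h5
  rw [key, hτ'] at h5
  have c1 : ctr hA ρ Φ [b.diff, τ] = 0 := ctr_eq_zero hΦ (diff_wordWeight hl') hv
  have c2 : ctr hA ρ Φ [b, τ.diff] = 0 :=
    ctr_eq_zero hΦ ⟨q, r, hqr, hb, q', r', hqr', diff_mem_wPiece hA hτ, trivial⟩ hv
  rw [wordDiff_cons _ _ (by simp), c1, wordDiff, barDiff_cons, c2, lastAct_single,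
    mergeHead_cons, mergeHead_nil, barDiff_nil, ctr_single hΦ, ctr_single hΦ,
    ctr_cons _ _ (by simp), ctr_single hK, koszulSign_succ]
  have h6 := koszulSign_mul_self b.deg
  have h7 : Φ [b, τ] = koszulSign b.deg • koszulSign b.deg • Φ [b, τ] := by
    rw [smul_smul, h6, one_smul]
  have h8 : koszulSign b.deg • Φ [b, τ] = hΦ.peel (cval b * cval τ) -
      ρ.act (cval τ) (hΦ.peel (cval b)) - hK.peel (cval τ) := (sub_eq_zero.1 h5.symm).symm
  have h9 : hΦ.peel (cval (b.mul τ)) = hΦ.peel (cval b * cval τ) := rfl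
  rw [h7, h8, h9]
  module

theorem wordDiff_ctr (hc : A.IsComplete) (hΦ : IsRightLin hA ρ Φ) {p : ℕ}
    {l : List (A.koszulDual hA).Red} (hl : WordWeight hA p l) (h2 : 2 ≤ l.length)
    (hv : ∀ w, WordWeight hA p w → w.length = l.length + 1 → Φ w = 0) :
    wordDiff ρ (ctr hA ρ Φ) l + ctr hA ρ (wordDiff ρ Φ) l = Φ l := by
  induction l generalizing p Φ with
  | nil => simp at h2
  | cons b l ih =>
    rcases l with _ | ⟨c, _ | ⟨e, l⟩⟩
    · simp at h2
    · exact wordDiff_ctr_pair hΦ hl hv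
    · have hl' := hl
      obtain ⟨q, r, hqr, hb, hl⟩ := hl
      have h1 := ih (hΦ.prefix b) hl (by simp) fun w hw hlen =>
        hv _ ⟨q, r, hqr, hb, hw⟩ (by simp only [List.length_cons] at hlen ⊢; omega)
      have h3 : wordDiff ρ (ctr hA ρ Φ) (b :: c :: e :: l) =
          -ctr hA ρ Φ (b.diff :: c :: e :: l) +
          koszulSign b.deg • ctr hA ρ Φ (b.mul c :: e :: l) +
          wordDiff ρ (ctr hA ρ fun w => Φ (b :: w)) (c :: e :: l) := by
        rw [wordDiff_cons _ _ (by simp), mergeHead_cons]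
        congr 1
        have h4 : ∀ w, w ≠ [] → ctr hA ρ Φ (b :: w) =
            koszulSign (b.deg + 1) • ctr hA ρ (fun w => Φ (b :: w)) w :=
          fun w hw => ctr_cons Φ b hw
        have h5 : barDiff (fun w => ctr hA ρ Φ (b :: w)) (c :: e :: l) =
            koszulSign (b.deg + 1) • barDiff (ctr hA ρ fun w => Φ (b :: w)) (c :: e :: l) := by
          rw [← barDiff_zsmul]
          exact barDiff_congr fun w hw => h4 w fun h => by simp [h] at hw
        have h6 : lastAct ρ (fun w => ctr hA ρ Φ (b :: w)) (c :: e :: l) =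
            koszulSign (b.deg + 1) • lastAct ρ (ctr hA ρ fun w => Φ (b :: w)) (c :: e :: l) := by
          obtain ⟨u, z, hu⟩ := (List.eq_nil_or_concat' (c :: e :: l)).resolve_left (by simp)
          rw [hu, lastAct_concat, lastAct_concat, h4 u, map_zsmul, smul_comm]
          rintro rfl
          simp at hu
        rw [wordDiff, wordDiff, h5, h6, ← smul_add, smul_smul, koszulSign_mul_self, one_smul]
      have h7 : ctr hA ρ (wordDiff ρ Φ) (b :: c :: e :: l) = koszulSign (b.deg + 1) •
          (-ctr hA ρ (fun w => Φ (b.diff :: w)) (c :: e :: l) +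
          koszulSign (c.deg + 1 + b.deg) • ctr hA ρ (fun w => Φ (b.mul c :: w)) (e :: l) +
          koszulSign (b.deg + 1) • ctr hA ρ (wordDiff ρ fun w => Φ (b :: w)) (c :: e :: l)) := by
        have g1 := (hΦ.prefix b.diff).prefix c
        have g2 := hΦ.prefix (b.mul c)
        have g3 := (hΦ.prefix b).wordDiff.prefix c
        have g4 : IsRightLin hA ρ fun w => (-1 : ℤ) • Φ (b.diff :: c :: w) :=
          zsmul_mem' (rightLin hA ρ) _ g1
        have g5 : IsRightLin hA ρ fun w => koszulSign b.deg • Φ (b.mul c :: w) :=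
          zsmul_mem' (rightLin hA ρ) _ g2
        have g6 : IsRightLin hA ρ fun w =>
            koszulSign (b.deg + 1) • wordDiff ρ (fun w => Φ (b :: w)) (c :: w) :=
          zsmul_mem' (rightLin hA ρ) _ g3
        have h8 : (fun w => wordDiff ρ Φ (b :: c :: w)) = fun w =>
            ((-1 : ℤ) • Φ (b.diff :: c :: w) + koszulSign b.deg • Φ (b.mul c :: w)) +
            koszulSign (b.deg + 1) • wordDiff ρ (fun w => Φ (b :: w)) (c :: w) := by
          funext w
          rw [wordDiff_cons _ _ (by simp), mergeHead_cons, neg_one_smul]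
        have g7 : IsRightLin hA ρ fun w =>
            (-1 : ℤ) • Φ (b.diff :: c :: w) + koszulSign b.deg • Φ (b.mul c :: w) :=
          (rightLin hA ρ).add_mem g4 g5
        rw [ctr_cons _ _ (by simp), ctr_cons _ c (by simp), ctr_cons _ c (by simp),
          ctr_cons _ c (by simp), h8, ctr_add g7 g6,
          ctr_add g4 g5, ctr_zsmul _ g1, ctr_zsmul _ g2, ctr_zsmul _ g3,
          koszulSign_add (c.deg + 1) b.deg]
        module
      rw [h3, h7, ← h1, ctr_cons Φ b.diff (by simp), ctr_cons Φ (b.mul c) (by simp)]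
      rw [smul_add, smul_add, smul_smul (koszulSign (b.deg + 1)) (koszulSign (b.deg + 1)),
        koszulSign_mul_self, one_smul]
      have s1 : koszulSign (b.diff.deg + 1) = -koszulSign (b.deg + 1) := by
        rw [← koszulSign_succ]; apply koszulSign_eq; rw [Red.diff_deg]; omega
      have s2 : koszulSign b.deg * koszulSign ((b.mul c).deg + 1) =
          -(koszulSign (b.deg + 1) * koszulSign (c.deg + 1 + b.deg)) := by
        rw [← koszulSign_add, ← koszulSign_add, ← koszulSign_succ]
        apply koszulSign_eq; rw [Red.mul_deg]; ring_nf; omega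
      rw [s1, smul_smul, s2, smul_smul]
      module

end contraction

section cochains
variable {hA : A.IsTypical}

variable (hA) in
/-- The right regular action of the cobar construction. -/
def regAct : RAct A (A.koszulDual hA).carrier :=
  AlgHom.ofLinearMap
    { toFun := fun τ : (A.koszulDual hA).carrier => MulOpposite.op (LinearMap.mulRight k τ)
      map_add' := fun σ τ => congrArg MulOpposite.op (LinearMap.ext fun n => mul_add n σ τ)
      map_smul' := fun r τ => congrArg MulOpposite.op (LinearMap.ext fun n => mul_smul_comm r n τ) }
    (congrArg MulOpposite.op (LinearMap.ext fun n => mul_one n))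
    (fun σ τ => congrArg MulOpposite.op (LinearMap.ext fun n => (mul_assoc n σ τ).symm))

theorem regAct_act (τ : A.Cobar) (n : (A.koszulDual hA).carrier) :
    (regAct hA).act τ n = n * (show (A.koszulDual hA).carrier from τ) := rfl

theorem regAct_cval (a : (A.koszulDual hA).Red) (n : (A.koszulDual hA).carrier) :
    (regAct hA).act (cval a) n = n * a.val := rfl

variable {n : ℤ} {f : List (A.koszulDual hA).Red → (A.koszulDual hA).carrier}

theorem IsCochain.isRightLin (hf : IsCochain n f) : IsRightLin hA (regAct hA) f where
  toIsMultilinear := hf.toIsMultilinear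
  right := hf.right

/-- The cup product with the twisting cochain from the left. -/
def headMul {A : AugDGKRing.{u, v} k t} (n : ℤ) (f : List A.Red → A.carrier) :
    List A.Red → A.carrier
  | [] => 0
  | a :: l => koszulSign (n * (a.deg + 1)) • (a.val * f l)

theorem cup_twist_left {A : AugDGKRing.{u, v} k t} (n : ℤ) (f : List A.Red → A.carrier)
    (l : List A.Red) : cup n twist f l = headMul n f l := by
  cases l with
  | nil => simp [cup, splitSum, twist, headMul]
  | cons a l =>
    rw [cup, splitSum_cons]
    have : splitSum (fun u v => koszulSign (n * barDeg (a :: u)) • (twist (a :: u) * f v)) l =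
        koszulSign (n * (a.deg + 1)) • (a.val * f l) := by
      cases l with
      | nil => simp [splitSum, twist, barDeg]
      | cons b l =>
        rw [splitSum_cons, splitSum_congr (H := fun _ _ => 0) fun u v _ => by simp [twist],
          splitSum_zero, add_zero]
        simp [twist, barDeg]
    rw [this]
    simp [twist, headMul]

theorem cup_twist_concat {A : AugDGKRing.{u, v} k t} (f : List A.Red → A.carrier)
    (u : List A.Red) (z : A.Red) :
    cup 1 f twist (u ++ [z]) = koszulSign (barDeg u) • (f u * z.val) := by
  rw [cup, splitSum_concat]
  have : splitSum (fun u v => koszulSign (1 * barDeg u) • (f u * twist (v ++ [z]))) u =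
      koszulSign (barDeg u) • (f u * z.val) := by
    obtain rfl | ⟨u, y, rfl⟩ := List.eq_nil_or_concat' u
    · simp [splitSum, twist]
    · rw [splitSum_concat, splitSum_congr (H := fun _ _ => 0) fun u v _ => ?_, splitSum_zero,
        zero_add]
      · simp [twist]
      · rcases v with _ | ⟨b, v⟩ <;> simp [twist]
  rw [this]
  simp [twist]

theorem cup_twist_right (f : List (A.koszulDual hA).Red → (A.koszulDual hA).carrier)
    (l : List (A.koszulDual hA).Red) : cup 1 f twist l = lastAct (regAct hA) f l := by
  obtain rfl | ⟨u, z, rfl⟩ := List.eq_nil_or_concat' l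
  · simp [cup, splitSum, twist, lastAct_nil]
  · rw [cup_twist_concat, lastAct_concat, regAct_cval]

theorem delta_eq_wordDiff (n : ℤ) (f : List (A.koszulDual hA).Red → (A.koszulDual hA).carrier)
    (l : List (A.koszulDual hA).Red) : delta n f l =
      (A.koszulDual hA).d (f l) - koszulSign n • wordDiff (regAct hA) f l + headMul n f l := by
  rw [delta, cup_twist_left, cup_twist_right, wordDiff, smul_add]
  abel

theorem IsRightLin.peel_left {f : List (A.koszulDual hA).Red → (A.koszulDual hA).carrier}
    (hf : IsRightLin hA (regAct hA) f)
    (hl : ∀ (v : List (A.koszulDual hA).Red) (x : Fin t → k) (a : (A.koszulDual hA).Red),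
      f (a.lact x :: v) = (A.koszulDual hA).unit x * f (a :: v)) (x : Fin t → k) (τ : A.Cobar) :
    hf.peel (A.cobarUnit x * τ) = (A.koszulDual hA).unit x * hf.peel τ := by
  refine cobar_rightInduction (P := fun τ => hf.peel (A.cobarUnit x * τ) =
    (A.koszulDual hA).unit x * hf.peel τ) (fun y => ?_) (fun a b ha hb => ?_)
    (fun m σ c hσ ih => ?_) τ
  · rw [← map_mul, hf.peel_unit, hf.peel_unit, mul_zero]
  · rw [mul_add, map_add, map_add, ha, hb, mul_add]
  · have hσ' : A.cobarUnit x * σ ∈ A.cobarPiece m := unit_mul_mem (A := A.koszulDual hA) hσ x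
    rw [← mul_assoc, hf.peel_gen hσ', hf.peel_gen hσ, ih, regAct_act, regAct_act, mul_add, mul_assoc,
      mul_smul_comm]
    congr 2
    have h := hl [redGen hA c] x (cobarHom hA m σ hσ).bar
    rw [← Hom.bar_lact] at h
    exact h

theorem IsRightLin.peel_mem {f : List (A.koszulDual hA).Red → (A.koszulDual hA).carrier}
    (hf : IsRightLin hA (regAct hA) f) {n : ℤ}
    (hd : ∀ l, f l ∈ (A.koszulDual hA).piece (barDeg l - n)) {m : ℤ} {τ : A.Cobar}
    (hτ : τ ∈ A.cobarPiece m) : hf.peel τ ∈ (A.koszulDual hA).piece (m + 1 - (n - 1)) := by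
  refine cobarPiece_induction (P := fun τ => hf.peel τ ∈ (A.koszulDual hA).piece (m + 1 - (n - 1)))
    ?_ (fun a b ha hb => ?_) (fun σ hσ => ?_) hτ
  · rw [map_zero]; exact Submodule.zero_mem _
  · rw [map_add]; exact Submodule.add_mem _ ha hb
  · clear hτ
    induction hσ with
    | unit x => rw [hf.peel_unit]; exact Submodule.zero_mem _
    | @mul_gen m σ c h ih =>
      rw [hf.peel_gen h.mem]
      refine Submodule.add_mem _ ?_ (zsmul_mem' _ _ ?_)
      · have := SetLike.mul_mem_graded (A := (A.koszulDual hA).piece) ih (gen_mem c)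
        rwa [show m + 1 - (n - 1) + (-c.deg - 1) = m + (-c.deg - 1) + 1 - (n - 1) by ring] at this
      · have := hd [(cobarHom hA m σ h.mem).bar, redGen hA c]
        rw [barDeg_cons, barDeg_cons, barDeg_nil] at this
        change _ ∈ (A.koszulDual hA).piece (m + 1 + (-c.deg - 1 + 1 + 0) - n) at this
        rwa [show m + 1 + (-c.deg - 1 + 1 + 0) - n = m + (-c.deg - 1) + 1 - (n - 1) by ring] at this

theorem ctr_mul_left (a : (A.koszulDual hA).carrier) (hf : IsRightLin hA (regAct hA) f)
    (l : List (A.koszulDual hA).Red) :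
    ctr hA (regAct hA) (fun w => a * f w) l = a * ctr hA (regAct hA) f l := by
  have h0 : IsRightLin hA (regAct hA) fun w => a * f w :=
    { add := fun u v b c e h1 h2 h3 => by
        change a * _ = a * _ + a * _
        rw [hf.add u v b c e h1 h2 h3, mul_add]
      smul := fun u v r b c h1 h2 => by
        change a * _ = r • (a * _)
        rw [hf.smul u v r b c h1 h2, mul_smul_comm]
      bal := fun u v x b c => congrArg (a * ·) (hf.bal u v x b c)
      right := fun u x b => (congrArg (a * ·) (hf.right u x b)).trans (mul_assoc _ _ _).symm }
  have h := ctr_comp (ρ' := regAct hA) 0 (LinearMap.mulLeft k a) (fun n τ x _ => by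
    rw [zero_mul, koszulSign_zero, one_smul]; exact mul_assoc _ _ _) hf (by
      simp only [zero_mul, koszulSign_zero, one_smul]
      exact h0) l
  simpa only [zero_mul, koszulSign_zero, one_smul, LinearMap.mulLeft_apply] using h

theorem IsCochain.ctr (hf : IsCochain n f) : IsCochain (n - 1) (ctr hA (regAct hA) f) where
  toIsMultilinear := hf.isRightLin.ctr.toIsMultilinear
  left v x a := by
    cases v with
    | nil =>
      rw [ctr_single hf.isRightLin, ctr_single hf.isRightLin]
      exact hf.isRightLin.peel_left hf.left x (cval a)
    | cons b v =>
      rw [ctr_cons _ (a.lact x) (l := b :: v) (by simp), ctr_cons _ a (l := b :: v) (by simp),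
        mul_smul_comm, ← ctr_mul_left _ (hf.isRightLin.prefix a)]
      have : (fun w => f (a.lact x :: w)) = fun w => (A.koszulDual hA).unit x * f (a :: w) :=
        funext fun w => hf.left w x a
      rw [this]
      rfl
  right u x a := hf.isRightLin.ctr.right u x a
  nil x := by rw [ctr_nil, mul_zero, zero_mul]
  deg l := by
    have h : ∀ (l : List (A.koszulDual hA).Red)
        (f : List (A.koszulDual hA).Red → (A.koszulDual hA).carrier) (n : ℤ),
        IsRightLin hA (regAct hA) f → (∀ l, f l ∈ (A.koszulDual hA).piece (barDeg l - n)) →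
        AugDGKRing.ctr hA (regAct hA) f l ∈ (A.koszulDual hA).piece (barDeg l - (n - 1)) := by
      intro l
      induction l with
      | nil => intro f n _ _; rw [ctr_nil]; exact Submodule.zero_mem _
      | cons b l ih =>
        intro f n hf hd
        by_cases hl : l = []
        · subst hl
          rw [ctr_single hf]
          have := hf.peel_mem hd b.mem
          rwa [show b.deg + 1 - (n - 1) = barDeg [b] - (n - 1) by simp [barDeg]] at this
        · rw [ctr_cons _ _ hl]
          refine zsmul_mem' _ _ ?_
          have := ih (fun w => f (b :: w)) (n - (b.deg + 1)) (hf.prefix b) fun w => by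
            have := hd (b :: w)
            rwa [barDeg_cons, show b.deg + 1 + barDeg w - n = barDeg w - (n - (b.deg + 1)) by
              ring] at this
          rwa [show barDeg l - (n - (b.deg + 1) - 1) = barDeg (b :: l) - (n - 1) by
            rw [barDeg_cons]; ring] at this
    exact h l f n hf.isRightLin hf.deg

theorem ctr_headMul (hf : IsRightLin hA (regAct hA) f) {l : List (A.koszulDual hA).Red}
    (hl : 2 ≤ l.length) :
    ctr hA (regAct hA) (headMul n f) l = headMul (n - 1) (ctr hA (regAct hA) f) l := by
  rcases l with _ | ⟨b, _ | ⟨c, l⟩⟩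
  · simp at hl
  · simp at hl
  · rw [ctr_cons _ _ (by simp)]
    have h := ctr_zsmul (ρ := regAct hA) (koszulSign (n * (b.deg + 1)))
      (Φ := fun w => b.val * f w) (hA := hA) ?_ (c :: l)
    · refine (congrArg _ (h.trans (congrArg _ (ctr_mul_left b.val hf (c :: l))))).trans ?_
      rw [headMul, smul_smul, ← koszulSign_add]
      congr 1
      apply koszulSign_eq
      ring_nf; omega
    · exact
      { add := fun u v a c e h1 h2 h3 => by
          change b.val * _ = b.val * _ + b.val * _
          rw [hf.add u v a c e h1 h2 h3, mul_add]
        smul := fun u v r a c h1 h2 => by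
          change b.val * _ = r • (b.val * _)
          rw [hf.smul u v r a c h1 h2, mul_smul_comm]
        bal := fun u v x a c => congrArg (b.val * ·) (hf.bal u v x a c)
        right := fun u x a => (congrArg (b.val * ·) (hf.right u x a)).trans (mul_assoc _ _ _).symm }

/-- One step of the reduction of a cochain to one that vanishes on long words. -/
def redStep (n : ℤ) (f : List (A.koszulDual hA).Red → (A.koszulDual hA).carrier) :
    List (A.koszulDual hA).Red → (A.koszulDual hA).carrier :=
  f - koszulSign n • delta (n - 1) (ctr hA (regAct hA) f)

theorem delta_zero {A : AugDGKRing.{u, v} k t} (n : ℤ) :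
    delta n (0 : List A.Red → A.carrier) = 0 := map_zero (A.deltaLin n)

theorem IsCochain.redStep (hf : IsCochain n f) : IsCochain n (redStep n f) := by
  have h := hf.ctr.delta
  rw [sub_add_cancel] at h
  exact ((A.koszulDual hA).cochains n).sub_mem hf (zsmul_mem' _ _ h)

theorem delta_redStep (hf : IsCochain n f) : delta n (redStep n f) = delta n f := by
  have h := delta_delta hf.ctr
  rw [sub_add_cancel] at h
  refine (map_sub ((A.koszulDual hA).deltaLin n) f _).trans ?_
  rw [map_zsmul]
  change _ - koszulSign n • delta n (delta (n - 1) _) = _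
  rw [h, smul_zero, sub_zero]
  rfl

theorem redStep_eq_zero (hc : A.IsComplete) (hf : IsCochain n f)
    (hδ : ∀ l, 2 ≤ l.length → delta n f l = 0) {p m : ℕ} (hm : 2 ≤ m)
    (hv : ∀ w, WordWeight hA p w → m + 1 ≤ w.length → f w = 0) {l : List (A.koszulDual hA).Red}
    (hl : WordWeight hA p l) (hlm : m ≤ l.length) : redStep n f l = 0 := by
  have hr := hf.isRightLin
  have hv' : ∀ w, WordWeight hA p w → w.length = l.length + 1 → f w = 0 :=
    fun w hw h => hv w hw (by omega)
  have h1 := wordDiff_ctr hc hr hl (hm.trans hlm) hv'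
  have h2 : AugDGKRing.ctr hA (regAct hA) f l = 0 := ctr_eq_zero hr hl hv'
  set d : List (A.koszulDual hA).Red → (A.koszulDual hA).carrier :=
    fun w => (A.koszulDual hA).d (f w) with hd
  have hdr : IsRightLin hA (regAct hA) d :=
    { add := fun u v a b c h1 h2 h3 => by simp only [hd, hf.add u v a b c h1 h2 h3, map_add]
      smul := fun u v r a c h1 h2 => by simp only [hd, hf.smul u v r a c h1 h2, map_smul]
      bal := fun u v x a b => by simp only [hd, hf.bal]
      right := fun u x a => by
        simp only [hd, hf.right]
        exact d_mul_unit (hf.deg _) x }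
  have hδr := hf.delta.isRightLin
  have hhr : IsRightLin hA (regAct hA) (headMul n f) := by
    have h := (rightLin hA (regAct hA)).add_mem ((rightLin hA (regAct hA)).sub_mem hδr hdr)
      (zsmul_mem' (rightLin hA (regAct hA)) (koszulSign n) hr.wordDiff)
    have e : headMul n f = delta n f - d + koszulSign n • wordDiff (regAct hA) f := by
      funext w
      change _ = delta n f w - d w + koszulSign n • wordDiff (regAct hA) f w
      rw [delta_eq_wordDiff]
      abel
    rwa [e]
  have e : wordDiff (regAct hA) f = fun w => koszulSign n • (d w + headMul n f w) +
      (-koszulSign n) • delta n f w := by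
    funext w
    rw [delta_eq_wordDiff, smul_add, smul_add, smul_sub, smul_smul, neg_mul, koszulSign_mul_self]
    module
  have e1 : AugDGKRing.ctr hA (regAct hA) d l = 0 := ctr_eq_zero hdr hl fun w hw h => by
    simp only [hd, hv' w hw h, map_zero]
  have e2 : AugDGKRing.ctr hA (regAct hA) (delta n f) l = 0 := ctr_eq_zero hδr hl fun w _ h =>
    hδ w (by omega)
  have a1 : IsRightLin hA (regAct hA) fun w => d w + headMul n f w :=
    (rightLin hA (regAct hA)).add_mem hdr hhr
  have e3 : AugDGKRing.ctr hA (regAct hA) (wordDiff (regAct hA) f) l =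
      koszulSign n • headMul (n - 1) (AugDGKRing.ctr hA (regAct hA) f) l := by
    have z1 : IsRightLin hA (regAct hA) fun w => koszulSign n • (d w + headMul n f w) :=
      zsmul_mem' (rightLin hA (regAct hA)) _ a1
    have z2 : IsRightLin hA (regAct hA) fun w => (-koszulSign n) • delta n f w :=
      zsmul_mem' (rightLin hA (regAct hA)) _ hδr
    rw [e, ctr_add z1 z2, ctr_zsmul _ a1, ctr_zsmul _ hδr, e2, smul_zero,
      add_zero, ctr_add hdr hhr, e1, zero_add, ctr_headMul hr (hm.trans hlm)]
  change f l - koszulSign n • delta (n - 1) (AugDGKRing.ctr hA (regAct hA) f) l = 0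
  rw [delta_eq_wordDiff, h2, map_zero, ← h1, e3]
  have s : koszulSign (n - 1) = -koszulSign n := koszulSign_eq_neg (by omega)
  rw [s, smul_add, smul_sub, smul_smul, mul_neg, koszulSign_mul_self]
  module

end cochains

section limits
variable {M : Type w} [AddCommGroup M]
open Filter

theorem eventually_barDiff {F : List A.Red → M} {G : ℕ → List A.Red → M}
    (h : ∀ l, ∀ᶠ N in atTop, G N l = F l) (l : List A.Red) :
    ∀ᶠ N in atTop, barDiff (G N) l = barDiff F l := by
  induction l generalizing F G with
  | nil => exact Eventually.of_forall fun _ => rfl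
  | cons a l ih =>
    have h1 : ∀ᶠ N in atTop, mergeHead (G N) a l = mergeHead F a l := by
      cases l with
      | nil => exact Eventually.of_forall fun _ => rfl
      | cons b l => exact (h (a.mul b :: l)).mono fun N hN => congrArg _ hN
    filter_upwards [h (a.diff :: l), h1, ih (F := fun w => F (a :: w))
      (G := fun N w => G N (a :: w)) fun w => h (a :: w)] with N h1 h2 h3
    rw [barDiff_cons, barDiff_cons, h1, h2, h3]

theorem eventually_splitSum {α : Type*} {F : List α → List α → M}
    {G : ℕ → List α → List α → M} (h : ∀ u v, ∀ᶠ N in atTop, G N u v = F u v) (l : List α) :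
    ∀ᶠ N in atTop, splitSum (G N) l = splitSum F l := by
  induction l generalizing F G with
  | nil => exact h [] []
  | cons a l ih =>
    filter_upwards [h [] (a :: l), ih (F := fun u => F (a :: u))
      (G := fun N u => G N (a :: u)) fun u => h (a :: u)] with N h1 h2
    rw [splitSum_cons, splitSum_cons, h1, h2]

theorem eventually_delta {f : List A.Red → A.carrier} {g : ℕ → List A.Red → A.carrier}
    (h : ∀ l, ∀ᶠ N in atTop, g N l = f l) (n : ℤ) (l : List A.Red) :
    ∀ᶠ N in atTop, delta n (g N) l = delta n f l := by
  have h1 : ∀ᶠ N in atTop, cup n twist (g N) l = cup n twist f l :=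
    eventually_splitSum (fun u v => (h v).mono fun N hN => by rw [hN]) l
  have h2 : ∀ᶠ N in atTop, cup 1 (g N) twist l = cup 1 f twist l :=
    eventually_splitSum (fun u v => (h u).mono fun N hN => by rw [hN]) l
  filter_upwards [h l, eventually_barDiff h l, h1, h2] with N e1 e2 e3 e4
  rw [delta, delta, e1, e2, e3, e4]

theorem isCochain_of_eventually {n : ℤ} {f : List A.Red → A.carrier}
    {g : ℕ → List A.Red → A.carrier} (h : ∀ l, ∀ᶠ N in atTop, g N l = f l)
    (hg : ∀ N, IsCochain n (g N)) : IsCochain n f where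
  add u v a b c h1 h2 h3 := by
    obtain ⟨N, e1, e2, e3⟩ := ((h (u ++ a :: v)).and ((h (u ++ b :: v)).and
      (h (u ++ c :: v)))).exists
    rw [← e1, ← e2, ← e3, (hg N).add u v a b c h1 h2 h3]
  smul u v r a c h1 h2 := by
    obtain ⟨N, e1, e2⟩ := ((h (u ++ a :: v)).and (h (u ++ c :: v))).exists
    rw [← e1, ← e2, (hg N).smul u v r a c h1 h2]
  bal u v x a b := by
    obtain ⟨N, e1, e2⟩ := ((h (u ++ a.ract x :: b :: v)).and (h (u ++ a :: b.lact x :: v))).exists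
    rw [← e1, ← e2, (hg N).bal]
  left v x a := by
    obtain ⟨N, e1, e2⟩ := ((h (a.lact x :: v)).and (h (a :: v))).exists
    rw [← e1, ← e2, (hg N).left]
  right u x a := by
    obtain ⟨N, e1, e2⟩ := ((h (u ++ [a.ract x])).and (h (u ++ [a]))).exists
    rw [← e1, ← e2, (hg N).right]
  nil x := by
    obtain ⟨N, e1⟩ := (h []).exists
    rw [← e1, (hg N).nil]
  deg l := by
    obtain ⟨N, e1⟩ := (h l).exists
    rw [← e1]
    exact (hg N).deg l

end limits

section reduction
variable {hA : A.IsTypical} {n : ℤ}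
  {f : List (A.koszulDual hA).Red → (A.koszulDual hA).carrier}

theorem exists_zero_mem_eq_zero {M : Type w} [AddCommGroup M] [Module k M]
    {F : List A.Red → M} (hF : IsMultilinear F) {l : List A.Red} (h : ∃ a ∈ l, a.val = 0) :
    F l = 0 := by
  obtain ⟨a, ha, h0⟩ := h
  obtain ⟨u, v, rfl⟩ := List.append_of_mem ha
  exact hF.zero h0 u v

/-- A cochain whose differential vanishes on words of length at least two is, up to a coboundary,
itself zero on such words. -/
theorem exists_reduced (hc : A.IsComplete) (hf : IsCochain n f)
    (hδ : ∀ l, 2 ≤ l.length → delta n f l = 0) :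
    ∃ g, IsCochain (n - 1) g ∧ ∀ l, 2 ≤ l.length → f l - delta (n - 1) g l = 0 := by
  let F : ℕ → List (A.koszulDual hA).Red → (A.koszulDual hA).carrier := fun i => (redStep n)^[i] f
  have F0 : F 0 = f := rfl
  have Fs : ∀ i, F (i + 1) = redStep n (F i) := fun i => Function.iterate_succ_apply' _ _ _
  have hF : ∀ i, IsCochain n (F i) ∧ delta n (F i) = delta n f := fun i => by
    induction i with
    | zero => exact ⟨hf, rfl⟩
    | succ i ih => rw [Fs]; exact ⟨ih.1.redStep, (delta_redStep ih.1).trans ih.2⟩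
  have hv : ∀ p i l, WordWeight hA p l → 2 ≤ l.length → p + 1 ≤ l.length + i → F i l = 0 := by
    intro p i
    induction i with
    | zero =>
      intro l hl _ h
      exact exists_zero_mem_eq_zero (hF 0).1.toIsMultilinear (hl.exists_eq_zero (by omega))
    | succ i ih =>
      intro l hl h2 hp
      rw [Fs]
      refine redStep_eq_zero hc (hF i).1 (fun l hl => by rw [(hF i).2, hδ l hl]) h2
        (fun w hw h => ih w hw (by omega) (by omega)) hl le_rfl
  have hs : ∀ p i l, WordWeight hA p l → 1 ≤ l.length → p ≤ i →
      ctr hA (regAct hA) (F i) l = 0 := fun p i l hl h1 hp =>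
    ctr_eq_zero (hF i).1.isRightLin hl fun w hw h => hv p i w hw (by omega) (by omega)
  let G : ℕ → List (A.koszulDual hA).Red → (A.koszulDual hA).carrier := fun N =>
    koszulSign n • ∑ i ∈ Finset.range N, ctr hA (regAct hA) (F i)
  have hG : ∀ N, IsCochain (n - 1) (G N) := fun N => zsmul_mem' _ _
    (Submodule.sum_mem ((A.koszulDual hA).cochains (n - 1)) fun (i : ℕ) _ => (hF i).1.ctr)
  have hFG : ∀ N, F N = f - delta (n - 1) (G N) := fun N => by
    induction N with
    | zero =>
      have : G 0 = 0 := by simp [G]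
      rw [this, delta_zero, sub_zero, F0]
    | succ N ih =>
      have : G (N + 1) = G N + koszulSign n • ctr hA (regAct hA) (F N) := by
        simp only [G, Finset.sum_range_succ, smul_add]
      rw [Fs, redStep, this]
      have e := map_add ((A.koszulDual hA).deltaLin (n - 1)) (G N)
        (koszulSign n • ctr hA (regAct hA) (F N))
      have e' := map_zsmul ((A.koszulDual hA).deltaLin (n - 1)) (koszulSign n)
        (ctr hA (regAct hA) (F N))
      rw [e'] at e
      change delta (n - 1) _ = delta (n - 1) (G N) + koszulSign n • delta (n - 1) _ at e
      rw [e, ih]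
      abel
  choose p hp using exists_wordWeight (hA := hA) hc
  have hst : ∀ l N, p l ≤ N → G N l = G (p l) l := by
    intro l N hN
    induction N, hN using Nat.le_induction with
    | base => rfl
    | succ N hN ih =>
      rw [← ih]
      simp only [G, Finset.sum_range_succ, smul_add, Pi.add_apply]
      refine add_eq_left.2 ?_
      rcases l with _ | ⟨b, l⟩
      · rw [Pi.smul_apply, ctr_nil, smul_zero]
      · rw [Pi.smul_apply, hs _ N _ (hp _) (by simp) hN, smul_zero]
  have hev : ∀ l, ∀ᶠ N in Filter.atTop, G N l = G (p l) l := fun l =>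
    (Filter.eventually_ge_atTop (p l)).mono fun N hN => hst l N hN
  refine ⟨fun l => G (p l) l, isCochain_of_eventually hev hG, fun l hl => ?_⟩
  obtain ⟨N, e1, e2⟩ := ((eventually_delta hev (n - 1) l).and
    (Filter.eventually_ge_atTop (p l + 1))).exists
  rw [← e1]
  have h := hv (p l) N l (hp l) hl (by omega)
  rw [hFG] at h
  exact h

end reduction

theorem zsmul_sign (m n : ℤ) {M : Type*} [AddCommGroup M] (x : M) :
    koszulSign m • koszulSign n • x = koszulSign (m + n) • x := by
  rw [smul_smul, koszulSign_add]

section short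
variable {n : ℤ} {f g : List A.Red → A.carrier}

theorem delta_single (n : ℤ) (f : List A.Red → A.carrier) (a : A.Red) : delta n f [a] =
    A.d (f [a]) + koszulSign n • f [a.diff] + koszulSign (n * (a.deg + 1)) • (a.val * f []) -
      koszulSign n • (f [] * a.val) := by
  have h := cup_twist_concat f [] a
  rw [List.nil_append, barDeg_nil, koszulSign_zero, one_smul] at h
  rw [delta, cup_twist_left, h, barDiff_cons, mergeHead_nil, barDiff_nil, headMul]
  module

theorem delta_pair (n : ℤ) (f : List A.Red → A.carrier) (hf : ∀ l, 2 ≤ l.length → f l = 0)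
    (a b : A.Red) : delta n f [a, b] = koszulSign (n * (a.deg + 1)) • (a.val * f [b]) +
      koszulSign (n + a.deg) • (f [a] * b.val) - koszulSign (n + a.deg) • f [a.mul b] := by
  have h := cup_twist_concat f [a] b
  rw [List.singleton_append] at h
  rw [delta, cup_twist_left, h, barDiff_cons, mergeHead_cons, barDiff_cons, mergeHead_nil,
    barDiff_nil, headMul, hf [a, b] le_rfl, hf [a.diff, b] le_rfl, hf [a, b.diff] le_rfl, map_zero,
    zsmul_sign]
  have : koszulSign (n + barDeg [a]) = -koszulSign (n + a.deg) := by
    apply koszulSign_eq_neg; simp only [barDeg_cons, barDeg_nil]; omega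
  simp only [smul_sub, smul_add, zsmul_sign, smul_neg, smul_zero, neg_zero, add_zero, zero_add, this]
  module

theorem delta_long (n : ℤ) {f : List A.Red → A.carrier} (hf : ∀ l, 2 ≤ l.length → f l = 0)
    {l : List A.Red} (hl : 3 ≤ l.length) : delta n f l = 0 := by
  have h1 : barDiff f l = 0 := by
    rw [← barDiff_zero (A := A) (M := A.carrier) l]
    exact barDiff_congr fun w hw => hf w (by omega)
  have h2 : headMul n f l = 0 := by
    rcases l with _ | ⟨a, l⟩
    · rfl
    · rw [headMul, hf l (by simpa using hl), mul_zero, smul_zero]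
  obtain ⟨u, z, rfl⟩ := (List.eq_nil_or_concat' l).resolve_left (by rintro rfl; simp at hl)
  rw [delta, cup_twist_left, h1, h2, cup_twist_concat, hf _ (by omega), hf u (by simpa using hl)]
  simp

theorem cup_short_nil (n : ℤ) (f g : List A.Red → A.carrier) : cup n f g [] = f [] * g [] := by
  simp [cup, splitSum, barDeg_nil, koszulSign_zero]

theorem cup_short_left (hf : ∀ l, 2 ≤ l.length → f l = 0) (n : ℤ) (g : List A.Red → A.carrier)
    (a : A.Red) (v : List A.Red) : cup n f g (a :: v) = f [] * g (a :: v) +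
      koszulSign (n * (a.deg + 1)) • (f [a] * g v) := by
  rw [cup, splitSum_cons, barDeg_nil, mul_zero, koszulSign_zero, one_smul]
  congr 1
  have h1 : barDeg [a] = a.deg + 1 := by simp [barDeg]
  cases v with
  | nil => rw [splitSum_nil, h1]
  | cons b v =>
    rw [splitSum_cons, splitSum_congr (H := fun _ _ => 0) fun u v _ => by
      rw [hf _ (by simp), zero_mul, smul_zero], splitSum_zero, add_zero, h1]

theorem cup_short_right (hf : ∀ l, 2 ≤ l.length → f l = 0) (n : ℤ) (g : List A.Red → A.carrier)
    (u : List A.Red) (z : A.Red) : cup n g f (u ++ [z]) =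
      koszulSign (n * barDeg (u ++ [z])) • (g (u ++ [z]) * f []) +
      koszulSign (n * barDeg u) • (g u * f [z]) := by
  rw [cup, splitSum_concat, add_comm]
  congr 1
  obtain rfl | ⟨u, y, rfl⟩ := List.eq_nil_or_concat' u
  · rfl
  · rw [splitSum_concat, splitSum_congr (H := fun _ _ => 0) fun u v _ => by
      rw [hf _ (by simp), mul_zero, smul_zero], splitSum_zero, zero_add]
    rfl

end short

section reduced
variable {hA : A.IsTypical} {n : ℤ}
  {f g : List (A.koszulDual hA).Red → (A.koszulDual hA).carrier}

variable (n f) in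
/-- `f` is a cochain on the cobar construction that, like its differential, vanishes on words of
length at least two: an element of the cobar construction together with a derivation. -/
structure IsReduced : Prop extends IsCochain n f where
  long : ∀ l, 2 ≤ l.length → f l = 0
  pair : ∀ a b, delta n f [a, b] = 0

theorem IsReduced.delta_long (h : IsReduced n f) {l : List (A.koszulDual hA).Red}
    (hl : 2 ≤ l.length) : delta n f l = 0 := by
  rcases l with _ | ⟨a, _ | ⟨b, _ | ⟨c, l⟩⟩⟩
  · simp at hl
  · simp at hl
  · exact h.pair a b
  · exact AugDGKRing.delta_long n h.long (by simp)

protected theorem IsReduced.delta (h : IsReduced n f) : IsReduced (n + 1) (delta n f) where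
  toIsCochain := h.toIsCochain.delta
  long l hl := h.delta_long hl
  pair a b := congrFun (delta_delta h.toIsCochain) _

/-- The linear extension of `a ↦ f [a]` that vanishes on `K`. -/
def IsCochain.lam (h : IsCochain n f) :
    (A.koszulDual hA).carrier →ₗ[k] (A.koszulDual hA).carrier :=
  h.isRightLin.barSlot [] [] fun _ => 1

theorem IsCochain.lam_apply (h : IsCochain n f) {m : ℤ} {σ : (A.koszulDual hA).carrier}
    (hσ : σ ∈ (A.koszulDual hA).piece m) : h.lam σ = f [Hom.bar ⟨m, σ, hσ⟩] := by
  refine (h.isRightLin.barSlot_apply [] [] _ hσ).trans ?_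
  rw [one_smul]
  rfl

theorem IsCochain.lam_red (h : IsCochain n f) (a : (A.koszulDual hA).Red) :
    h.lam a.val = f [a] := by
  rw [h.lam_apply a.mem]
  exact congrArg (fun a => f [a]) (Red.bar_toHom a)

theorem IsCochain.lam_unit (h : IsCochain n f) (x : Fin t → k) :
    h.lam ((A.koszulDual hA).unit x) = 0 := by
  rw [h.lam_apply ((A.koszulDual hA).unit_mem x)]
  refine h.zero_cons ?_ []
  change _ - (A.koszulDual hA).unit ((A.koszulDual hA).aug _) = 0
  rw [(A.koszulDual hA).aug_unit, sub_self]

theorem cobar_carrier_ext {M : Type*} [AddCommGroup M] [Module k M]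
    {L L' : (A.koszulDual hA).carrier →ₗ[k] M}
    (h : ∀ n, ∀ σ ∈ (A.koszulDual hA).piece n, L σ = L' σ) : L = L' := cobar_hom_ext h

theorem IsCochain.lam_mul_unit (h : IsCochain n f) (σ : (A.koszulDual hA).carrier)
    (x : Fin t → k) : h.lam (σ * (A.koszulDual hA).unit x) =
      h.lam σ * (A.koszulDual hA).unit x := by
  refine LinearMap.congr_fun (f := h.lam ∘ₗ LinearMap.mulRight k ((A.koszulDual hA).unit x))
    (g := LinearMap.mulRight k ((A.koszulDual hA).unit x) ∘ₗ h.lam)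
    (cobar_carrier_ext fun m σ hσ => ?_) σ
  simp only [LinearMap.comp_apply, LinearMap.mulRight_apply]
  rw [h.lam_apply hσ, h.lam_apply (mul_unit_mem hσ x), ← List.nil_append [_],
    ← List.nil_append [Hom.bar ⟨m, σ, hσ⟩], ← h.right, ← Hom.bar_ract]
  rfl

theorem IsCochain.lam_unit_mul (h : IsCochain n f) (σ : (A.koszulDual hA).carrier)
    (x : Fin t → k) : h.lam ((A.koszulDual hA).unit x * σ) =
      (A.koszulDual hA).unit x * h.lam σ := by
  refine LinearMap.congr_fun (f := h.lam ∘ₗ LinearMap.mulLeft k ((A.koszulDual hA).unit x))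
    (g := LinearMap.mulLeft k ((A.koszulDual hA).unit x) ∘ₗ h.lam)
    (cobar_carrier_ext fun m σ hσ => ?_) σ
  simp only [LinearMap.comp_apply, LinearMap.mulLeft_apply]
  rw [h.lam_apply hσ, h.lam_apply (unit_mul_mem hσ x), ← h.left, ← Hom.bar_lact]
  rfl

theorem IsCochain.lam_mem (h : IsCochain n f) {m : ℤ} {σ : (A.koszulDual hA).carrier}
    (hσ : σ ∈ (A.koszulDual hA).piece m) : h.lam σ ∈ (A.koszulDual hA).piece (m + 1 - n) := by
  rw [h.lam_apply hσ]
  have := h.deg [Hom.bar ⟨m, σ, hσ⟩]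
  rwa [barDeg_cons, barDeg_nil, add_zero] at this

/-- A homogeneous element is the sum of its component in the augmentation ideal and of an element
of `K` that vanishes unless the degree does. -/
theorem Hom.eq_bar_add (a : A.Hom) : ∃ x : Fin t → k, a.val = a.bar.val + A.unit x ∧
    (a.deg ≠ 0 → x = 0) :=
  ⟨A.aug a.val, (sub_add_cancel _ _).symm, fun h => A.aug_piece h a.mem⟩

theorem IsReduced.mul (h : IsReduced n f) (a b : (A.koszulDual hA).Red) :
    f [a.mul b] = f [a] * b.val + koszulSign ((n + 1) * a.deg) • (a.val * f [b]) := by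
  have h1 := h.pair a b
  rw [delta_pair n f h.long, sub_eq_zero] at h1
  have h2 := congrArg (koszulSign (n + a.deg) • ·) h1
  simp only [smul_add, zsmul_sign] at h2
  have e1 : koszulSign (n + a.deg + (n + a.deg)) = 1 := koszulSign_eq_one (by omega)
  have e2 : koszulSign (n + a.deg + n * (a.deg + 1)) = koszulSign ((n + 1) * a.deg) := by
    apply koszulSign_eq; ring_nf; omega
  rw [e1, e2, one_smul, one_smul] at h2
  rw [← h2, add_comm]

theorem IsReduced.lam_mul (h : IsReduced n f) {m : ℤ} {σ : (A.koszulDual hA).carrier}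
    (hσ : σ ∈ (A.koszulDual hA).piece m) (τ : (A.koszulDual hA).carrier) :
    h.lam (σ * τ) = h.lam σ * τ + koszulSign ((n + 1) * m) • (σ * h.lam τ) := by
  refine LinearMap.congr_fun (f := h.lam ∘ₗ LinearMap.mulLeft k σ)
    (g := LinearMap.mulLeft k (h.lam σ) + koszulSign ((n + 1) * m) • (LinearMap.mulLeft k σ ∘ₗ h.lam))
    (cobar_carrier_ext fun i τ hτ => ?_) τ
  simp only [LinearMap.comp_apply, LinearMap.mulLeft_apply, LinearMap.add_apply,
    LinearMap.smul_apply]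
  obtain ⟨x, hx, hx0⟩ := Hom.eq_bar_add (⟨m, σ, hσ⟩ : (A.koszulDual hA).Hom)
  obtain ⟨y, hy, -⟩ := Hom.eq_bar_add (⟨i, τ, hτ⟩ : (A.koszulDual hA).Hom)
  set a := (⟨m, σ, hσ⟩ : (A.koszulDual hA).Hom).bar with ha
  set b := (⟨i, τ, hτ⟩ : (A.koszulDual hA).Hom).bar with hb
  have h1 : h.lam (a.val * b.val) = _ := (h.lam_red (a.mul b)).trans (h.mul a b)
  rw [← h.lam_red a, ← h.lam_red b] at h1
  have h2 : koszulSign ((n + 1) * m) • ((A.koszulDual hA).unit x * h.lam b.val) =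
      (A.koszulDual hA).unit x * h.lam b.val := by
    by_cases hm : m = 0
    · rw [hm, mul_zero, koszulSign_zero, one_smul]
    · rw [hx0 hm, map_zero, zero_mul, smul_zero]
  change σ = _ at hx
  change τ = _ at hy
  rw [hx, hy]
  change _ = _ + koszulSign ((n + 1) * m) • _ at h1
  generalize koszulSign ((n + 1) * m) = s at h1 h2 ⊢
  simp only [add_mul, mul_add, map_add, h1, h.lam_mul_unit, h.lam_unit_mul, h.lam_unit, mul_zero,
    zero_mul, add_zero, zero_add, smul_add, h2, ← map_mul]
  abel

theorem IsReduced.lam_d (h : IsReduced n f) (hδ : ∀ a, delta n f [a] = 0) {m : ℤ}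
    {σ : (A.koszulDual hA).carrier} (hσ : σ ∈ (A.koszulDual hA).piece m) :
    (A.koszulDual hA).d (h.lam σ) + koszulSign n • h.lam ((A.koszulDual hA).d σ) +
      koszulSign (n * (m + 1)) • (σ * f []) - koszulSign n • (f [] * σ) = 0 := by
  obtain ⟨x, hx, hx0⟩ := Hom.eq_bar_add (⟨m, σ, hσ⟩ : (A.koszulDual hA).Hom)
  set a := (⟨m, σ, hσ⟩ : (A.koszulDual hA).Hom).bar with ha
  have h1 := hδ a
  rw [delta_single, ← h.lam_red a, ← h.lam_red a.diff] at h1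
  change σ = _ at hx
  have h2 : koszulSign (n * (m + 1)) • ((A.koszulDual hA).unit x * f []) =
      koszulSign n • (f [] * (A.koszulDual hA).unit x) := by
    by_cases hm : m = 0
    · rw [hm, zero_add, mul_one, h.nil]
    · rw [hx0 hm, map_zero, zero_mul, mul_zero, smul_zero, smul_zero]
  rw [hx]
  change _ + koszulSign n • h.lam ((A.koszulDual hA).d a.val) +
    koszulSign (n * (m + 1)) • _ - _ = 0 at h1
  generalize koszulSign (n * (m + 1)) = s at h1 h2 ⊢
  simp only [add_mul, mul_add, map_add, h.lam_unit, (A.koszulDual hA).d_unit, map_zero, add_zero,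
    smul_add, h2]
  rw [← h1]
  abel

theorem isCochain_lam_comp (hf : IsCochain n f) {q : ℤ} (hg : IsCochain q g) :
    IsCochain (n + q - 1) fun w => hf.lam (g w) where
  add u v a b c h1 h2 h3 := by simp only [hg.add u v a b c h1 h2 h3, map_add]
  smul u v r a c h1 h2 := by simp only [hg.smul u v r a c h1 h2, map_smul]
  bal u v x a b := by simp only [hg.bal]
  left v x a := by simp only [hg.left, hf.lam_unit_mul]
  right u x a := by simp only [hg.right, hf.lam_mul_unit]
  nil x := by simp only [← hf.lam_unit_mul, hg.nil, hf.lam_mul_unit]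
  deg l := by
    have := hf.lam_mem (hg.deg l)
    rwa [show barDeg l - q + 1 - n = barDeg l - (n + q - 1) by ring] at this

/-- A reduced cocycle commutes up to homotopy with every cocycle. -/
theorem IsReduced.delta_lam_comp (h : IsReduced n f) (hf : delta n f = 0) {q : ℤ}
    (hg : IsCochain q g) (hδ : delta q g = 0) :
    delta (n + q - 1) (fun w => h.lam (g w)) =
      koszulSign n • (cup q f g - koszulSign (n * q) • cup n g f) := by
  funext l
  have e2 := h.lam_d (fun a => congrFun hf _) (hg.deg l)
  have e1 := congrArg h.lam (congrFun hδ l)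
  rw [delta, Pi.zero_apply, map_zero, map_add, map_sub, map_zsmul, cup_twist_left] at e1
  rw [Pi.smul_apply, Pi.sub_apply, Pi.smul_apply, delta, cup_twist_left]
  have e3 : barDiff (fun w => h.lam (g w)) l = h.lam (barDiff g l) := map_barDiff h.lam g l
  rw [e3]
  have s1 : koszulSign (n + q - 1) = -koszulSign (n + q) := koszulSign_eq_neg (by omega)
  rcases l with _ | ⟨a, v⟩
  · have h1 : ∀ F : List (A.koszulDual hA).Red → (A.koszulDual hA).carrier,
      cup 1 F twist [] = 0 := fun F => by simp [cup, splitSum, twist]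
    rw [h1, headMul, barDiff_nil, cup_short_nil, cup_short_nil]
    rw [h1, headMul, barDiff_nil] at e1
    simp only [map_zero, smul_zero, sub_zero, add_zero] at e1 ⊢
    rw [e1, smul_zero, add_zero, barDeg_nil] at e2
    rw [smul_sub, zsmul_sign]
    have s2 : koszulSign (n * (0 - q + 1)) = koszulSign (n + n * q) := by
      apply koszulSign_eq; ring_nf; omega
    rw [s2] at e2
    linear_combination (norm := module) e2
  · obtain ⟨u, z, hu⟩ := (List.eq_nil_or_concat' (a :: v)).resolve_left (by simp)
    have c1 := cup_short_left h.long q g a v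
    have c2 := cup_short_right h.long n g u z
    have c3 := cup_twist_concat g u z
    have c4 := cup_twist_concat (fun w => h.lam (g w)) u z
    rw [← hu] at c2 c3 c4
    have m1 := h.lam_mul a.mem (g v)
    have m2 := h.lam_mul (hg.deg u) z.val
    rw [h.lam_red] at m1 m2
    rw [c1, c2, c4, headMul]
    rw [c3, headMul, map_sub, map_zsmul, map_zsmul, map_zsmul, m1, m2] at e1
    have e1' := congrArg (koszulSign n • ·) e1
    simp only [smul_add, smul_sub, zsmul_sign, smul_zero] at e1' ⊢
    have s2 : koszulSign (n + (q * (a.deg + 1) + (n + 1) * a.deg)) =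
        -koszulSign ((n + q - 1) * (a.deg + 1)) := by
      apply koszulSign_eq_neg; ring_nf; omega
    have s3 : koszulSign (n + (q + (barDeg u + (n + 1) * (barDeg u - q)))) =
        koszulSign (n + (n * q + n * barDeg u)) := by
      apply koszulSign_eq; ring_nf; omega
    have s4 : koszulSign (n * (barDeg (a :: v) - q + 1)) =
        koszulSign (n + (n * q + n * barDeg (a :: v))) := by
      apply koszulSign_eq; ring_nf; omega
    have s5 : koszulSign (n + q - 1 + barDeg u) = -koszulSign (n + (q + barDeg u)) := by
      apply koszulSign_eq_neg; omega
    rw [s2, s3] at e1'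
    rw [s4] at e2
    rw [s1, s5]
    linear_combination (norm := module) e2 - e1'

end reduced

section separation

theorem Codual.of_apply {i : ℤ} (g : Module.Dual k A.carrier) {a : A.carrier}
    (ha : a ∈ A.redPiece i) : (Codual.of i g).val a = g a :=
  congrArg g (redProj_same ha)

/-- Homogeneous elements are separated by the augmentation and the elements of the dual coring. -/
theorem eq_of_codual {i : ℤ} {a b : A.carrier} (ha : a ∈ A.piece i) (hb : b ∈ A.piece i)
    (h : A.aug a = A.aug b) (hc : ∀ c : A.Codual, c.val a = c.val b) : a = b := by
  rw [← sub_eq_zero]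
  have hm : a - b ∈ A.redPiece i := ⟨Submodule.sub_mem _ ha hb, by
    change A.aug (a - b) = 0
    rw [map_sub, h, sub_self]⟩
  refine (Module.forall_dual_apply_eq_zero_iff k _).1 fun g => ?_
  rw [← Codual.of_apply g hm, map_sub, hc, sub_self]

theorem cmat_unit (c : A.Codual) (x : Fin t → k) : cmat c.val (A.unit x) = 0 := by
  ext p q
  rw [cmat_apply, idem, idem, ← map_mul, ← map_mul, c.unit_eq]
  rfl

theorem cmat_bar (c : A.Codual) (a : A.Hom) : cmat c.val a.bar.val = cmat c.val a.val := by
  obtain ⟨x, hx, -⟩ := Hom.eq_bar_add a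
  rw [hx, cmat_add, cmat_unit, add_zero]

theorem cmat_of_mem_ne {c : A.Codual} {m : ℤ} {a : A.carrier} (ha : a ∈ A.piece m)
    (h : m ≠ c.deg) : cmat c.val a = 0 := by
  rw [show a = (⟨m, a, ha⟩ : A.Hom).val from rfl, ← cmat_bar]
  exact cmat_eq_zero h

theorem sum_cmat (g : Module.Dual k A.carrier) (a : A.carrier) :
    ∑ p, ∑ q, cmat g a p q = g a := by
  simp only [cmat_apply, ← map_sum, ← Finset.mul_sum, ← Finset.sum_mul, sum_idem, one_mul, mul_one]

end separation

section insertion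
variable {M : Type w} [AddCommGroup M] {n : ℤ} {F : List A.Red → A.carrier}

/-- The value of a cochain, as a homogeneous element. -/
def IsCochain.value (hF : IsCochain n F) (w : List A.Red) : A.Hom := ⟨barDeg w - n, F w, hF.deg w⟩

/-- The sum over all ways to replace a part of a word by its image under a cochain. -/
def IsCochain.ins (hF : IsCochain n F) : (List A.Red → M) → List A.Red → M
  | φ, [] => φ [(hF.value []).bar]
  | φ, a :: w => splitSum (fun u v => φ ((hF.value u).bar :: v)) (a :: w) +
      koszulSign ((n + 1) * (a.deg + 1)) • IsCochain.ins hF (fun v => φ (a :: v)) w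

theorem IsCochain.ins_add (hF : IsCochain n F) (φ ψ : List A.Red → M) (w : List A.Red) :
    hF.ins (φ + ψ) w = hF.ins φ w + hF.ins ψ w := by
  induction w generalizing φ ψ with
  | nil => rfl
  | cons a w ih =>
    have : hF.ins (fun v => (φ + ψ) (a :: v)) w = _ :=
      ih (fun v => φ (a :: v)) (fun v => ψ (a :: v))
    rw [IsCochain.ins, IsCochain.ins, IsCochain.ins, this]
    simp only [Pi.add_apply, splitSum_add, smul_add]
    abel

theorem IsCochain.map_ins {N : Type*} [AddCommGroup N] (hF : IsCochain n F) (L : M →+ N)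
    (φ : List A.Red → M) (w : List A.Red) : hF.ins (fun v => L (φ v)) w = L (hF.ins φ w) := by
  induction w generalizing φ with
  | nil => rfl
  | cons a w ih =>
    rw [IsCochain.ins, IsCochain.ins, ih (fun v => φ (a :: v)), map_add, map_splitSum, map_zsmul]

theorem IsCochain.ins_congr (hF : IsCochain n F) {φ ψ : List A.Red → M} {w : List A.Red}
    (h : ∀ v, barDeg v = barDeg w - n + 1 → φ v = ψ v) : hF.ins φ w = hF.ins ψ w := by
  have hv : ∀ u v : List A.Red, barDeg ((hF.value u).bar :: v) = barDeg (u ++ v) - n + 1 :=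
    fun u v => by
      rw [barDeg_cons, barDeg_append]
      change barDeg u - n + 1 + barDeg v = _
      ring
  induction w generalizing φ ψ with
  | nil => exact h _ (by rw [hv]; rfl)
  | cons a w ih =>
    rw [IsCochain.ins, IsCochain.ins, ih fun v hv => h _ (by rw [barDeg_cons, barDeg_cons, hv]; ring),
      splitSum_congr fun u v huv => h _ (by rw [hv, huv])]

theorem IsCochain.ins_sign (hF : IsCochain n F) (s : ℤ → ℤ) (φ : List A.Red → M)
    (w : List A.Red) : hF.ins (fun v => s (barDeg v) • φ v) w =
      s (barDeg w - n + 1) • hF.ins φ w := by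
  refine (hF.ins_congr (ψ := fun v => s (barDeg w - n + 1) • φ v) fun v hv => by rw [hv]).trans ?_
  exact hF.map_ins (zsmulAddGroupHom (s (barDeg w - n + 1)) : M →+ M) φ w

theorem splitSum_eq_last {α : Type*} {G : List α → List α → M} {l : List α}
    (h : ∀ u v, v ≠ [] → G u v = 0) : splitSum G l = G l [] := by
  obtain rfl | ⟨u, z, rfl⟩ := List.eq_nil_or_concat' l
  · rfl
  · rw [splitSum_concat, splitSum_congr (H := fun _ _ => 0) fun u v _ => h _ _ (by simp),
      splitSum_zero, zero_add]

theorem IsCochain.ins_eq_zero (hF : IsCochain n F) {φ : List A.Red → M}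
    (h : ∀ l, 1 ≤ l.length → φ l = 0) (w : List A.Red) : hF.ins φ w = 0 := by
  induction w generalizing φ with
  | nil => exact h _ le_rfl
  | cons a w ih =>
    rw [IsCochain.ins, ih fun l _ => h _ (by simp), smul_zero, add_zero,
      splitSum_congr (H := fun _ _ => 0) fun u v _ => h _ (by simp), splitSum_zero]

theorem IsCochain.ins_one (hF : IsCochain n F) {φ : List A.Red → M}
    (h : ∀ l, 2 ≤ l.length → φ l = 0) (w : List A.Red) : hF.ins φ w = φ [(hF.value w).bar] := by
  cases w with
  | nil => rfl
  | cons a w =>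
    rw [IsCochain.ins, hF.ins_eq_zero fun l hl => h _ (by simpa using hl), smul_zero, add_zero,
      splitSum_eq_last fun u v hv => h _ (by
      have := List.length_pos_iff.2 hv
      simp only [List.length_cons, List.length_append]
      omega)]

theorem IsCochain.ins_two (hF : IsCochain n F) {φ : List A.Red → M}
    (h : ∀ l, 3 ≤ l.length → φ l = 0) {a z : A.Red} {u w : List A.Red} (hw : a :: w = u ++ [z]) :
    hF.ins φ (a :: w) = φ [(hF.value (a :: w)).bar] + φ [(hF.value u).bar, z] +
      koszulSign ((n + 1) * (a.deg + 1)) • φ [a, (hF.value w).bar] := by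
  rw [IsCochain.ins, hF.ins_one fun l hl => h _ (by simpa using hl), hw, splitSum_concat,
    splitSum_eq_last fun u v hv => h _ (by
      have := List.length_pos_iff.2 hv
      simp only [List.length_cons, List.length_append]
      omega), List.nil_append,
    add_comm (φ _)]

end insertion

section related
variable {hA : A.IsTypical} {n : ℤ} {F : List A.Red → A.carrier}
  {f : List (A.koszulDual hA).Red → (A.koszulDual hA).carrier}

/-- The sign that relates cochains on `A` and on its Koszul dual. -/
def dualSign (n m : ℤ) : ℤ := koszulSign ((n + 1) * m + n)

variable (n F f) in
/-- The cochain `F` on `A` and the cochain `f` on the Koszul dual of `A` correspond to each other. -/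
structure IsDual : Prop where
  unitPart : ∀ w, A.ev (f []) w = dualSign n (barDeg w) • Matrix.diagonal (A.aug (F w))
  genPart : ∀ c w, A.ev (f [redGen hA c]) w = dualSign n (barDeg w) • cmat c.val (F w)

theorem matrix_zsmul_mul (r : ℤ) (X Y : Matrix (Fin t) (Fin t) k) : (r • X) * Y = r • (X * Y) :=
  smul_mul_assoc r X Y

theorem matrix_mul_zsmul (r : ℤ) (X Y : Matrix (Fin t) (Fin t) k) : X * (r • Y) = r • (X * Y) :=
  mul_smul_comm r X Y

/-- The derivation that corresponds to a cochain `F` acts by insertion of `F`. -/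
theorem ev_eq_ins (hF : IsCochain n F) {L : A.Cobar →ₗ[k] A.Cobar}
    (hu : ∀ x, L (A.cobarUnit x) = 0)
    (hL : ∀ (m : ℤ) (σ : A.Cobar) (c : A.Codual), σ ∈ A.cobarPiece m → L (σ * gen c) =
      L σ * gen c + koszulSign ((n + 1) * m) • (σ * L (gen c)))
    (hg : ∀ c w, A.ev (L (gen c)) w = dualSign n (barDeg w) • cmat c.val (F w))
    (τ : A.Cobar) (w : List A.Red) :
    A.ev (L τ) w = dualSign n (barDeg w) • hF.ins (A.ev τ) w := by
  refine cobar_rightInduction (P := fun τ => ∀ w, A.ev (L τ) w =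
    dualSign n (barDeg w) • hF.ins (A.ev τ) w) (fun x w => ?_) (fun a b ha hb w => ?_)
    (fun m σ c hσ ih w => ?_) τ w
  · rw [hu, map_zero, hF.ins_eq_zero fun l hl => ?_, smul_zero]
    · rfl
    · rcases l with _ | ⟨a, l⟩
      · simp at hl
      · exact ev_unit_cons x a l
  · rw [map_add, map_add, Pi.add_apply, ha, hb, map_add, hF.ins_add, smul_add]
  · have h1 : A.ev (σ * L (gen c)) w = splitSum (fun u v => dualSign n (barDeg u) •
        (A.ev (σ * gen c) ((hF.value u).bar :: v))) w := by
      rw [ev_mul]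
      refine splitSum_congr fun u v _ => ?_
      rw [hg, ev_mul_gen_cons, cmat_bar, matrix_zsmul_mul]
      rfl
    have h2 : koszulSign ((n + 1) * m) • A.ev (σ * L (gen c)) w = dualSign n (barDeg w) •
        splitSum (fun u v => A.ev (σ * gen c) ((hF.value u).bar :: v)) w := by
      rw [h1, ← splitSum_zsmul, ← splitSum_zsmul]
      refine splitSum_congr fun u v huv => ?_
      by_cases hv : barDeg v = -m
      · rw [smul_smul, dualSign, dualSign, ← koszulSign_add, ← huv, barDeg_append, hv]
        congr 1
        apply koszulSign_eq; ring_nf; omega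
      · rw [ev_mul_gen_cons, ev_eq_zero hσ hv, mul_zero, smul_zero, smul_zero, smul_zero]
    rw [hL m σ c hσ, map_add, map_zsmul, Pi.add_apply, Pi.smul_apply, h2]
    cases w with
    | nil => rw [ev_mul_gen_nil, zero_add]; rfl
    | cons a w =>
      have h3 : hF.ins (fun v => A.ev (σ * gen c) (a :: v)) w =
          cmat c.val a.val * hF.ins (A.ev σ) w := by
        rw [ev_mul_gen]
        exact hF.map_ins (AddMonoidHom.mulLeft (cmat c.val a.val)) (A.ev σ) w
      rw [ev_mul_gen_cons, ih, IsCochain.ins, h3, smul_add, add_comm, matrix_mul_zsmul, smul_smul,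
        dualSign, dualSign, ← koszulSign_add, barDeg_cons]
      congr 2
      apply koszulSign_eq; ring_nf; omega

theorem IsReduced.lam_gen (h : IsReduced n f) (c : A.Codual) :
    h.lam (gen c : A.Cobar) = f [redGen hA c] := h.lam_red (redGen hA c)

theorem IsDual.ev_lam (h : IsDual n F f) (hF : IsCochain n F) (hf : IsReduced n f)
    (τ : A.Cobar) (w : List A.Red) :
    A.ev (hf.lam τ) w = dualSign n (barDeg w) • hF.ins (A.ev τ) w :=
  ev_eq_ins (L := hf.lam) hF hf.lam_unit
    (fun m σ c hσ => hf.lam_mul hσ _) (fun c w => by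
      refine Eq.trans ?_ (h.genPart c w)
      exact congrFun (congrArg A.ev (hf.lam_gen c)) w) τ w

theorem ev_gen (c : A.Codual) : A.ev (gen c) = fun w => match w with
    | [a] => cmat c.val a.val
    | _ => 0 := by
  funext w
  have h := ev_mul_gen 1 c
  rcases w with _ | ⟨a, _ | ⟨b, w⟩⟩
  · have := ev_mul_gen_nil 1 c
    rwa [one_mul] at this
  · have := ev_mul_gen_cons 1 c a []
    rwa [one_mul, ev_one_nil, mul_one] at this
  · have := ev_mul_gen_cons 1 c a (b :: w)
    rwa [one_mul, ev_one_cons, mul_zero] at this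

theorem barDiff_gen_single (c : A.Codual) (a : A.Red) :
    barDiff (A.ev (gen c)) [a] = -cmat c.val (A.d a.val) := by
  rw [barDiff_cons, mergeHead_nil, barDiff_nil, ev_gen]
  simp [Red.diff, Hom.diff]

theorem barDiff_gen_pair (c : A.Codual) (a b : A.Red) :
    barDiff (A.ev (gen c)) [a, b] = koszulSign a.deg • cmat c.val (a.val * b.val) := by
  rw [barDiff_cons, mergeHead_cons, barDiff_cons, mergeHead_nil, barDiff_nil, ev_gen]
  simp [Red.mul, Hom.mul]

theorem barDiff_gen_long (c : A.Codual) {l : List A.Red} (hl : 3 ≤ l.length) :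
    barDiff (A.ev (gen c)) l = 0 := by
  rw [← barDiff_zero (A := A) (M := Matrix (Fin t) (Fin t) k) l, ev_gen]
  refine barDiff_congr fun w hw => ?_
  rcases w with _ | ⟨a, _ | ⟨b, w⟩⟩
  · rfl
  · simp at hw; omega
  · rfl

end related

section related
variable {hA : A.IsTypical} {n : ℤ} {F : List A.Red → A.carrier}
  {f : List (A.koszulDual hA).Red → (A.koszulDual hA).carrier}

theorem delta_nil (n : ℤ) (f : List A.Red → A.carrier) : delta n f [] = A.d (f []) := by
  rw [delta, cup_twist_left, headMul, barDiff_nil]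
  simp [cup, splitSum, twist]

theorem aug_delta (n : ℤ) (F : List A.Red → A.carrier) (w : List A.Red) :
    A.aug (delta n F w) = -koszulSign n • A.aug (barDiff F w) := by
  have h1 : A.aug (headMul n F w) = 0 := by
    cases w with
    | nil => exact map_zero _
    | cons a w => rw [headMul, map_zsmul, map_mul, a.aug_eq, zero_mul, smul_zero]
  have h2 : A.aug (cup 1 F twist w) = 0 := by
    obtain rfl | ⟨u, z, rfl⟩ := List.eq_nil_or_concat' w
    · simp [cup, splitSum, twist]
    · rw [cup_twist_concat, map_zsmul, map_mul, z.aug_eq, mul_zero, smul_zero]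
  rw [delta, cup_twist_left, map_add, map_sub, map_sub, map_zsmul, map_zsmul, h1, h2, A.aug_d]
  module

variable (A) in
/-- The augmentation as a diagonal matrix. -/
def augDiag : A.carrier →+ Matrix (Fin t) (Fin t) k :=
  (Matrix.diagonalAddMonoidHom (Fin t) k).comp (A.aug : A.carrier →+ (Fin t → k))

theorem augDiag_apply (a : A.carrier) : A.augDiag a = Matrix.diagonal (A.aug a) := rfl

/-- The matrix of a linear form, as a homomorphism. -/
def cmatHom (g : Module.Dual k A.carrier) : A.carrier →+ Matrix (Fin t) (Fin t) k where
  toFun := cmat g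
  map_zero' := by ext p q; simp [cmat_apply]
  map_add' := cmat_add g

theorem cmatHom_apply (g : Module.Dual k A.carrier) (a : A.carrier) : cmatHom g a = cmat g a := rfl

theorem cmat_unit_mul (g : Module.Dual k A.carrier) (x : Fin t → k) (a : A.carrier) :
    cmat g (A.unit x * a) = Matrix.diagonal x * cmat g a := cmat_lact g x a

theorem cmat_mul_unit (g : Module.Dual k A.carrier) (a : A.carrier) (x : Fin t → k) :
    cmat g (a * A.unit x) = cmat g a * Matrix.diagonal x := cmat_ract g x a

theorem cmat_bar_mul (c : A.Codual) (a : A.Hom) (b : A.Red) :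
    cmat c.val (a.bar.val * b.val) =
      cmat c.val (a.val * b.val) - A.augDiag a.val * cmat c.val b.val := by
  rw [augDiag_apply, ← cmat_unit_mul, ← cmatHom_apply, ← cmatHom_apply, ← cmatHom_apply, ← map_sub,
    ← sub_mul]
  rfl

theorem cmat_mul_bar (c : A.Codual) (a : A.Red) (b : A.Hom) :
    cmat c.val (a.val * b.bar.val) =
      cmat c.val (a.val * b.val) - cmat c.val a.val * A.augDiag b.val := by
  rw [augDiag_apply, ← cmat_mul_unit, ← cmatHom_apply, ← cmatHom_apply, ← cmatHom_apply, ← map_sub,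
    ← mul_sub]
  rfl

theorem IsCochain.aug_eq_zero (hF : IsCochain n F) {w : List A.Red} (h : barDeg w ≠ n) :
    A.augDiag (F w) = 0 := by
  rw [augDiag_apply, A.aug_piece (sub_ne_zero.2 h) (hF.deg w), Matrix.diagonal_zero']

theorem ev_diff_dual {σ : A.Cobar} (L : A.carrier →+ Matrix (Fin t) (Fin t) k)
    (h : ∀ w, A.ev σ w = dualSign n (barDeg w) • L (F w)) (w : List A.Red) :
    A.ev (cobarDiff hA σ) w = koszulSign (n * barDeg w) • L (barDiff F w) := by
  rw [ev_diff, funext h, barDiff_weight (dualSign n) (fun w => L (F w)), map_barDiff, smul_smul,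
    dualSign, ← koszulSign_add]
  congr 1
  apply koszulSign_eq; ring_nf; omega

theorem ev_gen_mul_concat (c : A.Codual) (σ : A.Cobar) (u : List A.Red) (z : A.Red) :
    A.ev (gen c * σ) (u ++ [z]) = A.ev σ u * cmat c.val z.val := by
  rw [ev_mul, splitSum_concat, splitSum_eq_last, ev_gen]
  · simp
  · intro u v hv
    obtain ⟨b, v, rfl⟩ := List.exists_cons_of_ne_nil hv
    rw [ev_gen]
    obtain ⟨d, y, hd⟩ := List.exists_cons_of_ne_nil (l := v ++ [z]) (by simp)
    simp [hd]

theorem ev_gen_mul_nil (c : A.Codual) (σ : A.Cobar) : A.ev (gen c * σ) [] = 0 := by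
  rw [ev_mul, splitSum_nil, ev_gen, mul_zero]

theorem Hom.d_bar (a : A.Hom) : A.d a.bar.val = A.d a.val := by
  change A.d (a.val - A.unit _) = _
  rw [map_sub, A.d_unit, sub_zero]

protected theorem IsDual.delta (h : IsDual n F f) (hF : IsCochain n F) (hf : IsReduced n f) :
    IsDual (n + 1) (delta n F) (delta n f) where
  unitPart w := by
    have e := congrArg (Matrix.diagonalAddMonoidHom (Fin t) k) (aug_delta n F w)
    rw [map_zsmul] at e
    change Matrix.diagonal _ = -koszulSign n • A.augDiag (barDiff F w) at e
    rw [delta_nil, e, smul_smul, dualSign]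
    refine (ev_diff_dual A.augDiag h.unitPart w).trans ?_
    congr 1
    rw [mul_neg, ← koszulSign_add, ← koszulSign_succ]
    apply koszulSign_eq; ring_nf; omega
  genPart c w := by
    have e1 := ev_diff_dual (hA := hA) (cmatHom c.val) (h.genPart c) w
    have e2 := h.ev_lam hF hf (cobarDiff hA (gen c)) w
    have e3 : hF.ins (A.ev (cobarDiff hA (gen c))) w =
        koszulSign (barDeg w - n) • hF.ins (barDiff (A.ev (gen c))) w := by
      rw [funext (ev_diff hA (gen c)), hF.ins_sign (fun m => koszulSign (m + 1))]
      congr 1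
      apply koszulSign_eq; omega
    have hl : f [(redGen hA c).diff] = hf.lam (cobarDiff hA (gen c)) :=
      (hf.lam_red (redGen hA c).diff).symm
    have e4 : A.ev (f [(redGen hA c).diff]) w = _ :=
      (congrFun (congrArg A.ev hl) w).trans (e2.trans (congrArg _ e3))
    rw [delta_single]
    change A.ev (cobarDiff hA (f [redGen hA c]) + koszulSign n • (show A.Cobar from f [(redGen hA c).diff]) +
      koszulSign (n * (-c.deg - 1 + 1)) • (gen c * (show A.Cobar from f [])) -
      koszulSign n • ((show A.Cobar from f []) * gen c)) w = _
    rw [map_sub, map_add, map_add, map_zsmul, map_zsmul, map_zsmul, Pi.sub_apply, Pi.add_apply,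
      Pi.add_apply, Pi.smul_apply, Pi.smul_apply, Pi.smul_apply, e1, e4]
    have hv : ∀ w, cmat c.val (A.d (hF.value w).bar.val) = cmat c.val (A.d (F w)) :=
      fun w => by rw [Hom.d_bar]; rfl
    rcases w with _ | ⟨a, w⟩
    · rw [delta_nil, IsCochain.ins, barDiff_gen_single, hv, ev_gen_mul_nil, ev_mul_gen_nil,
        barDiff_nil, map_zero, smul_zero, smul_zero, smul_zero, zero_add, sub_zero, add_zero, smul_neg,
        smul_neg, smul_neg, ← neg_smul, dualSign, dualSign, barDeg_nil, zsmul_sign, neg_smul,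
        zsmul_sign, ← neg_smul, ← koszulSign_succ]
      congr 1
      apply koszulSign_eq; ring_nf; omega
    · obtain ⟨u, z, hu⟩ := (List.eq_nil_or_concat' (a :: w)).resolve_left (by simp)
      have g1 := ev_gen_mul_concat c (f []) u z
      rw [← hu, h.unitPart] at g1
      have g2 := ev_mul_gen_cons (f []) c a w
      rw [h.unitPart] at g2
      have g3 := cup_twist_concat F u z
      rw [← hu] at g3
      have d1 : barDeg (a :: w) = barDeg u + z.deg + 1 := by
        rw [hu, barDeg_append, barDeg_cons, barDeg_nil]; ring
      have d2 := barDeg_cons a w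
      have hX : koszulSign (n * (-c.deg - 1 + 1)) • dualSign n (barDeg u) •
          (A.augDiag (F u) * cmat c.val z.val) = koszulSign (n + ((n + 1) * barDeg (a :: w) + n +
            (barDeg (a :: w) - n + (barDeg u - n)))) • (A.augDiag (F u) * cmat c.val z.val) := by
        by_cases h1 : barDeg u = n
        · by_cases h2 : z.deg = c.deg
          · rw [dualSign, zsmul_sign, d1, h1, h2]
            congr 1
            apply koszulSign_eq; ring_nf; omega
          · rw [cmat_eq_zero h2, mul_zero, smul_zero, smul_zero, smul_zero]
        · rw [hF.aug_eq_zero h1, zero_mul, smul_zero, smul_zero, smul_zero]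
      have hY : koszulSign n • dualSign n (barDeg w) • (cmat c.val a.val * A.augDiag (F w)) =
          -koszulSign (n + ((n + 1) * barDeg (a :: w) + n + (barDeg (a :: w) - n +
            ((n + 1) * (a.deg + 1) + a.deg)))) • (cmat c.val a.val * A.augDiag (F w)) := by
        by_cases h1 : barDeg w = n
        · rw [dualSign, zsmul_sign, d2, h1, ← koszulSign_succ]
          congr 1
          apply koszulSign_eq; ring_nf; omega
        · rw [hF.aug_eq_zero h1, mul_zero, smul_zero, smul_zero, smul_zero]
      rw [hF.ins_two (fun l hl => barDiff_gen_long c hl) hu, barDiff_gen_single, barDiff_gen_pair,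
        barDiff_gen_pair, cmat_bar_mul, cmat_mul_bar, hv, g1, g2, matrix_zsmul_mul,
        matrix_mul_zsmul, ← augDiag_apply, ← augDiag_apply, hX, hY, AugDGKRing.delta, cup_twist_left,
        headMul, g3]
      change koszulSign (n * barDeg (a :: w)) • _ + koszulSign n • dualSign n _ •
        koszulSign (barDeg (a :: w) - n) • (_ + koszulSign (barDeg u - n) • (cmat c.val (F u * z.val) - 
          A.augDiag (F u) * _) + _ • koszulSign a.deg • (cmat c.val (a.val * F w) - _ * A.augDiag (F w)))
          + _ - _ = dualSign (n + 1) (barDeg (a :: w)) • cmatHom c.val _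
      rw [map_add, map_sub, map_sub, map_zsmul, map_zsmul, map_zsmul, map_zsmul]
      simp only [cmatHom_apply, smul_add, smul_sub, smul_neg, zsmul_sign, dualSign]
      generalize barDeg (a :: w) = W
      have s1 : koszulSign ((n + 1 + 1) * W + (n + 1)) =
          -koszulSign (n + ((n + 1) * W + n + (W - n))) := by
        apply koszulSign_eq_neg; ring_nf; omega
      have s2 : koszulSign ((n + 1 + 1) * W + (n + 1) + n) = -koszulSign (n * W) := by
        apply koszulSign_eq_neg; ring_nf; omega
      have s3 : koszulSign ((n + 1 + 1) * W + (n + 1) + n * (a.deg + 1)) =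
          koszulSign (n + ((n + 1) * W + n + (W - n + ((n + 1) * (a.deg + 1) + a.deg)))) := by
        apply koszulSign_eq; ring_nf; omega
      have s4 : koszulSign ((n + 1 + 1) * W + (n + 1) + (n + barDeg u)) =
          -koszulSign (n + ((n + 1) * W + n + (W - n + (barDeg u - n)))) := by
        apply koszulSign_eq_neg; ring_nf; omega
      rw [s1, s2, s3, s4]
      module

end related

section existence
variable {hA : A.IsTypical} {n : ℤ}

theorem IsMultilinear.map {M N : Type*} [AddCommGroup M] [Module k M] [AddCommGroup N] [Module k N]
    {F : List A.Red → M} (hF : IsMultilinear F) (L : M →ₗ[k] N) : IsMultilinear fun w => L (F w) where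
  add u v a b c h1 h2 h3 := by rw [hF.add u v a b c h1 h2 h3, map_add]
  smul u v r a c h1 h2 := by rw [hF.smul u v r a c h1 h2, map_smul]
  bal u v x a b := by rw [hF.bal]

theorem eq_diagonal {M : Matrix (Fin t) (Fin t) k}
    (h : ∀ x, Matrix.diagonal x * M = M * Matrix.diagonal x) :
    M = Matrix.diagonal fun p => M p p := by
  ext p q
  by_cases hpq : p = q
  · subst hpq; rw [Matrix.diagonal_apply_eq]
  · rw [Matrix.diagonal_apply_ne _ hpq]
    have := congrFun (congrFun (h (Pi.single p 1)) p) q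
    rw [Matrix.diagonal_mul, Matrix.mul_diagonal] at this
    simpa [Ne.symm hpq] using this

theorem ev_unit_mul (σ : A.Cobar) (x : Fin t → k) (w : List A.Red) :
    A.ev (A.cobarUnit x * σ) w = A.ev σ w * Matrix.diagonal x := by
  rw [ev_mul, splitSum_eq_last, ev_unit_nil]
  intro u v hv
  obtain ⟨b, v, rfl⟩ := List.exists_cons_of_ne_nil hv
  rw [ev_unit_cons, mul_zero]

theorem IsCochain.exists_ev {F : List A.Red → A.carrier} (hF : IsCochain n F) (hA : A.IsTypical)
    {i : ℤ} (L : A.carrier →ₗ[k] Matrix (Fin t) (Fin t) k)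
    (hl : ∀ x a, L (A.unit x * a) = Matrix.diagonal x * L a)
    (hr : ∀ x a, L (a * A.unit x) = L a * Matrix.diagonal x)
    (hs : ∀ m, m ≠ i → ∀ a ∈ A.piece m, L a = 0) :
    ∃ τ ∈ A.cobarPiece (-(n + i)), ∀ w, A.ev τ w = dualSign n (barDeg w) • L (F w) := by
  obtain ⟨τ, h1, h2⟩ := ev_surjective hA (j := n + i)
    (φ := fun w => dualSign n (barDeg w) • L (F w))
    { toIsMultilinear := (hF.toIsMultilinear.map L).weight (dualSign n)
      left := fun v x a => by rw [barDeg_lact, hF.left, hl, matrix_mul_zsmul]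
      right := fun u x a => by rw [barDeg_ract, hF.right, hr, matrix_zsmul_mul]
      nil := ⟨_, eq_diagonal fun x => by
        rw [matrix_mul_zsmul, matrix_zsmul_mul, ← hl, hF.nil, hr]⟩
      supp := fun w hw => by rw [hs _ (fun h => hw (by omega)) _ (hF.deg w), smul_zero] }
  exact ⟨τ, h1, congrFun h2⟩

theorem carrier_ext {M : Type*} [AddCommGroup M] [Module k M]
    {L L' : (A.koszulDual hA).carrier →ₗ[k] M}
    (hu : ∀ x, L ((A.koszulDual hA).unit x) = L' ((A.koszulDual hA).unit x))
    (hgen : ∀ (m : ℤ) (σ : (A.koszulDual hA).carrier) (c : A.Codual),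
      σ ∈ (A.koszulDual hA).piece m → L σ = L' σ →
      L (σ * (redGen hA c).val) = L' (σ * (redGen hA c).val)) : L = L' :=
  cobar_linearMap_ext hu hgen

theorem carrier_induction {P : ℤ → (A.koszulDual hA).carrier → Prop} (h0 : ∀ m, P m 0)
    (hadd : ∀ m a b, P m a → P m b → P m (a + b))
    (hu : ∀ x, P 0 ((A.koszulDual hA).unit x))
    (hgen : ∀ (m : ℤ) (σ : (A.koszulDual hA).carrier) (c : A.Codual),
      σ ∈ (A.koszulDual hA).piece m → P m σ → P (m + (redGen hA c).deg) (σ * (redGen hA c).val))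
    {m : ℤ} {σ : (A.koszulDual hA).carrier} (hσ : σ ∈ (A.koszulDual hA).piece m) : P m σ := by
  refine cobarPiece_induction (P := fun σ => P m σ) (h0 m) (hadd m) (fun σ h => ?_) hσ
  clear hσ
  induction h with
  | unit x => exact hu x
  | mul_gen c h ih => exact hgen _ _ c h.mem ih

/-- The derivation of the cobar construction with given values on the generators. -/
theorem exists_derivation (hA : A.IsTypical) {D : A.Codual → (A.koszulDual hA).carrier}
    (hadd : ∀ a b c : A.Codual, a.deg = c.deg → b.deg = c.deg → c.val = a.val + b.val →
      D c = D a + D b)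
    (hsmul : ∀ (r : k) (a c : A.Codual), a.deg = c.deg → c.val = r • a.val → D c = r • D a)
    (hl : ∀ x c, D (c.lact x) = (A.koszulDual hA).unit x * D c)
    (hr : ∀ x c, D (c.ract x) = D c * (A.koszulDual hA).unit x)
    (hd : ∀ c, D c ∈ (A.koszulDual hA).piece (-c.deg - n)) :
    ∃ f, IsReduced n f ∧ f [] = 0 ∧ ∀ c, f [redGen hA c] = D c := by
  let g : A.Codual → A.Cobar →ₗ[k] (A.koszulDual hA).carrier := fun c =>
    homLift fun i => koszulSign ((n + 1) * i) • (LinearMap.mulRight k (D c) ∘ₗ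
      ((A.koszulDual hA).piece i).subtype)
  have hg : ∀ c {m : ℤ} {σ : (A.koszulDual hA).carrier}, σ ∈ (A.koszulDual hA).piece m →
      g c σ = koszulSign ((n + 1) * m) • (σ * D c) := fun c m σ hσ => homLift_apply _ hσ
  have hp : IsPeel (regAct hA) g :=
    { add := fun a b c h1 h2 h3 => cobar_carrier_ext fun m σ hσ => by
        refine (hg c hσ).trans (Eq.trans ?_
          (congrArg₂ (fun x y => x + y) (hg a hσ) (hg b hσ)).symm)
        rw [hadd a b c h1 h2 h3, mul_add, smul_add]
      smul := fun r a c h1 h2 => cobar_carrier_ext fun m σ hσ => by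
        refine (hg c hσ).trans (Eq.trans ?_ (congrArg (fun x => r • x) (hg a hσ)).symm)
        rw [hsmul r a c h1 h2, mul_smul_comm, smul_comm]
      lact := fun x c τ => by
        refine LinearMap.congr_fun (f := g (c.lact x))
          (g := g c ∘ₗ LinearMap.mulRight k (A.cobarUnit x)) (cobar_hom_ext fun m σ hσ => ?_) τ
        refine (hg (c.lact x) hσ).trans (Eq.trans ?_ (hg c (σ := σ * A.cobarUnit x)
          (mul_unit_mem (A := A.koszulDual hA) hσ x)).symm)
        rw [hl]
        exact congrArg _ (mul_assoc _ _ _).symm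
      ract := fun x c τ => by
        refine LinearMap.congr_fun (f := g (c.ract x))
          (g := ((regAct hA).act (A.cobarUnit x)).comp (g c)) (cobar_hom_ext fun m σ hσ => ?_) τ
        refine (hg (c.ract x) hσ).trans (Eq.trans ?_
          (congrArg (fun y => (regAct hA).act (A.cobarUnit x) y) (hg c hσ)).symm)
        rw [hr, map_zsmul]
        exact congrArg _ (mul_assoc _ _ _).symm }
  let P : (A.koszulDual hA).carrier →ₗ[k] (A.koszulDual hA).carrier := hp.peel
  have P_unit : ∀ x, P ((A.koszulDual hA).unit x) = 0 := hp.peel_unit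
  have P_gen : ∀ {m : ℤ} {σ : (A.koszulDual hA).carrier}, σ ∈ (A.koszulDual hA).piece m →
      ∀ c, P (σ * (redGen hA c).val) = P σ * (redGen hA c).val +
        koszulSign ((n + 1) * m) • (σ * D c) := fun {m σ} hσ c =>
    (hp.peel_gen σ c).trans (congrArg _ (hg c hσ))
  have P_mul_unit : ∀ σ x, P (σ * (A.koszulDual hA).unit x) = P σ * (A.koszulDual hA).unit x :=
    hp.peel_mul_unit
  have P_g : ∀ c, P (redGen hA c).val = D c := fun c => by
    have := P_gen (σ := 1) (m := 0) (Hom.one (A.koszulDual hA)).mem c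
    rw [← map_one (A.koszulDual hA).unit, P_unit, map_one, one_mul, zero_mul, zero_add, one_mul,
      mul_zero, koszulSign_zero, one_smul] at this
    exact this
  have P_mul : ∀ {m : ℤ} {σ : (A.koszulDual hA).carrier}, σ ∈ (A.koszulDual hA).piece m →
      ∀ τ, P (σ * τ) = P σ * τ + koszulSign ((n + 1) * m) • (σ * P τ) := by
    intro m σ hσ τ
    refine LinearMap.congr_fun (f := P ∘ₗ LinearMap.mulLeft k σ) (g := LinearMap.mulLeft k (P σ) +
      koszulSign ((n + 1) * m) • (LinearMap.mulLeft k σ ∘ₗ P)) (carrier_ext (fun x => ?_)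
      fun i τ c hτ ih => ?_) τ
    · simp only [LinearMap.comp_apply, LinearMap.mulLeft_apply, LinearMap.add_apply,
        LinearMap.smul_apply]
      rw [P_mul_unit, P_unit, mul_zero, smul_zero, add_zero]
    · simp only [LinearMap.comp_apply, LinearMap.mulLeft_apply, LinearMap.add_apply,
        LinearMap.smul_apply] at ih ⊢
      rw [← mul_assoc, P_gen (SetLike.mul_mem_graded hσ hτ), ih, P_gen hτ, mul_add ((n : ℤ) + 1),
        koszulSign_add, mul_smul]
      simp only [add_mul, mul_add, smul_add, smul_mul_assoc, mul_smul_comm, mul_assoc]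
      abel
  have P_unit_mul : ∀ x σ, P ((A.koszulDual hA).unit x * σ) = (A.koszulDual hA).unit x * P σ :=
    fun x σ => by
      rw [P_mul ((A.koszulDual hA).unit_mem x), P_unit, zero_mul, zero_add, mul_zero,
        koszulSign_zero, one_smul]
  have P_mem : ∀ {m : ℤ} {σ : (A.koszulDual hA).carrier}, σ ∈ (A.koszulDual hA).piece m →
      P σ ∈ (A.koszulDual hA).piece (m + 1 - n) := by
    intro m σ hσ
    refine carrier_induction (P := fun m σ => P σ ∈ (A.koszulDual hA).piece (m + 1 - n))
      (fun m => ?_) (fun m a b ha hb => ?_) (fun x => ?_) (fun m σ c hσ ih => ?_) hσ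
    · rw [map_zero]; exact Submodule.zero_mem _
    · rw [map_add]; exact Submodule.add_mem _ ha hb
    · rw [P_unit]; exact Submodule.zero_mem _
    · rw [P_gen hσ]
      refine Submodule.add_mem _ ?_ (zsmul_mem' _ _ ?_)
      · have := SetLike.mul_mem_graded ih (redGen hA c).mem
        rwa [show m + 1 - n + (redGen hA c).deg = m + (redGen hA c).deg + 1 - n by ring] at this
      · have := SetLike.mul_mem_graded hσ (hd c)
        rwa [show m + (-c.deg - n) = m + (redGen hA c).deg + 1 - n by
          change _ = m + (-c.deg - 1) + 1 - n; ring] at this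
  let f : List (A.koszulDual hA).Red → (A.koszulDual hA).carrier := fun w => match w with
    | [a] => P a.val
    | _ => 0
  have hf : IsCochain n f :=
    { add := fun u v a b c h1 h2 h3 => by
        rcases u with _ | ⟨d, _ | ⟨e, u⟩⟩ <;> rcases v with _ | ⟨z, v⟩ <;> simp [f, h3]
      smul := fun u v r a c h1 h2 => by
        rcases u with _ | ⟨d, _ | ⟨e, u⟩⟩ <;> rcases v with _ | ⟨z, v⟩ <;> simp [f, h2]
      bal := fun u v x a b => by rcases u with _ | ⟨d, u⟩ <;> simp [f]
      left := fun v x a => by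
        rcases v with _ | ⟨z, v⟩
        · exact P_unit_mul x a.val
        · exact (mul_zero _).symm
      right := fun u x a => by
        rcases u with _ | ⟨d, _ | ⟨e, u⟩⟩
        · exact P_mul_unit a.val x
        · exact (zero_mul _).symm
        · exact (zero_mul _).symm
      nil := fun x => (mul_zero _).trans (zero_mul _).symm
      deg := fun l => by
        rcases l with _ | ⟨a, _ | ⟨b, l⟩⟩
        · exact Submodule.zero_mem _
        · have := P_mem a.mem
          rwa [show a.deg + 1 - n = barDeg [a] - n by simp [barDeg]] at this
        · exact Submodule.zero_mem _ }
  have hlong : ∀ l, 2 ≤ l.length → f l = 0 := fun l hl => by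
    rcases l with _ | ⟨a, _ | ⟨b, l⟩⟩
    · rfl
    · simp at hl
    · rfl
  refine ⟨f, ⟨hf, hlong, fun a b => ?_⟩, rfl, fun c => P_g c⟩
  rw [delta_pair n f hlong]
  change _ • (a.val * P b.val) + koszulSign (n + a.deg) • (P a.val * b.val) -
    koszulSign (n + a.deg) • P (a.val * b.val) = 0
  rw [P_mul a.mem, smul_add, zsmul_sign]
  have : koszulSign (n + a.deg + (n + 1) * a.deg) = koszulSign (n * (a.deg + 1)) := by
    apply koszulSign_eq; ring_nf; omega
  rw [this]
  module

theorem isCochain_const (hA : A.IsTypical) {a : (A.koszulDual hA).carrier}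
    (ha : a ∈ (A.koszulDual hA).piece (-n))
    (hc : ∀ x, (A.koszulDual hA).unit x * a = a * (A.koszulDual hA).unit x) :
    IsReduced (hA := hA) n fun w => match w with
      | [] => a
      | _ => 0 := by
  have h : ∀ l : List (A.koszulDual hA).Red, 1 ≤ l.length →
      (match l with | [] => a | _ => 0 : (A.koszulDual hA).carrier) = 0 := fun l hl => by
    cases l with
    | nil => simp at hl
    | cons b l => rfl
  exact
    { add := fun u v b c e h1 h2 h3 => by
        rw [h _ (by simp; try omega), h _ (by simp; try omega), h _ (by simp; try omega), add_zero]
      smul := fun u v r b c h1 h2 => by rw [h _ (by simp; try omega), h _ (by simp; try omega), smul_zero]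
      bal := fun u v x b c => by rw [h _ (by simp; try omega), h _ (by simp; try omega)]
      left := fun v x b => (mul_zero _).symm
      right := fun u x b => by rw [h _ (by simp; try omega), h _ (by simp; try omega), zero_mul]
      nil := hc
      deg := fun l => by
        cases l with
        | nil => rwa [barDeg_nil, zero_sub]
        | cons b l => exact Submodule.zero_mem _
      long := fun l hl => h l (by omega)
      pair := fun b c => by
        rw [delta_pair n _ fun l hl => h l (by omega)]
        simp }

theorem IsReduced.add_reduced {f g : List (A.koszulDual hA).Red → (A.koszulDual hA).carrier}
    (hf : IsReduced n f) (hg : IsReduced n g) : IsReduced n (f + g) where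
  toIsCochain := ((A.koszulDual hA).cochains n).add_mem hf.toIsCochain hg.toIsCochain
  long l hl := by rw [Pi.add_apply, hf.long l hl, hg.long l hl, add_zero]
  pair a b := by
    have := map_add ((A.koszulDual hA).deltaLin n) f g
    refine (congrFun this _).trans ?_
    change delta n f _ + delta n g _ = 0
    rw [hf.pair, hg.pair, add_zero]

theorem IsReduced.smul_reduced {f : List (A.koszulDual hA).Red → (A.koszulDual hA).carrier}
    (hf : IsReduced n f) (r : k) : IsReduced n (r • f) where
  toIsCochain := ((A.koszulDual hA).cochains n).smul_mem r hf.toIsCochain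
  long l hl := by rw [Pi.smul_apply, hf.long l hl, smul_zero]
  pair a b := by
    have := map_smul ((A.koszulDual hA).deltaLin n) r f
    refine (congrFun this _).trans ?_
    change r • delta n f _ = 0
    rw [hf.pair, smul_zero]

theorem IsReduced.ext {f : List (A.koszulDual hA).Red → (A.koszulDual hA).carrier}
    (hf : IsReduced n f) (h0 : f [] = 0) (h1 : ∀ c, f [redGen hA c] = 0) : f = 0 := by
  have h : hf.lam = 0 := carrier_ext (fun x => hf.lam_unit x) fun m σ c hσ ih => by
    rw [hf.lam_mul hσ, ih, hf.lam_red, h1]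
    simp
  funext w
  rcases w with _ | ⟨a, _ | ⟨b, w⟩⟩
  · exact h0
  · rw [← hf.lam_red, h]; rfl
  · exact hf.long _ (by simp)

variable (A) in
/-- The augmentation as a linear map to diagonal matrices. -/
def augDiagLin : A.carrier →ₗ[k] Matrix (Fin t) (Fin t) k :=
  Matrix.diagonalLinearMap (Fin t) k k ∘ₗ A.aug.toLinearMap

/-- The matrix of a linear form, as a linear map. -/
def cmatLin (g : Module.Dual k A.carrier) : A.carrier →ₗ[k] Matrix (Fin t) (Fin t) k where
  toFun := cmat g
  map_add' := cmat_add g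
  map_smul' := cmat_smul g

theorem IsCochain.exists_dual (hA : A.IsTypical) {F : List A.Red → A.carrier}
    (hF : IsCochain n F) : ∃ f, IsReduced (hA := hA) n f ∧ IsDual n F f := by
  obtain ⟨f0, h0, e0⟩ := hF.exists_ev hA (i := 0) A.augDiagLin
    (fun x a => by
      change Matrix.diagonal (A.aug _) = Matrix.diagonal x * Matrix.diagonal (A.aug a)
      rw [map_mul, A.aug_unit, Matrix.diagonal_mul_diagonal]; rfl)
    (fun x a => by
      change Matrix.diagonal (A.aug _) = Matrix.diagonal (A.aug a) * Matrix.diagonal x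
      rw [map_mul, A.aug_unit, Matrix.diagonal_mul_diagonal]; rfl)
    (fun m hm a ha => by
      change Matrix.diagonal (A.aug a) = 0
      rw [A.aug_piece hm ha, Matrix.diagonal_zero'])
  rw [add_zero] at h0
  choose D hD eD using fun c : A.Codual => hF.exists_ev hA (i := c.deg) (cmatLin c.val)
    (fun x a => cmat_lact _ x a) (fun x a => cmat_ract _ x a)
    (fun m hm a ha => cmat_of_mem_ne ha hm)
  obtain ⟨f1, hf1, f10, hg1⟩ := exists_derivation (n := n) hA (D := D)
    (fun a b c h1 h2 h3 => ev_injective hA <| by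
      funext w
      refine Eq.trans ?_ (congrFun (map_add A.ev (D a) (D b)) w).symm
      rw [Pi.add_apply, eD, eD, eD, ← smul_add]
      congr 1
      change cmat c.val _ = cmat a.val _ + cmat b.val _
      rw [h3, cmat_add_left])
    (fun r a c h1 h2 => ev_injective hA <| by
      funext w
      refine Eq.trans ?_ (congrFun (map_smul A.ev r (D a)) w).symm
      rw [Pi.smul_apply, eD, eD, smul_comm]
      congr 1
      change cmat c.val _ = r • cmat a.val _
      rw [h2, cmat_smul_left])
    (fun x c => ev_injective hA <| by
      funext w
      refine Eq.trans ?_ (ev_unit_mul (D c) x w).symm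
      rw [eD, eD, matrix_zsmul_mul]
      congr 1
      exact cmat_comp_mulRight _ _ _)
    (fun x c => ev_injective hA <| by
      funext w
      refine Eq.trans ?_ (ev_mul_unit (D c) x w).symm
      rw [eD, eD, matrix_mul_zsmul]
      congr 1
      exact cmat_comp_mulLeft _ _ _)
    (fun c => by
      have := hD c
      rwa [show -(n + c.deg) = -c.deg - n by ring] at this)
  have hf0 := isCochain_const (n := n) hA (a := f0) h0 fun x => ev_injective hA <| by
    funext w
    refine (ev_unit_mul f0 x w).trans (Eq.trans ?_ (ev_mul_unit f0 x w).symm)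
    rw [e0, matrix_zsmul_mul, matrix_mul_zsmul]
    congr 1
    change Matrix.diagonal _ * _ = _ * Matrix.diagonal _
    rw [Matrix.diagonal_mul_diagonal, Matrix.diagonal_mul_diagonal]
    congr 1; funext p; exact mul_comm _ _
  refine ⟨_, hf0.add_reduced hf1, ⟨fun w => ?_, fun c w => ?_⟩⟩
  · rw [Pi.add_apply, f10, add_zero]
    exact e0 w
  · rw [Pi.add_apply, hg1]
    refine (congrFun (congrArg A.ev (zero_add (D c))) w).trans (eD c w)

end existence

section converse
variable {hA : A.IsTypical} {n : ℤ} {f : List (A.koszulDual hA).Red → (A.koszulDual hA).carrier}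

variable (k t) in
/-- The sum of the entries of a matrix. -/
def entrySum : Matrix (Fin t) (Fin t) k →ₗ[k] k where
  toFun M := ∑ p, ∑ q, M p q
  map_add' M N := by simp [Finset.sum_add_distrib]
  map_smul' r M := by simp [Finset.mul_sum]

theorem entrySum_cmat (g : Module.Dual k A.carrier) (a : A.carrier) :
    entrySum k t (cmat g a) = g a := sum_cmat g a

theorem dualSign_mul_self (n m : ℤ) : dualSign n m * dualSign n m = 1 := koszulSign_mul_self _

/-- A homogeneous element with given values under the augmentation and the dual coring. -/
theorem exists_value (hA : A.IsTypical) (i : ℤ) (x : Fin t → k) (hx : i ≠ 0 → x = 0)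
    (V : Module.Dual k (Module.Dual k A.carrier))
    (hV : ∀ g h : Module.Dual k A.carrier, (∀ a ∈ A.redPiece i, g a = h a) → V g = V h) :
    ∃ b ∈ A.piece i, A.aug b = x ∧ ∀ c : A.Codual, c.deg = i → c.val b = V c.val := by
  have hs : ∑ α, V (dualForm hA i α) • (redBasis hA i α : A.carrier) ∈ A.redPiece i :=
    Submodule.sum_mem _ fun α _ => Submodule.smul_mem _ _ (redBasis hA i α).2
  refine ⟨A.unit x + ∑ α, V (dualForm hA i α) • (redBasis hA i α : A.carrier),
    Submodule.add_mem _ ?_ hs.1, ?_, fun c hc => ?_⟩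
  · by_cases hi : i = 0
    · rw [hi]; exact A.unit_mem x
    · rw [hx hi, map_zero]; exact Submodule.zero_mem _
  · have : A.aug (∑ α, V (dualForm hA i α) • (redBasis hA i α : A.carrier)) = 0 := hs.2
    rw [map_add, this, A.aug_unit, add_zero]
  · rw [map_add, c.unit_eq, zero_add, map_sum]
    have : V c.val = V (∑ α, c.val (redBasis hA i α) • dualForm hA i α) := hV _ _ fun a ha => by
      conv_lhs => rw [← dualForm_sum hA ha]
      simp [mul_comm]
    rw [this, map_sum]
    simp [mul_comm]

theorem isCochain_of_values {F : List A.Red → A.carrier} {e0 : A.Cobar} {e : A.Codual → A.Cobar}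
    (hl : ∀ x (c : A.Codual) w, A.ev (e (c.lact x)) w = A.ev (e c) w * Matrix.diagonal x)
    (hr : ∀ x (c : A.Codual) w, A.ev (e (c.ract x)) w = Matrix.diagonal x * A.ev (e c) w)
    (hu : ∀ x w, A.ev e0 w * Matrix.diagonal x = Matrix.diagonal x * A.ev e0 w)
    (hF1 : ∀ w, F w ∈ A.piece (barDeg w - n))
    (hF2 : ∀ w p, A.aug (F w) p = dualSign n (barDeg w) • A.ev e0 w p p)
    (hF3 : ∀ w (c : A.Codual), c.val (F w) =
      dualSign n (barDeg w) • entrySum k t (A.ev (e c) w)) :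
    IsCochain n F ∧ (∀ w, A.ev e0 w = dualSign n (barDeg w) • Matrix.diagonal (A.aug (F w))) ∧
      ∀ c w, A.ev (e c) w = dualSign n (barDeg w) • cmat c.val (F w) := by
  have hmem : ∀ {i j : ℤ} {b : A.carrier}, b ∈ A.piece i → i = j → b ∈ A.piece j :=
    fun h e => e ▸ h
  refine ⟨?_, fun w => ?_, fun c w => ?_⟩
  · exact
    { add := fun u v a b c h1 h2 h3 => by
        have e1 : barDeg (u ++ a :: v) = barDeg (u ++ c :: v) := by
          simp [barDeg_append, barDeg_cons, h1]
        have e2 : barDeg (u ++ b :: v) = barDeg (u ++ c :: v) := by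
          simp [barDeg_append, barDeg_cons, h2]
        refine eq_of_codual (hF1 _) (Submodule.add_mem _ (hmem (hF1 _) (by rw [e1]))
          (hmem (hF1 _) (by rw [e2]))) (funext fun p => ?_) fun d => ?_
        · rw [map_add, Pi.add_apply, hF2, hF2, hF2, e1, e2,
            (ev_multilinear (e0)).add u v a b c h1 h2 h3, ← smul_add]
          rfl
        · rw [map_add, hF3, hF3, hF3, e1, e2,
            (ev_multilinear (e d)).add u v a b c h1 h2 h3, map_add, smul_add]
      smul := fun u v r a c h1 h2 => by
        have e1 : barDeg (u ++ a :: v) = barDeg (u ++ c :: v) := by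
          simp [barDeg_append, barDeg_cons, h1]
        refine eq_of_codual (hF1 _) (Submodule.smul_mem _ _ (hmem (hF1 _) (by rw [e1])))
          (funext fun p => ?_) fun d => ?_
        · rw [map_smul, Pi.smul_apply, hF2, hF2, e1,
            (ev_multilinear (e0)).smul u v r a c h1 h2, smul_comm r]
          rfl
        · rw [map_smul, hF3, hF3, e1,
            (ev_multilinear (e d)).smul u v r a c h1 h2, map_smul, smul_comm r]
      bal := fun u v x a b => by
        have e1 : barDeg (u ++ a.ract x :: b :: v) = barDeg (u ++ a :: b.lact x :: v) := by
          simp [barDeg_append, barDeg_cons, Red.ract, Red.lact, Hom.ract, Hom.lact]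
        refine eq_of_codual (hF1 _) (hmem (hF1 _) (by rw [e1])) (funext fun p => ?_) fun d => ?_
        · rw [hF2, hF2, e1, (ev_multilinear (e0)).bal]
        · rw [hF3, hF3, e1, (ev_multilinear (e d)).bal]
      left := fun v x a => by
        have e1 : barDeg (a.lact x :: v) = barDeg (a :: v) := barDeg_lact v a x
        refine eq_of_codual (hF1 _) (unit_mul_mem (hmem (hF1 _) (by rw [e1])) x)
          (funext fun p => ?_) fun d => ?_
        · rw [map_mul, A.aug_unit, Pi.mul_apply, hF2, hF2, e1, ev_left, Matrix.diagonal_mul,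
            mul_smul_comm]
        · have := hF3 (a :: v) (d.ract x)
          rw [hr] at this
          rw [hF3, e1, ev_left]
          exact this.symm
      right := fun u x a => by
        have e1 : barDeg (u ++ [a.ract x]) = barDeg (u ++ [a]) := barDeg_ract u a x
        refine eq_of_codual (hF1 _) (mul_unit_mem (hmem (hF1 _) (by rw [e1])) x)
          (funext fun p => ?_) fun d => ?_
        · rw [map_mul, A.aug_unit, Pi.mul_apply, hF2, hF2, e1, ev_right, Matrix.mul_diagonal,
            smul_mul_assoc]
        · have := hF3 (u ++ [a]) (d.lact x)
          rw [hl] at this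
          rw [hF3, e1, ev_right]
          exact this.symm
      nil := fun x => by
        refine eq_of_codual (unit_mul_mem (hF1 _) x) (mul_unit_mem (hF1 _) x) ?_ fun d => ?_
        · rw [map_mul, map_mul, mul_comm]
        · refine (hF3 [] (d.ract x)).trans (Eq.trans ?_ (hF3 [] (d.lact x)).symm)
          rw [hl, hr, ev_nil, Matrix.diagonal_mul_diagonal, Matrix.diagonal_mul_diagonal]
          simp only [mul_comm]
      deg := hF1 }
  · rw [show A.aug (F w) = fun p => dualSign n (barDeg w) • A.ev (e0) w p p from
      funext (hF2 w)]
    refine (eq_diagonal fun x => (hu x w).symm).trans ?_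
    ext p q
    by_cases hpq : p = q
    · subst hpq
      rw [Matrix.smul_apply, Matrix.diagonal_apply_eq, Matrix.diagonal_apply_eq, smul_smul,
        dualSign_mul_self, one_smul]
    · rw [Matrix.smul_apply, Matrix.diagonal_apply_ne _ hpq, Matrix.diagonal_apply_ne _ hpq,
        smul_zero]
  · ext p q
    have h1 := hF3 w ((c.ract (Pi.single p 1)).lact (Pi.single q 1))
    rw [hl, hr] at h1
    rw [Matrix.smul_apply, cmat_apply]
    have h2 : c.val (A.idem p * F w * A.idem q) = c.val (A.unit (Pi.single p 1) *
      (F w * A.unit (Pi.single q 1))) := by rw [← mul_assoc]; rfl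
    rw [h2]
    refine Eq.trans ?_ (congrArg (fun y => dualSign n (barDeg w) • y) h1.symm)
    rw [smul_smul, dualSign_mul_self, one_smul]
    refine Eq.trans ?_ (show ∑ p', ∑ q', (Matrix.diagonal (Pi.single p 1) *
      A.ev (e c) w * Matrix.diagonal (Pi.single q 1) : Matrix (Fin t) (Fin t) k) p' q' = _ from rfl)
    rw [Finset.sum_eq_single p, Finset.sum_eq_single q]
    · rw [Matrix.mul_diagonal, Matrix.diagonal_mul]
      simp
    · intro q' _ h
      rw [Matrix.mul_diagonal]; simp [h]
    · simp
    · intro p' _ h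
      refine Finset.sum_eq_zero fun q' _ => ?_
      rw [Matrix.mul_diagonal, Matrix.diagonal_mul]; simp [h]
    · simp

theorem IsReduced.exists_dual (hf : IsReduced n f) :
    ∃ F, IsCochain n F ∧ IsDual n F f := by
  have hex : ∀ w : List A.Red, ∃ b ∈ A.piece (barDeg w - n),
      (∀ p, A.aug b p = dualSign n (barDeg w) • A.ev (f []) w p p) ∧
      ∀ c : A.Codual, c.val b =
        dualSign n (barDeg w) • entrySum k t (A.ev (f [redGen hA c]) w) := by
    intro w
    let L : A.Cobar →ₗ[k] A.Cobar := hf.lam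
    let V : Module.Dual k (Module.Dual k A.carrier) := dualSign n (barDeg w) •
      (entrySum k t ∘ₗ LinearMap.proj w ∘ₗ A.ev ∘ₗ L ∘ₗ A.genLin (barDeg w - n))
    have hV : ∀ g, V g = dualSign n (barDeg w) • entrySum k t
      (A.ev (hf.lam (A.genLin (barDeg w - n) g)) w) := fun g => rfl
    obtain ⟨b, h1, h2, h3⟩ := exists_value hA (barDeg w - n)
      (fun p => dualSign n (barDeg w) • A.ev (f []) w p p) (fun h => by
        have := hf.deg []
        rw [barDeg_nil, zero_sub] at this
        funext p
        rw [ev_eq_zero this (by omega)]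
        simp) V fun g h hgh => by rw [hV, hV, genLin_congr hgh]
    refine ⟨b, h1, fun p => congrFun h2 p, fun c => ?_⟩
    by_cases hc : c.deg = barDeg w - n
    · rw [h3 c hc, hV, ← hc, genLin_val]
      exact congrArg (fun σ => dualSign n (barDeg w) • entrySum k t (A.ev σ w)) (hf.lam_gen c)
    · have h4 := hf.deg [redGen hA c]
      have h5 : barDeg [redGen hA c] - n = -(c.deg + n) := by
        rw [barDeg_cons, barDeg_nil]
        change -c.deg - 1 + 1 + 0 - n = _
        ring
      rw [h5] at h4
      rw [c.supp (Ne.symm hc) _ h1, ev_eq_zero h4 (by omega), map_zero, smul_zero]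
  choose F hF1 hF2 hF3 using hex
  obtain ⟨h1, h2, h3⟩ := isCochain_of_values (F := F) (e0 := f [])
    (e := fun c => f [redGen hA c]) (fun x c w => by
      rw [redGen_lact, hf.left]
      exact ev_unit_mul _ x w)
    (fun x c w => by
      have := hf.right [] x (redGen hA c)
      rw [List.nil_append, List.nil_append] at this
      rw [redGen_ract, this]
      exact ev_mul_unit _ x w)
    (fun x w => (ev_unit_mul (f []) x w).symm.trans
      ((congrFun (congrArg A.ev (hf.nil x)) w).trans (ev_mul_unit (f []) x w))) hF1 hF2 hF3
  exact ⟨F, h1, h2, h3⟩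

theorem IsDual.eq_zero {F : List A.Red → A.carrier} (h : IsDual n F f) (hF : IsCochain n F)
    (hf : f = 0) : F = 0 := by
  funext w
  have hs : ∀ {M : Matrix (Fin t) (Fin t) k}, 0 = dualSign n (barDeg w) • M → M = 0 :=
    fun {M} h => by
      have := congrArg (fun X => dualSign n (barDeg w) • X) h
      simp only [smul_zero, smul_smul, dualSign_mul_self, one_smul] at this
      exact this.symm
  have h0 : A.ev (0 : A.Cobar) w = 0 := by rw [map_zero]; rfl
  subst hf
  refine eq_of_codual (hF.deg w) (Submodule.zero_mem _) ?_ fun c => ?_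
  · refine (Matrix.diagonal_injective (hs (h0.symm.trans (h.unitPart w)) |>.trans
      Matrix.diagonal_zero.symm)).trans (map_zero A.aug).symm
  · rw [← entrySum_cmat, hs (h0.symm.trans (h.genPart c w)), map_zero]
    exact (map_zero c.val).symm

theorem IsDual.eq_zero' {F : List A.Red → A.carrier} (h : IsDual n F f) (hf : IsReduced n f)
    (hF : F = 0) : f = 0 := by
  subst hF
  refine hf.ext (ev_injective hA (funext fun w => ?_)) fun c =>
    ev_injective hA (funext fun w => ?_)
  · refine (h.unitPart w).trans ?_
    change dualSign _ _ • Matrix.diagonal (A.aug (0 : A.carrier)) = A.ev (0 : A.Cobar) w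
    rw [map_zero, map_zero, Matrix.diagonal_zero', smul_zero]; rfl
  · refine (h.genPart c w).trans ?_
    change dualSign _ _ • cmat c.val (0 : A.carrier) = A.ev (0 : A.Cobar) w
    have := cmat_smul c.val 0 (0 : A.carrier)
    rw [zero_smul, zero_smul] at this
    rw [this, map_zero, smul_zero]; rfl

theorem IsDual.add {F G : List A.Red → A.carrier}
    {g : List (A.koszulDual hA).Red → (A.koszulDual hA).carrier}
    (h : IsDual n F f) (h' : IsDual n G g) : IsDual n (F + G) (f + g) where
  unitPart w := by
    refine (congrFun (map_add A.ev (f []) (g [])) w).trans ?_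
    refine (congrArg₂ (fun X Y => X + Y) (h.unitPart w) (h'.unitPart w)).trans ?_
    rw [Pi.add_apply, map_add, ← smul_add, Matrix.diagonal_add]
    rfl
  genPart c w := by
    refine (congrFun (map_add A.ev (f [redGen hA c]) (g [redGen hA c])) w).trans ?_
    refine (congrArg₂ (fun X Y => X + Y) (h.genPart c w) (h'.genPart c w)).trans ?_
    rw [Pi.add_apply, cmat_add, smul_add]

theorem IsDual.smul {F : List A.Red → A.carrier} (h : IsDual n F f) (r : k) :
    IsDual n (r • F) (r • f) where
  unitPart w := by
    refine (congrFun (map_smul A.ev r (f [])) w).trans ?_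
    refine (congrArg (fun X => r • X) (h.unitPart w)).trans ?_
    rw [Pi.smul_apply, map_smul, smul_comm, Matrix.diagonal_smul]
  genPart c w := by
    refine (congrFun (map_smul A.ev r (f [redGen hA c])) w).trans ?_
    refine (congrArg (fun X => r • X) (h.genPart c w)).trans ?_
    rw [Pi.smul_apply, cmat_smul, smul_comm]

end converse

section insertion
variable {M : Type w} [AddCommGroup M] {n q : ℤ} {F G : List A.Red → A.carrier}

/-- The sum over all ways to replace the beginning and a later part of a word by their images under
two cochains. -/
def IsCochain.insHead (hF : IsCochain n F) (hG : IsCochain q G) (φ : List A.Red → M)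
    (w : List A.Red) : M :=
  splitSum (fun u v => koszulSign ((n + 1) * barDeg v) •
    hF.ins (fun x => φ ((hG.value u).bar :: x)) v) w

/-- The sum over all ways to replace two disjoint parts of a word by their images under two
cochains. -/
def IsCochain.insTwice (hF : IsCochain n F) (hG : IsCochain q G) : (List A.Red → M) → List A.Red → M
  | φ, [] => hF.insHead hG φ []
  | φ, a :: w => hF.insHead hG φ (a :: w) +
      koszulSign ((q + 1) * (a.deg + 1)) • IsCochain.insTwice hF hG (fun v => φ (a :: v)) w

variable (hF : IsCochain n F) (hG : IsCochain q G)

theorem IsCochain.insHead_add (φ ψ : List A.Red → M) (w : List A.Red) :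
    hF.insHead hG (φ + ψ) w = hF.insHead hG φ w + hF.insHead hG ψ w := by
  have h : ∀ u v, hF.ins (fun x => (φ + ψ) ((hG.value u).bar :: x)) v =
      hF.ins (fun x => φ ((hG.value u).bar :: x)) v +
      hF.ins (fun x => ψ ((hG.value u).bar :: x)) v := fun u v => hF.ins_add _ _ v
  simp only [IsCochain.insHead, h, smul_add, splitSum_add]

theorem IsCochain.insTwice_add (φ ψ : List A.Red → M) (w : List A.Red) :
    hF.insTwice hG (φ + ψ) w = hF.insTwice hG φ w + hF.insTwice hG ψ w := by
  induction w generalizing φ ψ with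
  | nil => exact hF.insHead_add hG φ ψ []
  | cons a w ih =>
    have : hF.insTwice hG (fun v => (φ + ψ) (a :: v)) w = _ :=
      ih (fun v => φ (a :: v)) (fun v => ψ (a :: v))
    rw [IsCochain.insTwice, IsCochain.insTwice, IsCochain.insTwice, this, hF.insHead_add hG]
    simp only [smul_add]
    abel

theorem IsCochain.map_insTwice {N : Type*} [AddCommGroup N] (L : M →+ N)
    (φ : List A.Red → M) (w : List A.Red) :
    hF.insTwice hG (fun v => L (φ v)) w = L (hF.insTwice hG φ w) := by
  have h : ∀ (φ : List A.Red → M) w, hF.insHead hG (fun v => L (φ v)) w =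
      L (hF.insHead hG φ w) := fun φ w => by
    simp only [IsCochain.insHead, hF.map_ins L, map_splitSum, map_zsmul]
  induction w generalizing φ with
  | nil => exact h φ []
  | cons a w ih =>
    rw [IsCochain.insTwice, IsCochain.insTwice, ih (fun v => φ (a :: v)), map_add, h, map_zsmul]

theorem IsCochain.insTwice_eq_zero {φ : List A.Red → M}
    (h : ∀ l, 2 ≤ l.length → φ l = 0) (w : List A.Red) : hF.insTwice hG φ w = 0 := by
  have h1 : ∀ {φ : List A.Red → M} (_ : ∀ l, 2 ≤ l.length → φ l = 0) w,
      hF.insHead hG φ w = 0 := fun {φ} h w => by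
    rw [IsCochain.insHead, splitSum_congr (H := fun _ _ => 0) fun u v _ => by
      rw [hF.ins_eq_zero fun l hl => h _ (by simpa using hl), smul_zero], splitSum_zero]
  induction w generalizing φ with
  | nil => exact h1 h []
  | cons a w ih =>
    rw [IsCochain.insTwice, h1 h, ih fun l hl => h _ (by simp; omega), smul_zero, add_zero]

theorem IsCochain.insTwice_pair {φ : List A.Red → M}
    (h : ∀ l, 3 ≤ l.length → φ l = 0) (w : List A.Red) : hF.insTwice hG φ w =
      splitSum (fun u v => koszulSign ((n + 1) * barDeg v) •
        φ [(hG.value u).bar, (hF.value v).bar]) w := by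
  have h1 : hF.insHead hG φ w = splitSum (fun u v => koszulSign ((n + 1) * barDeg v) •
        φ [(hG.value u).bar, (hF.value v).bar]) w :=
    splitSum_congr fun u v _ => by rw [hF.ins_one fun l hl => h _ (by simpa using hl)]
  cases w with
  | nil => exact h1
  | cons a w =>
    rw [IsCochain.insTwice, hF.insTwice_eq_zero hG fun l hl => h _ (by simpa using hl), smul_zero,
      add_zero, h1]

theorem ev_eq_insTwice {K L : A.Cobar →ₗ[k] A.Cobar} {e : A.Codual → A.Cobar}
    (hK : ∀ σ w, A.ev (K σ) w = dualSign n (barDeg w) • hF.ins (A.ev σ) w)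
    (hKm : ∀ m σ, σ ∈ A.cobarPiece m → K σ ∈ A.cobarPiece (m + 1 - n))
    (he : ∀ c w, A.ev (e c) w = dualSign q (barDeg w) • cmat c.val (G w))
    (hu : ∀ x, L (A.cobarUnit x) = 0)
    (hL : ∀ (m : ℤ) (σ : A.Cobar) (c : A.Codual), σ ∈ A.cobarPiece m → L (σ * gen c) =
      L σ * gen c + koszulSign (m + q * (m + 1)) • (K σ * e c))
    (τ : A.Cobar) (w : List A.Red) :
    A.ev (L τ) w = koszulSign ((q + 1) * barDeg w + ((q + 1) * (n + 1) + n)) •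
      hF.insTwice hG (A.ev τ) w := by
  refine cobar_rightInduction (P := fun τ => ∀ w, A.ev (L τ) w =
    koszulSign ((q + 1) * barDeg w + ((q + 1) * (n + 1) + n)) • hF.insTwice hG (A.ev τ) w)
    (fun x w => ?_) (fun a b ha hb w => ?_) (fun m σ c hσ ih w => ?_) τ w
  · rw [hu, map_zero, hF.insTwice_eq_zero hG fun l hl => ?_, smul_zero]
    · rfl
    · rcases l with _ | ⟨a, l⟩
      · simp at hl
      · exact ev_unit_cons x a l
  · rw [map_add, map_add, Pi.add_apply, ha, hb, map_add, hF.insTwice_add, smul_add]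
  · have h1 : ∀ u v, hF.ins (fun x => A.ev (σ * gen c) ((hG.value u).bar :: x)) v =
        cmat c.val (G u) * hF.ins (A.ev σ) v := fun u v => by
      simp only [ev_mul_gen_cons, cmat_bar]
      exact hF.map_ins (AddMonoidHom.mulLeft (cmat c.val (G u))) (A.ev σ) v
    have h2 : koszulSign (m + q * (m + 1)) • A.ev (K σ * e c) w =
        koszulSign ((q + 1) * barDeg w + ((q + 1) * (n + 1) + n)) •
          hF.insHead hG (A.ev (σ * gen c)) w := by
      rw [ev_mul, IsCochain.insHead, ← splitSum_zsmul, ← splitSum_zsmul]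
      refine splitSum_congr fun u v huv => ?_
      rw [h1, he]
      by_cases hv : barDeg v = -(m + 1 - n)
      · rw [hK, matrix_zsmul_mul, matrix_mul_zsmul, dualSign, dualSign, zsmul_sign, zsmul_sign,
          zsmul_sign, ← huv, barDeg_append, hv]
        congr 1
        apply koszulSign_eq; ring_nf; omega
      · have h3 := ev_eq_zero (hKm m σ hσ) hv
        have h4 : hF.ins (A.ev σ) v = 0 := by
          rw [hK] at h3
          have := congrArg (fun X => dualSign n (barDeg v) • X) h3
          simp only [smul_zero, smul_smul, dualSign_mul_self, one_smul] at this
          exact this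
        rw [h3, h4, mul_zero, mul_zero, smul_zero, smul_zero, smul_zero]
    rw [hL m σ c hσ, map_add, map_zsmul, Pi.add_apply, Pi.smul_apply, h2]
    cases w with
    | nil => rw [ev_mul_gen_nil, zero_add]; rfl
    | cons a w =>
      have h3 : hF.insTwice hG (fun v => A.ev (σ * gen c) (a :: v)) w =
          cmat c.val a.val * hF.insTwice hG (A.ev σ) w := by
        rw [ev_mul_gen]
        exact hF.map_insTwice hG (AddMonoidHom.mulLeft (cmat c.val a.val)) (A.ev σ) w
      rw [ev_mul_gen_cons, ih, IsCochain.insTwice, h3, smul_add, add_comm, matrix_mul_zsmul,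
        zsmul_sign, barDeg_cons]
      congr 2
      apply koszulSign_eq; ring_nf; omega


end insertion

section product
variable {hA : A.IsTypical} {n q : ℤ} {F G : List A.Red → A.carrier}
  {f g : List (A.koszulDual hA).Red → (A.koszulDual hA).carrier}

theorem redStep_nil (n : ℤ) (f : List (A.koszulDual hA).Red → (A.koszulDual hA).carrier) :
    redStep n f [] = f [] := by
  rw [redStep, Pi.sub_apply, Pi.smul_apply, delta_nil, ctr_nil, map_zero, smul_zero, sub_zero]

theorem IsRightLin.peel_one_gen {f : List (A.koszulDual hA).Red → (A.koszulDual hA).carrier}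
    (hf : IsRightLin hA (regAct hA) f) (c : A.Codual) : hf.peel (gen c) = 0 := by
  have h1 : (1 : A.Cobar) ∈ A.cobarPiece 0 := (Hom.one (A.koszulDual hA)).mem
  have h := hf.peel_gen h1 c
  have h0 := hf.peel_unit 1
  rw [map_one] at h0
  rw [one_mul, h0, map_zero, zero_add] at h
  rw [h]
  have h2 := hf.toIsMultilinear.zero (a := (cobarHom hA 0 1 h1).bar) (by
    change (1 : (A.koszulDual hA).carrier) - (A.koszulDual hA).unit ((A.koszulDual hA).aug 1) = 0
    rw [map_one, map_one, sub_self]) [] [redGen hA c]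
  rw [List.nil_append] at h2
  refine Eq.trans (congrArg _ ?_) (smul_zero _)
  convert h2 using 3

theorem redStep_gen (hf : IsRightLin hA (regAct hA) f) (n : ℤ) (c : A.Codual) :
    redStep n f [redGen hA c] = f [redGen hA c] + hf.peel (cobarDiff hA (gen c)) := by
  have h1 : ctr hA (regAct hA) f [redGen hA c] = 0 := (ctr_single hf _).trans (hf.peel_one_gen c)
  have h2 : ctr hA (regAct hA) f [(redGen hA c).diff] = hf.peel (cobarDiff hA (gen c)) :=
    ctr_single hf _
  rw [redStep, Pi.sub_apply, Pi.smul_apply, delta_single, ctr_nil, h1, h2, map_zero, mul_zero,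
    zero_mul, smul_zero, smul_zero, add_zero, sub_zero, zero_add, zsmul_sign]
  have : koszulSign (n + (n - 1)) = -1 := koszulSign_eq_neg_one (by omega)
  rw [this, neg_smul, one_smul, sub_neg_eq_add]

theorem cmat_bar_bar (c : A.Codual) (a b : A.Hom) :
    cmat c.val (a.bar.val * b.bar.val) = cmat c.val (a.val * b.val) -
      A.augDiag a.val * cmat c.val b.val - cmat c.val a.val * A.augDiag b.val := by
  have h1 : cmat c.val (a.val * b.val) = cmat c.val (a.val * b.bar.val) +
      cmat c.val a.val * A.augDiag b.val := by
    rw [augDiag_apply, ← cmat_mul_unit, ← cmat_add, ← mul_add]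
    congr 2
    exact (sub_add_cancel _ _).symm
  rw [h1, cmat_bar_mul, cmat_bar]
  abel

/-- The sign identities behind the compatibility with products. -/
theorem cmat_mul_values (hF : IsCochain n F) (hG : IsCochain q G) (c : A.Codual)
    (u v : List A.Red) :
    dualSign (n + q) (barDeg u + barDeg v) • koszulSign (n * q + n * barDeg u) •
        cmat c.val (G u * F v) =
      dualSign q (barDeg u) • dualSign n (barDeg v) • (cmat c.val (G u) * A.augDiag (F v)) +
      koszulSign (q * c.deg) • dualSign q (barDeg u) • dualSign n (barDeg v) •
        (A.augDiag (G u) * cmat c.val (F v)) +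
      koszulSign ((q + 1) * (barDeg u + barDeg v) + ((q + 1) * (n + 1) + n)) •
        koszulSign ((n + 1) * barDeg v) • koszulSign (barDeg v - n + 1) •
          cmat c.val ((hG.value u).bar.val * (hF.value v).bar.val) := by
  have h1 : dualSign q (barDeg u) • dualSign n (barDeg v) • (cmat c.val (G u) * A.augDiag (F v)) =
      koszulSign ((n + q + 1) * (barDeg u + barDeg v) + (n + q) + (n * q + n * barDeg u)) •
        (cmat c.val (G u) * A.augDiag (F v)) := by
    by_cases h : barDeg v = n
    · rw [dualSign, dualSign, zsmul_sign, h]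
      congr 1
      apply koszulSign_eq; ring_nf; omega
    · rw [hF.aug_eq_zero h, mul_zero, smul_zero, smul_zero, smul_zero]
  have h2 : koszulSign (q * c.deg) • dualSign q (barDeg u) • dualSign n (barDeg v) •
        (A.augDiag (G u) * cmat c.val (F v)) =
      koszulSign ((n + q + 1) * (barDeg u + barDeg v) + (n + q) + (n * q + n * barDeg u)) •
        (A.augDiag (G u) * cmat c.val (F v)) := by
    by_cases h : barDeg u = q
    · by_cases h' : barDeg v - n = c.deg
      · rw [dualSign, dualSign, zsmul_sign, zsmul_sign, h, ← h']
        congr 1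
        apply koszulSign_eq; ring_nf; omega
      · rw [cmat_of_mem_ne (hF.deg v) h', mul_zero, smul_zero, smul_zero, smul_zero, smul_zero]
    · rw [hG.aug_eq_zero h, zero_mul, smul_zero, smul_zero, smul_zero, smul_zero]
  have h3 : koszulSign ((q + 1) * (barDeg u + barDeg v) + ((q + 1) * (n + 1) + n) +
      (n + 1) * barDeg v + (barDeg v - n + 1)) =
      koszulSign ((n + q + 1) * (barDeg u + barDeg v) + (n + q) + (n * q + n * barDeg u)) := by
    apply koszulSign_eq; ring_nf; omega
  rw [h1, h2, cmat_bar_bar, zsmul_sign, zsmul_sign, h3, dualSign, zsmul_sign]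
  change _ = _ + _ + _ • (cmat c.val (G u * F v) - A.augDiag (G u) * cmat c.val (F v) -
    cmat c.val (G u) * A.augDiag (F v))
  module

theorem ev_diff_gen_pair (c : A.Codual) (a b : A.Red) :
    A.ev (cobarDiff hA (gen c)) [a, b] = koszulSign (b.deg + 1) • cmat c.val (a.val * b.val) := by
  rw [ev_diff, barDiff_gen_pair, zsmul_sign]
  congr 1
  apply koszulSign_eq
  simp only [barDeg_cons, barDeg_nil]
  omega

theorem ev_diff_gen_long (c : A.Codual) {l : List A.Red} (hl : 3 ≤ l.length) :
    A.ev (cobarDiff hA (gen c)) l = 0 := by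
  rw [ev_diff, barDiff_gen_long c hl, smul_zero]

theorem IsDual.redStep_cup (h : IsDual n F f) (h' : IsDual q G g) (hF : IsCochain n F)
    (hG : IsCochain q G) (hf : IsReduced n f) (hg : IsReduced q g) :
    IsDual (n + q) (koszulSign (n * q) • cup n G F) (redStep (n + q) (cup q f g)) := by
  have hr := (hf.toIsCochain.cup rfl hg.toIsCochain).isRightLin
  refine ⟨fun w => ?_, fun c w => ?_⟩
  · rw [redStep_nil, cup_short_nil]
    refine (ev_mul (f []) (g []) w).trans ?_
    change _ = _ • A.augDiag (koszulSign (n * q) • cup n G F w)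
    rw [map_zsmul, cup, map_splitSum, ← splitSum_zsmul, ← splitSum_zsmul]
    refine splitSum_congr fun u v huv => ?_
    refine (congrArg₂ (fun X Y => X * Y) (h'.unitPart u) (h.unitPart v)).trans ?_
    change (_ • A.augDiag (G u)) * (_ • A.augDiag (F v)) = _
    rw [map_zsmul, matrix_zsmul_mul, matrix_mul_zsmul]
    have hm : A.augDiag (G u * F v) = A.augDiag (G u) * A.augDiag (F v) := by
      rw [augDiag_apply, augDiag_apply, augDiag_apply, map_mul, Matrix.diagonal_mul_diagonal]
      rfl
    rw [hm]
    by_cases h1 : barDeg u = q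
    · by_cases h2 : barDeg v = n
      · rw [dualSign, dualSign, dualSign, zsmul_sign, zsmul_sign, zsmul_sign, ← huv, barDeg_append,
          h1, h2]
        congr 1
        apply koszulSign_eq; ring_nf; omega
      · rw [hF.aug_eq_zero h2, mul_zero]
        simp only [smul_zero]
    · rw [hG.aug_eq_zero h1, zero_mul]
      simp only [smul_zero]
  · have hP := ev_eq_insTwice hF hG (K := hf.lam) (L := hr.peel) (e := fun c => g [redGen hA c])
      (fun σ w => h.ev_lam hF hf σ w) (fun m σ hσ => hf.lam_mem hσ) h'.genPart hr.peel_unit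
      (fun m σ c hσ => (hr.peel_gen hσ c).trans (by
        rw [regAct_act]
        refine congrArg _ ?_
        rw [cup_short_left hf.long, hg.long _ le_rfl, mul_zero, zero_add, zsmul_sign]
        exact congrArg (fun X : (A.koszulDual hA).carrier => koszulSign (m + q * (m + 1)) •
          (X * g [redGen hA c])) (hf.lam_apply hσ).symm))
    have hP' := hP (cobarDiff hA (gen c)) w
    rw [hF.insTwice_pair hG fun l hl => ev_diff_gen_long c hl, ← splitSum_zsmul] at hP'
    rw [redStep_gen hr]
    refine (congrFun (map_add A.ev (cup q f g [redGen hA c]) (hr.peel _)) w).trans ?_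
    have hc : A.ev (cup q f g [redGen hA c]) w = splitSum (fun u v =>
        dualSign q (barDeg u) • dualSign n (barDeg v) • (cmat c.val (G u) * A.augDiag (F v)) +
        koszulSign (q * c.deg) • dualSign q (barDeg u) • dualSign n (barDeg v) •
          (A.augDiag (G u) * cmat c.val (F v))) w := by
      rw [cup_short_left hf.long]
      refine (congrFun (map_add A.ev (f [] * g [redGen hA c] : A.Cobar) _) w).trans ?_
      rw [splitSum_add, Pi.add_apply]
      refine congrArg₂ (fun X Y => X + Y) ((ev_mul (f []) (g [redGen hA c]) w).trans
        (splitSum_congr fun u v _ => ?_)) ?_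
      · refine (congrArg₂ (fun X Y => X * Y) (h'.genPart c u) (h.unitPart v)).trans ?_
        rw [matrix_zsmul_mul, matrix_mul_zsmul]
        rfl
      · refine (congrFun (map_zsmul A.ev _ (f [redGen hA c] * g [] : A.Cobar)) w).trans ?_
        rw [Pi.smul_apply, splitSum_zsmul]
        refine congrArg₂ (fun (s : ℤ) (X : Matrix (Fin t) (Fin t) k) => s • X) ?_
          ((ev_mul (f [redGen hA c]) (g []) w).trans (splitSum_congr fun u v _ => ?_))
        · apply koszulSign_eq
          change (q * (-c.deg - 1 + 1) - q * c.deg) % 2 = 0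
          ring_nf; omega
        · refine (congrArg₂ (fun X Y => X * Y) (h'.unitPart u) (h.genPart c v)).trans ?_
          rw [matrix_zsmul_mul, matrix_mul_zsmul]
          rfl
    refine (congrArg₂ (fun X Y => X + Y) hc hP').trans ?_
    rw [← splitSum_add, Pi.smul_apply, cmat_zsmul, ← cmatHom_apply, cup, map_splitSum,
      ← splitSum_zsmul, ← splitSum_zsmul]
    refine splitSum_congr fun u v huv => ?_
    rw [map_zsmul, zsmul_sign (n * q), cmatHom_apply, ← huv, barDeg_append, cmat_mul_values hF hG,
      ev_diff_gen_pair]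
    rfl

theorem IsReduced.redStep_cup (hc : A.IsComplete) (hf : IsReduced n f) (hg : IsReduced q g)
    (hδ : delta n f = 0) (hδ' : delta q g = 0) : IsReduced (n + q) (redStep (n + q) (cup q f g)) := by
  have hfg := hf.toIsCochain.cup rfl hg.toIsCochain
  have h0 : delta (n + q) (cup q f g) = 0 :=
    (cup_mem_cocycles rfl ⟨hf.toIsCochain, hδ⟩ ⟨hg.toIsCochain, hδ'⟩).2
  refine ⟨hfg.redStep, fun l hl => ?_, fun a b => by rw [delta_redStep hfg, h0]; rfl⟩
  obtain ⟨p, hp⟩ := exists_wordWeight hc l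
  refine redStep_eq_zero hc hfg (fun l _ => congrFun h0 l) le_rfl (fun w _ hw => ?_) hp hl
  rcases w with _ | ⟨a, _ | ⟨b, w⟩⟩
  · simp at hw
  · simp at hw
  · rw [cup_short_left hf.long, hg.long _ (by simp), hg.long _ (by simpa using hw), mul_zero,
      mul_zero, smul_zero, add_zero]

end product

theorem _root_.exists_linearEquiv_of_relation {R V W : Type*} [Ring R] [AddCommGroup V]
    [AddCommGroup W] [Module R V] [Module R W] (S : Submodule R (V × W))
    (h1 : ∀ v, ∃ w, (v, w) ∈ S) (h2 : ∀ w, ∃ v, (v, w) ∈ S) (h3 : ∀ w, (0, w) ∈ S → w = 0)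
    (h4 : ∀ v, (v, 0) ∈ S → v = 0) : ∃ e : V ≃ₗ[R] W, ∀ v w, (v, w) ∈ S → e v = w := by
  have ha : Function.Bijective (LinearMap.fst R V W ∘ₗ S.subtype) := by
    refine ⟨(injective_iff_map_eq_zero _).2 ?_, fun v => ?_⟩
    · rintro ⟨⟨v, w⟩, h⟩ (rfl : v = 0)
      obtain rfl := h3 w h
      rfl
    · obtain ⟨w, h⟩ := h1 v
      exact ⟨⟨(v, w), h⟩, rfl⟩
  have hb : Function.Bijective (LinearMap.snd R V W ∘ₗ S.subtype) := by
    refine ⟨(injective_iff_map_eq_zero _).2 ?_, fun w => ?_⟩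
    · rintro ⟨⟨v, w⟩, h⟩ (rfl : w = 0)
      obtain rfl := h4 v h
      rfl
    · obtain ⟨v, h⟩ := h2 w
      exact ⟨⟨(v, w), h⟩, rfl⟩
  refine ⟨(LinearEquiv.ofBijective _ ha).symm.trans (LinearEquiv.ofBijective _ hb),
    fun v w h => ?_⟩
  have : (LinearEquiv.ofBijective _ ha).symm v = ⟨(v, w), h⟩ :=
    (LinearEquiv.symm_apply_eq _).2 rfl
  rw [LinearEquiv.trans_apply, this]
  rfl

section comparison
variable {hA : A.IsTypical} {n q : ℤ} {F G : List A.Red → A.carrier}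
  {f g : List (A.koszulDual hA).Red → (A.koszulDual hA).carrier}

theorem IsDual.right_unique (h : IsDual n F f) (h' : IsDual n F g) (hf : IsReduced n f)
    (hg : IsReduced n g) : f = g := by
  have h1 := h.add (h'.smul (-1))
  have h2 := h1.eq_zero' (hf.add_reduced (hg.smul_reduced (-1))) (by
    rw [neg_smul, one_smul, add_neg_cancel])
  rwa [neg_smul, one_smul, add_neg_eq_zero] at h2

theorem IsDual.left_unique (h : IsDual n F f) (h' : IsDual n G f) (hF : IsCochain n F)
    (hG : IsCochain n G) : F = G := by
  have h1 := h.add (h'.smul (-1))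
  have h2 := h1.eq_zero ((A.cochains n).add_mem hF ((A.cochains n).smul_mem (-1) hG)) (by
    rw [neg_smul, one_smul, add_neg_cancel])
  rwa [neg_smul, one_smul, add_neg_eq_zero] at h2

variable (hA n) in
/-- The relation between the Hochschild cohomologies of `A` and of its Koszul dual that is given by
corresponding cocycles. -/
def dualRelation : Submodule k (A.HHCoh n × (A.koszulDual hA).HHCoh n) where
  carrier := {x | ∃ (F : A.cocycles n) (f : (A.koszulDual hA).cocycles n), IsReduced n f.1 ∧
    IsDual n F.1 f.1 ∧ x = (Submodule.Quotient.mk F, Submodule.Quotient.mk f)}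
  add_mem' := by
    rintro _ _ ⟨F, f, h1, h2, rfl⟩ ⟨G, g, h3, h4, rfl⟩
    exact ⟨F + G, f + g, h1.add_reduced h3, h2.add h4, rfl⟩
  zero_mem' := ⟨0, 0, by
    have : IsReduced (hA := hA) n 0 := ⟨((A.koszulDual hA).cochains n).zero_mem, fun _ _ => rfl,
      fun a b => congrFun (delta_zero n) _⟩
    exact this, ⟨fun w => by
      change A.ev (0 : A.Cobar) w = dualSign _ _ • Matrix.diagonal (A.aug (0 : A.carrier))
      rw [map_zero, map_zero, Matrix.diagonal_zero', smul_zero]; rfl, fun c w => by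
      change A.ev (0 : A.Cobar) w = dualSign _ _ • cmatHom c.val (0 : A.carrier)
      rw [map_zero, map_zero, smul_zero]; rfl⟩, rfl⟩
  smul_mem' := by
    rintro r _ ⟨F, f, h1, h2, rfl⟩
    exact ⟨r • F, r • f, h1.smul_reduced r, h2.smul r, rfl⟩

theorem exists_reduced_cocycle (hc : A.IsComplete) (y : (A.koszulDual hA).HHCoh n) :
    ∃ f : (A.koszulDual hA).cocycles n, IsReduced n f.1 ∧ Submodule.Quotient.mk f = y := by
  obtain ⟨⟨f, hf, hδ⟩, rfl⟩ := Submodule.Quotient.mk_surjective _ y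
  have hδ' : delta n f = 0 := hδ
  obtain ⟨g, hg, hl⟩ := exists_reduced hc (n := n) hf fun l _ => congrFun hδ' l
  have hdg : IsCochain n (delta (n - 1) g) := by
    have := hg.delta
    rwa [sub_add_cancel] at this
  have hdd : delta n (delta (n - 1) g) = 0 := by
    have := delta_delta hg
    rwa [sub_add_cancel] at this
  have hd0 : delta n (f - delta (n - 1) g) = 0 := by
    refine (map_sub ((A.koszulDual hA).deltaLin n) f _).trans ?_
    change delta n f - delta n _ = 0
    rw [hδ', hdd, sub_zero]
  have hm := ((A.koszulDual hA).cochains n).sub_mem hf hdg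
  refine ⟨⟨f - delta (n - 1) g, hm, hd0⟩, ⟨hm, hl, fun a b => congrFun hd0 _⟩, ?_⟩
  refine (Submodule.Quotient.eq _).2 ⟨-g, ((A.koszulDual hA).cochains _).neg_mem hg, ?_⟩
  rw [map_neg]
  change -delta (n - 1) g = f - delta (n - 1) g - f
  abel

/-- The comparison isomorphisms of Hochschild cohomology. -/
theorem exists_cohEquiv (hA : A.IsTypical) (hc : A.IsComplete) (n : ℤ) :
    ∃ e : A.HHCoh n ≃ₗ[k] (A.koszulDual hA).HHCoh n,
      ∀ x y, (x, y) ∈ dualRelation hA n → e x = y := by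
  refine exists_linearEquiv_of_relation _ (fun x => ?_) (fun y => ?_) ?_ ?_
  · obtain ⟨⟨F, hF, hδ⟩, rfl⟩ := Submodule.Quotient.mk_surjective _ x
    have hδ' : delta n F = 0 := hδ
    obtain ⟨f, hf, h⟩ := IsCochain.exists_dual hA hF
    exact ⟨_, ⟨F, hF, hδ⟩, ⟨f, hf.toIsCochain, (h.delta hF hf).eq_zero' hf.delta hδ'⟩, hf, h, rfl⟩
  · obtain ⟨f, hf, rfl⟩ := exists_reduced_cocycle hc y
    obtain ⟨F, hF, h⟩ := hf.exists_dual
    exact ⟨_, ⟨F, hF, (h.delta hF hf).eq_zero hF.delta f.2.2⟩, f, hf, h, rfl⟩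
  · rintro _ ⟨F, f, hf, h, e⟩
    obtain ⟨e1, rfl⟩ := Prod.mk.inj e
    obtain ⟨E, hE, hEF⟩ := (Submodule.Quotient.mk_eq_zero _).1 e1.symm
    obtain ⟨e, he, h'⟩ := IsCochain.exists_dual hA hE
    have h2 := h'.delta hE he
    have h3 := he.delta
    rw [sub_add_cancel] at h2 h3
    have hEF' : delta (n - 1) E = F.1 := hEF
    rw [hEF'] at h2
    exact (Submodule.Quotient.mk_eq_zero _).2 ⟨e, he.toIsCochain, h2.right_unique h h3 hf⟩
  · rintro _ ⟨F, f, hf, h, e⟩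
    obtain ⟨rfl, e1⟩ := Prod.mk.inj e
    obtain ⟨e, he, hef⟩ := (Submodule.Quotient.mk_eq_zero _).1 e1.symm
    have hef' : delta (n - 1) e = f.1 := hef
    obtain ⟨g, hg, hl⟩ := exists_reduced hc he fun l hl => by rw [hef', hf.long l hl]
    have hdg := hg.delta
    rw [sub_add_cancel] at hdg
    have hm := ((A.koszulDual hA).cochains (n - 1)).sub_mem he hdg
    have hdd := delta_delta hg
    rw [sub_add_cancel] at hdd
    have hd : delta (n - 1) (e - delta (n - 1 - 1) g) = f.1 := by
      refine (map_sub ((A.koszulDual hA).deltaLin (n - 1)) e _).trans ?_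
      change delta _ e - delta _ _ = _
      rw [hdd, sub_zero, hef']
    have hr : IsReduced (n - 1) (e - delta (n - 1 - 1) g) :=
      ⟨hm, hl, fun a b => by rw [hd, hf.long _ le_rfl]⟩
    obtain ⟨E, hE, h'⟩ := hr.exists_dual
    have h2 := h'.delta hE hr
    have h3 := hE.delta
    rw [hd] at h2
    rw [sub_add_cancel] at h2 h3
    exact (Submodule.Quotient.mk_eq_zero _).2 ⟨E, hE, h2.left_unique h h3 F.2.1⟩

/-- Hochschild cohomology of the Koszul dual is graded commutative. -/
theorem koszulDual_cup_comm (hA : A.IsTypical) (hc : A.IsComplete) (m n p : ℤ) (hp : m + n = p)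
    (x : (A.koszulDual hA).HHCoh m) (y : (A.koszulDual hA).HHCoh n) :
    HHCoh.cup (A.koszulDual hA) m n p hp x y = koszulSign (m * n) •
      HHCoh.cup (A.koszulDual hA) n m p ((add_comm n m).trans hp) y x := by
  obtain ⟨f, hf, rfl⟩ := exists_reduced_cocycle hc x
  obtain ⟨g, rfl⟩ := Submodule.Quotient.mk_surjective _ y
  have h := hf.delta_lam_comp f.2.2 g.2.1 g.2.2
  have hl := isCochain_lam_comp hf.toIsCochain g.2.1
  refine (Submodule.Quotient.eq (p := ((A.koszulDual hA).coboundaries p).submoduleOf _)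
    (x := (A.koszulDual hA).cupCocycles m n p hp f g) (y := koszulSign (m * n) •
      (A.koszulDual hA).cupCocycles n m p ((add_comm n m).trans hp) g f)).2 ?_
  subst hp
  refine ⟨koszulSign m • fun w => hf.lam (g.1 w), zsmul_mem' _ _ hl, ?_⟩
  rw [map_zsmul]
  change koszulSign m • delta (m + n - 1) (fun w => hf.lam (g.1 w)) =
    cup n f.1 g.1 - koszulSign (m * n) • cup m g.1 f.1
  rw [h, smul_smul, koszulSign_mul_self, one_smul]

theorem cohEquiv_cup (hA : A.IsTypical) (hc : A.IsComplete)
    {e : ∀ n, A.HHCoh n ≃ₗ[k] (A.koszulDual hA).HHCoh n}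
    (he : ∀ n x y, (x, y) ∈ dualRelation hA n → e n x = y)
    (m n p : ℤ) (hp : m + n = p) (x : A.HHCoh m) (y : A.HHCoh n) :
    e p (HHCoh.cup A m n p hp x y) = HHCoh.cup (A.koszulDual hA) m n p hp (e m x) (e n y) := by
  obtain ⟨⟨G, hG, hδG⟩, rfl⟩ := Submodule.Quotient.mk_surjective _ x
  obtain ⟨⟨F, hF, hδF⟩, rfl⟩ := Submodule.Quotient.mk_surjective _ y
  have hδF' : delta n F = 0 := hδF
  have hδG' : delta m G = 0 := hδG
  obtain ⟨f, hf, h⟩ := IsCochain.exists_dual hA hF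
  obtain ⟨g, hg, h'⟩ := IsCochain.exists_dual hA hG
  have hδf := (h.delta hF hf).eq_zero' hf.delta hδF'
  have hδg := (h'.delta hG hg).eq_zero' hg.delta hδG'
  have e1 := he n _ _ ⟨⟨F, hF, hδF⟩, ⟨f, hf.toIsCochain, hδf⟩, hf, h, rfl⟩
  have e2 := he m _ _ ⟨⟨G, hG, hδG⟩, ⟨g, hg.toIsCochain, hδg⟩, hg, h', rfl⟩
  have hfg : cup m f g ∈ (A.koszulDual hA).cocycles (n + m) :=
    cup_mem_cocycles rfl ⟨hf.toIsCochain, hδf⟩ ⟨hg.toIsCochain, hδg⟩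
  have hGF : koszulSign (n * m) • cup n G F ∈ A.cocycles (n + m) :=
    zsmul_mem' _ _ (cup_mem_cocycles (add_comm m n) ⟨hG, hδG⟩ ⟨hF, hδF⟩)
  have hr := hf.redStep_cup hc hg hδf hδg
  have hrδ : delta (n + m) (redStep (n + m) (cup m f g)) = 0 :=
    (delta_redStep hfg.1).trans hfg.2
  have e3 := he (n + m) _ _ ⟨⟨_, hGF⟩, ⟨_, hr.toIsCochain, hrδ⟩, hr,
    h.redStep_cup h' hF hG hf hg, rfl⟩
  have e4 : (Submodule.Quotient.mk ⟨_, hr.toIsCochain, hrδ⟩ : (A.koszulDual hA).HHCoh (n + m)) =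
      Submodule.Quotient.mk ⟨cup m f g, hfg⟩ := by
    refine (Submodule.Quotient.eq _).2 ⟨-(koszulSign (n + m) • AugDGKRing.ctr hA (regAct hA) (cup m f g)),
      ((A.koszulDual hA).cochains _).neg_mem (zsmul_mem' _ _ (IsCochain.ctr hfg.1)), ?_⟩
    rw [map_neg, map_zsmul]
    change -(koszulSign (n + m) • delta (n + m - 1) _) = redStep (n + m) (cup m f g) - cup m f g
    rw [redStep]
    abel
  rw [koszulDual_cup_comm hA hc m n p hp, e1, e2]
  obtain rfl : n + m = p := (add_comm n m).trans hp
  rw [e4] at e3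
  have e5 : e (n + m) (koszulSign (n * m) • HHCoh.cup A m n (n + m) hp (Submodule.Quotient.mk
      ⟨G, hG, hδG⟩) (Submodule.Quotient.mk ⟨F, hF, hδF⟩)) =
      HHCoh.cup (A.koszulDual hA) n m (n + m) rfl (Submodule.Quotient.mk ⟨f, hf.toIsCochain, hδf⟩)
        (Submodule.Quotient.mk ⟨g, hg.toIsCochain, hδg⟩) := e3
  rw [map_zsmul] at e5
  rw [← e5, smul_smul, mul_comm m n, koszulSign_mul_self, one_smul]

theorem isDual_cupOne (hA : A.IsTypical) :
    IsDual (hA := hA) 0 A.cupOne (A.koszulDual hA).cupOne where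
  unitPart w := by
    change A.ev 1 w = _
    cases w with
    | nil =>
      rw [ev_one_nil]
      change _ = koszulSign _ • Matrix.diagonal (A.aug 1)
      rw [map_one, barDeg_nil, mul_zero, add_zero, koszulSign_zero, one_smul]
      exact Matrix.diagonal_one.symm
    | cons a w =>
      rw [ev_one_cons]
      change _ = dualSign _ _ • Matrix.diagonal (A.aug 0)
      rw [map_zero, Matrix.diagonal_zero', smul_zero]
  genPart c w := by
    have h : cmat c.val (A.cupOne w) = 0 := by
      cases w with
      | nil =>
        have := cmat_unit c 1
        rwa [map_one] at this
      | cons a w => exact map_zero (cmatHom c.val)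
    rw [h, smul_zero]
    change A.ev (0 : A.Cobar) w = 0
    rw [map_zero]; rfl

theorem isReduced_cupOne (hA : A.IsTypical) : IsReduced (hA := hA) 0 (A.koszulDual hA).cupOne :=
  ⟨isCochain_cupOne _, fun l hl => by
    rcases l with _ | ⟨a, l⟩
    · simp at hl
    · rfl, fun a b => congrFun delta_cupOne _⟩

/-- The isomorphism of graded commutative algebras between the Hochschild cohomologies. -/
theorem exists_cohAlgEquiv (hA : A.IsTypical) (hc : A.IsComplete) :
    (∃ h : ∀ n : ℤ, A.HHCoh n ≃ₗ[k] (A.koszulDual hA).HHCoh n,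
      h 0 (HHCoh.one A) = HHCoh.one (A.koszulDual hA) ∧
      (∀ (m n : ℤ) (x : A.HHCoh m) (y : A.HHCoh n), h (m + n) (HHCoh.cup A m n (m + n) rfl x y) =
        HHCoh.cup (A.koszulDual hA) m n (m + n) rfl (h m x) (h n y))) ∧
    (∀ (m n : ℤ) (x : A.HHCoh m) (y : A.HHCoh n), HHCoh.cup A m n (m + n) rfl x y =
      koszulSign (m * n) • HHCoh.cup A n m (m + n) (add_comm n m) y x) := by
  choose e he using exists_cohEquiv hA hc
  refine ⟨⟨e, he 0 _ _ ⟨_, _, isReduced_cupOne hA, isDual_cupOne hA, rfl⟩,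
    fun m n x y => cohEquiv_cup hA hc he m n _ rfl x y⟩, fun m n x y => (e (m + n)).injective ?_⟩
  rw [cohEquiv_cup hA hc he, map_zsmul, cohEquiv_cup hA hc he]
  exact koszulDual_cup_comm hA hc m n _ rfl _ _

end comparison

/-! ### The pairing of Hochschild chains -/

section rot
variable {M : Type w} [AddCommGroup M] [Module k M]

variable (A) (M) in
/-- The right action of the cobar construction on linear functions by left multiplication of the
argument. -/
def rotAct : RAct A (A.Cobar →ₗ[k] M) :=
  AlgHom.ofLinearMap
    { toFun := fun τ => MulOpposite.op (LinearMap.lcomp k M (LinearMap.mulLeft k τ))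
      map_add' := fun σ τ => by
        rw [← MulOpposite.op_add]
        refine congrArg MulOpposite.op (LinearMap.ext fun n => LinearMap.ext fun x => ?_)
        change n ((σ + τ) * x) = n (σ * x) + n (τ * x)
        rw [add_mul, map_add]
      map_smul' := fun r τ => by
        rw [RingHom.id_apply, ← MulOpposite.op_smul]
        refine congrArg MulOpposite.op (LinearMap.ext fun n => LinearMap.ext fun x => ?_)
        change n ((r • τ) * x) = r • n (τ * x)
        rw [smul_mul_assoc, map_smul] }
    (congrArg MulOpposite.op (LinearMap.ext fun n => LinearMap.ext fun x => by
      change n (1 * x) = n x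
      rw [one_mul]))
    (fun σ τ => congrArg MulOpposite.op (LinearMap.ext fun n => LinearMap.ext fun x => by
      change n (σ * τ * x) = n (σ * (τ * x))
      rw [mul_assoc]))

theorem rotAct_apply (τ : A.Cobar) (n : A.Cobar →ₗ[k] M) (x : A.Cobar) :
    (rotAct A M).act τ n x = n (τ * x) := rfl

/-- The linear extension of `τ ↦ (-1)^((s+1)|τ|) X(- τ)`. -/
def rotSlot (s : ℤ) (X : A.Cobar →ₗ[k] M) : A.Cobar →ₗ[k] A.Cobar →ₗ[k] M :=
  homLift fun i => (fun i => koszulSign ((s + 1) * i)) i •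
    ((LinearMap.mul k A.Cobar).flip.compr₂ X ∘ₗ (A.cobarPiece i).subtype)

theorem rotSlot_apply (s : ℤ) (X : A.Cobar →ₗ[k] M) {n : ℤ} {σ : A.Cobar}
    (hσ : σ ∈ A.cobarPiece n) (τ : A.Cobar) :
    rotSlot s X σ τ = koszulSign ((s + 1) * n) • X (τ * σ) := by
  rw [rotSlot, homLift_sign _ _ hσ]
  rfl

end rot

section pairing

/-- The form `τ ↦ tr(c τ(l))`. -/
def traceForm (l : List A.Red) (c : Matrix (Fin t) (Fin t) k) : A.Cobar →ₗ[k] k :=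
  Matrix.traceLinearMap (Fin t) k k ∘ₗ LinearMap.mulLeft k c ∘ₗ LinearMap.proj l ∘ₗ A.ev

/-- The value of the pairing on generators. -/
def genForm (a : A.Hom) (l : List A.Red) (c : A.Codual) : A.Cobar →ₗ[k] k :=
  koszulSign (a.deg + 1 + a.deg * barDeg l) • traceForm l (cmat c.val a.val)

theorem genForm_apply (a : A.Hom) (l : List A.Red) (c : A.Codual) (τ : A.Cobar) :
    genForm a l c τ =
      koszulSign (a.deg + 1 + a.deg * barDeg l) • (cmat c.val a.val * A.ev τ l).trace := rfl

theorem cmat_codual_lact (c : A.Codual) (x : Fin t → k) (a : A.carrier) :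
    cmat (c.lact x).val a = cmat c.val a * Matrix.diagonal x := by
  rw [← cmat_ract]
  ext p q
  change c.val (A.idem p * a * A.idem q * A.unit x) = c.val (A.idem p * (a * A.unit x) * A.idem q)
  rw [idem, idem, mul_assoc, mul_assoc, mul_assoc, mul_assoc, ← map_mul, ← map_mul, mul_comm x]

theorem cmat_codual_ract (c : A.Codual) (x : Fin t → k) (a : A.carrier) :
    cmat (c.ract x).val a = Matrix.diagonal x * cmat c.val a := by
  rw [← cmat_lact]
  ext p q
  change c.val (A.unit x * (A.idem p * a * A.idem q)) = c.val (A.idem p * (A.unit x * a) * A.idem q)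
  simp only [idem, ← mul_assoc, ← map_mul]
  rw [mul_comm x]

theorem genForm_lact (a : A.Hom) (l : List A.Red) (c : A.Codual) (x : Fin t → k) (τ : A.Cobar) :
    genForm a l (c.lact x) τ = genForm a l c (τ * A.cobarUnit x) := by
  rw [genForm_apply, genForm_apply, ev_mul_unit, cmat_codual_lact, mul_assoc]

theorem genForm_ract (a : A.Hom) (l : List A.Red) (c : A.Codual) (x : Fin t → k) (τ : A.Cobar) :
    genForm a l (c.ract x) τ = genForm a l c (A.cobarUnit x * τ) := by
  rw [genForm_apply, genForm_apply, ev_unit_mul, cmat_codual_ract, mul_assoc, Matrix.trace_mul_comm,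
    mul_assoc]

theorem genForm_eq_zero {a : A.Hom} {l : List A.Red} {c : A.Codual} {n : ℤ} {τ : A.Cobar}
    (hτ : τ ∈ A.cobarPiece n) (h : n - c.deg + a.deg + barDeg l ≠ 0) : genForm a l c τ = 0 := by
  rw [genForm_apply]
  by_cases h1 : a.deg = c.deg
  · rw [ev_eq_zero hτ (by omega), mul_zero, Matrix.trace_zero, smul_zero]
  · rw [cmat_of_mem_ne a.mem h1, zero_mul, Matrix.trace_zero, smul_zero]

theorem isPeel_genForm (a : A.Hom) (l : List A.Red) :
    IsPeel (rotAct A k) fun c => rotSlot (a.deg + barDeg l + 1) (genForm a l c) where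
  add b c d h1 h2 h3 := cobar_hom_ext fun n σ hσ => LinearMap.ext fun τ => by
    simp only [LinearMap.add_apply, rotSlot_apply _ _ hσ, genForm_apply, h3, cmat_add_left, add_mul,
      Matrix.trace_add, smul_add]
  smul r b c h1 h2 := cobar_hom_ext fun n σ hσ => LinearMap.ext fun τ => by
    simp only [LinearMap.smul_apply, rotSlot_apply _ _ hσ, genForm_apply, h2, cmat_smul_left,
      smul_mul_assoc, Matrix.trace_smul, smul_comm r]
  lact x c τ := by
    refine LinearMap.congr_fun (f := rotSlot _ (genForm a l (c.lact x)))
      (g := rotSlot _ (genForm a l c) ∘ₗ LinearMap.mulRight k (A.cobarUnit x))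
      (cobar_hom_ext fun n σ hσ => LinearMap.ext fun τ => ?_) τ
    have h := SetLike.mul_mem_graded hσ (cobarUnit_mem x)
    rw [LinearMap.comp_apply, LinearMap.mulRight_apply, rotSlot_apply _ _ hσ, rotSlot_apply _ _ h,
      genForm_lact, add_zero, mul_assoc]
  ract x c τ := by
    refine LinearMap.congr_fun (f := rotSlot _ (genForm a l (c.ract x)))
      (g := (rotAct A k).act (A.cobarUnit x) ∘ₗ rotSlot _ (genForm a l c))
      (cobar_hom_ext fun n σ hσ => LinearMap.ext fun τ => ?_) τ
    rw [LinearMap.comp_apply, rotAct_apply, rotSlot_apply _ _ hσ, rotSlot_apply _ _ hσ,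
      genForm_ract, mul_assoc]

/-- The universal cyclic derivation, paired with `a ⊗ l`. -/
def cycForm (a : A.Hom) (l : List A.Red) : A.Cobar →ₗ[k] A.Cobar →ₗ[k] k := (isPeel_genForm a l).peel

theorem cycForm_unit (a : A.Hom) (l : List A.Red) (x : Fin t → k) :
    cycForm a l (A.cobarUnit x) = 0 := (isPeel_genForm a l).peel_unit x

theorem cycForm_mul_gen (a : A.Hom) (l : List A.Red) {n : ℤ} {σ : A.Cobar} (hσ : σ ∈ A.cobarPiece n)
    (c : A.Codual) (τ : A.Cobar) :
    cycForm a l (σ * gen c) τ = cycForm a l σ (gen c * τ) +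
      koszulSign ((a.deg + barDeg l) * n) • genForm a l c (τ * σ) := by
  refine (LinearMap.congr_fun ((isPeel_genForm a l).peel_gen σ c) τ).trans ?_
  rw [LinearMap.add_apply, rotSlot_apply _ _ hσ, koszulSign_congr (n := (a.deg + barDeg l) * n)
    ⟨n, by ring⟩]
  rfl

theorem cycForm_gen (a : A.Hom) (l : List A.Red) (c : A.Codual) (τ : A.Cobar) :
    cycForm a l (gen c) τ = genForm a l c τ := by
  have h := cycForm_mul_gen a l (cobarUnit_mem 1) c τ
  rwa [cycForm_unit, map_one, one_mul, mul_one, mul_zero, koszulSign_zero, one_smul,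
    LinearMap.zero_apply, zero_add] at h

theorem cycForm_mul_unit (a : A.Hom) (l : List A.Red) (σ : A.Cobar) (x : Fin t → k) (τ : A.Cobar) :
    cycForm a l (σ * A.cobarUnit x) τ = cycForm a l σ (A.cobarUnit x * τ) :=
  LinearMap.congr_fun ((isPeel_genForm a l).peel_mul_unit σ x) τ

theorem cycForm_mul (a : A.Hom) (l : List A.Red) {n : ℤ} {σ : A.Cobar} (hσ : σ ∈ A.cobarPiece n)
    (ρ τ : A.Cobar) : cycForm a l (σ * ρ) τ =
      koszulSign ((a.deg + barDeg l) * n) • cycForm a l ρ (τ * σ) + cycForm a l σ (ρ * τ) := by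
  refine cobar_rightInduction (P := fun ρ => ∀ τ, cycForm a l (σ * ρ) τ =
    koszulSign ((a.deg + barDeg l) * n) • cycForm a l ρ (τ * σ) + cycForm a l σ (ρ * τ))
    (fun x τ => ?_) (fun u v hu hv τ => ?_) (fun m ρ c hρ ih τ => ?_) ρ τ
  · rw [cycForm_mul_unit, cycForm_unit, LinearMap.zero_apply, smul_zero, zero_add]
  · rw [mul_add, map_add, LinearMap.add_apply, hu, hv, map_add, LinearMap.add_apply,
      add_mul u v τ, map_add, smul_add]
    abel
  · rw [← mul_assoc, cycForm_mul_gen a l (SetLike.mul_mem_graded hσ hρ), cycForm_mul_gen a l hρ, ih,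
      mul_assoc, mul_assoc, mul_assoc, mul_add (a.deg + barDeg l), koszulSign_add, mul_smul, smul_add]
    abel

theorem cycForm_unit_mul (a : A.Hom) (l : List A.Red) (x : Fin t → k) (ρ τ : A.Cobar) :
    cycForm a l (A.cobarUnit x * ρ) τ = cycForm a l ρ (τ * A.cobarUnit x) := by
  rw [cycForm_mul a l (cobarUnit_mem x), cycForm_unit, mul_zero, koszulSign_zero, one_smul,
    LinearMap.zero_apply, add_zero]

theorem cycForm_eq_zero {a : A.Hom} {l : List A.Red} {m n : ℤ} {σ τ : A.Cobar}
    (hσ : σ ∈ A.cobarPiece m) (hτ : τ ∈ A.cobarPiece n) (h : n + m + 1 + a.deg + barDeg l ≠ 0) :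
    cycForm a l σ τ = 0 := by
  refine cobarPiece_induction (P := fun σ => cycForm a l σ τ = 0) (by rw [map_zero]; rfl)
    (fun u v hu hv => by rw [map_add, LinearMap.add_apply, hu, hv, add_zero]) (fun σ h' => ?_) hσ
  clear hσ
  induction h' generalizing n τ with
  | unit x => rw [cycForm_unit]; rfl
  | @mul_gen m σ c h' ih =>
    rw [cycForm_mul_gen a l h'.mem, ih (SetLike.mul_mem_graded (gen_mem c) hτ) (by omega),
      genForm_eq_zero (SetLike.mul_mem_graded hτ h'.mem) (by omega), smul_zero, add_zero]

/-- The value of the pairing on `τ_0 ⊗ []`. -/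
def headForm (a : A.Hom) (l : List A.Red) : A.Cobar →ₗ[k] k :=
  koszulSign (barDeg l) • traceForm l (A.augDiag a.val)

theorem headForm_apply (a : A.Hom) (l : List A.Red) (τ : A.Cobar) :
    headForm a l τ = koszulSign (barDeg l) • (A.augDiag a.val * A.ev τ l).trace := rfl

theorem diagonal_comm (x y : Fin t → k) :
    Matrix.diagonal x * Matrix.diagonal y = Matrix.diagonal y * Matrix.diagonal x := by
  rw [Matrix.diagonal_mul_diagonal, Matrix.diagonal_mul_diagonal]
  simp only [mul_comm]

theorem diagonal_mul (x y : Fin t → k) :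
    Matrix.diagonal (x * y) = Matrix.diagonal x * Matrix.diagonal y :=
  (Matrix.diagonal_mul_diagonal x y).symm

theorem headForm_cyc (a : A.Hom) (l : List A.Red) (x : Fin t → k) (τ : A.Cobar) :
    headForm a l (τ * A.cobarUnit x) = headForm a l (A.cobarUnit x * τ) := by
  rw [headForm_apply, headForm_apply, ev_mul_unit, ev_unit_mul, augDiag_apply, ← mul_assoc,
    diagonal_comm, mul_assoc, Matrix.trace_mul_comm, mul_assoc]

theorem headForm_eq_zero {a : A.Hom} {l : List A.Red} {n : ℤ} {τ : A.Cobar}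
    (hτ : τ ∈ A.cobarPiece n) (h : n + a.deg + barDeg l ≠ 0) : headForm a l τ = 0 := by
  rw [headForm_apply]
  by_cases h1 : a.deg = 0
  · rw [ev_eq_zero hτ (by omega), mul_zero, Matrix.trace_zero, smul_zero]
  · rw [augDiag_apply, A.aug_piece h1 a.mem]
    simp

theorem isCyclic_headForm (τ : A.Cobar) : IsCyclic fun a l => headForm a l τ where
  slots a := by
    have h := ev_multilinear τ
    refine IsMultilinear.weight (F := fun l => (A.augDiag a.val * A.ev τ l).trace)
      (h.map (Matrix.traceLinearMap (Fin t) k k ∘ₗ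
        LinearMap.mulLeft k (A.augDiag a.val))) koszulSign
  add l a b c h1 h2 h3 := by
    simp only [headForm_apply, h3, map_add, add_mul, Matrix.trace_add, smul_add]
  smul l r a c h1 h2 := by
    simp only [headForm_apply, h2, augDiag_apply, map_smul, Matrix.diagonal_smul, smul_mul_assoc,
      Matrix.trace_smul, smul_comm r]
  bal v x a b := by
    simp only [headForm_apply, barDeg_lact, ev_left, augDiag_apply, Hom.ract, map_mul, A.aug_unit,
      ← mul_assoc, diagonal_mul]
  cyc u x a b := by
    simp only [headForm_apply, barDeg_ract, ev_right, augDiag_apply, Hom.lact, map_mul, A.aug_unit,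
      diagonal_mul]
    rw [← mul_assoc, Matrix.trace_mul_comm, mul_assoc]
  cyc_nil x a := by
    simp only [headForm_apply, augDiag_apply, Hom.lact, Hom.ract, map_mul, A.aug_unit, mul_comm]

theorem IsCyclic.add' {M : Type*} [AddCommGroup M] [Module k M] {F G : A.Hom → List A.Red → M}
    (hF : IsCyclic F) (hG : IsCyclic G) : IsCyclic fun a l => F a l + G a l where
  slots a := (hF.slots a).add' (hG.slots a)
  add l a b c h1 h2 h3 := by
    rw [hF.add l a b c h1 h2 h3, hG.add l a b c h1 h2 h3]; abel
  smul l r a c h1 h2 := by rw [hF.smul l r a c h1 h2, hG.smul l r a c h1 h2, smul_add]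
  bal v x a b := by rw [hF.bal, hG.bal]
  cyc u x a b := by rw [hF.cyc, hG.cyc]
  cyc_nil x a := by rw [hF.cyc_nil, hG.cyc_nil]

theorem IsCyclic.weight {M : Type*} [AddCommGroup M] [Module k M] {F : A.Hom → List A.Red → M}
    (hF : IsCyclic F) (c : ℤ → ℤ → ℤ) : IsCyclic fun a l => c a.deg (barDeg l) • F a l where
  slots a := (hF.slots a).weight (c a.deg)
  add l a b d h1 h2 h3 := by rw [hF.add l a b d h1 h2 h3, h1, h2, smul_add]
  smul l r a d h1 h2 := by rw [hF.smul l r a d h1 h2, h1, smul_comm]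
  bal v x a b := by rw [hF.bal, barDeg_lact]; rfl
  cyc u x a b := by rw [hF.cyc, barDeg_ract]; rfl
  cyc_nil x a := congrArg (fun y => c a.deg 0 • y) (hF.cyc_nil x a)

theorem isCyclic_zero {M : Type*} [AddCommGroup M] [Module k M] :
    IsCyclic fun (_ : A.Hom) (_ : List A.Red) => (0 : M) :=
  ⟨fun _ => ⟨by simp, by simp, by simp⟩, by simp, by simp, by simp, by simp, by simp⟩

theorem isCyclic_genForm (c : A.Codual) (τ : A.Cobar) : IsCyclic fun a l => genForm a l c τ := by
  refine IsCyclic.weight (F := fun a l => (cmat c.val a.val * A.ev τ l).trace) ?_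
    fun m n => koszulSign (m + 1 + m * n)
  exact {
    slots := fun a => (ev_multilinear τ).map (Matrix.traceLinearMap (Fin t) k k ∘ₗ
        LinearMap.mulLeft k (cmat c.val a.val))
    add := fun l a b d h1 h2 h3 => by simp only [h3, cmat_add, add_mul, Matrix.trace_add]
    smul := fun l r a d h1 h2 => by simp only [h2, cmat_smul, smul_mul_assoc, Matrix.trace_smul]
    bal := fun v x a b => by
      simp only [Hom.ract]
      rw [cmat_mul_unit, ev_left, mul_assoc]
    cyc := fun u x a b => by
      simp only [Hom.lact]
      rw [cmat_unit_mul, ev_right, ← mul_assoc, Matrix.trace_mul_comm, mul_assoc]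
    cyc_nil := fun x a => by
      simp only [Hom.lact, Hom.ract]
      rw [cmat_unit_mul, cmat_mul_unit, ev_nil, mul_assoc, mul_assoc, diagonal_comm, ← mul_assoc,
        Matrix.trace_mul_comm] }

theorem isCyclic_cycForm (σ τ : A.Cobar) : IsCyclic fun a l => cycForm a l σ τ := by
  refine cobar_rightInduction (P := fun σ => ∀ τ, IsCyclic fun a l => cycForm a l σ τ)
    (fun x τ => ?_) (fun u v hu hv τ => ?_) (fun m ρ c hρ ih τ => ?_) σ τ
  · simp only [cycForm_unit]
    exact isCyclic_zero
  · simp only [map_add, LinearMap.add_apply]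
    exact (hu τ).add' (hv τ)
  · simp only [cycForm_mul_gen _ _ hρ]
    exact (ih _).add' ((isCyclic_genForm c (τ * ρ)).weight fun i j => koszulSign ((i + j) * m))

end pairing

section pairing
variable {hA : A.IsTypical}

/-- The element of the cobar construction underlying a homogeneous element. -/
def hval (a : (A.koszulDual hA).Hom) : A.Cobar := a.val

/-- The pairing of `τ_0 ⊗ w` and `a ⊗ l`. -/
def pairWord (a : A.Hom) (l : List A.Red) (τ : (A.koszulDual hA).Hom) :
    List (A.koszulDual hA).Red → k
  | [] => headForm a l (hval τ)
  | [b] => koszulSign ((a.deg + barDeg l + 1) * b.deg) • cycForm a l (cval b) (hval τ)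
  | _ => 0

theorem pairWord_nil (a : A.Hom) (l : List A.Red) (τ : (A.koszulDual hA).Hom) :
    pairWord a l τ [] = headForm a l (hval τ) := rfl

theorem pairWord_single (a : A.Hom) (l : List A.Red) (τ : (A.koszulDual hA).Hom)
    (b : (A.koszulDual hA).Red) : pairWord a l τ [b] =
      koszulSign ((a.deg + barDeg l + 1) * b.deg) • cycForm a l (cval b) (hval τ) := rfl

theorem pairWord_long (a : A.Hom) (l : List A.Red) (τ : (A.koszulDual hA).Hom)
    {w : List (A.koszulDual hA).Red} (hw : 2 ≤ w.length) : pairWord a l τ w = 0 := by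
  rcases w with _ | ⟨b, _ | ⟨c, w⟩⟩
  · simp at hw
  · simp at hw
  · rfl

theorem isCyclic_pairWord (τ : (A.koszulDual hA).Hom) (w : List (A.koszulDual hA).Red) :
    IsCyclic fun a l => pairWord a l τ w := by
  rcases w with _ | ⟨b, _ | ⟨c, w⟩⟩
  · exact isCyclic_headForm _
  · exact (isCyclic_cycForm (cval b) (hval τ)).weight fun i j => koszulSign ((i + j + 1) * b.deg)
  · exact isCyclic_zero

theorem isCyclic_pairWord_right (a : A.Hom) (l : List A.Red) :
    IsCyclic (pairWord (hA := hA) a l) where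
  slots τ :=
    { add := fun u v b c d h1 h2 h3 => by
        rcases u with _ | ⟨e, _ | ⟨f, u⟩⟩
        · rcases v with _ | ⟨g, v⟩
          · have h4 : cval d = cval b + cval c := h3
            simp only [List.nil_append, pairWord_single, h1, h2, h4, map_add, LinearMap.add_apply,
              smul_add]
          · exact (add_zero _).symm
        · exact (add_zero _).symm
        · exact (add_zero _).symm
      smul := fun u v r b d h1 h2 => by
        rcases u with _ | ⟨e, _ | ⟨f, u⟩⟩
        · rcases v with _ | ⟨g, v⟩
          · have h4 : cval d = r • cval b := h2
            simp only [List.nil_append, pairWord_single, h1, h4, map_smul, LinearMap.smul_apply,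
              smul_comm r]
          · exact (smul_zero _).symm
        · exact (smul_zero _).symm
        · exact (smul_zero _).symm
      bal := fun u v x b c => by
        rcases u with _ | ⟨e, u⟩
        · rfl
        · rw [pairWord_long, pairWord_long] <;> simp <;> omega }
  add w b c d h1 h2 h3 := by
    have h4 : hval d = hval b + hval c := h3
    rcases w with _ | ⟨e, _ | ⟨f, w⟩⟩
    · simp only [pairWord_nil, h4, map_add]
    · simp only [pairWord_single, h4, map_add, smul_add]
    · exact (add_zero _).symm
  smul w r b d h1 h2 := by
    have h4 : hval d = r • hval b := h2
    rcases w with _ | ⟨e, _ | ⟨f, w⟩⟩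
    · simp only [pairWord_nil, h4, map_smul]
    · simp only [pairWord_single, h4, map_smul, smul_comm r]
    · exact (smul_zero _).symm
  bal v x τ b := by
    rcases v with _ | ⟨e, v⟩
    · exact congrArg _ (cycForm_unit_mul a l x (cval b) (hval τ)).symm
    · rfl
  cyc u x τ b := by
    rcases u with _ | ⟨e, u⟩
    · exact congrArg _ (cycForm_mul_unit a l (cval b) x (hval τ))
    · rw [pairWord_long _ _ _ (by simp), pairWord_long _ _ _ (by simp)]
  cyc_nil x τ := headForm_cyc a l x (hval τ)

variable (hA) in
/-- The pairing of the Hochschild chains of the Koszul dual of `A` with those of `A`. -/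
def pairing : (A.koszulDual hA).Chain →ₗ[k] Module.Dual k A.Chain :=
  chainLift (fun τ w => chainLift (fun a l => pairWord a l τ w) (isCyclic_pairWord τ w))
    { slots := fun τ =>
        { add := fun u v b c d h1 h2 h3 => chain_ext fun a l => by
            simp only [LinearMap.add_apply, chainLift_sym]
            exact ((isCyclic_pairWord_right a l).slots τ).add u v b c d h1 h2 h3
          smul := fun u v r b d h1 h2 => chain_ext fun a l => by
            simp only [LinearMap.smul_apply, chainLift_sym]
            exact ((isCyclic_pairWord_right a l).slots τ).smul u v r b d h1 h2
          bal := fun u v x b c => chain_ext fun a l => by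
            simp only [chainLift_sym]
            exact ((isCyclic_pairWord_right a l).slots τ).bal u v x b c }
      add := fun w b c d h1 h2 h3 => chain_ext fun a l => by
        simp only [LinearMap.add_apply, chainLift_sym]
        exact (isCyclic_pairWord_right a l).add w b c d h1 h2 h3
      smul := fun w r b d h1 h2 => chain_ext fun a l => by
        simp only [LinearMap.smul_apply, chainLift_sym]
        exact (isCyclic_pairWord_right a l).smul w r b d h1 h2
      bal := fun v x τ b => chain_ext fun a l => by
        simp only [chainLift_sym]
        exact (isCyclic_pairWord_right a l).bal v x τ b
      cyc := fun u x τ b => chain_ext fun a l => by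
        simp only [chainLift_sym]
        exact (isCyclic_pairWord_right a l).cyc u x τ b
      cyc_nil := fun x τ => chain_ext fun a l => by
        simp only [chainLift_sym]
        exact (isCyclic_pairWord_right a l).cyc_nil x τ }

theorem pairing_sym (τ : (A.koszulDual hA).Hom) (w : List (A.koszulDual hA).Red) (a : A.Hom)
    (l : List A.Red) : pairing hA (sym τ w) (sym a l) = pairWord a l τ w := by
  rw [pairing, chainLift_sym, chainLift_sym]

theorem pairWord_eq_zero {a : A.Hom} {l : List A.Red} {τ : (A.koszulDual hA).Hom}
    {w : List (A.koszulDual hA).Red} (h : τ.deg + barDeg w + a.deg + barDeg l ≠ 0) :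
    pairWord a l τ w = 0 := by
  rcases w with _ | ⟨b, _ | ⟨c, w⟩⟩
  · exact headForm_eq_zero τ.mem (by simpa only [barDeg_nil, add_zero] using h)
  · rw [pairWord_single, cycForm_eq_zero (σ := cval b) (τ := hval τ) b.mem τ.mem, smul_zero]
    simpa only [barDeg_cons, barDeg_nil, add_zero, ← add_assoc] using h
  · rfl

theorem koszulSign_smul_mem {M : Type*} [AddCommGroup M] [Module k M] {S : Submodule k M} (e : ℤ)
    {y : M} (h : koszulSign e • y ∈ S) : y ∈ S := by
  have := zsmul_mem' S (koszulSign e) h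
  rwa [smul_smul, koszulSign_mul_self, one_smul] at this

theorem bar_mul_gen {m : ℤ} {σ : A.Cobar} (hσ : σ ∈ A.cobarPiece m) (c : A.Codual)
    (hσc : σ * gen c ∈ A.cobarPiece (m + (-c.deg - 1))) {M : Type*} [AddCommGroup M] [Module k M]
    {Φ : List (A.koszulDual hA).Red → M} (hΦ : IsMultilinear Φ) :
    Φ [(cobarHom hA _ (σ * gen c) hσc).bar] = Φ [(cobarHom hA m σ hσ).bar.mul (redGen hA c)] +
      Φ [redGen hA (c.lact (A.cobarAug σ))] := by
  have e2 : (cobarHom hA _ (σ * gen c) hσc).bar.val =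
      ((cobarHom hA m σ hσ).bar.mul (redGen hA c)).val +
        (redGen hA (c.lact (A.cobarAug σ))).val := by
    change σ * gen c - A.cobarUnit (A.cobarAug (σ * gen c)) =
      (σ - A.cobarUnit (A.cobarAug σ)) * gen c + gen (c.lact (A.cobarAug σ))
    rw [map_mul, cobarAug_gen, mul_zero, map_zero, sub_zero, sub_mul, gen_lact, sub_add_cancel]
  by_cases hm : m = 0
  · subst hm
    exact hΦ.add [] [] _ _ (cobarHom hA _ (σ * gen c) hσc).bar rfl (zero_add _).symm e2
  · rw [hΦ.zero_cons (a := redGen hA (c.lact (A.cobarAug σ))) ?_ [], add_zero]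
    · refine congrArg (fun z => Φ [z]) (Red.ext rfl (e2.trans ?_))
      refine (congrArg _ (?_ : (redGen hA (c.lact (A.cobarAug σ))).val = 0)).trans (add_zero _)
      exact (gen_lact _ _).trans (by rw [cobarAug_piece hm hσ, map_zero, zero_mul]; rfl)
    · exact (gen_lact _ _).trans (by rw [cobarAug_piece hm hσ, map_zero, zero_mul]; rfl)

/-- Spanning of the chains, up to the boundaries of words of length two. -/
theorem chains_le {S : Submodule k (A.koszulDual hA).Chain} {n : ℤ}
    (h0 : ∀ τ : (A.koszulDual hA).Hom, τ.deg = n → sym τ [] ∈ S)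
    (h1 : ∀ (τ : (A.koszulDual hA).Hom) (c : A.Codual), τ.deg - c.deg = n →
      sym τ [redGen hA c] ∈ S)
    (h2 : ∀ (τ : (A.koszulDual hA).Hom) (w : List (A.koszulDual hA).Red), 2 ≤ w.length →
      τ.deg + barDeg w = n → sym τ w ∈ S)
    (hb : ∀ (τ : (A.koszulDual hA).Hom) (w : List (A.koszulDual hA).Red), w.length = 2 →
      τ.deg + barDeg w = n + 1 → (A.koszulDual hA).hochBoundary (sym τ w) ∈ S) :
    (A.koszulDual hA).chains n ≤ S := by
  refine Submodule.span_le.2 ?_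
  rintro _ ⟨τ, w, hn, rfl⟩
  rcases w with _ | ⟨b, _ | ⟨c, w⟩⟩
  · exact h0 τ (by simpa only [barDeg_nil, add_zero] using hn)
  · suffices H : ∀ (m : ℤ) (σ : A.Cobar) (hσ : σ ∈ A.cobarPiece m) (τ : (A.koszulDual hA).Hom),
        τ.deg + m + 1 = n → sym τ [(cobarHom hA m σ hσ).bar] ∈ S by
      have h := H b.deg (cval b) b.mem τ (by
        simpa only [barDeg_cons, barDeg_nil, add_zero, ← add_assoc] using hn)
      rwa [show (cobarHom hA b.deg (cval b) b.mem).bar = b from Red.bar_toHom b] at h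
    intro m σ hσ
    have hmul := fun τ : (A.koszulDual hA).Hom => isCyclic_sym.slots τ
    refine (cobarPiece_induction (P := fun σ => ∃ hσ : σ ∈ A.cobarPiece m,
      ∀ τ : (A.koszulDual hA).Hom, τ.deg + m + 1 = n → sym τ [(cobarHom hA m σ hσ).bar] ∈ S)
      ⟨Submodule.zero_mem _, fun τ _ => ?_⟩ (fun σ σ' => ?_) (fun σ h => ⟨h.mem, ?_⟩) hσ).2
    · rw [(hmul τ).zero_cons ?_ []]
      · exact S.zero_mem
      · change (0 : A.Cobar) - A.cobarUnit (A.cobarAug 0) = 0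
        rw [map_zero, map_zero, sub_zero]
    · rintro ⟨hs, h⟩ ⟨hs', h'⟩
      refine ⟨Submodule.add_mem _ hs hs', fun τ hτ => ?_⟩
      have e := (hmul τ).add [] [] (cobarHom hA m σ hs).bar (cobarHom hA m σ' hs').bar
        (cobarHom hA m _ (Submodule.add_mem _ hs hs')).bar rfl rfl (by
          change σ + σ' - A.cobarUnit (A.cobarAug (σ + σ')) =
            σ - A.cobarUnit (A.cobarAug σ) + (σ' - A.cobarUnit (A.cobarAug σ'))
          rw [map_add, map_add]; abel)
      exact (congrArg (· ∈ S) e).mpr (S.add_mem (h τ hτ) (h' τ hτ))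
    · clear hσ
      induction h with
      | unit x =>
        intro τ _
        rw [(hmul τ).zero_cons ?_ []]
        · exact S.zero_mem
        · change A.cobarUnit x - A.cobarUnit (A.cobarAug (A.cobarUnit x)) = 0
          rw [cobarAug_unit, sub_self]
      | @mul_gen m σ c h ih =>
        intro τ hτ
        rw [bar_mul_gen h.mem c _ (hmul τ)]
        refine S.add_mem ?_ ?_
        · set s := (cobarHom hA m σ h.mem).bar with hs
          have hd : s.deg = m := rfl
          have hc : (redGen hA c).deg = -c.deg - 1 := rfl
          have hbs := hb τ [s, redGen hA c] rfl (by
            simp only [barDeg_cons, barDeg_nil, hd, hc]; omega)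
          rw [hochBoundary, chainLift_sym] at hbs
          have e : boundaryFun sym τ [s, redGen hA c] = sym τ.diff [s, redGen hA c] +
              koszulSign τ.deg • (-sym τ [s.diff, redGen hA c] +
                koszulSign s.deg • sym τ [s.mul (redGen hA c)] +
                koszulSign (s.deg + 1) • (-sym τ [s, (redGen hA c).diff])) +
              koszulSign (τ.deg + 1) • sym (τ.mul s.toHom) [redGen hA c] +
              koszulSign ((τ.deg + barDeg [s]) * ((redGen hA c).deg + 1)) •
                sym ((redGen hA c).toHom.mul τ) [s] := by
            simp only [boundaryFun, barDiff_cons, barDiff_nil, mergeHead, smul_zero, add_zero,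
              headTerm]
            congr 1
          rw [e] at hbs
          have m1 := h2 τ.diff [s, redGen hA c] (by simp) (by
            simp only [barDeg_cons, barDeg_nil, hd, hc, Hom.diff]; omega)
          have m2 := h2 τ [s.diff, redGen hA c] (by simp) (by
            simp only [barDeg_cons, barDeg_nil, hc, Red.diff, Hom.diff, hd]; omega)
          have m3 := h2 τ [s, (redGen hA c).diff] (by simp) (by
            simp only [barDeg_cons, barDeg_nil, hd, Red.diff, Hom.diff, hc]; omega)
          have m4 := h1 (τ.mul s.toHom) c (by
            change τ.deg + m - c.deg = n; omega)
          have m5 := ih ((redGen hA c).toHom.mul τ) (by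
            change -c.deg - 1 + τ.deg + m + 1 = n; omega)
          refine koszulSign_smul_mem s.deg (koszulSign_smul_mem τ.deg ?_)
          have m6 := S.sub_mem (S.sub_mem (S.sub_mem hbs m1) (zsmul_mem' S
            (koszulSign (τ.deg + 1)) m4)) (zsmul_mem' S
              (koszulSign ((τ.deg + barDeg [s]) * ((redGen hA c).deg + 1))) m5)
          have m7 := S.add_mem (S.add_mem m6 (zsmul_mem' S (koszulSign τ.deg) m2))
            (zsmul_mem' S (koszulSign τ.deg) (zsmul_mem' S (koszulSign (s.deg + 1)) m3))
          refine (congrArg (· ∈ S) ?_).mpr m7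
          module
        · by_cases hm : m = 0
          · exact h1 τ (c.lact _) (by change τ.deg - c.deg = n; omega)
          · rw [(hmul τ).zero_cons ?_ []]
            · exact S.zero_mem
            · exact (gen_lact _ _).trans (by rw [cobarAug_piece hm h.mem, map_zero, zero_mul]; rfl)
  · exact h2 τ _ (by simp) hn

end pairing

section cycSum
variable {hA : A.IsTypical}

theorem splitSum_shift {α M : Type*} [AddCommGroup M] {G H : List α → List α → M}
    {l : List α} (h : ∀ u b v, u ++ b :: v = l → G u (b :: v) = H (u ++ [b]) v) :
    splitSum G l + H [] l = G l [] + splitSum H l := by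
  induction l generalizing G H with
  | nil => rfl
  | cons b l ih =>
    have := ih (G := fun u v => G (b :: u) v) (H := fun u v => H (b :: u) v)
      fun u c v huv => h (b :: u) c v (congrArg (b :: ·) huv)
    rw [splitSum_cons, splitSum_cons, h [] b l rfl, List.nil_append, add_assoc,
      add_left_comm (G (b :: l) []), ← this]
    abel

theorem splitSum_eq_first {α M : Type*} [AddCommGroup M] {G : List α → List α → M} {l : List α}
    (h : ∀ b u v, G (b :: u) v = 0) : splitSum G l = G [] l := by
  cases l with
  | nil => rfl
  | cons b l =>
    rw [splitSum_cons, splitSum_congr (H := fun _ _ => 0) fun u v _ => h b u v, splitSum_zero,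
      add_zero]

/-- The sum over the cyclic words that contain `a` in the first factor. -/
def cycSum (a : A.Hom) (φ ψ : A.MatFun) (l : List A.Red) : k :=
  splitSum (fun v => splitSum fun m u =>
    koszulSign (barDeg u * (a.deg + 1 + barDeg v + barDeg m) + barDeg m) •
      (φ (u ++ a.bar :: v) * ψ m).trace) l

theorem cycSum_mul_gen (a : A.Hom) (l : List A.Red) {n : ℤ} {σ : A.Cobar} (hσ : σ ∈ A.cobarPiece n)
    (c : A.Codual) (τ : A.Cobar) : cycSum a (A.ev (σ * gen c)) (A.ev τ) l =
      koszulSign ((a.deg + barDeg l + 1) * (c.deg + 1)) • cycSum a (A.ev σ) (A.ev (gen c * τ)) l +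
      koszulSign ((a.deg + barDeg l + 1) * (n - c.deg - 1)) •
        koszulSign ((a.deg + barDeg l) * n) • genForm a l c (τ * σ) := by
  have h1 : ∀ v m : List A.Red, v ++ m = l →
      koszulSign (barDeg m) • (cmat c.val a.bar.val * A.ev σ v * A.ev τ m).trace =
      koszulSign ((a.deg + barDeg l + 1) * (n - c.deg - 1)) • koszulSign ((a.deg + barDeg l) * n) •
        koszulSign (a.deg + 1 + a.deg * barDeg l) •
          (cmat c.val a.val * (A.ev σ v * A.ev τ m)).trace := by
    intro v m hl
    rw [cmat_bar, mul_assoc]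
    by_cases ha : a.deg = c.deg
    · by_cases hv : barDeg v = -n
      · rw [zsmul_sign, zsmul_sign, ← hl, barDeg_append, hv, ← ha]
        congr 1
        obtain ⟨q, hq⟩ := Int.even_mul_succ_self a.deg
        refine koszulSign_congr ⟨-(a.deg + 1) * (n + barDeg m) + n * n - n * a.deg + 2 * barDeg m -
          barDeg m * n + a.deg * n + barDeg m * a.deg + q, by linear_combination hq⟩
      · rw [ev_eq_zero hσ hv]
        simp
    · rw [cmat_of_mem_ne a.mem ha]
      simp
  have h2 : koszulSign ((a.deg + barDeg l + 1) * (n - c.deg - 1)) •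
      koszulSign ((a.deg + barDeg l) * n) • genForm a l c (τ * σ) =
      splitSum (fun v m => koszulSign (barDeg m) •
        (cmat c.val a.bar.val * A.ev σ v * A.ev τ m).trace) l := by
    rw [splitSum_congr h1, splitSum_zsmul, splitSum_zsmul, splitSum_zsmul, genForm_apply, ev_mul,
      mul_splitSum]
    congr 3
    exact map_splitSum (Matrix.traceAddMonoidHom (Fin t) k) _ _
  rw [h2, cycSum, cycSum, ← splitSum_zsmul, ← splitSum_add]
  refine splitSum_congr fun v r hl => ?_
  have h3 := splitSum_shift (l := r) (G := fun m u =>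
    koszulSign (barDeg u * (a.deg + 1 + barDeg v + barDeg m) + barDeg m) •
      (A.ev (σ * gen c) (u ++ a.bar :: v) * A.ev τ m).trace)
    (H := fun m u => koszulSign ((a.deg + barDeg l + 1) * (c.deg + 1)) •
      koszulSign (barDeg u * (a.deg + 1 + barDeg v + barDeg m) + barDeg m) •
      (A.ev σ (u ++ a.bar :: v) * A.ev (gen c * τ) m).trace) fun m b u hr => by
      rw [ev_gen_mul_concat, List.cons_append, ev_mul_gen_cons]
      by_cases hb : b.deg = c.deg
      · rw [mul_assoc, Matrix.trace_mul_comm, mul_assoc, zsmul_sign, ← hl, ← hr]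
        simp only [barDeg_append, barDeg_cons, barDeg_nil, ← hb]
        congr 1
        obtain ⟨q, hq⟩ := Int.even_mul_succ_self b.deg
        refine koszulSign_congr ⟨-q - (b.deg + 1) - barDeg u * (b.deg + 1), ?_⟩
        linear_combination -hq
      · rw [cmat_eq_zero hb]
        simp
  rw [ev_gen_mul_nil, mul_zero, Matrix.trace_zero, smul_zero, smul_zero, add_zero] at h3
  rw [h3, splitSum_zsmul, add_comm]
  simp only [barDeg_nil, zero_mul, zero_add, List.nil_append, ev_mul_gen_cons]

theorem cycForm_eq_cycSum (a : A.Hom) (l : List A.Red) {n : ℤ} {σ : A.Cobar}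
    (hσ : σ ∈ A.cobarPiece n) (τ : A.Cobar) :
    koszulSign ((a.deg + barDeg l + 1) * n) • cycForm a l σ τ = cycSum a (A.ev σ) (A.ev τ) l := by
  refine cobarPiece_induction (P := fun σ => koszulSign ((a.deg + barDeg l + 1) * n) •
    cycForm a l σ τ = cycSum a (A.ev σ) (A.ev τ) l) ?_ (fun u v hu hv => ?_) (fun σ h => ?_) hσ
  · simp only [map_zero, LinearMap.zero_apply, smul_zero, cycSum, Pi.zero_apply, zero_mul,
      Matrix.trace_zero]
    exact ((splitSum_congr fun v r _ => splitSum_zero r).trans (splitSum_zero l)).symm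
  · rw [map_add, LinearMap.add_apply, smul_add, hu, hv, cycSum, cycSum, cycSum, ← splitSum_add]
    refine splitSum_congr fun v r _ => ?_
    rw [← splitSum_add]
    refine splitSum_congr fun m u _ => ?_
    rw [map_add, Pi.add_apply, add_mul, Matrix.trace_add, smul_add]
  · clear hσ
    induction h generalizing τ with
    | unit x =>
      rw [cycForm_unit, LinearMap.zero_apply, smul_zero, cycSum,
        splitSum_congr (H := fun _ _ => 0) fun v r _ => ?_, splitSum_zero]
      rw [splitSum_congr (H := fun _ _ => 0) fun m u _ => ?_, splitSum_zero]
      obtain ⟨b, w, hw⟩ := List.exists_cons_of_ne_nil (l := u ++ a.bar :: v) (by simp)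
      rw [hw, ev_unit_cons, zero_mul, Matrix.trace_zero, smul_zero]
    | @mul_gen m σ c h ih =>
      rw [cycForm_mul_gen a l h.mem, cycSum_mul_gen a l h.mem, ← ih, smul_add,
        zsmul_sign _ ((a.deg + barDeg l + 1) * m), show m + (-c.deg - 1) = m - c.deg - 1 by ring]
      congr 2
      apply koszulSign_congr
      exact ⟨-((a.deg + barDeg l + 1) * (c.deg + 1)), by ring⟩

end cycSum

section chainMap
variable {hA : A.IsTypical}

theorem headTerm_cons' {M : Type*} [AddCommGroup M] (F : A.Hom → List A.Red → M) (a : A.Hom)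
    (b : A.Red) (l : List A.Red) :
    headTerm F a (b :: l) = koszulSign (a.deg + 1) • F (a.mul b.toHom) l := rfl

/-- The value of `cycSum` on a function that is supported on words of length at most two. -/
theorem cycSum_short (a : A.Hom) {φ ψ : A.MatFun} (hφ : ∀ w, 3 ≤ w.length → φ w = 0)
    {l l₁ l₂ : List A.Red} {b z : A.Red} (h1 : l = b :: l₁) (h2 : l = l₂ ++ [z]) :
    cycSum a φ ψ l = koszulSign (barDeg l) • (φ [a.bar] * ψ l).trace +
      koszulSign (barDeg l₁) • (φ [a.bar, b] * ψ l₁).trace +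
      koszulSign ((z.deg + 1) * (a.deg + 1 + barDeg l₂) + barDeg l₂) •
        (φ [z, a.bar] * ψ l₂).trace := by
  have e1 : splitSum (fun m u => koszulSign (barDeg u * (a.deg + 1 + barDeg ([] : List A.Red) + barDeg m) +
      barDeg m) • (φ (u ++ [a.bar]) * ψ m).trace) l =
      koszulSign ((z.deg + 1) * (a.deg + 1 + barDeg l₂) + barDeg l₂) •
        (φ [z, a.bar] * ψ l₂).trace + koszulSign (barDeg l) • (φ [a.bar] * ψ l).trace := by
    rw [h2, splitSum_concat, splitSum_eq_last (l := l₂)]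
    · simp [barDeg_nil, barDeg_cons]
    · intro m u hu
      rw [hφ, zero_mul, Matrix.trace_zero, smul_zero]
      have := List.length_pos_iff.2 hu
      simp; omega
  have e2 : splitSum (fun v => splitSum fun m u =>
      koszulSign (barDeg u * (a.deg + 1 + barDeg (b :: v) + barDeg m) + barDeg m) •
        (φ (u ++ a.bar :: b :: v) * ψ m).trace) l₁ =
      koszulSign (barDeg l₁) • (φ [a.bar, b] * ψ l₁).trace := by
    rw [splitSum_eq_first, splitSum_eq_last]
    · simp [barDeg_nil]
    · intro m u hu
      rw [hφ, zero_mul, Matrix.trace_zero, smul_zero]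
      have := List.length_pos_iff.2 hu
      simp; omega
    · intro c v r
      refine (splitSum_congr fun m u _ => ?_).trans (splitSum_zero r)
      rw [hφ, zero_mul, Matrix.trace_zero, smul_zero]
      simp; omega
  rw [cycSum, h1, splitSum_cons, ← h1, e1, e2]
  abel

theorem ev_diff_gen_single (c : A.Codual) (a : A.Red) :
    A.ev (cobarDiff hA (gen c)) [a] = koszulSign (a.deg + 1) • cmat c.val (A.d a.val) := by
  rw [ev_diff, barDiff_gen_single, smul_neg, ← neg_smul, ← koszulSign_succ]
  congr 1
  apply koszulSign_eq
  simp only [barDeg_cons, barDeg_nil]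
  omega

theorem pairWord_single_eq (a : A.Hom) (l : List A.Red) (τ : (A.koszulDual hA).Hom)
    (b : (A.koszulDual hA).Red) :
    pairWord a l τ [b] = cycSum a (A.ev (cval b)) (A.ev (hval τ)) l :=
  cycForm_eq_cycSum a l (σ := cval b) b.mem (hval τ)

theorem pairWord_gen (a : A.Hom) (l : List A.Red) (τ : (A.koszulDual hA).Hom) (c : A.Codual) :
    pairWord a l τ [redGen hA c] =
      koszulSign (barDeg l) • (cmat c.val a.val * A.ev (hval τ) l).trace := by
  change koszulSign ((a.deg + barDeg l + 1) * (-c.deg - 1)) • cycForm a l (gen c) (hval τ) = _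
  rw [cycForm_gen, genForm_apply, zsmul_sign]
  by_cases h : a.deg = c.deg
  · rw [← h]
    congr 1
    obtain ⟨q, hq⟩ := Int.even_mul_succ_self a.deg
    exact koszulSign_congr ⟨-q - barDeg l, by linear_combination -hq⟩
  · rw [cmat_of_mem_ne a.mem h, zero_mul, Matrix.trace_zero, smul_zero, smul_zero]

theorem pairing_boundary_left (τ : (A.koszulDual hA).Hom) (w : List (A.koszulDual hA).Red)
    (a : A.Hom) (l : List A.Red) :
    pairing hA ((A.koszulDual hA).hochBoundary (sym τ w)) (sym a l) =
      boundaryFun (fun τ w => pairWord a l τ w) τ w := by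
  rw [hochBoundary, chainLift_sym]
  refine (map_boundaryFun (LinearMap.applyₗ (sym a l) ∘ₗ pairing hA) sym τ w).trans ?_
  congr 1
  funext τ w
  exact pairing_sym τ w a l

theorem pairing_boundary_right (τ : (A.koszulDual hA).Hom) (w : List (A.koszulDual hA).Red)
    (a : A.Hom) (l : List A.Red) :
    pairing hA (sym τ w) (A.hochBoundary (sym a l)) = boundaryFun (fun a l => pairWord a l τ w) a l := by
  rw [hochBoundary, chainLift_sym, map_boundaryFun]
  congr 1
  funext a l
  exact pairing_sym τ w a l

theorem boundary_pairWord_nil (τ : (A.koszulDual hA).Hom) (a : A.Hom) (l : List A.Red) :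
    boundaryFun (fun τ w => pairWord a l τ w) τ [] = koszulSign (a.deg + barDeg l) •
      boundaryFun (fun a l => pairWord a l τ []) a l := by
  have e1 : headTerm (fun a l => pairWord a l τ []) a l = 0 := by
    rcases l with _ | ⟨b, l⟩
    · rfl
    · rw [headTerm_cons', pairWord_nil, headForm_apply, augDiag_apply]
      simp [Hom.mul, b.aug_eq]
  have e2 : lastTerm (fun a l => pairWord a l τ []) a l = 0 := by
    obtain rfl | ⟨l, z, rfl⟩ := List.eq_nil_or_concat' l
    · rfl
    · rw [lastTerm_concat, pairWord_nil, headForm_apply, augDiag_apply]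
      simp [Hom.mul, z.aug_eq]
  have e3 : pairWord a.diff l τ [] = 0 := by
    rw [pairWord_nil, headForm_apply, augDiag_apply]
    simp [Hom.diff, A.aug_d]
  have e4 : barDiff (fun l => pairWord a l τ []) l = koszulSign (barDeg l - 1) •
      (A.augDiag a.val * barDiff (A.ev (hval τ)) l).trace := by
    refine (barDiff_weight koszulSign (fun l => (A.augDiag a.val * A.ev (hval τ) l).trace) l).trans ?_
    congr 1
    exact map_barDiff (Matrix.traceLinearMap (Fin t) k k ∘ₗ LinearMap.mulLeft k (A.augDiag a.val)) _ _
  rw [boundaryFun, boundaryFun, e1, e2, e3, e4, barDiff_nil, lastTerm_nil, pairWord_nil,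
    headForm_apply]
  change koszulSign (barDeg l) • (A.augDiag a.val * A.ev (cobarDiff hA (hval τ)) l).trace + _ +
    (0 : k) + 0 = _
  rw [ev_diff, mul_smul_comm, Matrix.trace_smul, zsmul_sign, smul_zero]
  simp only [add_zero, zero_add, zsmul_sign]
  congr 1
  apply koszulSign_eq; ring_nf; omega

theorem koszulSign_smul_congr {m n : ℤ} {x : k} (h : x ≠ 0 → Even (m - n)) :
    koszulSign m • x = koszulSign n • x := by
  by_cases hx : x = 0
  · rw [hx, smul_zero, smul_zero]
  · rw [koszulSign_congr (h hx)]

theorem boundary_pairWord_gen (τ : (A.koszulDual hA).Hom) (c : A.Codual) (a : A.Hom)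
    (l : List A.Red) :
    boundaryFun (fun τ w => pairWord a l τ w) τ [redGen hA c] = koszulSign (a.deg + barDeg l) •
      boundaryFun (fun a l => pairWord a l τ [redGen hA c]) a l := by
  have e4 : barDiff (fun l => pairWord a l τ [redGen hA c]) l = koszulSign (barDeg l - 1) •
      (cmat c.val a.val * barDiff (A.ev (hval τ)) l).trace := by
    simp only [pairWord_gen]
    refine (barDiff_weight koszulSign (fun l => (cmat c.val a.val * A.ev (hval τ) l).trace) l).trans ?_
    congr 1
    exact map_barDiff (Matrix.traceLinearMap (Fin t) k k ∘ₗ LinearMap.mulLeft k (cmat c.val a.val)) _ _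
  have e5 : pairWord a l τ.diff [redGen hA c] =
      -(cmat c.val a.val * barDiff (A.ev (hval τ)) l).trace := by
    rw [pairWord_gen]
    change koszulSign (barDeg l) • (_ * A.ev (cobarDiff hA (hval τ)) l).trace = _
    rw [ev_diff, mul_smul_comm, Matrix.trace_smul, zsmul_sign, koszulSign_eq_neg_one (by omega),
      neg_smul, one_smul]
  have e6 : boundaryFun (fun τ w => pairWord a l τ w) τ [redGen hA c] =
      pairWord a l τ.diff [redGen hA c] - koszulSign τ.deg • pairWord a l τ [(redGen hA c).diff] +
      koszulSign (τ.deg + 1) • headForm a l (hval τ * gen c) +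
      koszulSign (τ.deg * c.deg) • headForm a l (gen c * hval τ) := by
    have h := lastTerm_concat (fun τ w => pairWord a l τ w) τ [] (redGen hA c)
    rw [boundaryFun, barDiff_cons, mergeHead_nil, barDiff_nil, headTerm_cons', ← List.nil_append
      [redGen hA c], h, koszulSign_congr
        (m := (τ.deg + barDeg []) * ((redGen hA c).deg + 1)) (n := τ.deg * c.deg)]
    · simp only [smul_zero, add_zero, smul_neg, List.nil_append, sub_eq_add_neg]
      rfl
    · change Even ((τ.deg + 0) * (-c.deg - 1 + 1) - τ.deg * c.deg)
      exact ⟨-(τ.deg * c.deg), by ring⟩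
  have e7 : pairWord a l τ [(redGen hA c).diff] =
      cycSum a (A.ev (cobarDiff hA (gen c))) (A.ev (hval τ)) l := pairWord_single_eq _ _ _ _
  have hτ : hval τ ∈ A.cobarPiece τ.deg := τ.mem
  rw [e6, e7, e5, boundaryFun, e4, headForm_apply, headForm_apply]
  obtain rfl | ⟨l₂, z, h2⟩ := List.eq_nil_or_concat' l
  · have g : cycSum a (A.ev (cobarDiff hA (gen c))) (A.ev (hval τ)) [] =
        (A.ev (cobarDiff hA (gen c)) [a.bar] * A.ev (hval τ) []).trace := by
      simp [cycSum, splitSum_nil, barDeg_nil, koszulSign_zero]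
    rw [g, ev_diff_gen_single, Hom.d_bar, ev_mul_gen_nil, ev_gen_mul_nil, lastTerm_nil, pairWord_gen]
    have g1 : koszulSign τ.deg • (cmat c.val (A.d a.val) * A.ev (hval τ) []).trace =
        (cmat c.val (A.d a.val) * A.ev (hval τ) []).trace := by
      by_cases h : τ.deg = 0
      · rw [h, koszulSign_zero, one_smul]
      · rw [ev_eq_zero hτ (by rw [barDeg_nil]; omega), mul_zero, Matrix.trace_zero, smul_zero]
    have g2 : a.bar.deg = a.deg := rfl
    have g3 : headTerm (fun a l => pairWord a l τ [redGen hA c]) a [] = 0 := rfl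
    have g4 : a.diff.val = A.d a.val := rfl
    rw [g3, barDiff_nil, smul_mul_assoc, Matrix.trace_smul, smul_comm, g1, g2, g4, barDeg_nil,
      koszulSign_succ]
    simp [koszulSign_zero]
  obtain ⟨b, l₁, h1⟩ := List.exists_cons_of_ne_nil (l := l) (by simp [h2])
  have t1 : headTerm (fun a l => pairWord a l τ [redGen hA c]) a l =
      koszulSign (a.deg + 1 + barDeg l₁) •
        (cmat c.val (a.val * b.val) * A.ev (hval τ) l₁).trace := by
    rw [h1, headTerm_cons', pairWord_gen, zsmul_sign]; rfl
  have t2 : lastTerm (fun a l => pairWord a l τ [redGen hA c]) a l =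
      koszulSign ((a.deg + barDeg l₂) * (z.deg + 1) + barDeg l₂) •
        (cmat c.val (z.val * a.val) * A.ev (hval τ) l₂).trace := by
    rw [h2, lastTerm_concat, pairWord_gen, zsmul_sign]; rfl
  have t3 : (A.augDiag a.val * A.ev (hval τ * gen c) l).trace =
      (A.augDiag a.val * cmat c.val b.val * A.ev (hval τ) l₁).trace := by
    rw [h1, ev_mul_gen_cons, mul_assoc]
  have t4 : (A.augDiag a.val * A.ev (gen c * hval τ) l).trace =
      (cmat c.val z.val * A.augDiag a.val * A.ev (hval τ) l₂).trace := by
    rw [h2, ev_gen_mul_concat, ← mul_assoc, Matrix.trace_mul_comm, mul_assoc]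
  rw [t1, t2, t3, t4, cycSum_short a (fun w hw => ev_diff_gen_long c hw) h1 h2, ev_diff_gen_single,
    ev_diff_gen_pair, ev_diff_gen_pair, Hom.d_bar, cmat_bar_mul, cmat_mul_bar, pairWord_gen]
  simp only [smul_mul_assoc, sub_mul, Matrix.trace_sub, Matrix.trace_smul, smul_sub, smul_add]
  have v1 : ∀ (m : Matrix (Fin t) (Fin t) k) (w : List A.Red),
      (m * A.ev (hval τ) w).trace ≠ 0 → τ.deg = -barDeg w := fun m w hw => by
    by_contra h
    rw [ev_eq_zero hτ (by omega), mul_zero, Matrix.trace_zero] at hw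
    exact hw rfl
  have d1 : barDeg l = b.deg + 1 + barDeg l₁ := by rw [h1, barDeg_cons]
  have d2 : barDeg l = barDeg l₂ + (z.deg + 1) := by
    rw [h2, barDeg_append, barDeg_cons, barDeg_nil, add_zero]
  have d3 : a.bar.deg = a.deg := rfl
  have f1 : koszulSign (τ.deg + (barDeg l + (a.deg + 1))) •
      (cmat c.val (A.d a.val) * A.ev (hval τ) l).trace = koszulSign (a.deg + barDeg l + barDeg l + 1) •
      (cmat c.val (A.d a.val) * A.ev (hval τ) l).trace := koszulSign_smul_congr fun h => by
    rw [v1 _ _ h]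
    exact ⟨-barDeg l, by ring⟩
  have f2 : koszulSign (τ.deg + (barDeg l₁ + (b.deg + 1))) •
      (cmat c.val (a.val * b.val) * A.ev (hval τ) l₁).trace =
      koszulSign (a.deg + barDeg l + (a.deg + 1 + barDeg l₁) + 1) •
      (cmat c.val (a.val * b.val) * A.ev (hval τ) l₁).trace := koszulSign_smul_congr fun h => by
    rw [v1 _ _ h, d1]
    exact ⟨-a.deg - barDeg l₁ - 1, by ring⟩
  have f3 : koszulSign (τ.deg + 1 + barDeg l) =
      koszulSign (τ.deg + (barDeg l₁ + (b.deg + 1)) + 1) := by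
    rw [d1]; congr 1; ring
  have f4 : koszulSign (τ.deg + ((z.deg + 1) * (a.deg + 1 + barDeg l₂) + barDeg l₂ + (a.deg + 1))) •
      (cmat c.val (z.val * a.val) * A.ev (hval τ) l₂).trace =
      koszulSign (a.deg + barDeg l + ((a.deg + barDeg l₂) * (z.deg + 1) + barDeg l₂) + 1) •
      (cmat c.val (z.val * a.val) * A.ev (hval τ) l₂).trace := koszulSign_smul_congr fun h => by
    rw [v1 _ _ h, d2]
    exact ⟨-barDeg l₂, by ring⟩
  have f5 : koszulSign (τ.deg * c.deg + barDeg l) •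
      (cmat c.val z.val * A.augDiag a.val * A.ev (hval τ) l₂).trace =
      koszulSign (τ.deg + ((z.deg + 1) * (a.deg + 1 + barDeg l₂) + barDeg l₂ + (a.deg + 1)) + 1) •
      (cmat c.val z.val * A.augDiag a.val * A.ev (hval τ) l₂).trace :=
    koszulSign_smul_congr fun h => by
      rw [v1 _ _ h, d2]
      have g1 : a.deg = 0 := by
        by_contra h'
        rw [augDiag_apply, A.aug_piece h' a.mem] at h
        simp at h
      have g2 : z.deg = c.deg := by
        by_contra h'
        rw [cmat_eq_zero h'] at h
        simp at h
      rw [g1, g2]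
      exact ⟨-(barDeg l₂ * c.deg) - 1, by ring⟩
  have f6 : koszulSign (a.deg + barDeg l + (a.deg + (barDeg l - 1))) = -1 :=
    koszulSign_eq_neg_one (by omega)
  have f7 : a.diff.val = A.d a.val := rfl
  simp only [zsmul_sign, d3, f7]
  simp only [f1, f2, f3, f4, f5, f6, koszulSign_succ]
  module

theorem barDiff_zero_of {M : Type*} [AddCommGroup M] {F : List A.Red → M} {l : List A.Red}
    (h : ∀ w, l.length ≤ w.length + 1 → F w = 0) : barDiff F l = 0 :=
  (barDiff_congr h).trans (barDiff_zero l)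

theorem boundary_pairWord_long (τ : (A.koszulDual hA).Hom) {w : List (A.koszulDual hA).Red}
    (hw : 2 ≤ w.length) (a : A.Hom) (l : List A.Red) :
    boundaryFun (fun τ w => pairWord a l τ w) τ w = 0 := by
  rcases w with _ | ⟨b, _ | ⟨c, _ | ⟨e, w⟩⟩⟩
  · simp at hw
  · simp at hw
  · have e1 : boundaryFun (fun τ w => pairWord a l τ w) τ [b, c] =
        koszulSign (τ.deg + b.deg) • pairWord a l τ [b.mul c] +
        koszulSign (τ.deg + 1) • pairWord a l (τ.mul b.toHom) [c] +
        koszulSign ((τ.deg + (b.deg + 1)) * (c.deg + 1)) • pairWord a l (c.toHom.mul τ) [b] := by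
      have h0 : ∀ (τ : (A.koszulDual hA).Hom) (x y : (A.koszulDual hA).Red),
        pairWord a l τ [x, y] = 0 := fun _ _ _ => rfl
      have h1 : lastTerm (fun τ w => pairWord a l τ w) τ [b, c] = _ :=
        lastTerm_concat (fun τ w => pairWord a l τ w) τ [b] c
      rw [boundaryFun, barDiff_cons, barDiff_cons, mergeHead_cons, mergeHead_nil, barDiff_nil,
        headTerm_cons', h1, barDeg_cons, barDeg_nil, h0, h0, h0]
      simp only [smul_zero, add_zero, zero_add, neg_zero, zsmul_sign]
    rw [e1]
    by_cases h : τ.deg + b.deg + c.deg + a.deg + barDeg l + 1 = 0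
    · have e2 := cycForm_mul a l (σ := cval b) b.mem (cval c) (hval τ)
      have e3 : cval (b.mul c) = cval b * cval c := rfl
      have e4 : hval (τ.mul b.toHom) = hval τ * cval b := rfl
      have e5 : hval (c.toHom.mul τ) = cval c * hval τ := rfl
      have e6 : a.deg = -τ.deg - b.deg - c.deg - barDeg l - 1 := by omega
      rw [pairWord_single, pairWord_single, pairWord_single, e3, e4, e5, e2, Red.mul_deg, e6]
      simp only [zsmul_sign, smul_add]
      obtain ⟨r, hr⟩ := Int.even_mul_succ_self c.deg
      have s1 : koszulSign (τ.deg + 1 + (-τ.deg - b.deg - c.deg - barDeg l - 1 + barDeg l + 1) *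
          c.deg) = koszulSign (τ.deg + b.deg + ((-τ.deg - b.deg - c.deg - barDeg l - 1 + barDeg l +
          1) * (b.deg + c.deg) + (-τ.deg - b.deg - c.deg - barDeg l - 1 + barDeg l) * b.deg) + 1) := by
        exact koszulSign_congr ⟨(τ.deg + b.deg + c.deg) * b.deg, by ring⟩
      have s2 : koszulSign ((τ.deg + (b.deg + 1)) * (c.deg + 1) +
          (-τ.deg - b.deg - c.deg - barDeg l - 1 + barDeg l + 1) * b.deg) =
          koszulSign (τ.deg + b.deg + (-τ.deg - b.deg - c.deg - barDeg l - 1 + barDeg l +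
          1) * (b.deg + c.deg) + 1) := by
        exact koszulSign_congr ⟨r + c.deg * (τ.deg + b.deg), by linear_combination hr⟩
      rw [s1, s2, koszulSign_succ, koszulSign_succ]
      module
    · rw [pairWord_eq_zero, pairWord_eq_zero, pairWord_eq_zero]
      · simp only [smul_zero, add_zero]
      all_goals
        simp only [barDeg_cons, barDeg_nil, Red.mul_deg, Hom.mul_deg]
        omega
  · have h1 : headTerm (fun τ w => pairWord a l τ w) τ (b :: c :: e :: w) = 0 := by
      rw [headTerm_cons', pairWord_long _ _ _ (by simp), smul_zero]
    have h2 : lastTerm (fun τ w => pairWord a l τ w) τ (b :: c :: e :: w) = 0 := by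
      obtain ⟨u, z, hu⟩ := (List.eq_nil_or_concat' (b :: c :: e :: w)).resolve_left (by simp)
      have h3 := congrArg List.length hu
      rw [hu, lastTerm_concat, pairWord_long, smul_zero]
      simp at h3; omega
    rw [boundaryFun, h1, h2, barDiff_zero_of fun v hv => pairWord_long _ _ _ (by simp at hv; omega),
      pairWord_long _ _ _ (by simp)]
    simp

variable (hA) in
/-- The chains on which the pairing is compatible with the boundary. -/
def pairCompat : Submodule k (A.koszulDual hA).Chain where
  carrier := {x | ∀ (a : A.Hom) (l : List A.Red),
    pairing hA ((A.koszulDual hA).hochBoundary x) (sym a l) =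
      koszulSign (a.deg + barDeg l) • pairing hA x (A.hochBoundary (sym a l))}
  add_mem' {x y} hx hy a l := by
    rw [map_add, map_add, map_add, LinearMap.add_apply, LinearMap.add_apply, hx, hy, smul_add]
  zero_mem' a l := by simp
  smul_mem' r x hx a l := by
    rw [map_smul, map_smul, map_smul, LinearMap.smul_apply, LinearMap.smul_apply, hx, smul_comm r]

theorem sym_mem_chains (a : A.Hom) (l : List A.Red) : sym a l ∈ A.chains (a.deg + barDeg l) :=
  Submodule.subset_span ⟨a, l, rfl, rfl⟩

theorem sym_mem_pairCompat {τ : (A.koszulDual hA).Hom} {w : List (A.koszulDual hA).Red}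
    (h : ∀ (a : A.Hom) (l : List A.Red), boundaryFun (fun τ w => pairWord a l τ w) τ w =
      koszulSign (a.deg + barDeg l) • boundaryFun (fun a l => pairWord a l τ w) a l) :
    sym τ w ∈ pairCompat hA := fun a l => by
  rw [pairing_boundary_left, pairing_boundary_right, h]

theorem boundary_pairWord_long' (τ : (A.koszulDual hA).Hom) {w : List (A.koszulDual hA).Red}
    (hw : 2 ≤ w.length) (a : A.Hom) (l : List A.Red) :
    boundaryFun (fun a l => pairWord a l τ w) a l = 0 := by
  have h : (fun (a : A.Hom) (l : List A.Red) => pairWord a l τ w) = fun _ _ => 0 :=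
    funext fun a => funext fun l => pairWord_long a l τ hw
  rw [h, boundaryFun, barDiff_zero]
  rcases l with _ | ⟨b, l⟩
  · simp [lastTerm_nil, headTerm]
  · obtain ⟨u, z, hu⟩ := (List.eq_nil_or_concat' (b :: l)).resolve_left (by simp)
    rw [hu, lastTerm_concat, ← hu, headTerm_cons']
    simp

theorem chains_le_pairCompat (n : ℤ) : (A.koszulDual hA).chains n ≤ pairCompat hA := by
  refine chains_le (fun τ _ => sym_mem_pairCompat fun a l => boundary_pairWord_nil τ a l)
    (fun τ c _ => sym_mem_pairCompat fun a l => boundary_pairWord_gen τ c a l)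
    (fun τ w hw _ => sym_mem_pairCompat fun a l => ?_) (fun τ w hw _ a l => ?_)
  · rw [boundary_pairWord_long τ hw, boundary_pairWord_long' τ hw, smul_zero]
  · rw [hochBoundary_hochBoundary, map_zero]
    have h : pairing hA ((A.koszulDual hA).hochBoundary (sym τ w)) = 0 := chain_ext fun a l => by
      rw [pairing_boundary_left, boundary_pairWord_long τ hw.ge]; rfl
    rw [h]
    simp

/-- The pairing is compatible with the Hochschild boundaries. -/
theorem pairing_boundary (x : (A.koszulDual hA).Chain) (a : A.Hom) (l : List A.Red) :
    pairing hA ((A.koszulDual hA).hochBoundary x) (sym a l) =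
      koszulSign (a.deg + barDeg l) • pairing hA x (A.hochBoundary (sym a l)) := by
  have h : LinearMap.applyₗ (sym a l) ∘ₗ pairing hA ∘ₗ (A.koszulDual hA).hochBoundary =
      koszulSign (a.deg + barDeg l) • (LinearMap.applyₗ (A.hochBoundary (sym a l)) ∘ₗ pairing hA) :=
    chain_ext fun τ w => chains_le_pairCompat _ (sym_mem_chains τ w) a l
  exact LinearMap.congr_fun h x

end chainMap

section connesPairing
variable {hA : A.IsTypical}

theorem cval_bar_ev (τ : (A.koszulDual hA).Hom) {w : List A.Red} (hw : w ≠ []) :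
    A.ev (cval τ.bar) w = A.ev (hval τ) w := by
  obtain ⟨b, w, rfl⟩ := List.exists_cons_of_ne_nil hw
  change A.ev (hval τ - A.cobarUnit (A.cobarAug (hval τ))) (b :: w) = _
  rw [map_sub, Pi.sub_apply, ev_unit_cons, sub_zero]

theorem connes_pairWord_nil (τ : (A.koszulDual hA).Hom) (a : A.Hom) (l : List A.Red) :
    connesFun (fun τ w => pairWord a l τ w) τ [] = koszulSign (a.deg + barDeg l + 1) •
      connesFun (fun a l => pairWord a l τ []) a l := by
  have h1 : hval (Hom.one (A.koszulDual hA)) = 1 := rfl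
  rw [connesFun, connesFun, splitSum_nil, barDeg_nil, mul_zero, koszulSign_zero, one_smul,
    List.nil_append, pairWord_single_eq, cycSum, ← splitSum_zsmul, h1]
  refine splitSum_congr fun v r hl => ?_
  rw [splitSum_eq_first fun b m u => by rw [ev_one_cons, mul_zero, Matrix.trace_zero, smul_zero],
    ev_one_nil, mul_one, cval_bar_ev τ (by simp), pairWord_nil, headForm_apply, augDiag_apply]
  have h2 : (Hom.one A).val = 1 := rfl
  rw [h2, map_one, zsmul_sign, zsmul_sign, ← hl]
  have h3 : Matrix.diagonal (1 : Fin t → k) = 1 := Matrix.diagonal_one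
  rw [h3, one_mul]
  congr 1
  simp only [barDeg_append, barDeg_cons, barDeg_nil]
  rw [show a.bar.deg = a.deg from rfl]
  exact koszulSign_congr ⟨-(a.deg + barDeg v + barDeg r + 1), by ring⟩

theorem pairWord_one_single (τ : (A.koszulDual hA).Hom) (b : (A.koszulDual hA).Red)
    (l : List A.Red) : pairWord (Hom.one A) l τ [b] = 0 := by
  rw [pairWord_single_eq, cycSum, splitSum_congr (H := fun _ _ => 0) fun v r _ => ?_, splitSum_zero]
  rw [splitSum_congr (H := fun _ _ => 0) fun m u _ => ?_, splitSum_zero]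
  rw [(ev_multilinear _).zero, zero_mul, Matrix.trace_zero, smul_zero]
  change (1 : A.carrier) - A.unit (A.aug 1) = 0
  rw [map_one, map_one, sub_self]

/-- The pairing is compatible with the Connes operators. -/
theorem pairing_connes (x : (A.koszulDual hA).Chain) (a : A.Hom) (l : List A.Red) :
    pairing hA ((A.koszulDual hA).connes x) (sym a l) =
      koszulSign (a.deg + barDeg l + 1) • pairing hA x (A.connes (sym a l)) := by
  have h : LinearMap.applyₗ (sym a l) ∘ₗ pairing hA ∘ₗ (A.koszulDual hA).connes =
      koszulSign (a.deg + barDeg l + 1) • (LinearMap.applyₗ (A.connes (sym a l)) ∘ₗ pairing hA) := by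
    refine chain_ext fun τ w => ?_
    have e1 : pairing hA ((A.koszulDual hA).connes (sym τ w)) (sym a l) =
        connesFun (fun τ w => pairWord a l τ w) τ w := by
      rw [AugDGKRing.connes, chainLift_sym]
      refine (map_connesFun (LinearMap.applyₗ (sym a l) ∘ₗ pairing hA) sym τ w).trans ?_
      congr 1
      funext τ w
      exact pairing_sym τ w a l
    have e2 : pairing hA (sym τ w) (A.connes (sym a l)) =
        connesFun (fun a l => pairWord a l τ w) a l := by
      rw [AugDGKRing.connes, chainLift_sym, map_connesFun]
      congr 1
      funext a l
      exact pairing_sym τ w a l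
    refine e1.trans (Eq.trans ?_ (congrArg (fun y => koszulSign (a.deg + barDeg l + 1) • y) e2.symm))
    by_cases hw : w = []
    · rw [hw]
      exact connes_pairWord_nil τ a l
    · have e3 : connesFun (fun τ w => pairWord a l τ w) τ w = 0 :=
        (splitSum_congr fun u v huv => by
          refine (congrArg _ (pairWord_long a l _ ?_)).trans (smul_zero _)
          have := List.length_pos_iff.2 hw
          simp only [← huv, List.length_append, List.length_cons] at this ⊢
          omega).trans
          (splitSum_zero w)
      have e4 : connesFun (fun a l => pairWord a l τ w) a l = 0 :=
        (splitSum_congr fun u v huv => by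
          rcases w with _ | ⟨b, _ | ⟨c, w⟩⟩
          · exact absurd rfl hw
          · exact (congrArg _ (pairWord_one_single τ b _)).trans (smul_zero _)
          · exact smul_zero _).trans (splitSum_zero l)
      rw [e3, e4, smul_zero]
  exact LinearMap.congr_fun h x

theorem pairing_eq_zero {n : ℤ} {x : (A.koszulDual hA).Chain} (hx : x ∈ (A.koszulDual hA).chains n)
    {a : A.Hom} {l : List A.Red} (h : a.deg + barDeg l ≠ -n) : pairing hA x (sym a l) = 0 := by
  suffices H : (A.koszulDual hA).chains n ≤
      LinearMap.ker (LinearMap.applyₗ (sym a l) ∘ₗ pairing hA) from H hx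
  refine Submodule.span_le.2 ?_
  rintro _ ⟨τ, w, hn, rfl⟩
  exact (pairing_sym τ w a l).trans (pairWord_eq_zero (by omega))

end connesPairing

section cyclic
variable {hA : A.IsTypical} {M : Type w} [AddCommGroup M] [Module k M]
  {F : (A.koszulDual hA).Hom → List (A.koszulDual hA).Red → M}

/-- A cyclic function as a function on words with values in linear functions of the first entry. -/
def IsCyclic.lin (hF : IsCyclic F) (l : List (A.koszulDual hA).Red) : A.Cobar →ₗ[k] M :=
  homLift fun i => (fun i => koszulSign (i * barDeg l)) i •
    ({ toFun := fun σ => F (cobarHom hA i σ.1 σ.2) l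
       map_add' := fun σ τ => hF.add l _ _ _ rfl rfl rfl
       map_smul' := fun r σ => hF.smul l r _ _ rfl rfl } : A.cobarPiece i →ₗ[k] M)

theorem IsCyclic.lin_apply (hF : IsCyclic F) (l : List (A.koszulDual hA).Red)
    (a : (A.koszulDual hA).Hom) : hF.lin l (hval a) = koszulSign (a.deg * barDeg l) • F a l :=
  homLift_apply _ a.mem

theorem IsCyclic.eq_lin (hF : IsCyclic F) (l : List (A.koszulDual hA).Red)
    (a : (A.koszulDual hA).Hom) : F a l = koszulSign (a.deg * barDeg l) • hF.lin l (hval a) := by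
  rw [hF.lin_apply, smul_smul, koszulSign_mul_self, one_smul]

theorem linearMap_hom_ext {L L' : A.Cobar →ₗ[k] M}
    (h : ∀ a : (A.koszulDual hA).Hom, L (hval a) = L' (hval a)) : L = L' :=
  cobar_hom_ext fun n σ hσ => h (cobarHom hA n σ hσ)

theorem IsCyclic.lin_isRightLin (hF : IsCyclic F) : IsRightLin hA (rotAct A M) hF.lin where
  add u v b c d h1 h2 h3 := linearMap_hom_ext (hA := hA) fun a => by
    rw [LinearMap.add_apply, hF.lin_apply, hF.lin_apply, hF.lin_apply,
      (hF.slots a).add u v b c d h1 h2 h3, smul_add]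
    simp only [barDeg_append, barDeg_cons, h1, h2]
  smul u v r b d h1 h2 := linearMap_hom_ext (hA := hA) fun a => by
    rw [LinearMap.smul_apply, hF.lin_apply, hF.lin_apply, (hF.slots a).smul u v r b d h1 h2,
      smul_comm r]
    simp only [barDeg_append, barDeg_cons, h1]
  bal u v x b c := linearMap_hom_ext (hA := hA) fun a => by
    rw [hF.lin_apply, hF.lin_apply, (hF.slots a).bal]
    simp only [barDeg_append, barDeg_cons]
    rfl
  right u x b := linearMap_hom_ext (hA := hA) fun a => by
    rw [hF.lin_apply, hF.cyc, rotAct_apply, barDeg_ract]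
    exact (hF.lin_apply _ (a.lact x)).symm

theorem IsCyclic.lin_lact (hF : IsCyclic F) (x : Fin t → k) (b : (A.koszulDual hA).Red)
    (w : List (A.koszulDual hA).Red) :
    hF.lin (b.lact x :: w) = hF.lin (b :: w) ∘ₗ LinearMap.mulRight k (A.cobarUnit x) :=
  linearMap_hom_ext (hA := hA) fun a => by
    rw [hF.lin_apply, ← hF.bal, barDeg_lact]
    exact (hF.lin_apply _ (a.ract x)).symm

theorem ctr_left {N : Type*} [AddCommGroup N] [Module k N] {ρ : RAct A N}
    {Φ : List (A.koszulDual hA).Red → N} (hΦ : IsRightLin hA ρ Φ) (f : N →ₗ[k] N)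
    (hf : ∀ (τ : A.Cobar) (n : N), ρ.act τ (f n) = f (ρ.act τ n)) (x : Fin t → k)
    (hl : ∀ (b : (A.koszulDual hA).Red) (w : List (A.koszulDual hA).Red),
      Φ (b.lact x :: w) = f (Φ (b :: w)))
    (b : (A.koszulDual hA).Red) (w : List (A.koszulDual hA).Red) :
    ctr hA ρ Φ (b.lact x :: w) = f (ctr hA ρ Φ (b :: w)) := by
  by_cases hw : w = []
  · subst hw
    rw [ctr_single hΦ, ctr_single hΦ]
    change hΦ.peel (A.cobarUnit x * cval b) = f (hΦ.peel (cval b))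
    refine cobar_rightInduction (P := fun τ => hΦ.peel (A.cobarUnit x * τ) = f (hΦ.peel τ))
      (fun y => ?_) (fun a b ha hb => ?_) (fun m σ c hσ ih => ?_) (cval b)
    · rw [← map_mul, hΦ.peel_unit, hΦ.peel_unit, map_zero]
    · rw [mul_add, map_add, map_add, ha, hb, map_add]
    · have hσ' : A.cobarUnit x * σ ∈ A.cobarPiece m := unit_mul_mem (A := A.koszulDual hA) hσ x
      rw [← mul_assoc, hΦ.peel_gen hσ', hΦ.peel_gen hσ, ih, hf, map_add, map_zsmul]
      congr 2
      have h := hl (cobarHom hA m σ hσ).bar [redGen hA c]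
      rw [← Hom.bar_lact] at h
      exact h
  · have e : (fun l => Φ (b.lact x :: l)) = fun l => f (Φ (b :: l)) := funext fun l => hl b l
    have h1 := hΦ.prefix (b.lact x)
    rw [e] at h1
    have h := ctr_comp (ρ' := ρ) 0 f (fun n τ y _ => by
      rw [zero_mul, koszulSign_zero, one_smul, hf]) (hΦ.prefix b) (by
        simpa only [zero_mul, koszulSign_zero, one_smul] using h1) w
    simp only [zero_mul, koszulSign_zero, one_smul] at h
    rw [ctr_cons _ _ hw, ctr_cons _ _ hw, e, h, map_zsmul]
    rfl

/-- The contraction of cyclic functions. -/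
def IsCyclic.contr (hF : IsCyclic F) (a : (A.koszulDual hA).Hom)
    (l : List (A.koszulDual hA).Red) : M :=
  koszulSign (a.deg * barDeg l) • AugDGKRing.ctr hA (rotAct A M) hF.lin l (hval a)

theorem IsCyclic.isCyclic_contr (hF : IsCyclic F) : IsCyclic hF.contr := by
  have hC := hF.lin_isRightLin.ctr
  refine IsCyclic.weight (F := fun a l => AugDGKRing.ctr hA (rotAct A M) hF.lin l (hval a)) ?_
    fun m n => koszulSign (m * n)
  exact {
    slots := fun a => hC.toIsMultilinear.map (LinearMap.applyₗ (hval a))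
    add := fun l a b c _ _ h => (congrArg _ h).trans (map_add _ _ _)
    smul := fun l r a c _ h => (congrArg _ h).trans (map_smul _ _ _)
    bal := fun v x a b => by
      rw [ctr_left hF.lin_isRightLin (LinearMap.lcomp k M (LinearMap.mulRight k (A.cobarUnit x)))
        (fun τ n => LinearMap.ext fun y => congrArg n (mul_assoc τ y _)) x
        (fun b w => hF.lin_lact x b w)]
      rfl
    cyc := fun u x a b => by
      rw [hC.right]
      rfl
    cyc_nil := fun x a => by
      rw [ctr_nil]
      rfl }

theorem IsCyclic.lin_contr (hF : IsCyclic F) :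
    hF.isCyclic_contr.lin = AugDGKRing.ctr hA (rotAct A M) hF.lin :=
  funext fun l => linearMap_hom_ext (hA := hA) fun a => by
    rw [IsCyclic.lin_apply, IsCyclic.contr, smul_smul, koszulSign_mul_self, one_smul]

/-- The part of the boundary of a cyclic function that comes from the differential of the first
entry. -/
def entryDiff (hA : A.IsTypical) (Φ : List (A.koszulDual hA).Red → A.Cobar →ₗ[k] M)
    (l : List (A.koszulDual hA).Red) : A.Cobar →ₗ[k] M :=
  koszulSign (barDeg l) • (Φ l ∘ₗ A.cobarDiff hA)

/-- The linear extension of `x ↦ -(-1)^(|x||b|) x b`. -/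
def signMulRight (b : (A.koszulDual hA).Red) : A.Cobar →ₗ[k] A.Cobar :=
  homLift fun i => (fun i => koszulSign (i * b.deg + 1)) i •
    (LinearMap.mulRight k (cval b) ∘ₗ (A.cobarPiece i).subtype)

theorem signMulRight_apply (b : (A.koszulDual hA).Red) {n : ℤ} {σ : A.Cobar}
    (hσ : σ ∈ A.cobarPiece n) :
    signMulRight b σ = koszulSign (n * b.deg + 1) • (σ * cval b) :=
  homLift_sign (fun i => koszulSign (i * b.deg + 1)) (LinearMap.mulRight k (cval b)) hσ

theorem signMulRight_mul (b : (A.koszulDual hA).Red) {n : ℤ} {τ : A.Cobar}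
    (hτ : τ ∈ A.cobarPiece n) (x : A.Cobar) :
    signMulRight b (τ * x) = koszulSign (b.deg * n) • (τ * signMulRight b x) := by
  refine LinearMap.congr_fun (f := signMulRight b ∘ₗ LinearMap.mulLeft k τ)
    (g := koszulSign (b.deg * n) • (LinearMap.mulLeft k τ ∘ₗ signMulRight b))
    (cobar_hom_ext fun m σ hσ => ?_) x
  rw [LinearMap.smul_apply, LinearMap.comp_apply, LinearMap.comp_apply, LinearMap.mulLeft_apply,
    LinearMap.mulLeft_apply, signMulRight_apply b hσ,
    signMulRight_apply b (SetLike.mul_mem_graded hτ hσ), mul_smul_comm, smul_smul,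
    ← koszulSign_add, mul_assoc]
  congr 1
  exact koszulSign_congr ⟨0, by ring⟩

/-- The part of the boundary of a cyclic function that comes from the multiplication of the first
two entries. -/
def entryMul (Φ : List (A.koszulDual hA).Red → A.Cobar →ₗ[k] M) :
    List (A.koszulDual hA).Red → A.Cobar →ₗ[k] M
  | [] => 0
  | b :: l => koszulSign (b.deg * barDeg l) • LinearMap.lcomp k M (signMulRight b) (Φ l)

theorem IsCyclic.lin_boundary (hF : IsCyclic F) (l : List (A.koszulDual hA).Red) :
    hF.boundary.lin l =
      wordDiff (rotAct A M) hF.lin l + entryDiff hA hF.lin l + entryMul hF.lin l := by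
  refine linearMap_hom_ext (hA := hA) fun a => ?_
  have e1 : AugDGKRing.barDiff hF.lin l (hval a) =
      koszulSign (a.deg * (barDeg l - 1)) • AugDGKRing.barDiff (F a) l := by
    rw [← barDiff_weight (fun n => koszulSign (a.deg * n))]
    refine (map_barDiff (LinearMap.applyₗ (hval a) : (A.Cobar →ₗ[k] M) →ₗ[k] M) hF.lin l).symm.trans
      (congrArg (fun G => AugDGKRing.barDiff G l) (funext fun w => hF.lin_apply w a))
  have e2 : lastAct (rotAct A M) hF.lin l (hval a) =
      koszulSign (a.deg * barDeg l) • AugDGKRing.lastTerm F a l := by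
    obtain rfl | ⟨u, z, rfl⟩ := List.eq_nil_or_concat' l
    · rw [lastAct_nil, lastTerm_nil, smul_zero]; rfl
    · rw [lastAct_concat, lastTerm_concat, LinearMap.smul_apply, rotAct_apply]
      refine (congrArg _ (hF.lin_apply u (z.toHom.mul a))).trans ?_
      rw [smul_smul, smul_smul, ← koszulSign_add, ← koszulSign_add, barDeg_append, barDeg_cons,
        barDeg_nil]
      congr 1
      change koszulSign (barDeg u + (z.deg + a.deg) * barDeg u) = _
      exact koszulSign_congr ⟨-(a.deg * (z.deg + 1)), by ring⟩
  have e3 : entryDiff hA hF.lin l (hval a) = koszulSign (a.deg * barDeg l) • F a.diff l := by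
    rw [entryDiff, LinearMap.smul_apply]
    refine (congrArg _ (hF.lin_apply l a.diff)).trans ?_
    rw [smul_smul, ← koszulSign_add]
    congr 1
    change koszulSign (barDeg l + (a.deg - 1) * barDeg l) = _
    exact koszulSign_congr ⟨0, by ring⟩
  have e4 : entryMul hF.lin l (hval a) =
      koszulSign (a.deg * barDeg l) • AugDGKRing.headTerm F a l := by
    rcases l with _ | ⟨b, l⟩
    · rw [AugDGKRing.headTerm, smul_zero]; rfl
    · rw [entryMul, AugDGKRing.headTerm, LinearMap.smul_apply, LinearMap.lcomp_apply]
      refine (congrArg (fun y => _ • hF.lin l y) (signMulRight_apply b a.mem)).trans ?_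
      rw [map_zsmul]
      refine (congrArg (fun y => _ • _ • y) (hF.lin_apply l (a.mul b.toHom))).trans ?_
      rw [smul_smul, smul_smul, smul_smul, ← koszulSign_add, ← koszulSign_add, ← koszulSign_add,
        barDeg_cons]
      congr 1
      change koszulSign (b.deg * barDeg l + (a.deg * b.deg + 1) + (a.deg + b.deg) * barDeg l) = _
      exact koszulSign_congr ⟨b.deg * barDeg l - a.deg, by ring⟩
  rw [hF.boundary.lin_apply, boundaryFun, LinearMap.add_apply, LinearMap.add_apply, wordDiff,
    LinearMap.add_apply, e1, e2, e3, e4, smul_add, smul_add, smul_add, smul_smul, ← koszulSign_add,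
    koszulSign_congr (m := a.deg * (barDeg l - 1)) (n := a.deg * barDeg l + a.deg)
      ⟨-a.deg, by ring⟩]
  abel

theorem isRightLin_entryDiff {Φ : List (A.koszulDual hA).Red → A.Cobar →ₗ[k] M}
    (hΦ : IsRightLin hA (rotAct A M) Φ) : IsRightLin hA (rotAct A M) (entryDiff hA Φ) where
  toIsMultilinear :=
    (hΦ.toIsMultilinear.map (LinearMap.lcomp k M (A.cobarDiff hA))).weight koszulSign
  right u x a := LinearMap.ext fun y => by
    rw [entryDiff, hΦ.right, barDeg_ract]
    exact congrArg (fun z => koszulSign (barDeg (u ++ [a])) • Φ (u ++ [a]) z)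
      ((A.koszulDual hA).d_unit_mul x y).symm

theorem IsCyclic.isRightLin_entryMul (hF : IsCyclic F) :
    IsRightLin hA (rotAct A M) (entryMul hF.lin) := by
  have h := (rightLin hA (rotAct A M)).sub_mem ((rightLin hA (rotAct A M)).sub_mem
    hF.boundary.lin_isRightLin hF.lin_isRightLin.wordDiff) (isRightLin_entryDiff hF.lin_isRightLin)
  have e : entryMul hF.lin = hF.boundary.lin - wordDiff (rotAct A M) hF.lin -
      entryDiff hA hF.lin := funext fun l => by
    rw [Pi.sub_apply, Pi.sub_apply, hF.lin_boundary]
    abel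
  rwa [e]

theorem IsCyclic.ctr_entryMul (hF : IsCyclic F) {l : List (A.koszulDual hA).Red}
    (hl : 2 ≤ l.length) : AugDGKRing.ctr hA (rotAct A M) (entryMul hF.lin) l =
      -entryMul (AugDGKRing.ctr hA (rotAct A M) hF.lin) l := by
  rcases l with _ | ⟨b, l⟩
  · simp at hl
  · have hl' : l ≠ [] := by rintro rfl; simp at hl
    rw [ctr_cons _ _ hl']
    have h := ctr_comp (ρ' := rotAct A M) b.deg (LinearMap.lcomp k M (signMulRight b))
      (fun n τ x hτ => LinearMap.ext fun y => by
        rw [LinearMap.smul_apply, rotAct_apply, LinearMap.lcomp_apply, LinearMap.lcomp_apply,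
          signMulRight_mul b hτ, map_zsmul, rotAct_apply]) hF.lin_isRightLin
      (hF.isRightLin_entryMul.prefix b) l
    refine (congrArg _ h).trans ?_
    rw [entryMul, smul_smul, ← koszulSign_add, ← neg_smul, ← koszulSign_succ]
    congr 1
    exact koszulSign_congr ⟨b.deg, by ring⟩

/-- If the boundary of `F` vanishes on long words, then one step of the reduction extends the range
in which `F` vanishes. -/
theorem IsCyclic.sub_boundary_contr (hc : A.IsComplete) (hF : IsCyclic F)
    (hb : ∀ a l, 2 ≤ l.length → boundaryFun F a l = 0) {p m : ℕ} (hm : 2 ≤ m)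
    (hv : ∀ a w, WordWeight hA p w → m + 1 ≤ w.length → F a w = 0)
    {l : List (A.koszulDual hA).Red} (hl : WordWeight hA p l) (hlm : m ≤ l.length)
    (a : (A.koszulDual hA).Hom) : F a l - boundaryFun hF.contr a l = 0 := by
  have hz : ∀ {G : (A.koszulDual hA).Hom → List (A.koszulDual hA).Red → M} (hG : IsCyclic G)
      (w : List (A.koszulDual hA).Red), (∀ a, G a w = 0) → hG.lin w = 0 := fun hG w h =>
    linearMap_hom_ext (hA := hA) fun a => by rw [hG.lin_apply, h, smul_zero]; rfl
  have hΦ := hF.lin_isRightLin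
  have hv' : ∀ w, WordWeight hA p w → w.length = l.length + 1 → hF.lin w = 0 := fun w hw h =>
    hz hF w fun a => hv a w hw (by omega)
  have h2 : 2 ≤ l.length := hm.trans hlm
  have h1 := wordDiff_ctr hc hΦ hl h2 hv'
  have h3 : AugDGKRing.ctr hA (rotAct A M) hF.lin l = 0 := ctr_eq_zero hΦ hl hv'
  have h4 : AugDGKRing.ctr hA (rotAct A M) (entryDiff hA hF.lin) l = 0 :=
    ctr_eq_zero (isRightLin_entryDiff hΦ) hl fun w hw h => by
      rw [entryDiff, hv' w hw h, LinearMap.zero_comp, smul_zero]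
  have h5 : AugDGKRing.ctr hA (rotAct A M) hF.boundary.lin l = 0 :=
    ctr_eq_zero hF.boundary.lin_isRightLin hl fun w hw h => hz _ w fun a => hb a w (by omega)
  have h6 : hF.boundary.lin = fun w => (wordDiff (rotAct A M) hF.lin w + entryDiff hA hF.lin w) +
      entryMul hF.lin w := funext hF.lin_boundary
  have h7 : IsRightLin hA (rotAct A M) fun w =>
      wordDiff (rotAct A M) hF.lin w + entryDiff hA hF.lin w :=
    (rightLin hA (rotAct A M)).add_mem hΦ.wordDiff (isRightLin_entryDiff hΦ)
  rw [h6, ctr_add h7 hF.isRightLin_entryMul, ctr_add hΦ.wordDiff (isRightLin_entryDiff hΦ), h4,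
    add_zero, hF.ctr_entryMul h2, add_neg_eq_zero] at h5
  have h8 := hF.isCyclic_contr.lin_boundary l
  rw [hF.lin_contr, entryDiff, h3, LinearMap.zero_comp, smul_zero, add_zero, ← h5, h1] at h8
  rw [hF.eq_lin, hF.isCyclic_contr.boundary.eq_lin, h8, sub_self]

end cyclic

section limits
variable {M : Type w} [AddCommGroup M] [Module k M]
open Filter

theorem eventually_boundaryFun {F : A.Hom → List A.Red → M} {G : ℕ → A.Hom → List A.Red → M}
    (h : ∀ a l, ∀ᶠ N in atTop, G N a l = F a l) (a : A.Hom) (l : List A.Red) :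
    ∀ᶠ N in atTop, boundaryFun (G N) a l = boundaryFun F a l := by
  have h1 : ∀ᶠ N in atTop, headTerm (G N) a l = headTerm F a l := by
    rcases l with _ | ⟨b, l⟩
    · exact Eventually.of_forall fun _ => rfl
    · exact (h (a.mul b.toHom) l).mono fun N hN => congrArg _ hN
  have h2 : ∀ᶠ N in atTop, lastTerm (G N) a l = lastTerm F a l := by
    obtain rfl | ⟨u, z, rfl⟩ := List.eq_nil_or_concat' l
    · exact Eventually.of_forall fun _ => rfl
    · simp only [lastTerm_concat]
      exact (h (z.toHom.mul a) u).mono fun N hN => congrArg _ hN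
  filter_upwards [h a.diff l, eventually_barDiff (fun w => h a w) l, h1, h2] with N e1 e2 e3 e4
  rw [boundaryFun, boundaryFun, e1, e2, e3, e4]

theorem isCyclic_of_eventually {F : A.Hom → List A.Red → M} {G : ℕ → A.Hom → List A.Red → M}
    (h : ∀ a l, ∀ᶠ N in atTop, G N a l = F a l) (hG : ∀ N, IsCyclic (G N)) : IsCyclic F where
  slots d :=
    { add := fun u v a b c h1 h2 h3 => by
        obtain ⟨N, e1, e2, e3⟩ := ((h d (u ++ a :: v)).and ((h d (u ++ b :: v)).and
          (h d (u ++ c :: v)))).exists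
        rw [← e1, ← e2, ← e3, ((hG N).slots d).add u v a b c h1 h2 h3]
      smul := fun u v r a c h1 h2 => by
        obtain ⟨N, e1, e2⟩ := ((h d (u ++ a :: v)).and (h d (u ++ c :: v))).exists
        rw [← e1, ← e2, ((hG N).slots d).smul u v r a c h1 h2]
      bal := fun u v x a b => by
        obtain ⟨N, e1, e2⟩ := ((h d (u ++ a.ract x :: b :: v)).and
          (h d (u ++ a :: b.lact x :: v))).exists
        rw [← e1, ← e2, ((hG N).slots d).bal] }
  add l a b c h1 h2 h3 := by
    obtain ⟨N, e1, e2, e3⟩ := ((h a l).and ((h b l).and (h c l))).exists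
    rw [← e1, ← e2, ← e3, (hG N).add l a b c h1 h2 h3]
  smul l r a c h1 h2 := by
    obtain ⟨N, e1, e2⟩ := ((h a l).and (h c l)).exists
    rw [← e1, ← e2, (hG N).smul l r a c h1 h2]
  bal v x a b := by
    obtain ⟨N, e1, e2⟩ := ((h (a.ract x) (b :: v)).and (h a (b.lact x :: v))).exists
    rw [← e1, ← e2, (hG N).bal]
  cyc u x a b := by
    obtain ⟨N, e1, e2⟩ := ((h a (u ++ [b.ract x])).and (h (a.lact x) (u ++ [b]))).exists
    rw [← e1, ← e2, (hG N).cyc]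
  cyc_nil x a := by
    obtain ⟨N, e1, e2⟩ := ((h (a.ract x) []).and (h (a.lact x) [])).exists
    rw [← e1, ← e2, (hG N).cyc_nil]

theorem boundaryFun_sub {F G : A.Hom → List A.Red → M} (hF : IsCyclic F) (hG : IsCyclic G)
    (a : A.Hom) (l : List A.Red) :
    boundaryFun (fun a l => F a l - G a l) a l = boundaryFun F a l - boundaryFun G a l := by
  have h := map_boundaryFun (chainLift F hF - chainLift G hG) sym a l
  simp only [LinearMap.sub_apply, chainLift_sym] at h
  rw [← h, map_boundaryFun, map_boundaryFun]
  simp only [chainLift_sym]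

theorem boundaryFun_boundaryFun {F : A.Hom → List A.Red → M} (hF : IsCyclic F) (a : A.Hom)
    (l : List A.Red) : boundaryFun (boundaryFun F) a l = 0 := by
  have h := congrArg (chainLift F hF) (hochBoundary_hochBoundary (sym a l))
  rw [map_zero, hochBoundary, chainLift_sym, map_boundaryFun] at h
  simpa only [chainLift_sym, map_boundaryFun] using h

theorem IsCyclic.sub {F G : A.Hom → List A.Red → M} (hF : IsCyclic F) (hG : IsCyclic G) :
    IsCyclic fun a l => F a l - G a l := by
  have h := hF.add' (hG.weight fun _ _ => -1)
  simpa only [neg_one_smul, ← sub_eq_add_neg] using h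

end limits

section reduction
variable {hA : A.IsTypical} {M : Type w} [AddCommGroup M] [Module k M]
  {F : (A.koszulDual hA).Hom → List (A.koszulDual hA).Red → M}

/-- A cyclic function whose boundary vanishes on words of length at least two is, up to a boundary,
itself zero on such words. -/
theorem IsCyclic.exists_reduced (hc : A.IsComplete) (hF : IsCyclic F)
    (hb : ∀ a l, 2 ≤ l.length → boundaryFun F a l = 0) :
    ∃ G : (A.koszulDual hA).Hom → List (A.koszulDual hA).Red → M, IsCyclic G ∧
      ∀ a l, 2 ≤ l.length → F a l - boundaryFun G a l = 0 := by
  let T := {G : (A.koszulDual hA).Hom → List (A.koszulDual hA).Red → M // IsCyclic G}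
  let step : T → T := fun G =>
    ⟨fun a l => G.1 a l - boundaryFun G.2.contr a l, G.2.sub G.2.isCyclic_contr.boundary⟩
  let S : ℕ → T := fun i => step^[i] ⟨F, hF⟩
  have Ss : ∀ i, S (i + 1) = step (S i) := fun i => Function.iterate_succ_apply' _ _ _
  have hS : ∀ i a l, boundaryFun (S i).1 a l = boundaryFun F a l := fun i => by
    induction i with
    | zero => exact fun a l => rfl
    | succ i ih =>
      intro a l
      rw [Ss, ← ih]
      refine (boundaryFun_sub (S i).2 (S i).2.isCyclic_contr.boundary a l).trans ?_
      rw [boundaryFun_boundaryFun (S i).2.isCyclic_contr, sub_zero]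
  have hv : ∀ p i a l, WordWeight hA p l → 2 ≤ l.length → p + 1 ≤ l.length + i →
      (S i).1 a l = 0 := by
    intro p i
    induction i with
    | zero =>
      intro a l hl _ h
      exact exists_zero_mem_eq_zero (hF.slots a) (hl.exists_eq_zero (by omega))
    | succ i ih =>
      intro a l hl h2 hp
      rw [Ss]
      exact (S i).2.sub_boundary_contr hc (fun a l hl => by rw [hS, hb a l hl]) h2
        (fun a w hw h => ih a w hw (by omega) (by omega)) hl le_rfl a
  have hs : ∀ p i a l, WordWeight hA p l → p ≤ i → (S i).2.contr a l = 0 := by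
    intro p i a l hl hp
    rcases l with _ | ⟨b, l⟩
    · rw [IsCyclic.contr, ctr_nil, LinearMap.zero_apply, smul_zero]
    · rw [IsCyclic.contr, ctr_eq_zero (S i).2.lin_isRightLin hl fun w hw h =>
        linearMap_hom_ext (hA := hA) fun a => ?_, LinearMap.zero_apply, smul_zero]
      rw [List.length_cons] at h
      rw [IsCyclic.lin_apply, hv p i a w hw (by omega) (by omega), smul_zero]
      rfl
  let G : ℕ → (A.koszulDual hA).Hom → List (A.koszulDual hA).Red → M := fun N a l =>
    ∑ i ∈ Finset.range N, (S i).2.contr a l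
  have Gs : ∀ N, G (N + 1) = fun a l => G N a l + (S N).2.contr a l := fun N =>
    funext fun a => funext fun l => Finset.sum_range_succ _ _
  have hG : ∀ N, IsCyclic (G N) := fun N => by
    induction N with
    | zero => exact isCyclic_zero
    | succ N ih => rw [Gs]; exact ih.add' (S N).2.isCyclic_contr
  have hFG : ∀ N a l, (S N).1 a l = F a l - boundaryFun (G N) a l := fun N => by
    induction N with
    | zero =>
      intro a l
      have h := boundaryFun_sub (hG 0) (hG 0) a l
      simp only [sub_self] at h
      change F a l = F a l - boundaryFun (fun _ _ => 0) a l
      rw [h, sub_zero]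
    | succ N ih =>
      intro a l
      rw [Ss]
      have h := boundaryFun_sub (hG (N + 1)) (S N).2.isCyclic_contr a l
      simp only [Gs, add_sub_cancel_right] at h
      rw [Gs]
      change (S N).1 a l - boundaryFun (S N).2.contr a l = _
      rw [ih, sub_sub]
      congr 1
      exact eq_sub_iff_add_eq.1 h
  choose p hp using exists_wordWeight (hA := hA) hc
  have hst : ∀ a l N, p l ≤ N → G N a l = G (p l) a l := by
    intro a l N hN
    induction N, hN using Nat.le_induction with
    | base => rfl
    | succ N hN ih => rw [← ih, Gs]; exact (congrArg _ (hs _ N a l (hp l) hN)).trans (add_zero _)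
  have hev : ∀ a l, ∀ᶠ N in Filter.atTop, G N a l = G (p l) a l := fun a l =>
    (Filter.eventually_ge_atTop (p l)).mono fun N hN => hst a l N hN
  refine ⟨fun a l => G (p l) a l, isCyclic_of_eventually hev hG, fun a l hl => ?_⟩
  obtain ⟨N, e1, e2⟩ := ((eventually_boundaryFun hev a l).and
    (Filter.eventually_ge_atTop (p l + 1))).exists
  rw [← e1, ← hFG]
  exact hv (p l) N a l (hp l) hl (by omega)

end reduction

section coefficients

/-- The Peirce component `e_p a e_q`. -/
def Hom.corner (p q : Fin t) (a : A.Hom) : A.Hom := (a.lact (Pi.single p 1)).ract (Pi.single q 1)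

/-- The matrix valued function of words with entries `(-1)^|l| φ(e_p a e_q ⊗ l)`. -/
def coeff (a : A.Hom) : Module.Dual k A.Chain →ₗ[k] A.MatFun where
  toFun φ l := Matrix.of fun q p => koszulSign (barDeg l) • φ (sym (a.corner p q) l)
  map_add' φ ψ := by
    ext l q p
    exact smul_add (koszulSign (barDeg l)) (φ (sym (a.corner p q) l)) (ψ (sym (a.corner p q) l))
  map_smul' r φ := by
    ext l q p
    exact smul_comm (koszulSign (barDeg l)) r (φ (sym (a.corner p q) l))

theorem coeff_apply (a : A.Hom) (φ : Module.Dual k A.Chain) (l : List A.Red) (q p : Fin t) :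
    coeff a φ l q p = koszulSign (barDeg l) • φ (sym (a.corner p q) l) := rfl

theorem single_mul (p : Fin t) (x : Fin t → k) : x * Pi.single p 1 = x p • Pi.single p 1 := by
  ext q
  by_cases h : q = p
  · subst h; simp
  · simp [h]

theorem corner_ract (a : A.Hom) (p q : Fin t) (x : Fin t → k) :
    ((a.corner p q).ract x).val = x q • (a.corner p q).val := by
  change A.unit (Pi.single p 1) * a.val * A.unit (Pi.single q 1) * A.unit x =
    x q • (A.unit (Pi.single p 1) * a.val * A.unit (Pi.single q 1))
  rw [mul_assoc, ← map_mul, mul_comm _ x, single_mul, map_smul, mul_smul_comm]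

theorem corner_lact (a : A.Hom) (p q : Fin t) (x : Fin t → k) :
    ((a.corner p q).lact x).val = x p • (a.corner p q).val := by
  change A.unit x * (A.unit (Pi.single p 1) * a.val * A.unit (Pi.single q 1)) =
    x p • (A.unit (Pi.single p 1) * a.val * A.unit (Pi.single q 1))
  rw [← mul_assoc, ← mul_assoc, ← map_mul, single_mul, map_smul, smul_mul_assoc, smul_mul_assoc]

theorem sym_corner_ract (a : A.Hom) (p q : Fin t) (x : Fin t → k) (l : List A.Red) :
    sym ((a.corner p q).ract x) l = x q • sym (a.corner p q) l :=
  isCyclic_sym.smul l (x q) _ _ rfl (corner_ract a p q x)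

theorem sym_corner_lact (a : A.Hom) (p q : Fin t) (x : Fin t → k) (l : List A.Red) :
    sym ((a.corner p q).lact x) l = x p • sym (a.corner p q) l :=
  isCyclic_sym.smul l (x p) _ _ rfl (corner_lact a p q x)

theorem isMatCochain_coeff (a : A.Hom) {φ : Module.Dual k A.Chain} {m : ℤ}
    (hφ : ∀ (a : A.Hom) (l : List A.Red), a.deg + barDeg l ≠ m → φ (sym a l) = 0) :
    A.IsMatCochain (m - a.deg) (coeff a φ) where
  add u v b c d h1 h2 h3 := by
    ext q p
    rw [Matrix.add_apply, coeff_apply, coeff_apply, coeff_apply,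
      (isCyclic_sym.slots _).add u v b c d h1 h2 h3, map_add, smul_add]
    simp only [barDeg_append, barDeg_cons, h1, h2]
  smul u v r b d h1 h2 := by
    ext q p
    rw [Matrix.smul_apply, coeff_apply, coeff_apply, (isCyclic_sym.slots _).smul u v r b d h1 h2,
      map_smul, smul_comm]
    simp only [barDeg_append, barDeg_cons, h1]
  bal u v x b c := by
    ext q p
    rw [coeff_apply, coeff_apply, (isCyclic_sym.slots _).bal]
    simp only [barDeg_append, barDeg_cons]
    rfl
  left v x b := by
    ext q p
    rw [Matrix.diagonal_mul, coeff_apply, coeff_apply, ← isCyclic_sym.bal, barDeg_lact,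
      sym_corner_ract, map_smul,
      smul_comm, smul_eq_mul]
  right u x b := by
    ext q p
    rw [Matrix.mul_diagonal, coeff_apply, coeff_apply, isCyclic_sym.cyc, barDeg_ract,
      sym_corner_lact, map_smul,
      smul_comm, smul_eq_mul, mul_comm]
  nil := by
    refine ⟨(coeff a φ []).diag, Matrix.ext fun q p => ?_⟩
    by_cases h : q = p
    · subst h; simp
    · rw [Matrix.diagonal_apply_ne _ h, coeff_apply]
      have h1 := sym_corner_ract a p q (Pi.single q 1) []
      rw [isCyclic_sym.cyc_nil, sym_corner_lact, Pi.single_eq_same, Pi.single_eq_of_ne (Ne.symm h), zero_smul,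
        one_smul] at h1
      rw [← h1, map_zero, smul_zero]
  supp w hw := by
    ext q p
    rw [coeff_apply, hφ _ _ (fun h => hw ?_), smul_zero]
    · rfl
    · rw [← h]
      change barDeg w = a.deg + barDeg w - a.deg
      ring

/-- The symbol `a ⊗ l`, as a linear function of the first entry. -/
def symLin (l : List A.Red) (i : ℤ) : A.carrier →ₗ[k] A.Chain where
  toFun a := sym ⟨i, GradedAlgebra.proj A.piece i a, SetLike.coe_mem _⟩ l
  map_add' a b := isCyclic_sym.add l _ _ _ rfl rfl (map_add _ _ _)
  map_smul' r a := isCyclic_sym.smul l r _ _ rfl (map_smul _ _ _)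

theorem symLin_apply (l : List A.Red) (a : A.Hom) : symLin l a.deg a.val = sym a l :=
  congrArg (fun a => sym a l) (Hom.ext rfl (by
    change GradedAlgebra.proj A.piece a.deg a.val = a.val
    rw [GradedAlgebra.proj_apply, DirectSum.decompose_of_mem_same _ a.mem]))

theorem sum_idem_mul (a : A.carrier) : ∑ r, A.idem r * a = a := by
  rw [← Finset.sum_mul, sum_idem, one_mul]

theorem sum_corner (a : A.carrier) : ∑ p, ∑ q, A.idem p * a * A.idem q = a := by
  simp only [sum_mul_idem, sum_idem_mul]

theorem sum_dualForm (hA : A.IsTypical) (i : ℤ) (a : A.carrier) :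
    ∑ α, dualForm hA i α a • (redBasis hA i α : A.carrier) = A.redProj i a := by
  have h := congrArg (A.redPiece i).subtype ((redBasis hA i).sum_repr (A.redProj i a))
  rw [map_sum] at h
  exact h

theorem redProj_corner (i : ℤ) (p q : Fin t) (a : A.carrier) :
    (A.redProj i (A.idem p * a * A.idem q) : A.carrier) =
      A.idem p * A.redProj i a * A.idem q := by
  rw [idem, idem, redProj_mul_unit, redProj_unit_mul]

theorem casimir (hA : A.IsTypical) (i : ℤ) (f : Module.Dual k A.carrier) (a : A.carrier) :
    ∑ α, ∑ p, ∑ q, dualForm hA i α (A.idem p * a * A.idem q) *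
      f (A.idem p * redBasis hA i α * A.idem q) = f (A.redProj i a) := by
  rw [Finset.sum_comm]
  conv_rhs => rw [← sum_corner (A.redProj i a : A.carrier)]
  rw [map_sum]
  refine Finset.sum_congr rfl fun p _ => ?_
  rw [Finset.sum_comm, map_sum]
  refine Finset.sum_congr rfl fun q _ => ?_
  have h := congrArg (fun y => A.idem p * y * A.idem q)
    (sum_dualForm hA i (A.idem p * a * A.idem q))
  simp only [Finset.mul_sum, Finset.sum_mul, mul_smul_comm, smul_mul_assoc, redProj_corner] at h
  have h' := congrArg f h
  simp only [map_sum, map_smul, smul_eq_mul] at h'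
  rw [h', ← mul_assoc, ← mul_assoc, idem_mul_self, mul_assoc _ (A.idem q), idem_mul_self]

end coefficients

section normalForm
variable (hA : A.IsTypical)

/-- The symbol `σ ⊗ w`, as a linear function of the first entry. -/
def headSym (w : List (A.koszulDual hA).Red) : A.Cobar →ₗ[k] (A.koszulDual hA).Chain :=
  homLift fun i =>
    { toFun := fun σ => sym (cobarHom hA i σ.1 σ.2) w
      map_add' := fun _ _ => isCyclic_sym.add w _ _ _ rfl rfl rfl
      map_smul' := fun r _ => isCyclic_sym.smul w r _ _ rfl rfl }

variable {hA} in
theorem headSym_apply (w : List (A.koszulDual hA).Red) {i : ℤ} {σ : A.Cobar}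
    (h : σ ∈ A.cobarPiece i) : headSym hA w σ = sym (cobarHom hA i σ h) w := homLift_apply _ h

variable {hA} in
theorem headSym_hval (w : List (A.koszulDual hA).Red) (τ : (A.koszulDual hA).Hom) :
    headSym hA w (hval τ) = sym τ w := homLift_apply _ τ.mem

/-- The symbol `σ ⊗ [g]`, as a linear function of `g`. -/
def genSym (i : ℤ) (σ : A.Cobar) : Module.Dual k A.carrier →ₗ[k] (A.koszulDual hA).Chain where
  toFun g := headSym hA [redGen hA (Codual.of i g)] σ
  map_add' g h := LinearMap.congr_fun (f := headSym hA [redGen hA (Codual.of i (g + h))])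
    (g := headSym hA [redGen hA (Codual.of i g)] + headSym hA [redGen hA (Codual.of i h)])
    (linearMap_hom_ext (hA := hA) fun a => by
      rw [LinearMap.add_apply, headSym_hval, headSym_hval, headSym_hval]
      exact (isCyclic_sym.slots a).add [] [] _ _ _ rfl rfl (gen_add rfl rfl rfl)) σ
  map_smul' r g := LinearMap.congr_fun (f := headSym hA [redGen hA (Codual.of i (r • g))])
    (g := r • headSym hA [redGen hA (Codual.of i g)])
    (linearMap_hom_ext (hA := hA) fun a => by
      rw [LinearMap.smul_apply, headSym_hval, headSym_hval]
      exact (isCyclic_sym.slots a).smul [] [] r _ _ rfl (gen_smul rfl rfl)) σ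

theorem genSym_apply (i : ℤ) (σ : A.Cobar) (g : Module.Dual k A.carrier) :
    genSym hA i σ g = headSym hA [redGen hA (Codual.of i g)] σ := rfl

theorem genSym_congr {i : ℤ} (σ : A.Cobar) {g h : Module.Dual k A.carrier}
    (H : ∀ a ∈ A.redPiece i, g a = h a) : genSym hA i σ g = genSym hA i σ h :=
  congrArg (fun c => headSym hA [redGen hA c] σ)
    (Codual.ext rfl (LinearMap.ext fun a => H _ (A.redProj i a).2))

theorem genSym_corner (i : ℤ) (p q : Fin t) (σ : A.Cobar) (g : Module.Dual k A.carrier) :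
    genSym hA i (A.cobarUnit (Pi.single p 1) * σ * A.cobarUnit (Pi.single q 1)) g =
      genSym hA i σ (g ∘ₗ LinearMap.mulLeft k (A.idem p) ∘ₗ LinearMap.mulRight k (A.idem q)) := by
  have h1 : redGen hA (Codual.of i
      (g ∘ₗ LinearMap.mulLeft k (A.idem p) ∘ₗ LinearMap.mulRight k (A.idem q))) =
      ((redGen hA (Codual.of i g)).ract (Pi.single p 1)).lact (Pi.single q 1) := by
    refine Red.ext rfl ?_
    change A.genLin i _ = A.cobarUnit _ * (A.genLin i g * A.cobarUnit _)
    rw [← genLin_ract, ← genLin_lact]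
    rfl
  rw [genSym_apply, genSym_apply, h1]
  refine LinearMap.congr_fun (f := headSym hA [redGen hA (Codual.of i g)] ∘ₗ
      LinearMap.mulRight k (A.cobarUnit (Pi.single q 1)) ∘ₗ
      LinearMap.mulLeft k (A.cobarUnit (Pi.single p 1)))
    (g := headSym hA [((redGen hA (Codual.of i g)).ract (Pi.single p 1)).lact (Pi.single q 1)])
    (linearMap_hom_ext (hA := hA) fun a => ?_) σ
  rw [headSym_hval, ← isCyclic_sym.bal]
  refine Eq.trans ?_ (isCyclic_sym.cyc [] (Pi.single p 1) (a.ract (Pi.single q 1))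
    (redGen hA (Codual.of i g))).symm
  refine Eq.trans ?_ (headSym_hval _ ((a.ract (Pi.single q 1)).lact (Pi.single p 1)))
  exact congrArg (headSym hA [redGen hA (Codual.of i g)]) (mul_assoc _ _ _)

end normalForm

section normalForm
variable (hA : A.IsTypical)

/-- A linear left inverse of the evaluation of the cobar construction on words. -/
def evInv : A.MatFun →ₗ[k] A.Cobar :=
  Classical.choose (LinearMap.exists_leftInverse_of_injective A.ev
    (LinearMap.ker_eq_bot.2 (ev_injective hA)))

theorem evInv_ev (σ : A.Cobar) : evInv hA (A.ev σ) = σ :=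
  LinearMap.congr_fun (Classical.choose_spec (LinearMap.exists_leftInverse_of_injective A.ev
    (LinearMap.ker_eq_bot.2 (ev_injective hA)))) σ

theorem ev_evInv {j : ℤ} {φ : A.MatFun} (hφ : A.IsMatCochain j φ) :
    evInv hA φ ∈ A.cobarPiece (-j) ∧ A.ev (evInv hA φ) = φ := by
  obtain ⟨σ, hσ, rfl⟩ := ev_surjective hA hφ
  rw [evInv_ev]
  exact ⟨hσ, rfl⟩

/-- The chain `σ ⊗ [] + ∑ σ_α ⊗ [x_α^*]` with prescribed pairings, the sum being over a basis of the
components of the augmentation ideal with degrees in `I`. -/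
def normalForm (I : Finset ℤ) : Module.Dual k A.Chain →ₗ[k] (A.koszulDual hA).Chain :=
  headSym hA [] ∘ₗ evInv hA ∘ₗ coeff (Hom.one A) +
    ∑ i ∈ I, ∑ α, headSym hA [redGen hA (Codual.of i (dualForm hA i α))] ∘ₗ evInv hA ∘ₗ
      coeff (Red.of i (redBasis hA i α)).toHom

theorem normalForm_apply (I : Finset ℤ) (φ : Module.Dual k A.Chain) : normalForm hA I φ =
    headSym hA [] (evInv hA (coeff (Hom.one A) φ)) + ∑ i ∈ I, ∑ α,
      genSym hA i (evInv hA (coeff (Red.of i (redBasis hA i α)).toHom φ)) (dualForm hA i α) := by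
  rw [normalForm, LinearMap.add_apply, LinearMap.sum_apply]
  simp only [LinearMap.sum_apply]
  rfl

variable {hA}

section surjective
variable {φ : Module.Dual k A.Chain} {m : ℤ}

theorem evInv_coeff
    (hφ : ∀ (a : A.Hom) (l : List A.Red), a.deg + barDeg l ≠ m → φ (sym a l) = 0)
    (a : A.Hom) : evInv hA (coeff a φ) ∈ A.cobarPiece (a.deg - m) ∧
    A.ev (evInv hA (coeff a φ)) = coeff a φ := by
  have h := ev_evInv hA (isMatCochain_coeff a hφ)
  rwa [neg_sub] at h

theorem normalForm_mem
    (hφ : ∀ (a : A.Hom) (l : List A.Red), a.deg + barDeg l ≠ m → φ (sym a l) = 0)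
    (I : Finset ℤ) : normalForm hA I φ ∈ (A.koszulDual hA).chains (-m) := by
  rw [normalForm_apply]
  refine Submodule.add_mem _ ?_ (Submodule.sum_mem _ fun i _ => Submodule.sum_mem _ fun α _ => ?_)
  · rw [headSym_apply _ (evInv_coeff hφ _).1]
    refine Submodule.subset_span ⟨_, _, ?_, rfl⟩
    change 0 - m + 0 = -m
    ring
  · rw [genSym_apply, headSym_apply _ (evInv_coeff hφ _).1]
    refine Submodule.subset_span ⟨_, _, ?_, rfl⟩
    rw [barDeg_cons, barDeg_nil]
    change i - m + (-i - 1 + 1 + 0) = -m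
    ring

theorem pairing_headSym_coeff
    (hφ : ∀ (a : A.Hom) (l : List A.Red), a.deg + barDeg l ≠ m → φ (sym a l) = 0)
    (a : A.Hom) (l : List A.Red) :
    pairing hA (headSym hA [] (evInv hA (coeff (Hom.one A) φ))) (sym a l) =
      φ (sym a.const l) := by
  obtain ⟨h1, h2⟩ := evInv_coeff (hA := hA) hφ (Hom.one A)
  rw [headSym_apply _ h1, pairing_sym, pairWord_nil, headForm_apply]
  change koszulSign (barDeg l) • (A.augDiag a.val * A.ev (evInv hA _) l).trace = _
  rw [h2, augDiag_apply, Matrix.trace]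
  simp only [Matrix.diag_apply, Matrix.diagonal_mul, coeff_apply]
  rw [Finset.smul_sum]
  have h3 : ∀ p, koszulSign (barDeg l) • (A.aug a.val p * koszulSign (barDeg l) •
      φ (sym ((Hom.one A).corner p p) l)) = A.aug a.val p • φ (symLin l 0 (A.idem p)) := fun p => by
    rw [mul_smul_comm, smul_smul, koszulSign_mul_self, one_smul, smul_eq_mul]
    congr 2
    refine (symLin_apply l ((Hom.one A).corner p p)).symm.trans (congrArg (symLin l 0) ?_)
    change A.idem p * 1 * A.idem p = A.idem p
    rw [mul_one, idem_mul_self]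
  simp only [h3]
  by_cases h0 : a.deg = 0
  · rw [← symLin_apply, show a.const.deg = 0 from h0, show a.const.val = A.unit (A.aug a.val) from rfl,
      unit_eq_sum, map_sum, map_sum]
    simp only [map_smul]
  · have h4 := A.aug_piece h0 a.mem
    rw [isCyclic_sym.zero (a := a.const) (by
      change A.unit (A.aug a.val) = 0
      rw [h4, map_zero]), map_zero, h4]
    simp

theorem pairing_genSym_coeff
    (hφ : ∀ (a : A.Hom) (l : List A.Red), a.deg + barDeg l ≠ m → φ (sym a l) = 0)
    (a : A.Hom) (l : List A.Red) (i : ℤ)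
    (α : Fin (Module.finrank k (A.redPiece i))) :
    pairing hA (genSym hA i (evInv hA (coeff (Red.of i (redBasis hA i α)).toHom φ))
      (dualForm hA i α)) (sym a l) = if a.deg = i then
        ∑ p, ∑ q, dualForm hA i α (A.idem p * a.val * A.idem q) *
          φ (symLin l i (A.idem p * redBasis hA i α * A.idem q)) else 0 := by
  obtain ⟨h1, h2⟩ := evInv_coeff (hA := hA) hφ (Red.of i (redBasis hA i α)).toHom
  rw [genSym_apply, headSym_apply _ h1, pairing_sym, pairWord_gen]
  change koszulSign (barDeg l) • (cmat _ a.val * A.ev (evInv hA _) l).trace = _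
  rw [h2]
  split_ifs with h
  · rw [Matrix.trace, Finset.smul_sum]
    refine Finset.sum_congr rfl fun p _ => ?_
    rw [Matrix.diag_apply, Matrix.mul_apply, Finset.smul_sum]
    refine Finset.sum_congr rfl fun q _ => ?_
    rw [coeff_apply, mul_smul_comm, smul_smul, koszulSign_mul_self, one_smul, cmat_apply]
    congr 1
    · change dualForm hA i α (A.redProj i (A.idem p * a.val * A.idem q)) = _
      exact congrArg ((redBasis hA i).coord α)
        (Subtype.ext (redProj_same (A.redProj i (A.idem p * a.val * A.idem q)).2))
    · exact congrArg φ (symLin_apply l ((Red.of i (redBasis hA i α)).toHom.corner p q)).symm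
  · rw [cmat_of_mem_ne a.mem h, zero_mul, Matrix.trace_zero, smul_zero]

theorem pairing_normalForm
    (hφ : ∀ (a : A.Hom) (l : List A.Red), a.deg + barDeg l ≠ m → φ (sym a l) = 0)
    {I : Finset ℤ} (hI : Finset.Icc (-|m| - 2) (|m| + 2) ⊆ I) :
    pairing hA (normalForm hA I φ) = φ := by
  classical
  refine chain_ext fun a l => ?_
  rw [normalForm_apply]
  simp only [map_add, map_sum, LinearMap.add_apply, LinearMap.sum_apply, pairing_headSym_coeff hφ,
    pairing_genSym_coeff hφ]
  have h1 : φ (sym a l) = φ (sym a.const l) + φ (sym a.bar.toHom l) := by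
    rw [← map_add]
    refine congrArg φ (isCyclic_sym.add l _ _ _ rfl rfl ?_)
    change a.val = A.unit (A.aug a.val) + (a.val - A.unit (A.aug a.val))
    abel
  rw [h1]
  congr 1
  by_cases hi : a.deg ∈ I
  · rw [Finset.sum_eq_single_of_mem _ hi fun i _ h => Finset.sum_eq_zero fun α _ =>
      if_neg (Ne.symm h)]
    simp only [if_true]
    refine (casimir hA a.deg (φ ∘ₗ symLin l a.deg) a.val).trans (congrArg φ ?_)
    refine Eq.trans (congrArg _ ?_) (symLin_apply l a.bar.toHom)
    rw [redProj_coe, GradedAlgebra.proj_apply, DirectSum.decompose_of_mem_same _ a.mem]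
    rfl
  · rw [Finset.sum_eq_zero fun i hi' => Finset.sum_eq_zero fun α _ =>
      if_neg fun h => hi (by rw [h]; exact hi')]
    by_contra hne
    obtain ⟨s, hs, h⟩ := hA.sign
    have h2 : sym a.bar.toHom l ≠ 0 := fun h => hne (by rw [h, map_zero])
    have h3 := length_le_barDeg h ((isCyclic_sym.slots a.bar.toHom).ne_zero h2)
    have h4 : a.bar.val ≠ 0 := fun h => h2 (isCyclic_sym.zero h l)
    have h5 := h a.deg fun h => h4 (Red.val_eq_zero (a := a.bar) h)
    have h6 : a.deg + barDeg l = m := by_contra fun h => hne (hφ a.bar.toHom l h).symm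
    refine hi (hI (Finset.mem_Icc.2 ?_))
    rcases hs with rfl | rfl <;> rcases abs_cases m with h | h <;> omega

end surjective

theorem trace_single (p q : Fin t) (C N : Matrix (Fin t) (Fin t) k) :
    (Matrix.diagonal (Pi.single p 1) * C * Matrix.diagonal (Pi.single q 1) * N).trace =
      C p q * N q p := by
  rw [Matrix.trace, Finset.sum_eq_single p, Matrix.diag_apply, Matrix.mul_apply,
    Finset.sum_eq_single q]
  · simp
  · intro r _ hr; simp [hr]
  · simp
  · intro r _ hr
    rw [Matrix.diag_apply, mul_assoc, mul_assoc, Matrix.diagonal_mul, Pi.single_eq_of_ne hr,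
      zero_mul]
  · simp

theorem ev_corner (p q q' p' : Fin t) (σ : A.Cobar) (l : List A.Red) :
    A.ev (A.cobarUnit (Pi.single p 1) * σ * A.cobarUnit (Pi.single q 1)) l q' p' =
      if p = p' ∧ q = q' then A.ev σ l q' p' else 0 := by
  rw [ev_mul_unit, ev_unit_mul, Matrix.diagonal_mul, Matrix.mul_diagonal, Pi.single_apply,
    Pi.single_apply]
  simp only [eq_comm (a := q'), eq_comm (a := p')]
  split_ifs <;> simp_all

theorem coeff_pairing_nil (a : A.Hom) (τ : (A.koszulDual hA).Hom) :
    coeff a (pairing hA (sym τ [])) = A.ev (∑ p, A.aug a.val p •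
      (A.cobarUnit (Pi.single p 1) * hval τ * A.cobarUnit (Pi.single p 1))) := by
  ext l q p
  rw [coeff_apply, pairing_sym, pairWord_nil, headForm_apply, smul_smul, koszulSign_mul_self,
    one_smul, map_sum, Finset.sum_apply, Matrix.sum_apply]
  simp only [map_smul, Pi.smul_apply, Matrix.smul_apply, ev_corner]
  have h : A.augDiag (a.corner p q).val = Matrix.diagonal (Pi.single p 1) *
      Matrix.diagonal (A.aug a.val) * Matrix.diagonal (Pi.single q 1) := by
    rw [augDiag_apply, ← diagonal_mul, ← diagonal_mul]
    change Matrix.diagonal (A.aug (A.unit _ * a.val * A.unit _)) = _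
    rw [map_mul, map_mul, A.aug_unit, A.aug_unit]
  rw [h, trace_single, Finset.sum_eq_single p]
  · by_cases hpq : p = q
    · subst hpq; simp
    · simp [hpq]
  · intro r _ hr; simp [hr]
  · simp

theorem coeff_pairing_gen (a : A.Hom) (τ : (A.koszulDual hA).Hom) (c : A.Codual) :
    coeff a (pairing hA (sym τ [redGen hA c])) = A.ev (∑ p, ∑ q,
      c.val (A.idem p * a.val * A.idem q) •
        (A.cobarUnit (Pi.single p 1) * hval τ * A.cobarUnit (Pi.single q 1))) := by
  ext l q p
  rw [coeff_apply, pairing_sym, pairWord_gen, smul_smul, koszulSign_mul_self, one_smul, map_sum,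
    Finset.sum_apply, Matrix.sum_apply]
  have h : cmat c.val (a.corner p q).val = Matrix.diagonal (Pi.single p 1) *
      cmat c.val a.val * Matrix.diagonal (Pi.single q 1) := by
    change cmat c.val (A.unit _ * a.val * A.unit _) = _
    rw [cmat_mul_unit, cmat_unit_mul]
  rw [h, trace_single, cmat_apply, Finset.sum_eq_single p]
  · simp only [map_sum, map_smul, Finset.sum_apply, Pi.smul_apply, Matrix.sum_apply,
      Matrix.smul_apply, ev_corner]
    rw [Finset.sum_eq_single q]
    · simp
    · intro r _ hr; simp [hr]
    · simp
  · intro r _ hr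
    simp only [map_sum, map_smul, Finset.sum_apply, Pi.smul_apply, Matrix.sum_apply,
      Matrix.smul_apply, ev_corner]
    simp [hr]
  · simp

theorem normalForm_pairing_nil (I : Finset ℤ) (τ : (A.koszulDual hA).Hom) :
    normalForm hA I (pairing hA (sym τ [])) = sym τ [] := by
  rw [normalForm_apply]
  simp only [coeff_pairing_nil, evInv_ev]
  rw [Finset.sum_eq_zero fun i _ => Finset.sum_eq_zero fun α _ => ?_, add_zero, map_sum]
  · have h : ∀ p, headSym hA [] (A.aug (Hom.one A).val p •
        (A.cobarUnit (Pi.single p 1) * hval τ * A.cobarUnit (Pi.single p 1))) =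
        headSym hA [] (hval τ * A.cobarUnit (Pi.single p 1)) := fun p => by
      have h1 : A.aug (Hom.one A).val p = 1 := congrFun (map_one A.aug) p
      rw [h1, one_smul, mul_assoc]
      refine (headSym_hval [] ((τ.ract (Pi.single p 1)).lact (Pi.single p 1))).trans ?_
      rw [← isCyclic_sym.cyc_nil]
      refine (headSym_hval [] ((τ.ract (Pi.single p 1)).ract (Pi.single p 1))).symm.trans
        (congrArg (headSym hA []) ?_)
      refine (mul_assoc (hval τ) _ _).trans (congrArg (hval τ * ·) ?_)
      change A.cobarUnit _ * A.cobarUnit _ = A.cobarUnit _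
      rw [← map_mul]
      congr 1
      rw [single_mul, Pi.single_eq_same, one_smul]
    simp only [h]
    rw [← map_sum, ← Finset.mul_sum, ← map_sum, ← headSym_hval]
    congr 1
    have h2 : ∑ p : Fin t, (Pi.single p 1 : Fin t → k) = 1 := by
      ext q
      simp [Finset.sum_apply, Pi.single_apply]
    rw [h2, map_one, mul_one]
  · have h1 : A.aug (Red.of i (redBasis hA i α)).val = 0 := (Red.of i (redBasis hA i α)).aug_eq
    simp only [h1, Pi.zero_apply, zero_smul, Finset.sum_const_zero]
    exact map_zero (headSym hA _)

theorem normalForm_pairing_gen {I : Finset ℤ} (τ : (A.koszulDual hA).Hom) {c : A.Codual}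
    (hI : c.deg ∈ I) :
    normalForm hA I (pairing hA (sym τ [redGen hA c])) = sym τ [redGen hA c] := by
  rw [normalForm_apply]
  simp only [coeff_pairing_gen, evInv_ev]
  have h0 : ∀ p q, c.val (A.idem p * (Hom.one A).val * A.idem q) = 0 := fun p q => by
    change c.val (A.unit _ * 1 * A.unit _) = 0
    rw [mul_one, ← map_mul, c.unit_eq]
  simp only [h0, zero_smul, Finset.sum_const_zero, map_zero, zero_add]
  rw [Finset.sum_eq_single_of_mem _ hI fun i _ h => Finset.sum_eq_zero fun α _ => ?_]
  · have h1 : ∀ α, genSym hA c.deg (∑ p, ∑ q,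
        c.val (A.idem p * (Red.of c.deg (redBasis hA c.deg α)).val * A.idem q) •
        (A.cobarUnit (Pi.single p 1) * hval τ * A.cobarUnit (Pi.single q 1)))
          (dualForm hA c.deg α) = genSym hA c.deg (hval τ) (∑ p, ∑ q,
            c.val (A.idem p * (redBasis hA c.deg α : A.carrier) * A.idem q) •
            (dualForm hA c.deg α ∘ₗ LinearMap.mulLeft k (A.idem p) ∘ₗ
              LinearMap.mulRight k (A.idem q))) := fun α => by
      rw [genSym_apply]
      simp only [map_sum, map_smul]
      refine Finset.sum_congr rfl fun p _ => Finset.sum_congr rfl fun q _ => ?_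
      rw [← genSym_corner]
      rfl
    simp only [h1]
    rw [← map_sum]
    refine (genSym_congr hA (h := c.val) _ fun a ha => ?_).trans ?_
    · simp only [LinearMap.sum_apply, LinearMap.smul_apply, LinearMap.comp_apply,
        LinearMap.mulLeft_apply, LinearMap.mulRight_apply, smul_eq_mul]
      refine Eq.trans ?_ ((casimir hA c.deg c.val a).trans (congrArg c.val (redProj_same ha)))
      refine Finset.sum_congr rfl fun α _ => Finset.sum_congr rfl fun p _ =>
        Finset.sum_congr rfl fun q _ => ?_
      rw [mul_comm]
      simp only [mul_assoc]
    · rw [genSym_apply, Codual.of_self, headSym_hval]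
  · have h1 : ∀ p q, c.val (A.idem p * (Red.of i (redBasis hA i α)).val * A.idem q) = 0 :=
      fun p q => c.supp h _ ((Red.of i (redBasis hA i α)).toHom.corner p q).mem
    simp only [h1, zero_smul, Finset.sum_const_zero]
    exact map_zero (headSym hA _)

variable (hA) in
/-- The chains spanned by long words and by boundaries of words of length two. -/
def longChains : Submodule k (A.koszulDual hA).Chain :=
  Submodule.span k {x | ∃ (τ : (A.koszulDual hA).Hom) (w : List (A.koszulDual hA).Red),
    2 ≤ w.length ∧ (x = sym τ w ∨ x = (A.koszulDual hA).hochBoundary (sym τ w))}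

theorem pairing_boundary_long (τ : (A.koszulDual hA).Hom) {w : List (A.koszulDual hA).Red}
    (hw : 2 ≤ w.length) : pairing hA ((A.koszulDual hA).hochBoundary (sym τ w)) = 0 :=
  chain_ext fun a l => (pairing_boundary_left τ w a l).trans (boundary_pairWord_long τ hw a l)

theorem mem_longChains {n : ℤ} {x : (A.koszulDual hA).Chain} (hx : x ∈ (A.koszulDual hA).chains n)
    (h : pairing hA x = 0) : x ∈ longChains hA := by
  classical
  let S : Submodule k (A.koszulDual hA).Chain :=
    { carrier := {x | ∃ I₀ : Finset ℤ, ∀ I, I₀ ⊆ I →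
        x - normalForm hA I (pairing hA x) ∈ longChains hA}
      zero_mem' := ⟨∅, fun I _ => by
        rw [map_zero, map_zero, sub_zero]; exact Submodule.zero_mem _⟩
      add_mem' := by
        rintro x y ⟨I₁, h₁⟩ ⟨I₂, h₂⟩
        refine ⟨I₁ ∪ I₂, fun I hI => ?_⟩
        rw [map_add, map_add, add_sub_add_comm]
        exact Submodule.add_mem _ (h₁ I (Finset.union_subset_left hI))
          (h₂ I (Finset.union_subset_right hI))
      smul_mem' := by
        rintro r x ⟨I₁, h₁⟩
        refine ⟨I₁, fun I hI => ?_⟩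
        rw [map_smul, map_smul, ← smul_sub]
        exact Submodule.smul_mem _ _ (h₁ I hI) }
  have hS : (A.koszulDual hA).chains n ≤ S := by
    refine chains_le (fun τ _ => ⟨∅, fun I _ => ?_⟩) (fun τ c _ => ⟨{c.deg}, fun I hI => ?_⟩)
      (fun τ w hw _ => ⟨∅, fun I _ => ?_⟩) (fun τ w hw _ => ⟨∅, fun I _ => ?_⟩)
    · rw [normalForm_pairing_nil, sub_self]; exact Submodule.zero_mem _
    · rw [normalForm_pairing_gen τ (hI (Finset.mem_singleton_self _)), sub_self]
      exact Submodule.zero_mem _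
    · have h0 : pairing hA (sym τ w) = 0 := chain_ext fun a l =>
        (pairing_sym τ w a l).trans (pairWord_long a l τ hw)
      rw [h0, map_zero, sub_zero]
      exact Submodule.subset_span ⟨τ, w, hw, Or.inl rfl⟩
    · rw [pairing_boundary_long τ hw.ge, map_zero, sub_zero]
      exact Submodule.subset_span ⟨τ, w, hw.ge, Or.inr rfl⟩
  obtain ⟨I, hI⟩ := hS hx
  have := hI I subset_rfl
  rwa [h, map_zero, sub_zero] at this

end normalForm

section chainProj

theorem IsCyclic.map {M N : Type*} [AddCommGroup M] [Module k M] [AddCommGroup N] [Module k N]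
    {F : A.Hom → List A.Red → M} (hF : IsCyclic F) (L : M →ₗ[k] N) :
    IsCyclic fun a l => L (F a l) where
  slots a := (hF.slots a).map L
  add l a b c h1 h2 h3 := by rw [hF.add l a b c h1 h2 h3, map_add]
  smul l r a c h1 h2 := by rw [hF.smul l r a c h1 h2, map_smul]
  bal v x a b := by rw [hF.bal]
  cyc u x a b := by rw [hF.cyc]
  cyc_nil x a := by rw [hF.cyc_nil]

open Classical in
variable (A) in
/-- The projection of the Hochschild chains onto those of degree `n`. -/
def chainProj (n : ℤ) : A.Chain →ₗ[k] A.Chain :=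
  chainLift (fun a l => (if a.deg + barDeg l = n then 1 else 0 : ℤ) • sym a l)
    (isCyclic_sym.weight fun i j => if i + j = n then 1 else 0)

theorem chain_induction {n : ℤ} {P : A.Chain → Prop} (h0 : P 0) (hadd : ∀ x y, P x → P y → P (x + y))
    (hsmul : ∀ (r : k) (x : A.Chain), P x → P (r • x))
    (hs : ∀ (a : A.Hom) (l : List A.Red), a.deg + barDeg l = n → P (sym a l)) {x : A.Chain}
    (hx : x ∈ A.chains n) : P x :=
  Submodule.span_induction (fun _ ⟨a, l, h, e⟩ => e ▸ hs a l h) h0 (fun x y _ _ => hadd x y)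
    (fun r x _ => hsmul r x) hx

theorem eqOn_chains {M : Type*} [AddCommGroup M] [Module k M] {n : ℤ} {f g : A.Chain →ₗ[k] M}
    (h : ∀ (a : A.Hom) (l : List A.Red), a.deg + barDeg l = n → f (sym a l) = g (sym a l))
    {x : A.Chain} (hx : x ∈ A.chains n) : f x = g x :=
  chain_induction (P := fun x => f x = g x) (by rw [map_zero, map_zero])
    (fun x y hx hy => by rw [map_add, map_add, hx, hy])
    (fun r x hx => by rw [map_smul, map_smul, hx]) h hx

theorem chainProj_same {n : ℤ} {x : A.Chain} (hx : x ∈ A.chains n) : A.chainProj n x = x :=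
  eqOn_chains (g := LinearMap.id) (fun a l h => by
    rw [chainProj, chainLift_sym, if_pos h, one_smul]; rfl) hx

theorem chainProj_ne {m n : ℤ} (hm : m ≠ n) {x : A.Chain} (hx : x ∈ A.chains m) :
    A.chainProj n x = 0 :=
  eqOn_chains (g := 0) (fun a l h => by
    rw [chainProj, chainLift_sym, if_neg (by omega), zero_smul]; rfl) hx

theorem hochBoundary_sym (a : A.Hom) (l : List A.Red) :
    A.hochBoundary (sym a l) = boundaryFun sym a l := chainLift_sym _ _ _ _

theorem chainLift_hochBoundary {M : Type*} [AddCommGroup M] [Module k M]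
    {F : A.Hom → List A.Red → M} (hF : IsCyclic F) (a : A.Hom) (l : List A.Red) :
    chainLift F hF (A.hochBoundary (sym a l)) = boundaryFun F a l := by
  rw [hochBoundary_sym, map_boundaryFun]
  simp only [chainLift_sym]

end chainProj

section duality
variable {hA : A.IsTypical}

/-- The kernel of the pairing is acyclic. -/
theorem exists_hochBoundary_eq (hc : A.IsComplete) {n : ℤ} {x : (A.koszulDual hA).Chain}
    (hx : x ∈ (A.koszulDual hA).chains n) (hp : pairing hA x = 0)
    (hb : (A.koszulDual hA).hochBoundary x = 0) :
    ∃ z ∈ (A.koszulDual hA).chains (n + 1), pairing hA z = 0 ∧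
      (A.koszulDual hA).hochBoundary z = x := by
  let S : Submodule k (A.koszulDual hA).Chain :=
    Submodule.span k {x | ∃ (τ : (A.koszulDual hA).Hom) (w : List (A.koszulDual hA).Red),
      2 ≤ w.length ∧ τ.deg + barDeg w = n + 1 ∧ x = sym τ w}
  have hS : S ≤ (A.koszulDual hA).chains (n + 1) ⊓ LinearMap.ker (pairing hA) := by
    refine Submodule.span_le.2 ?_
    rintro _ ⟨τ, w, hw, hd, rfl⟩
    exact ⟨hd ▸ sym_mem_chains τ w, chain_ext fun a l =>
      (pairing_sym τ w a l).trans (pairWord_long a l τ hw)⟩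
  by_cases hxS : x ∈ S.map (A.koszulDual hA).hochBoundary
  · obtain ⟨z, hz, rfl⟩ := hxS
    exact ⟨z, (hS hz).1, (hS hz).2, rfl⟩
  exfalso
  obtain ⟨f, hfx, hfS⟩ := Submodule.exists_le_ker_of_notMem hxS
  have hF : IsCyclic fun (a : (A.koszulDual hA).Hom) (l : List (A.koszulDual hA).Red) =>
      f ((A.koszulDual hA).chainProj n (sym a l)) :=
    isCyclic_sym.map (f ∘ₗ (A.koszulDual hA).chainProj n)
  have hFb : ∀ a l, boundaryFun (fun (a : (A.koszulDual hA).Hom)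
      (l : List (A.koszulDual hA).Red) => f ((A.koszulDual hA).chainProj n (sym a l))) a l =
      f ((A.koszulDual hA).chainProj n ((A.koszulDual hA).hochBoundary (sym a l))) := fun a l => by
    rw [hochBoundary_sym]
    exact (map_boundaryFun (f ∘ₗ (A.koszulDual hA).chainProj n) sym a l).symm
  have hFz : ∀ a l, 2 ≤ l.length → f ((A.koszulDual hA).chainProj n
      ((A.koszulDual hA).hochBoundary (sym a l))) = 0 := fun a l hl => by
    have h1 := hochBoundary_mem_chains (sym_mem_chains a l)
    by_cases hd : a.deg + barDeg l = n + 1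
    · rw [hd, add_sub_cancel_right] at h1
      rw [chainProj_same h1]
      exact hfS ⟨_, Submodule.subset_span ⟨a, l, hl, hd, rfl⟩, rfl⟩
    · rw [chainProj_ne (by omega) h1, map_zero]
  obtain ⟨G, hG, hFG⟩ := hF.exists_reduced hc fun a l hl => (hFb a l).trans (hFz a l hl)
  have key : longChains hA ≤ LinearMap.ker (f ∘ₗ (A.koszulDual hA).chainProj n -
      chainLift G hG ∘ₗ (A.koszulDual hA).hochBoundary) := by
    refine Submodule.span_le.2 ?_
    rintro _ ⟨τ, w, hw, rfl | rfl⟩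
    · change f _ - chainLift G hG _ = 0
      rw [chainLift_hochBoundary]
      exact hFG τ w hw
    · change f _ - chainLift G hG _ = 0
      rw [hochBoundary_hochBoundary, map_zero, sub_zero]
      exact hFz τ w hw
  have h := key (mem_longChains hx hp)
  change f _ - chainLift G hG _ = 0 at h
  rw [hb, map_zero, sub_zero, chainProj_same hx] at h
  exact hfx h

theorem pairing_hochBoundary (x : (A.koszulDual hA).Chain) {n : ℤ} {c : A.Chain}
    (h : c ∈ A.chains n) : pairing hA ((A.koszulDual hA).hochBoundary x) c =
      koszulSign n • pairing hA x (A.hochBoundary c) :=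
  eqOn_chains (g := koszulSign n • (pairing hA x ∘ₗ A.hochBoundary))
    (fun a l hd => hd ▸ pairing_boundary x a l) h

theorem pairing_connes_chains (x : (A.koszulDual hA).Chain) {n : ℤ} {c : A.Chain}
    (h : c ∈ A.chains n) : pairing hA ((A.koszulDual hA).connes x) c =
      koszulSign (n + 1) • pairing hA x (A.connes c) :=
  eqOn_chains (g := koszulSign (n + 1) • (pairing hA x ∘ₗ A.connes))
    (fun a l hd => hd ▸ pairing_connes x a l) h

/-- Every form on the chains of degree `n` is given by the pairing. -/
theorem exists_pairing_eq (hA : A.IsTypical) (f : Module.Dual k A.Chain) (n : ℤ) :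
    ∃ x ∈ (A.koszulDual hA).chains (-n), pairing hA x = f ∘ₗ A.chainProj n := by
  have h : ∀ (a : A.Hom) (l : List A.Red), a.deg + barDeg l ≠ n →
      (f ∘ₗ A.chainProj n) (sym a l) = 0 := fun a l hd => by
    rw [LinearMap.comp_apply, chainProj_ne hd (sym_mem_chains a l), map_zero]
  exact ⟨_, normalForm_mem h _, pairing_normalForm h subset_rfl⟩

variable (hA) in
/-- The form on Hochschild homology defined by a Hochschild cycle of the Koszul dual. -/
def cyclePairing (n : ℤ) : (A.koszulDual hA).cycles (-n) →ₗ[k] Module.Dual k (A.HHHom n) where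
  toFun x := ((A.boundaries n).submoduleOf (A.cycles n)).liftQ
    (pairing hA x.1 ∘ₗ (A.cycles n).subtype) (by
      rintro ⟨_, _⟩ ⟨e, he, rfl⟩
      have h := pairing_hochBoundary x.1 he
      rw [LinearMap.mem_ker.1 x.2.2, map_zero] at h
      have h2 := congrArg (koszulSign (n + 1) • ·) h
      simp only [smul_smul, koszulSign_mul_self, one_smul] at h2
      exact h2.symm.trans (smul_zero _))
  map_add' x y := Submodule.linearMap_qext _ (LinearMap.ext fun c =>
    LinearMap.congr_fun (map_add (pairing hA) x.1 y.1) c.1)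
  map_smul' r x := Submodule.linearMap_qext _ (LinearMap.ext fun c =>
    LinearMap.congr_fun (map_smul (pairing hA) r x.1) c.1)

variable (hA) in
/-- The pairing of the Hochschild homologies of the Koszul dual of `A` and of `A`. -/
def homPairing (n : ℤ) : (A.koszulDual hA).HHHom (-n) →ₗ[k] Module.Dual k (A.HHHom n) :=
  (((A.koszulDual hA).boundaries (-n)).submoduleOf ((A.koszulDual hA).cycles (-n))).liftQ
    (cyclePairing hA n) (by
      rintro ⟨_, _⟩ ⟨e, he, rfl⟩
      refine Submodule.linearMap_qext _ (LinearMap.ext fun c => ?_)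
      change pairing hA ((A.koszulDual hA).hochBoundary e) c.1 = 0
      rw [pairing_hochBoundary e c.2.1, LinearMap.mem_ker.1 c.2.2, map_zero, smul_zero])

theorem homPairing_injective (hc : A.IsComplete) (n : ℤ) :
    Function.Injective (homPairing hA n) := by
  rw [injective_iff_map_eq_zero]
  intro y hy
  obtain ⟨⟨x, hx, hbx⟩, rfl⟩ := Submodule.Quotient.mk_surjective _ y
  have hbx' : (A.koszulDual hA).hochBoundary x = 0 := hbx
  have h0 : ∀ c ∈ A.chains n, A.hochBoundary c = 0 → pairing hA x c = 0 := fun c h1 h2 =>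
    LinearMap.congr_fun hy (Submodule.Quotient.mk ⟨c, h1, h2⟩)
  have h1 : pairing hA x ∘ₗ (A.chains n).subtype ∈
      LinearMap.range (A.hochBoundary ∘ₗ (A.chains n).subtype).dualMap := by
    rw [LinearMap.range_dualMap_eq_dualAnnihilator_ker]
    exact (Submodule.mem_dualAnnihilator _).2 fun c hc => h0 c.1 c.2 hc
  obtain ⟨f, hf⟩ := h1
  have hf' : ∀ c ∈ A.chains n, f (A.hochBoundary c) = pairing hA x c := fun c h =>
    LinearMap.congr_fun hf ⟨c, h⟩
  obtain ⟨y, hy1, hy2⟩ := exists_pairing_eq hA f (n - 1)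
  rw [show -(n - 1) = -n + 1 by ring] at hy1
  have hby := hochBoundary_mem_chains hy1
  rw [add_sub_cancel_right] at hby
  have hx' : x - koszulSign n • (A.koszulDual hA).hochBoundary y ∈ (A.koszulDual hA).chains (-n) :=
    Submodule.sub_mem _ hx (zsmul_mem' _ _ hby)
  obtain ⟨z, hz1, -, hz2⟩ := exists_hochBoundary_eq hc hx' (chain_ext fun a l => by
    by_cases hd : a.deg + barDeg l = n
    · have hs : sym a l ∈ A.chains n := hd ▸ sym_mem_chains a l
      rw [map_sub, map_zsmul, LinearMap.sub_apply, LinearMap.smul_apply, pairing_hochBoundary y hs,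
        smul_smul, koszulSign_mul_self, one_smul, hy2, LinearMap.comp_apply,
        chainProj_same (hochBoundary_mem_chains hs), hf' _ hs, sub_self]
      rfl
    · exact pairing_eq_zero hx' (by rwa [neg_neg])) (by
    rw [map_sub, map_zsmul, hochBoundary_hochBoundary, hbx', smul_zero, sub_zero])
  refine (Submodule.Quotient.mk_eq_zero _).2
    ⟨z + koszulSign n • y, Submodule.add_mem _ hz1 (zsmul_mem' _ _ hy1), ?_⟩
  rw [map_add, map_zsmul, hz2, sub_add_cancel]
  rfl

theorem homPairing_surjective (hc : A.IsComplete) (n : ℤ) :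
    Function.Surjective (homPairing hA n) := by
  intro f
  obtain ⟨g, hg⟩ := LinearMap.exists_extend
    (f ∘ₗ ((A.boundaries n).submoduleOf (A.cycles n)).mkQ)
  have hg' : ∀ c : A.cycles n, g c.1 = f (Submodule.Quotient.mk c) := fun c =>
    LinearMap.congr_fun hg c
  obtain ⟨x, hx, hgx⟩ := exists_pairing_eq hA g n
  have hbx := hochBoundary_mem_chains hx
  obtain ⟨z, hz1, hz2, hz3⟩ := exists_hochBoundary_eq hc hbx (chain_ext fun a l => by
    rw [pairing_boundary, hgx, LinearMap.comp_apply]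
    have h1 := hochBoundary_mem_chains (sym_mem_chains a l)
    by_cases hd : a.deg + barDeg l = n + 1
    · rw [hd, add_sub_cancel_right] at h1
      rw [chainProj_same h1]
      have h2 : (Submodule.Quotient.mk ⟨_, h1, hochBoundary_hochBoundary (sym a l)⟩ :
          A.HHHom n) = 0 :=
        (Submodule.Quotient.mk_eq_zero _).2 ⟨sym a l, hd ▸ sym_mem_chains a l, rfl⟩
      have h2 := (hg' ⟨_, h1, hochBoundary_hochBoundary (sym a l)⟩).trans
        ((congrArg f h2).trans (map_zero f))
      exact (congrArg _ h2).trans (smul_zero _)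
    · rw [chainProj_ne (by omega) h1, map_zero, smul_zero]
      rfl) (hochBoundary_hochBoundary x)
  rw [sub_add_cancel] at hz1
  refine ⟨Submodule.Quotient.mk ⟨x - z, Submodule.sub_mem _ hx hz1, ?_⟩,
    Submodule.linearMap_qext _ (LinearMap.ext fun c => ?_)⟩
  · change (A.koszulDual hA).hochBoundary (x - z) = 0
    rw [map_sub, hz3, sub_self]
  · change pairing hA (x - z) c.1 = f (Submodule.Quotient.mk c)
    rw [map_sub, hz2, sub_zero, hgx, LinearMap.comp_apply, chainProj_same c.2.1, hg']

theorem homPairing_connes (n : ℤ) (y : (A.koszulDual hA).HHHom (-(n + 1))) :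
    homPairing hA n (HHHom.connes (A.koszulDual hA) (-(n + 1)) (-n) (by ring) y) =
      HHHom.connesDual A n (homPairing hA (n + 1) y) := by
  obtain ⟨x, rfl⟩ := Submodule.Quotient.mk_surjective _ y
  refine Submodule.linearMap_qext _ (LinearMap.ext fun c => ?_)
  change pairing hA ((A.koszulDual hA).connes x.1) c.1 =
    koszulSign (n + 1) • pairing hA x.1 (A.connes c.1)
  exact pairing_connes_chains x.1 c.2.1

theorem exists_homEquiv (hA : A.IsTypical) (hc : A.IsComplete) :
    ∃ h : ∀ n : ℤ, Module.Dual k (A.HHHom n) ≃ₗ[k] (A.koszulDual hA).HHHom (-n),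
      ∀ (n : ℤ) (φ : Module.Dual k (A.HHHom (n + 1))),
        h n (HHHom.connesDual A n φ) =
          HHHom.connes (A.koszulDual hA) (-(n + 1)) (-n) (by ring) (h (n + 1) φ) := by
  let e : ∀ n : ℤ, (A.koszulDual hA).HHHom (-n) ≃ₗ[k] Module.Dual k (A.HHHom n) := fun n =>
    LinearEquiv.ofBijective (homPairing hA n)
      ⟨homPairing_injective hc n, homPairing_surjective hc n⟩
  refine ⟨fun n => (e n).symm, fun n φ => ?_⟩
  rw [LinearEquiv.symm_apply_eq]
  refine Eq.trans ?_ (homPairing_connes n _).symm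
  exact congrArg _ ((e (n + 1)).apply_symm_apply φ).symm

end duality

end AugDGKRing

end

theorem theorem8 {k : Type u} [Field k] {t : ℕ} (ht : 0 < t) (A : AugDGKRing.{u, v} k t)
    (hA : A.IsTypical) (hc : A.IsComplete) :
    (∃ h : ∀ n : ℤ, A.HHCoh n ≃ₗ[k] (A.koszulDual hA).HHCoh n,
      h 0 (AugDGKRing.HHCoh.one A) = AugDGKRing.HHCoh.one (A.koszulDual hA) ∧
      (∀ (m n : ℤ) (x : A.HHCoh m) (y : A.HHCoh n),
        h (m + n) (AugDGKRing.HHCoh.cup A m n (m + n) rfl x y) =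
          AugDGKRing.HHCoh.cup (A.koszulDual hA) m n (m + n) rfl (h m x) (h n y))) ∧
    (∀ (m n : ℤ) (x : A.HHCoh m) (y : A.HHCoh n),
      AugDGKRing.HHCoh.cup A m n (m + n) rfl x y =
        koszulSign (m * n) • AugDGKRing.HHCoh.cup A n m (m + n) (add_comm n m) y x) ∧
    (∀ (m n : ℤ) (x : (A.koszulDual hA).HHCoh m) (y : (A.koszulDual hA).HHCoh n),
      AugDGKRing.HHCoh.cup (A.koszulDual hA) m n (m + n) rfl x y =
        koszulSign (m * n) •
          AugDGKRing.HHCoh.cup (A.koszulDual hA) n m (m + n) (add_comm n m) y x) ∧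
    (∃ h : ∀ n : ℤ, Module.Dual k (A.HHHom n) ≃ₗ[k] (A.koszulDual hA).HHHom (-n),
      ∀ (n : ℤ) (φ : Module.Dual k (A.HHHom (n + 1))),
        h n (AugDGKRing.HHHom.connesDual A n φ) =
          AugDGKRing.HHHom.connes (A.koszulDual hA) (-(n + 1)) (-n) (by ring) (h (n + 1) φ)) := by
  obtain ⟨h1, h2⟩ := AugDGKRing.exists_cohAlgEquiv hA hc
  exact ⟨h1, h2, fun m n x y => AugDGKRing.koszulDual_cup_comm hA hc m n _ rfl x y, AugDGKRing.exists_homEquiv hA hc⟩
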